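/- Let $k$ be an algebraically closed field of characteristic $0$ and let $n\ge 0$ be an integer. All schemes are $k$-schemes. Families. A family of dimension $n$ over $S$ is a smooth morphism $\pi:X\to S$ of relative dimension $n$; a pointed family $\pi:X\rightleftarrows S:\sigma$ is a family with a section $\sigma$. A morphism $(f_X,f_S):X/S\to X'/S'$ of families (a commutative square) is fibrewise étale if for every $s\in S$ the induced morphism $X_s\to X'_{f_S(s)}\otimes_{\kappa(f_S(s))}\kappa(s)$ is étale. Universal $\mathcal O$-modules. A universal $\mathcal O$-module $F$ of dimension $n$ consists of a quasi-coherent sheaf $F_{X/S}$ on $X$ for each family $X/S$ of dimension $n$, and of an isomorphism $F(f):F_{X/S}\cong f_X^*F_{X'/S'}$ for each fibrewise étale $f:X/S\to X'/S'$, compatible with composition. Morphisms of universal $\mathcal O$-modules are families of $\mathcal O_X$-linear maps compatible with the isomorphisms $F(f)$. Germs. Let $\widetilde{\mathcal P}_n$ be the category fibred in groupoids over $k$-schemes whose objects over $S$ are the pointed families $X\rightleftarrows S$ of dimension $n$. A morphism from $X\rightleftarrows S$ to $Y\rightleftarrows T$ over $g:S\to T$ is represented by a common étale neighbourhood: a pointed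 family $V\rightleftarrows S$ with morphisms $\phi:V\to X$, $\psi:V\to Y$ over $S$ and $g$, compatible with the sections, such that $\phi$ and the induced morphism $V\to Y\times_TS$ are étale. Two of these are identified if, Zariski-locally on $S$, there are a pointed family $W\rightleftarrows S$ and étale morphisms $a:W\to V$, $b:W\to V'$ compatible with projections and sections such that $\phi a=\phi' b$ and $\psi a=\psi' b$. Composition is by fibre product. Let $\mathcal P_{n,\mathrm{triv}}\subset\widetilde{\mathcal P}_n$ be the full subcategory on the families $\mathbb A^n_S\rightleftarrows S$ with the zero section. The stack $\mathcal P_n$ of pointed étale germs is the stackification of $\mathcal P_{n,\mathrm{triv}}$ in the étale topology. A quasi-coherent sheaf $M$ on a category fibred in groupoids over $k$-schemes consists of a quasi-coherent sheaf $M_x$ on $S$ for each object $x$ over $S$, and of an isomorphism $f^*M_y\cong M_x$ for each morphism $x\to y$ over $f:S\to T$, compatible with composition. Theorem. Restriction along $\mathcal P_{n,\mathrm{triv}}\to\widetilde{\mathcal P}_n$ and along $\mathcal P_{n,\mathrm{triv}}\to\mathcal P_n$ gives equivalences $$\mathrm{QCoh}(\widetilde{\mathcal P}_n)\simeq\mathrm{QCoh}(\mathcal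 P_{n,\mathrm{triv}})\simeq\mathrm{QCoh}(\mathcal P_n).$$ There is an equivalence $\theta$ from the category of universal $\mathcal O$-modules of dimension $n$ to $\mathrm{QCoh}(\widetilde{\mathcal P}_n)$ with $$\theta(F)_{X\rightleftarrows S}\cong\sigma^*F_{X/S},$$ naturally in $F$ and compatibly with the structure isomorphisms for all fibrewise étale morphisms of pointed families, and with quasi-inverse $$\Psi(M)_{X/S}\cong M_{\mathrm{pr}_1:X\times_SX\rightleftarrows X:\Delta},$$ naturally in $M$ and compatibly with the structure isomorphisms for all fibrewise étale morphisms of families. Consequently the category of universal $\mathcal O$-modules of dimension $n$ is equivalent to $\mathrm{QCoh}(\mathcal P_n)$, by an equivalence that agrees with $\theta$ after restriction to $\mathcal P_{n,\mathrm{triv}}$. -/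

import Mathlib

open CategoryTheory AlgebraicGeometry Limits TensorProduct

universe u

namespace UniversalModule

noncomputable section

/-! ### Fibrewise étale morphisms -/

attribute [local instance] Algebra.TensorProduct.rightAlgebra in
theorem unram_of_fiber {R A : Type u} [CommRing R] [CommRing A] [Algebra R A]
    [Algebra.FiniteType R A]
    (h : ∀ (p : Ideal R) [p.IsPrime], Algebra.FormallyUnramified p.ResidueField (p.Fiber A)) :
    Algebra.FormallyUnramified R A := by
  rw [Algebra.formallyUnramified_iff, ← Module.support_eq_empty_iff (R := A),
    Set.eq_empty_iff_forall_notMem]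
  intro q hq
  rw [Module.mem_support_iff_nontrivial_residueField_tensorProduct] at hq
  let p := q.asIdeal.under R
  have := h p
  have : Subsingleton (Ω[p.Fiber A⁄p.ResidueField]) := inferInstance
  have e := KaehlerDifferential.tensorKaehlerEquiv R p.ResidueField A (p.Fiber A)
  have : Subsingleton (p.Fiber A ⊗[A] Ω[A⁄R]) := e.toEquiv.subsingleton
  let f : p.Fiber A →+* q.asIdeal.ResidueField :=
    (Algebra.TensorProduct.lift (Ideal.ResidueField.mapₐ p q.asIdeal (Algebra.ofId R A) rfl)
      (IsScalarTower.toAlgHom R A q.asIdeal.ResidueField) (fun _ _ ↦ .all _ _)).toRingHom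
  algebraize [f]
  have : IsScalarTower A (p.Fiber A) q.asIdeal.ResidueField := by
    refine .of_algebraMap_eq fun a ↦ ?_
    change _ = f (1 ⊗ₜ a)
    simp [f]
  have e2 := TensorProduct.AlgebraTensorModule.cancelBaseChange A (p.Fiber A) (p.Fiber A)
    q.asIdeal.ResidueField Ω[A⁄R]
  have : Subsingleton (q.asIdeal.ResidueField ⊗[A] Ω[A⁄R]) := e2.symm.toEquiv.subsingleton
  exact not_nontrivial _ hq

theorem etale_of_unram {R A B : Type u} [CommRing R] [CommRing A] [CommRing B] [Algebra R A]
    [Algebra R B] [Algebra A B] [IsScalarTower R A B] (n : ℕ)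
    [Algebra.IsStandardSmoothOfRelativeDimension n R A]
    [Algebra.IsStandardSmoothOfRelativeDimension n R B]
    [Algebra.FormallyUnramified A B] : Algebra.Etale A B := by
  cases subsingleton_or_nontrivial B
  · have : Algebra.FormallySmooth A B := ⟨@Module.Projective.of_free _ _ _ _ _ (@Module.Free.of_subsingleton _ _ _ _ _ (Module.subsingleton B _)), Module.subsingleton B _⟩
    have : Algebra.IsStandardSmooth R A := Algebra.IsStandardSmoothOfRelativeDimension.isStandardSmooth n
    have : Algebra.IsStandardSmooth R B := Algebra.IsStandardSmoothOfRelativeDimension.isStandardSmooth n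
    have : Algebra.FormallyEtale A B := .of_formallyUnramified_and_formallySmooth
    exact { finitePresentation := .of_restrict_scalars_finitePresentation R A B }
  have : Nontrivial A := (algebraMap A B).domain_nontrivial
  have : Algebra.IsStandardSmooth R A :=
    Algebra.IsStandardSmoothOfRelativeDimension.isStandardSmooth n
  have : Algebra.IsStandardSmooth R B :=
    Algebra.IsStandardSmoothOfRelativeDimension.isStandardSmooth n
  have hA := Algebra.IsStandardSmoothOfRelativeDimension.rank_kaehlerDifferential (R := R) (S := A) n
  have hB := Algebra.IsStandardSmoothOfRelativeDimension.rank_kaehlerDifferential (R := R) (S := B) n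
  have hsurj : Function.Surjective (KaehlerDifferential.mapBaseChange R A B) := by
    intro y
    exact (KaehlerDifferential.exact_mapBaseChange_map R A B y).mp (Subsingleton.elim _ _)
  have hr : Module.finrank B (B ⊗[A] Ω[A⁄R]) = Module.finrank B Ω[B⁄R] := by
    rw [Module.finrank_baseChange]
    simp [Module.finrank, hA, hB]
  let e : B ⊗[A] Ω[A⁄R] ≃ₗ[B] Ω[B⁄R] := LinearEquiv.ofFinrankEq _ _ hr
  have hinj : Function.Injective (KaehlerDifferential.mapBaseChange R A B) := by
    have := OrzechProperty.injective_of_surjective_of_injective e.toLinearMap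
      (KaehlerDifferential.mapBaseChange R A B) e.injective hsurj
    exact this
  have hH : Subsingleton (Algebra.H1Cotangent A B) := by
    refine ⟨fun a b ↦ ?_⟩
    have key : ∀ x : Algebra.H1Cotangent A B, x = 0 := by
      intro x
      have h1 : Algebra.H1Cotangent.δ R A B x = 0 := by
        apply hinj
        rw [map_zero]
        exact (Algebra.H1Cotangent.exact_δ_mapBaseChange R A B _).mpr ⟨x, rfl⟩
      obtain ⟨y, hy⟩ := (Algebra.H1Cotangent.exact_map_δ R A B x).mp h1
      rw [← hy, Subsingleton.elim y 0, map_zero]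
    rw [key a, key b]
  have : Algebra.FormallySmooth A B := ⟨inferInstance, hH⟩
  have : Algebra.FormallyEtale A B := .of_formallyUnramified_and_formallySmooth
  have : Algebra.FinitePresentation R B := inferInstance
  exact { finitePresentation := .of_restrict_scalars_finitePresentation R A B }

theorem localTarget_of_ring (P : MorphismProperty Scheme.{u})
    {Q : {R S : Type u} → [CommRing R] → [CommRing S] → (R →+* S) → Prop}
    [HasRingHomProperty P Q] :
    IsZariskiLocalAtTarget P ∧ IsZariskiLocalAtSource P ∧ P.RespectsIso :=
  ⟨inferInstance, inferInstance, inferInstance⟩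

theorem unram_of_fiberScheme {X Y : Scheme.{u}} (f : X ⟶ Y) [LocallyOfFiniteType f]
    (h : ∀ y, FormallyUnramified (f.fiberToSpecResidueField y)) : FormallyUnramified f := by
  have h0 := localTarget_of_ring @FormallyUnramified.{u}
  have i1 := h0.1
  have i2 := h0.2.1
  have i3 := h0.2.2
  clear h0
  wlog hY : ∃ R, Y = Spec R with H
  · rw [IsZariskiLocalAtTarget.iff_of_openCover (P := @FormallyUnramified.{u}) Y.affineCover]
    intro i
    dsimp [Scheme.Cover.pullbackHom]
    have h3 {Z : Scheme.{u}} (g : Z ⟶ Y) : LocallyOfFiniteType (pullback.snd f g) := inferInstance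
    have := h3 (Y.affineCover.f i)
    refine H (pullback.snd f (Y.affineCover.f i)) (fun y ↦ ?_) i1 i2 i3 ⟨_, rfl⟩
    apply MorphismProperty.of_isPullback (P := @FormallyUnramified.{u})
    · exact isPullback_fiberToSpecResidueField_of_isPullback (IsPullback.of_hasPullback _ _) _
    · exact h _
  obtain ⟨R, rfl⟩ := hY
  wlog hX : ∃ S, X = Spec S generalizing f X with H
  · rw [IsZariskiLocalAtSource.iff_of_openCover (P := @FormallyUnramified.{u}) X.affineCover]
    intro i
    have _ (y) : FormallyUnramified (pullback.snd f ((Spec R).fromSpecResidueField y)) := h y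
    refine H _ (fun y ↦ ?_) ⟨_, rfl⟩
    rw [Scheme.Hom.fiberToSpecResidueField, ← pullbackRightPullbackFstIso_inv_snd_snd]
    have h1 : FormallyUnramified (pullback.snd (X.affineCover.f i)
      (pullback.fst f ((Spec R).fromSpecResidueField y))) := inferInstance
    have h2 : FormallyUnramified (pullbackRightPullbackFstIso f
      ((Spec R).fromSpecResidueField y) (X.affineCover.f i)).inv := inferInstance
    exact MorphismProperty.comp_mem @FormallyUnramified.{u} _ _ h2
      (MorphismProperty.comp_mem @FormallyUnramified.{u} _ _ h1 (h y))
  obtain ⟨S, rfl⟩ := hX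
  obtain ⟨φ, rfl⟩ := Spec.map_surjective f
  simp only [HasRingHomProperty.Spec_iff (P := @FormallyUnramified.{u}),
    HasRingHomProperty.Spec_iff (P := @LocallyOfFiniteType)] at *
  algebraize [φ.hom]
  refine unram_of_fiber fun p hp ↦ ?_
  rw [← RingHom.formallyUnramified_algebraMap]
  rw [← CommRingCat.hom_ofHom (algebraMap p.ResidueField (p.Fiber ↑S)),
    ← HasRingHomProperty.Spec_iff (P := @FormallyUnramified.{u}),
    ← MorphismProperty.arrow_mk_iso_iff (P := @FormallyUnramified.{u})
    (Spec.fiberToSpecResidueFieldIso R S ⟨p, hp⟩)]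
  exact h ⟨p, hp⟩

theorem etale_pullback_snd_of_factor {X Y Y' Z : Scheme.{u}} (g : X ⟶ Y) (i : Y' ⟶ Y) (l : Z ⟶ Y')
    (j : Z ⟶ Y) (hj : l ≫ i = j)
    (h : Etale (pullback.snd g i)) : Etale (pullback.snd g j) := by
  subst hj
  have hp : IsPullback (pullback.lift (pullback.fst g (l ≫ i)) (pullback.snd g (l ≫ i) ≫ l)
        (by simp [pullback.condition])) (pullback.snd g (l ≫ i)) (pullback.snd g i) l := by
    refine IsPullback.of_right (h₁₂ := pullback.fst g i) (h₂₂ := i) (v₁₃ := g) ?_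
      (pullback.lift_snd _ _ _) (IsPullback.of_hasPullback g i)
    rw [pullback.lift_fst]
    exact IsPullback.of_hasPullback g (l ≫ i)
  exact MorphismProperty.of_isPullback (P := @Etale.{u}) hp h

theorem exists_std (n : ℕ) {X S : Scheme.{u}} (p : X ⟶ S) [hq : SmoothOfRelativeDimension n p]
    (x : X) (W : S.affineOpens) (U : X.Opens) (hx : x ∈ U) (e : U ≤ p ⁻¹ᵁ W.1) :
    ∃ (V : X.affineOpens) (_ : x ∈ V.1) (e' : V.1 ≤ U),
      (p.appLE W.1 V.1 (e'.trans e)).hom.IsStandardSmoothOfRelativeDimension n := by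
  have hloc : HasRingHomProperty (@SmoothOfRelativeDimension.{u} n)
    (RingHom.Locally (RingHom.IsStandardSmoothOfRelativeDimension n)) := inferInstance
  have hR := RingHom.isStandardSmoothOfRelativeDimension_respectsIso (n := n)
  obtain ⟨V, hV, hxV, eV⟩ := TopologicalSpace.Opens.isBasis_iff_nbhd.mp X.isBasis_affineOpens hx
  have hf := (HasRingHomProperty.iff_appLE (P := @SmoothOfRelativeDimension.{u} n)).mp hq W ⟨V, hV⟩
    (eV.trans e)
  rw [RingHom.locally_iff_isLocalization hR] at hf
  obtain ⟨s, hs, hfs⟩ := hf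
  apply iSup_basicOpen_of_span_eq_top at hs
  have h1 : x ∈ (⨆ i ∈ s, X.basicOpen i) := hs.symm ▸ hxV
  have h2 : ∃ r ∈ s, x ∈ X.basicOpen r := by simpa using h1
  obtain ⟨r, hr, hrs⟩ := h2
  refine ⟨⟨X.basicOpen r, hV.basicOpen r⟩, hrs, (X.basicOpen_le r).trans eV, ?_⟩
  rw [← p.appLE_map (eV.trans e) (homOfLE (X.basicOpen_le r)).op]
  have : IsLocalization.Away r Γ(X, X.basicOpen r) := hV.isLocalization_basicOpen r
  exact hfs r hr _

theorem etale_of_fibers (n : ℕ) {X Y S : Scheme.{u}} (g : X ⟶ Y) (q : Y ⟶ S) (p : X ⟶ S)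
    (hp : g ≫ q = p) [hq : SmoothOfRelativeDimension n q] [hpp : SmoothOfRelativeDimension n p]
    (h : ∀ s : S, Etale (pullback.snd g (pullback.fst q (S.fromSpecResidueField s)))) :
    Etale g := by
  subst hp
  have hqs : Smooth q := SmoothOfRelativeDimension.smooth n q
  have hps : Smooth (g ≫ q) := SmoothOfRelativeDimension.smooth n (g ≫ q)
  have hft : LocallyOfFiniteType g := locallyOfFiniteType_of_comp g q
  have hun : FormallyUnramified g := by
    refine unram_of_fiberScheme g fun y ↦ ?_
    have : Etale (pullback.snd g (Y.fromSpecResidueField y)) := by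
      refine etale_pullback_snd_of_factor g _
        (pullback.lift (Y.fromSpecResidueField y) (Spec.map (q.residueFieldMap y)) (by simp)) _
        (pullback.lift_fst _ _ _) (h (q y))
    exact inferInstanceAs (FormallyUnramified (pullback.snd g (Y.fromSpecResidueField y)))
  have hQ : RingHom.StableUnderCompositionWithLocalizationAwaySource RingHom.Etale.{u,u} :=
    (RingHom.Etale.stableUnderComposition.stableUnderCompositionWithLocalizationAway
      (RingHom.Etale.propertyIsLocal.HoldsForLocalizationAway RingHom.Etale.containsIdentities)).1
  rw [HasRingHomProperty.iff_exists_appLE (P := @Etale.{u}) hQ]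
  intro x
  obtain ⟨W, hW, hsW, -⟩ := TopologicalSpace.Opens.isBasis_iff_nbhd.mp S.isBasis_affineOpens
    (TopologicalSpace.Opens.mem_top (q (g x)))
  obtain ⟨U, hU, eU, hUs⟩ := exists_std n q (g x) ⟨W, hW⟩ (q ⁻¹ᵁ W) hsW le_rfl
  obtain ⟨V, hV, eV, hVs⟩ := exists_std n (g ≫ q) x ⟨W, hW⟩ (g ⁻¹ᵁ U.1) hU
    (fun y hy ↦ eU hy)
  refine ⟨U, V, hV, eV, ?_⟩
  have hunr := (HasRingHomProperty.iff_appLE (P := @FormallyUnramified.{u})).mp hun U V eV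
  have hc := Scheme.Hom.appLE_comp_appLE g q W U.1 V.1 eU eV
  rw [← hc] at hVs
  algebraize [(q.appLE W U.1 eU).hom, (g.appLE U.1 V.1 eV).hom,
    (q.appLE W U.1 eU ≫ g.appLE U.1 V.1 eV).hom]
  have : IsScalarTower Γ(S, W) Γ(Y, U.1) Γ(X, V.1) := .of_algebraMap_eq fun _ ↦ rfl
  exact etale_of_unram (R := Γ(S, W)) n

section EtSq

theorem etale_comp_mem {X Y Z : Scheme.{u}} {f : X ⟶ Y} {g : Y ⟶ Z} (hf : Etale f) (hg : Etale g) :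
    Etale (f ≫ g) :=
  Etale.etale_comp f g

/-- A commutative square `fX ≫ π' = π ≫ fS` is *étale onto the base change* if the induced morphism
`X ⟶ X' ×_{S'} S` is étale. -/
def EtSq {X S X' S' : Scheme.{u}} (π : X ⟶ S) (π' : X' ⟶ S') (fX : X ⟶ X') (fS : S ⟶ S') : Prop :=
  ∃ w : fX ≫ π' = π ≫ fS, Etale (pullback.lift fX π w)

variable {X S X' S' X'' S'' P : Scheme.{u}} {π : X ⟶ S} {π' : X' ⟶ S'} {π'' : X'' ⟶ S''}
  {fX : X ⟶ X'} {fS : S ⟶ S'} {gX : X' ⟶ X''} {gS : S' ⟶ S''}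

theorem EtSq.iff_lift {p : P ⟶ X'} {q : P ⟶ S} (hP : IsPullback p q π' fS)
    (w : fX ≫ π' = π ≫ fS) : EtSq π π' fX fS ↔ Etale (hP.lift fX π w) := by
  have e : pullback.lift fX π w = hP.lift fX π w ≫ hP.isoPullback.hom := by
    apply pullback.hom_ext
    · rw [pullback.lift_fst]; simp
    · rw [pullback.lift_snd]; simp
  refine ⟨fun ⟨_, h'⟩ ↦ ?_, fun h' ↦ ⟨w, e ▸ etale_comp_mem h' inferInstance⟩⟩
  rw [(Iso.eq_comp_inv hP.isoPullback).mpr e.symm]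
  exact etale_comp_mem h' inferInstance

theorem EtSq.of_factor {p : P ⟶ X'} {q : P ⟶ S} (hP : IsPullback p q π' fS) (l : X ⟶ P)
    (hl : Etale l) (h1 : l ≫ p = fX) (h2 : l ≫ q = π) : EtSq π π' fX fS := by
  subst h1 h2
  rw [EtSq.iff_lift hP (by simp [hP.w])]
  convert hl
  apply hP.hom_ext <;> simp

theorem EtSq.exists_factor {p : P ⟶ X'} {q : P ⟶ S} (hP : IsPullback p q π' fS)
    (h : EtSq π π' fX fS) : ∃ l : X ⟶ P, Etale l ∧ l ≫ p = fX ∧ l ≫ q = π := by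
  obtain ⟨w, h'⟩ := h
  exact ⟨hP.lift fX π w, (EtSq.iff_lift hP w).mp ⟨w, h'⟩, by simp, by simp⟩

theorem EtSq.id_base (f : X ⟶ X') (r : X' ⟶ S) (π : X ⟶ S) (w : f ≫ r = π) (hf : Etale f) :
    EtSq π r f (𝟙 S) :=
  EtSq.of_factor (IsPullback.id_horiz r).flip.flip f hf (by simp) w

theorem EtSq.etale {f : X ⟶ X'} {r : X' ⟶ S} (h : EtSq π r f (𝟙 S)) : Etale f := by
  obtain ⟨l, hl, h1, -⟩ := h.exists_factor (IsPullback.id_horiz r)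
  rw [← h1]; simpa using hl

theorem EtSq.comp (h : EtSq π π' fX fS) (h' : EtSq π' π'' gX gS) :
    EtSq π π'' (fX ≫ gX) (fS ≫ gS) := by
  obtain ⟨w', hc'⟩ := h'
  have Q := IsPullback.of_hasPullback π'' gS
  have Q' := IsPullback.of_hasPullback (pullback.snd π'' gS) fS
  obtain ⟨l, hl, h1, h2⟩ := h.exists_factor (IsPullback.of_hasPullback π' fS)
  have sq : IsPullback (pullback.fst π' fS)
      (pullback.lift (pullback.fst π' fS ≫ pullback.lift gX π' w') (pullback.snd π' fS)
        (by rw [Category.assoc, pullback.lift_snd, pullback.condition]) :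
        pullback π' fS ⟶ pullback (pullback.snd π'' gS) fS)
      (pullback.lift gX π' w') (pullback.fst _ _) := by
    refine IsPullback.of_bot (h₃₁ := fS) (v₂₁ := pullback.snd _ _) (v₂₂ := pullback.snd _ _)
      ?_ (pullback.lift_fst _ _ _).symm Q'.flip.flip
    rw [pullback.lift_snd, pullback.lift_snd]
    exact IsPullback.of_hasPullback π' fS
  have het := MorphismProperty.of_isPullback (P := @Etale.{u}) sq hc'
  refine EtSq.of_factor (Q'.paste_horiz Q) (l ≫ pullback.lift _ _ _)
    (etale_comp_mem hl het) ?_ ?_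
  · rw [Category.assoc, pullback.lift_fst_assoc, Category.assoc, pullback.lift_fst, ← h1,
      Category.assoc]
  · rw [Category.assoc, pullback.lift_snd, h2]

/-- Stability of `EtSq` under base change in the target. -/
theorem EtSq.pullback_snd {B : Scheme.{u}} (h : EtSq π π' fX fS) (φ : B ⟶ X') :
    EtSq (pullback.fst fX φ ≫ π) (φ ≫ π') (pullback.snd fX φ) fS := by
  obtain ⟨l, hl, h1, h2⟩ := h.exists_factor (IsPullback.of_hasPullback π' fS)
  have P1 := IsPullback.of_hasPullback π' fS
  have P2 := IsPullback.of_hasPullback φ (pullback.fst π' fS)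
  have P3 : IsPullback (pullback.fst φ (pullback.fst π' fS))
    (pullback.snd φ (pullback.fst π' fS) ≫ pullback.snd π' fS) (φ ≫ π') fS :=
    (P2.flip.paste_horiz P1.flip).flip
  have sq : IsPullback (pullback.lift (pullback.snd fX φ) (pullback.fst fX φ ≫ l)
      (by rw [Category.assoc, h1, pullback.condition])) (pullback.fst fX φ)
      (pullback.snd φ (pullback.fst π' fS)) l := by
    refine IsPullback.of_right (h₁₂ := pullback.fst _ _) (h₂₂ := pullback.fst π' fS) (v₁₃ := φ)
      ?_ (pullback.lift_snd _ _ _) P2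
    rw [pullback.lift_fst, h1]
    exact (IsPullback.of_hasPullback fX φ).flip
  refine EtSq.of_factor P3 _ (MorphismProperty.of_isPullback (P := @Etale.{u}) sq.flip hl)
    (pullback.lift_fst _ _ _) ?_
  rw [pullback.lift_snd_assoc, Category.assoc, h2]

theorem EtSq.cancel (h : EtSq π π'' (fX ≫ gX) (fS ≫ gS)) (w : fX ≫ π' = π ≫ fS)
    (P : IsPullback gX π' π'' gS) : EtSq π π' fX fS := by
  have R := IsPullback.of_hasPullback π' fS
  obtain ⟨l, hl, h1, h2⟩ := h.exists_factor (R.flip.paste_vert P.flip).flip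
  refine EtSq.of_factor R l hl (P.hom_ext (by simpa using h1) ?_) h2
  rw [w, ← h2, Category.assoc, Category.assoc, R.w]

theorem EtSq.of_isPullback (h : IsPullback fX π π' fS) : EtSq π π' fX fS :=
  EtSq.of_factor h (𝟙 X) inferInstance (by simp) (by simp)

/-- A morphism of families `(fX, fS) : X/S ⟶ X'/S'` is *fibrewise étale* if, for every point `s` of
`S` with residue field `κ(s)`, the induced morphism `X_s ⟶ X'_{fS(s)} ⊗ κ(s)` from the fibre of `X/S`
over `s` to the base change to `κ(s)` of the fibre of `X'/S'` is étale. -/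
def FibrewiseEtale (π : X ⟶ S) (π' : X' ⟶ S') (fX : X ⟶ X') (fS : S ⟶ S') : Prop :=
  ∃ w : fX ≫ π' = π ≫ fS, ∀ s : S,
    Etale (pullback.lift (π.fiberι s ≫ fX) (π.fiberToSpecResidueField s)
      (by rw [Category.assoc, w, ← Category.assoc, ← Category.assoc, Scheme.Hom.fiber_fac]) :
        π.fiber s ⟶ pullback π' (S.fromSpecResidueField s ≫ fS))

/-- For families that are smooth of the same relative dimension, being fibrewise étale is the same as
being étale onto the base change. -/
theorem fibrewiseEtale_iff (n : ℕ) [SmoothOfRelativeDimension n π]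
    [SmoothOfRelativeDimension n π'] : FibrewiseEtale π π' fX fS ↔ EtSq π π' fX fS := by
  have key (w : fX ≫ π' = π ≫ fS) (s : S) :
      IsPullback (π.fiberι s) (pullback.lift (π.fiberι s ≫ fX) (π.fiberToSpecResidueField s)
        (by rw [Category.assoc, w, ← Category.assoc, ← Category.assoc, Scheme.Hom.fiber_fac]) :
        π.fiber s ⟶ pullback π' (S.fromSpecResidueField s ≫ fS))
        (pullback.lift fX π w)
        (pullback.lift (pullback.fst _ _) (pullback.snd _ _ ≫ S.fromSpecResidueField s)
          (by rw [Category.assoc, pullback.condition])) := by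
    have P1 := IsPullback.of_hasPullback π' fS
    have P2 : IsPullback (pullback.lift (pullback.fst _ _)
        (pullback.snd _ _ ≫ S.fromSpecResidueField s)
          (by rw [Category.assoc, pullback.condition]) :
          pullback π' (S.fromSpecResidueField s ≫ fS) ⟶ pullback π' fS)
        (pullback.snd _ _) (pullback.snd π' fS) (S.fromSpecResidueField s) := by
      refine IsPullback.of_right (h₁₂ := pullback.fst π' fS) (h₂₂ := fS) (v₁₃ := π') ?_
        (pullback.lift_snd _ _ _) P1
      rw [pullback.lift_fst]
      exact IsPullback.of_hasPullback _ _
    refine IsPullback.of_bot (h₃₁ := S.fromSpecResidueField s) (v₂₁ := pullback.snd _ _)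
      (v₂₂ := pullback.snd _ _) ?_ ?_ P2
    · rw [pullback.lift_snd, pullback.lift_snd]
      exact IsPullback.of_hasPullback _ _
    · apply pullback.hom_ext
      · simp only [Category.assoc, pullback.lift_fst]
      · simp only [Category.assoc, pullback.lift_snd, pullback.lift_snd_assoc,
          Scheme.Hom.fiber_fac]
  have hsm : SmoothOfRelativeDimension n (pullback.snd π' fS) :=
    (smoothOfRelativeDimension_isStableUnderBaseChange n).of_isPullback
      (IsPullback.of_hasPullback π' fS) ‹_›
  constructor
  · rintro ⟨w, h⟩
    refine ⟨w, etale_of_fibers n _ (pullback.snd π' fS) π (pullback.lift_snd _ _ _) fun s ↦ ?_⟩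
    refine etale_pullback_snd_of_factor _
      (pullback.lift (pullback.fst _ _) (pullback.snd _ _ ≫ S.fromSpecResidueField s)
          (by rw [Category.assoc, pullback.condition]) :
          pullback π' (S.fromSpecResidueField s ≫ fS) ⟶ pullback π' fS)
      (pullback.lift (pullback.fst _ _ ≫ pullback.fst _ _) (pullback.snd _ _)
        (by simp only [Category.assoc]; rw [pullback.condition, pullback.condition_assoc])) _ ?_ ?_
    · apply pullback.hom_ext
      · simp only [Category.assoc, pullback.lift_fst]
      · simp only [Category.assoc, pullback.lift_snd, pullback.lift_snd_assoc]
        exact pullback.condition.symm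
    · have e := (key w s).isoPullback_inv_snd
      rw [← e]
      exact etale_comp_mem inferInstance (h s)
  · rintro ⟨w, h⟩
    exact ⟨w, fun s ↦ MorphismProperty.of_isPullback (P := @Etale.{u}) (key w s) h⟩

end EtSq

/-! ### Families and pointed families -/

section Families

theorem smooth_etale_comp {n : ℕ} {X Y Z : Scheme.{u}} {f : X ⟶ Y} {g : Y ⟶ Z} (hf : Etale f)
    (hg : SmoothOfRelativeDimension n g) : SmoothOfRelativeDimension n (f ≫ g) := by
  have := (Etale.iff_smoothOfRelativeDimension_zero f).mp hf
  have := smoothOfRelativeDimension_comp 0 n f g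
  rwa [Nat.zero_add] at this

/-- A family of smooth schemes of dimension `n` over `S`. -/
structure Family (n : ℕ) (S : Scheme.{u}) where
  total : Scheme.{u}
  π : total ⟶ S
  smooth : SmoothOfRelativeDimension n π

/-- A pointed `n`-dimensional family over `S`: a family with a section. -/
structure PointedFamily (n : ℕ) (S : Scheme.{u}) extends Family n S where
  σ : S ⟶ total
  σ_π : σ ≫ π = 𝟙 S

attribute [instance] Family.smooth
attribute [simp] PointedFamily.σ_π

variable (k : Type u) [Field k] (n : ℕ)

/-- The category of `k`-schemes. -/
abbrev SchOver : Type (u + 1) := Over (Spec (CommRingCat.of k))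

/-- The category of families `X/S` of smooth schemes of dimension `n` over `k`-schemes `S`, and
fibrewise étale morphisms. -/
structure Fam where
  base : SchOver k
  fam : Family n base.left

/-- The category of pointed families `X ⇄ S` of dimension `n` over `k`-schemes `S`, and fibrewise
étale morphisms compatible with the sections. -/
structure PtFam where
  base : SchOver k
  fam : PointedFamily n base.left

variable {k n}

/-- Fibrewise étale morphisms of families. -/
@[ext]
structure Fam.Hom (X Y : Fam k n) where
  base : X.base ⟶ Y.base
  total : X.fam.total ⟶ Y.fam.total
  fibrewiseEtale : FibrewiseEtale X.fam.π Y.fam.π total base.left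

theorem Fam.Hom.etSq {X Y : Fam k n} (f : Fam.Hom X Y) :
    EtSq X.fam.π Y.fam.π f.total f.base.left :=
  (fibrewiseEtale_iff n).mp f.fibrewiseEtale

instance : Category (Fam k n) where
  Hom := Fam.Hom
  id X := ⟨𝟙 _, 𝟙 _, (fibrewiseEtale_iff n).mpr
    (EtSq.id_base _ _ _ (Category.id_comp _) inferInstance)⟩
  comp f g := ⟨f.base ≫ g.base, f.total ≫ g.total,
    (fibrewiseEtale_iff n).mpr (f.etSq.comp g.etSq)⟩
  id_comp f := Fam.Hom.ext (Category.id_comp _) (Category.id_comp _)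
  comp_id f := Fam.Hom.ext (Category.comp_id _) (Category.comp_id _)
  assoc f g h := Fam.Hom.ext (Category.assoc _ _ _) (Category.assoc _ _ _)

/-- Fibrewise étale morphisms of pointed families. -/
@[ext]
structure PtFam.Hom (X Y : PtFam k n) where
  base : X.base ⟶ Y.base
  total : X.fam.total ⟶ Y.fam.total
  fibrewiseEtale : FibrewiseEtale X.fam.π Y.fam.π total base.left
  σ_total : X.fam.σ ≫ total = base.left ≫ Y.fam.σ

theorem PtFam.Hom.etSq {X Y : PtFam k n} (f : PtFam.Hom X Y) :
    EtSq X.fam.π Y.fam.π f.total f.base.left :=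
  (fibrewiseEtale_iff n).mp f.fibrewiseEtale

instance : Category (PtFam k n) where
  Hom := PtFam.Hom
  id X := ⟨𝟙 _, 𝟙 _, (fibrewiseEtale_iff n).mpr
    (EtSq.id_base _ _ _ (Category.id_comp _) inferInstance), by simp⟩
  comp f g := ⟨f.base ≫ g.base, f.total ≫ g.total,
    (fibrewiseEtale_iff n).mpr (f.etSq.comp g.etSq), by
      rw [← Category.assoc, f.σ_total, Category.assoc, g.σ_total, Over.comp_left, Category.assoc]⟩
  id_comp f := PtFam.Hom.ext (Category.id_comp _) (Category.id_comp _)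
  comp_id f := PtFam.Hom.ext (Category.comp_id _) (Category.comp_id _)
  assoc f g h := PtFam.Hom.ext (Category.assoc _ _ _) (Category.assoc _ _ _)

/-- `X/S ↦ X`. -/
def Fam.totalFunctor : Fam k n ⥤ Scheme.{u} where
  obj X := X.fam.total
  map f := Fam.Hom.total f

/-- Forgetting the section. -/
def PtFam.forget : PtFam k n ⥤ Fam k n where
  obj X := ⟨X.base, X.fam.toFamily⟩
  map f := ⟨PtFam.Hom.base f, PtFam.Hom.total f, PtFam.Hom.fibrewiseEtale f⟩

/-- `(X ⇄ S) ↦ S`. -/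
def PtFam.baseFunctor : PtFam k n ⥤ SchOver k where
  obj X := X.base
  map f := PtFam.Hom.base f

/-- The section `σ : S ⟶ X`, natural in the pointed family `X ⇄ S`. -/
def PtFam.σ : (PtFam.baseFunctor ⋙ Over.forget _ : PtFam k n ⥤ Scheme.{u}) ⟶
    PtFam.forget ⋙ Fam.totalFunctor where
  app X := X.fam.σ
  naturality _ _ f := (PtFam.Hom.σ_total f).symm

end Families

/-! ### Pointed étale germs -/

section Germs

variable {k : Type u} [Field k] {n : ℕ}

/-- A common étale neighbourhood between `X ⇄ S` and the base change of `Y ⇄ T` along a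
morphism `base : S ⟶ T` of `k`-schemes: a third pointed family `V ⇄ S` and morphisms
`φ : V ⟶ X` and `ψ : V ⟶ Y`, compatible with the projections and with the sections, such that
`φ` and the morphism `V ⟶ Y ×_T S` induced by `ψ` are étale. -/
structure EtaleNbhd (X Y : PtFam k n) where
  base : X.base ⟶ Y.base
  V : PointedFamily n X.base.left
  φ : V.total ⟶ X.fam.total
  etale_φ : Etale φ
  φ_π : φ ≫ X.fam.π = V.π
  σ_φ : V.σ ≫ φ = X.fam.σ
  ψ : V.total ⟶ Y.fam.total
  etSq_ψ : EtSq V.π Y.fam.π ψ base.left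
  σ_ψ : V.σ ≫ ψ = base.left ≫ Y.fam.σ

namespace EtaleNbhd

variable {X Y Z : PtFam k n}

attribute [instance] etale_φ

/-- Two common étale neighbourhoods over the same morphism of base schemes are *equivalent* if,
Zariski locally on `S`, they are similar: every point of `S` has an open neighbourhood `U` such that
there are a pointed family `W ⇄ U` and étale morphisms from `W` to the restrictions of the two
neighbourhoods to `U`, which are compatible with the projections and the sections, and become equal
after composition with the morphisms to `X`, and also with those to `Y`. -/
def Equivalent (A B : EtaleNbhd X Y) : Prop :=
  A.base = B.base ∧ ∀ s : X.base.left, ∃ U : X.base.left.Opens, s ∈ U ∧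
    ∃ (W : PointedFamily n U) (a : W.total ⟶ A.V.total) (b : W.total ⟶ B.V.total),
      Etale a ∧ Etale b ∧
      a ≫ A.V.π = W.π ≫ U.ι ∧ b ≫ B.V.π = W.π ≫ U.ι ∧
      W.σ ≫ a = U.ι ≫ A.V.σ ∧ W.σ ≫ b = U.ι ≫ B.V.σ ∧
      a ≫ A.φ = b ≫ B.φ ∧ a ≫ A.ψ = b ≫ B.ψ

theorem equivalent_of (A B : EtaleNbhd X Y) (hbase : A.base = B.base)
    (h : ∀ s : X.base.left, ∃ U : X.base.left.Opens, s ∈ U ∧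
      ∃ (W : Scheme.{u}) (a : W ⟶ A.V.total) (b : W ⟶ B.V.total) (τ : U.toScheme ⟶ W),
        Etale a ∧ Etale b ∧ τ ≫ a = U.ι ≫ A.V.σ ∧ τ ≫ b = U.ι ≫ B.V.σ ∧
        a ≫ A.φ = b ≫ B.φ ∧ a ≫ A.ψ = b ≫ B.ψ) : A.Equivalent B := by
  refine ⟨hbase, fun s ↦ ?_⟩
  obtain ⟨U, hU, W, a, b, τ, ha, hb, h1, h2, h3, h4⟩ := h s
  have hsm : SmoothOfRelativeDimension n (a ≫ A.V.π) := by
    exact smooth_etale_comp ha A.V.smooth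
  have hπ : a ≫ A.V.π = b ≫ B.V.π := by
    rw [← A.φ_π, ← B.φ_π, reassoc_of% h3]
  have hfst : Etale (pullback.fst (a ≫ A.V.π) U.ι) := inferInstance
  refine ⟨U, hU, ⟨⟨pullback (a ≫ A.V.π) U.ι, pullback.snd _ _,
    (smoothOfRelativeDimension_isStableUnderBaseChange n).of_isPullback
      (IsPullback.of_hasPullback _ _) hsm⟩, pullback.lift τ (𝟙 _) ?_, pullback.lift_snd _ _ _⟩,
    pullback.fst _ _ ≫ a, pullback.fst _ _ ≫ b, etale_comp_mem hfst ha, etale_comp_mem hfst hb,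
    ?_, ?_, ?_, ?_, ?_, ?_⟩
  · rw [reassoc_of% h1, A.V.σ_π, Category.comp_id, Category.id_comp]
  · simp only [Category.assoc, pullback.condition]
  · simp only [Category.assoc, ← hπ, pullback.condition]
  · dsimp only; rw [pullback.lift_fst_assoc, h1]
  · dsimp only; rw [pullback.lift_fst_assoc, h2]
  · simp only [Category.assoc, h3]
  · simp only [Category.assoc, h4]

theorem Equivalent.exists {A B : EtaleNbhd X Y} (h : A.Equivalent B) (s : X.base.left) :
    ∃ U : X.base.left.Opens, s ∈ U ∧
      ∃ (W : Scheme.{u}) (a : W ⟶ A.V.total) (b : W ⟶ B.V.total) (τ : U.toScheme ⟶ W),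
        Etale a ∧ Etale b ∧ τ ≫ a = U.ι ≫ A.V.σ ∧ τ ≫ b = U.ι ≫ B.V.σ ∧
        a ≫ A.φ = b ≫ B.φ ∧ a ≫ A.ψ = b ≫ B.ψ := by
  obtain ⟨U, hU, W, a, b, ha, hb, -, -, h1, h2, h3, h4⟩ := h.2 s
  exact ⟨U, hU, W.total, a, b, W.σ, ha, hb, h1, h2, h3, h4⟩

theorem equivalent_of_map {A B : EtaleNbhd X Y} (hbase : A.base = B.base)
    (h : A.V.total ⟶ B.V.total) (hh : Etale h) (h1 : A.V.σ ≫ h = B.V.σ) (h2 : h ≫ B.φ = A.φ)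
    (h3 : h ≫ B.ψ = A.ψ) : A.Equivalent B :=
  equivalent_of A B hbase fun _ ↦ ⟨⊤, trivial, A.V.total, 𝟙 _, h, Scheme.Opens.ι ⊤ ≫ A.V.σ,
    inferInstance, hh, by simp, by simp [h1], by simp [h2], by simp [h3]⟩

theorem Equivalent.refl (A : EtaleNbhd X Y) : A.Equivalent A :=
  equivalent_of_map rfl (𝟙 _) inferInstance (by simp) (by simp) (by simp)

theorem Equivalent.symm {A B : EtaleNbhd X Y} (h : A.Equivalent B) : B.Equivalent A :=
  ⟨h.1.symm, fun s ↦ by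
    obtain ⟨U, hU, W, a, b, h1, h2, h3, h4, h5, h6, h7, h8⟩ := h.2 s
    exact ⟨U, hU, W, b, a, h2, h1, h4, h3, h6, h5, h7.symm, h8.symm⟩⟩

theorem Equivalent.trans {A B C : EtaleNbhd X Y} (h : A.Equivalent B) (h' : B.Equivalent C) :
    A.Equivalent C := by
  refine equivalent_of A C (h.1.trans h'.1) fun s ↦ ?_
  obtain ⟨U, hU, W, a, b, τ, ha, hb, h1, h2, h3, h4⟩ := h.exists s
  obtain ⟨U', hU', W', b', c, τ', hb', hc, h1', h2', h3', h4'⟩ := h'.exists s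
  have e1 : Etale (pullback.fst b b') := inferInstance
  have e2 : Etale (pullback.snd b b') := inferInstance
  refine ⟨U ⊓ U', ⟨hU, hU'⟩, pullback b b', pullback.fst _ _ ≫ a, pullback.snd _ _ ≫ c,
    pullback.lift (Scheme.homOfLE _ inf_le_left ≫ τ) (Scheme.homOfLE _ inf_le_right ≫ τ')
      (by simp [h2, h1']), etale_comp_mem e1 ha, etale_comp_mem e2 hc, ?_, ?_, ?_, ?_⟩
  · rw [pullback.lift_fst_assoc]; simp [h1]
  · rw [pullback.lift_snd_assoc]; simp [h2']
  · simp only [Category.assoc, h3, ← h3', pullback.condition_assoc]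
  · simp only [Category.assoc, h4, ← h4', pullback.condition_assoc]

instance setoid (X Y : PtFam k n) : Setoid (EtaleNbhd X Y) where
  r := Equivalent
  iseqv := ⟨Equivalent.refl, Equivalent.symm, Equivalent.trans⟩

/-- A morphism of pointed families, as a common étale neighbourhood. -/
def ofHom (f : X ⟶ Y) : EtaleNbhd X Y where
  base := PtFam.Hom.base f
  V := X.fam
  φ := 𝟙 _
  etale_φ := inferInstance
  φ_π := Category.id_comp _
  σ_φ := Category.comp_id _
  ψ := PtFam.Hom.total f
  etSq_ψ := PtFam.Hom.etSq f
  σ_ψ := PtFam.Hom.σ_total f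

/-- The composition of common étale neighbourhoods, by means of the fibre product. -/
def comp (A : EtaleNbhd X Y) (B : EtaleNbhd Y Z) : EtaleNbhd X Z where
  base := A.base ≫ B.base
  V :=
    { total := pullback A.ψ B.φ
      π := pullback.fst _ _ ≫ A.V.π
      smooth := by
        have h1 : Etale (pullback.fst A.ψ B.φ) := inferInstance
        exact smooth_etale_comp h1 A.V.smooth
      σ := pullback.lift A.V.σ (A.base.left ≫ B.V.σ) (by rw [A.σ_ψ, Category.assoc, B.σ_φ])
      σ_π := by rw [pullback.lift_fst_assoc, A.V.σ_π] }
  φ := pullback.fst _ _ ≫ A.φ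
  etale_φ := by
    have h1 : Etale (pullback.fst A.ψ B.φ) := inferInstance
    exact etale_comp_mem h1 A.etale_φ
  φ_π := by dsimp only; rw [Category.assoc, A.φ_π]
  σ_φ := by dsimp only; rw [pullback.lift_fst_assoc, A.σ_φ]
  ψ := pullback.snd _ _ ≫ B.ψ
  etSq_ψ := by
    have h := A.etSq_ψ.pullback_snd B.φ
    rw [B.φ_π] at h
    exact h.comp B.etSq_ψ
  σ_ψ := by
    dsimp only
    rw [pullback.lift_snd_assoc, Category.assoc, B.σ_ψ, Over.comp_left, Category.assoc]

theorem comp_congr_left {A A' : EtaleNbhd X Y} (h : A.Equivalent A') (B : EtaleNbhd Y Z) :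
    (A.comp B).Equivalent (A'.comp B) := by
  refine equivalent_of _ _ (congrArg (· ≫ B.base) h.1) fun s ↦ ?_
  obtain ⟨U, hU, W, a, b, τ, ha, hb, h1, h2, h3, h4⟩ := h.exists s
  have key (C : EtaleNbhd X Y) (c : W ⟶ C.V.total) (hc : Etale c) (e : a ≫ A.ψ = c ≫ C.ψ) :
      Etale (pullback.lift (pullback.fst (a ≫ A.ψ) B.φ ≫ c) (pullback.snd _ _)
        (by rw [Category.assoc, ← e, pullback.condition]) :
        pullback (a ≫ A.ψ) B.φ ⟶ pullback C.ψ B.φ) := by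
    have sq := IsPullback.of_hasPullback C.ψ B.φ
    refine MorphismProperty.of_isPullback (P := @Etale.{u}) (IsPullback.of_bot (h₃₁ := B.φ)
      (v₂₁ := pullback.snd _ _) (v₂₂ := C.ψ) (h₁₁ := pullback.fst _ _)
      (v₁₂ := c) ?_ ?_ sq) hc
    · rw [pullback.lift_snd, ← e]
      exact IsPullback.of_hasPullback _ _
    · rw [pullback.lift_fst]
  refine ⟨U, hU, pullback (a ≫ A.ψ) B.φ,
    pullback.lift (pullback.fst _ _ ≫ a) (pullback.snd _ _)
      (by rw [Category.assoc, pullback.condition]),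
    pullback.lift (pullback.fst _ _ ≫ b) (pullback.snd _ _)
      (by rw [Category.assoc, ← h4, pullback.condition]),
    pullback.lift τ (U.ι ≫ A.base.left ≫ B.V.σ)
      (by rw [reassoc_of% h1, A.σ_ψ]; simp [B.σ_φ]), key A a ha rfl, key A' b hb h4, ?_, ?_, ?_, ?_⟩
  · refine pullback.hom_ext ?_ ?_
    · simp only [Category.assoc, pullback.lift_fst, comp, pullback.lift_fst_assoc, h1]
    · simp only [Category.assoc, pullback.lift_snd, comp]
  · refine pullback.hom_ext ?_ ?_
    · simp only [Category.assoc, pullback.lift_fst, comp, pullback.lift_fst_assoc, h2]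
    · simp only [Category.assoc, pullback.lift_snd, comp, h.1]
  · simp only [comp, pullback.lift_fst_assoc, Category.assoc, h3]
  · simp only [comp, pullback.lift_snd_assoc, Category.assoc]

theorem comp_congr_right (A : EtaleNbhd X Y) {B B' : EtaleNbhd Y Z} (h : B.Equivalent B') :
    (A.comp B).Equivalent (A.comp B') := by
  refine equivalent_of _ _ (congrArg (A.base ≫ ·) h.1) fun s ↦ ?_
  obtain ⟨U, hU, W, a, b, τ, ha, hb, h1, h2, h3, h4⟩ := h.exists (A.base.left s)
  have key (C : EtaleNbhd Y Z) (c : W ⟶ C.V.total) (hc : Etale c) (e : a ≫ B.φ = c ≫ C.φ) :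
      Etale (pullback.lift (pullback.fst A.ψ (a ≫ B.φ)) (pullback.snd _ _ ≫ c)
        (by rw [Category.assoc, ← e, pullback.condition]) :
        pullback A.ψ (a ≫ B.φ) ⟶ pullback A.ψ C.φ) := by
    have sq := IsPullback.of_hasPullback A.ψ C.φ
    refine MorphismProperty.of_isPullback (P := @Etale.{u}) (IsPullback.of_bot (h₃₁ := A.ψ)
      (v₂₁ := pullback.fst _ _) (v₂₂ := C.φ) (h₁₁ := pullback.snd _ _)
      (v₁₂ := c) ?_ ?_ sq.flip) hc
    · rw [pullback.lift_fst, ← e]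
      exact (IsPullback.of_hasPullback _ _).flip
    · rw [pullback.lift_snd]
  refine ⟨A.base.left ⁻¹ᵁ U, hU, pullback A.ψ (a ≫ B.φ),
    pullback.lift (pullback.fst _ _) (pullback.snd _ _ ≫ a)
      (by rw [Category.assoc, pullback.condition]),
    pullback.lift (pullback.fst _ _) (pullback.snd _ _ ≫ b)
      (by rw [Category.assoc, ← h3, pullback.condition]),
    pullback.lift (Scheme.Opens.ι _ ≫ A.V.σ) ((A.base.left ∣_ U) ≫ τ)
      (by simp [A.σ_ψ, reassoc_of% h1, B.σ_φ]), key B a ha rfl, key B' b hb h3, ?_, ?_, ?_, ?_⟩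
  · refine pullback.hom_ext ?_ ?_
    · simp only [Category.assoc, pullback.lift_fst, comp]
    · simp only [Category.assoc, pullback.lift_snd, comp, pullback.lift_snd_assoc, h1,
        morphismRestrict_ι_assoc]
  · refine pullback.hom_ext ?_ ?_
    · simp only [Category.assoc, pullback.lift_fst, comp]
    · simp only [Category.assoc, pullback.lift_snd, comp, pullback.lift_snd_assoc, h2,
        morphismRestrict_ι_assoc]
  · simp only [comp, pullback.lift_fst_assoc, Category.assoc]
  · simp only [comp, pullback.lift_snd_assoc, Category.assoc, h4]

end EtaleNbhd
end Germs

section GermCategory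

theorem etale_fst {X Y Z : Scheme.{u}} {f : X ⟶ Z} {g : Y ⟶ Z} (hg : Etale g) :
    Etale (pullback.fst f g) := inferInstance

theorem etale_snd {X Y Z : Scheme.{u}} {f : X ⟶ Z} {g : Y ⟶ Z} (hf : Etale f) :
    Etale (pullback.snd f g) := inferInstance

theorem etale_of_iso {X Y : Scheme.{u}} (e : X ≅ Y) : Etale e.hom := inferInstance

theorem etale_of_isIso {X Y : Scheme.{u}} (f : X ⟶ Y) [IsIso f] : Etale f := inferInstance

variable (k : Type u) [Field k] (n : ℕ)

/-- The category, fibred in groupoids over the category of `k`-schemes, of pointed étale germs that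
come from pointed families: its objects are the pointed families `X ⇄ S`, and its morphisms
from `X ⇄ S` to `Y ⇄ T` over `S ⟶ T` are the equivalence classes of common étale neighbourhoods
between `X ⇄ S` and `Y ×_T S ⇄ S`. -/
structure FamilyGerm where
  pt : PtFam k n

variable {k n}

namespace FamilyGerm

open EtaleNbhd

instance : Category (FamilyGerm k n) where
  Hom X Y := Quotient (EtaleNbhd.setoid X.pt Y.pt)
  id X := Quotient.mk _ (ofHom (𝟙 X.pt))
  comp f g := Quotient.map₂ EtaleNbhd.comp
    (fun _ _ h _ _ h' ↦ (comp_congr_left h _).trans (comp_congr_right _ h')) f g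
  id_comp {X Y} f := by
    induction f using Quotient.inductionOn with | _ A
    refine Quotient.sound (equivalent_of_map (Category.id_comp A.base) (pullback.snd _ _)
      ?_ ?_ ?_ rfl)
    · exact etale_snd (f := (ofHom (𝟙 X.pt)).ψ) (etale_of_isIso (𝟙 X.pt.fam.total))
    · simp only [EtaleNbhd.comp, pullback.lift_snd]
      exact Category.id_comp _
    · simp only [EtaleNbhd.comp, ← pullback.condition]
      rfl
  comp_id {X Y} f := by
    induction f using Quotient.inductionOn with | _ A
    refine Quotient.sound (equivalent_of_map (Category.comp_id A.base) (pullback.fst _ _)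
      ?_ ?_ rfl ?_)
    · exact etale_fst (ofHom (𝟙 Y.pt)).etale_φ
    · simp only [EtaleNbhd.comp, pullback.lift_fst]
    · simp only [EtaleNbhd.comp, pullback.condition]
      rfl
  assoc f g h := by
    induction f using Quotient.inductionOn with | _ A
    induction g using Quotient.inductionOn with | _ B
    induction h using Quotient.inductionOn with | _ C
    refine Quotient.sound (equivalent_of_map (Category.assoc _ _ _)
      (pullbackAssoc A.ψ B.φ B.ψ C.φ).hom (etale_of_iso _) ?_ ?_ ?_)
    · refine pullback.hom_ext ?_ (pullback.hom_ext ?_ ?_)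
      · simp [EtaleNbhd.comp, pullback.lift_fst, pullback.lift_fst_assoc]
      · simp [EtaleNbhd.comp, pullback.lift_fst, pullback.lift_snd, pullback.lift_fst_assoc]
      · simp [EtaleNbhd.comp, pullback.lift_snd]
    · simp [EtaleNbhd.comp]
    · simp [EtaleNbhd.comp]

/-- The functor to `k`-schemes. -/
def proj : FamilyGerm k n ⥤ SchOver k where
  obj X := X.pt.base
  map f := Quotient.lift EtaleNbhd.base (fun _ _ h ↦ (h : Equivalent _ _).1) f
  map_id _ := rfl
  map_comp f g := by
    induction f using Quotient.inductionOn with | _ A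
    induction g using Quotient.inductionOn with | _ B
    rfl

theorem ofPtFam_aux {P X Y Z : Scheme.{u}} {a : P ⟶ X} {b : P ⟶ Y} (f : X ⟶ Y) (i : Y ⟶ Y)
    (g : Y ⟶ Z) (h : a ≫ f = b ≫ i) (hi : i = 𝟙 Y := by rfl) : a ≫ f ≫ g = b ≫ g := by
  subst hi
  rw [reassoc_of% h]

/-- A fibrewise étale morphism of pointed families induces a morphism of germs. -/
def ofPtFam : PtFam k n ⥤ FamilyGerm k n where
  obj X := ⟨X⟩
  map f := Quotient.mk _ (ofHom f)
  map_id _ := rfl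
  map_comp {X Y Z} f g := by
    refine Quotient.sound (Equivalent.symm (equivalent_of_map rfl (pullback.fst _ _)
      ?_ ?_ ?_ ?_))
    · exact etale_fst (ofHom g).etale_φ
    · exact pullback.lift_fst _ _ _
    · rfl
    · exact ofPtFam_aux _ _ _ pullback.condition

end FamilyGerm

section DiagMap

variable {X S X' S' X'' S'' : Scheme.{u}} {π : X ⟶ S} {π' : X' ⟶ S'} {π'' : X'' ⟶ S''}
  {f : X ⟶ X'} {g : S ⟶ S'} {f' : X' ⟶ X''} {g' : S' ⟶ S''}

/-- The map `X ×_S X ⟶ X' ×_{S'} X'` induced by a commutative square. -/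
def diagMap (w : f ≫ π' = π ≫ g) : pullback π π ⟶ pullback π' π' :=
  pullback.lift (pullback.fst _ _ ≫ f) (pullback.snd _ _ ≫ f)
    (by simp only [Category.assoc, w, pullback.condition_assoc])

theorem diagMap_fst (w : f ≫ π' = π ≫ g) :
    diagMap w ≫ pullback.fst _ _ = pullback.fst _ _ ≫ f := pullback.lift_fst _ _ _

theorem diagMap_snd (w : f ≫ π' = π ≫ g) :
    diagMap w ≫ pullback.snd _ _ = pullback.snd _ _ ≫ f := pullback.lift_snd _ _ _

theorem diagMap_etSq (h : EtSq π π' f g) :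
    EtSq (pullback.fst π π) (pullback.fst π' π') (diagMap h.1) f := by
  have h' := (EtSq.of_isPullback (IsPullback.of_hasPullback π π).flip).comp h
  rw [← h.1] at h'
  refine EtSq.cancel (gX := pullback.snd _ _) (π'' := π') (gS := π') ?_
    (pullback.lift_fst _ _ _) (IsPullback.of_hasPullback π' π').flip
  rw [diagMap_snd]
  exact h'

theorem diagonal_diagMap (w : f ≫ π' = π ≫ g) :
    pullback.diagonal π ≫ diagMap w = f ≫ pullback.diagonal π' := by
  apply pullback.hom_ext
  · simp [diagMap_fst]
  · simp [diagMap_snd]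

theorem diagMap_id {f : X ⟶ X} {g : S ⟶ S} (w : f ≫ π = π ≫ g) (hf : f = 𝟙 _) :
    diagMap w = 𝟙 _ := by
  subst hf
  apply pullback.hom_ext
  · simp [diagMap_fst]
  · simp [diagMap_snd]

theorem diagMap_comp (w : f ≫ π' = π ≫ g) (w' : f' ≫ π'' = π' ≫ g')
    {f'' : X ⟶ X''} {g'' : S ⟶ S''} (w'' : f'' ≫ π'' = π ≫ g'') (e : f'' = f ≫ f') :
    diagMap w'' = diagMap w ≫ diagMap w' := by
  subst e
  apply pullback.hom_ext
  · rw [Category.assoc, diagMap_fst, diagMap_fst, ← Category.assoc, ← Category.assoc, diagMap_fst]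
  · rw [Category.assoc, diagMap_snd, diagMap_snd, ← Category.assoc, ← Category.assoc, diagMap_snd]

end DiagMap

/-- The pointed family `X ×_S X ⇄ X`, with the first projection and the diagonal section. -/
def Family.diagonal {S : Scheme.{u}} (X : Family n S) : PointedFamily n X.total where
  total := pullback X.π X.π
  π := pullback.fst _ _
  smooth := (smoothOfRelativeDimension_isStableUnderBaseChange n).of_isPullback
    (IsPullback.of_hasPullback _ _).flip X.smooth
  σ := pullback.diagonal X.π
  σ_π := pullback.diagonal_fst _

theorem Fam.Hom.w {X Y : Fam k n} (f : Fam.Hom X Y) :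
    f.total ≫ Y.fam.π = X.fam.π ≫ f.base.left := f.etSq.1

theorem Fam.Hom.w_assoc {X Y : Fam k n} (f : Fam.Hom X Y) :
    f.total ≫ Y.fam.π ≫ Y.base.hom = X.fam.π ≫ X.base.hom := by
  rw [reassoc_of% f.w, Over.w]

/-- `X/S ↦ (X ×_S X ⇄ X)`. -/
def Fam.diagonal : Fam k n ⥤ PtFam k n where
  obj X := ⟨Over.mk (X.fam.π ≫ X.base.hom), X.fam.diagonal⟩
  map {X Y} f :=
    { base := Over.homMk (Fam.Hom.total f) (Fam.Hom.w_assoc f)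
      total := diagMap (Fam.Hom.w f)
      fibrewiseEtale := (fibrewiseEtale_iff n).mpr (diagMap_etSq (Fam.Hom.etSq f))
      σ_total := diagonal_diagMap (Fam.Hom.w f) }
  map_id X := PtFam.Hom.ext rfl (diagMap_id (Fam.Hom.w (𝟙 X)) rfl)
  map_comp f g := PtFam.Hom.ext rfl
    (diagMap_comp (Fam.Hom.w f) (Fam.Hom.w g) (Fam.Hom.w (f ≫ g)) rfl)

end GermCategory

/-! ### Stackification of a fibred category by the plus construction -/

section PlusConstruction

universe v₁ u₁ v₂ u₂

variable {C : Type u₁} [Category.{v₁} C] (J : GrothendieckTopology C)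
  {P : Type u₂} [Category.{v₂} P] (p : P ⥤ C)

/-- The objects over `base` of the plus construction of a category `p : P ⥤ C` fibred in groupoids:
a covering sieve of `base` and a morphism of fibred categories over `C` from this sieve to `P`. -/
structure Plus where
  base : C
  R : Sieve base
  mem : R ∈ J base
  obj : ∀ ⦃T : C⦄ (g : T ⟶ base), R g → P
  map : ∀ ⦃T T' : C⦄ (h : T' ⟶ T) (g : T ⟶ base) (g' : T' ⟶ base) (_ : h ≫ g = g')
    (hg : R g) (hg' : R g'), obj g' hg' ⟶ obj g hg
  isHomLift_map : ∀ ⦃T T' : C⦄ (h : T' ⟶ T) (g : T ⟶ base) (g' : T' ⟶ base) (w : h ≫ g = g')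
    (hg : R g) (hg' : R g'), p.IsHomLift h (map h g g' w hg hg')
  map_id : ∀ ⦃T : C⦄ (g : T ⟶ base) (w : 𝟙 T ≫ g = g) (hg : R g), map (𝟙 T) g g w hg hg = 𝟙 _
  map_comp : ∀ ⦃T T' T'' : C⦄ (h : T' ⟶ T) (h' : T'' ⟶ T') (g : T ⟶ base) (g' : T' ⟶ base)
    (g'' : T'' ⟶ base) (w : h ≫ g = g') (w' : h' ≫ g' = g'') (w'' : (h' ≫ h) ≫ g = g'')
    (hg : R g) (hg' : R g') (hg'' : R g''),
    map (h' ≫ h) g g'' w'' hg hg'' = map h' g' g'' w' hg' hg'' ≫ map h g g' w hg hg'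

namespace Plus

variable {J p}

/-- A morphism from the restriction of `x` to the restriction of `y` on a covering sieve `Q`. -/
structure PreHom (x y : Plus J p) where
  base : x.base ⟶ y.base
  Q : Sieve x.base
  mem : Q ∈ J x.base
  le_left : ∀ ⦃T : C⦄ (g : T ⟶ x.base), Q g → x.R g
  le_right : ∀ ⦃T : C⦄ (g : T ⟶ x.base), Q g → y.R (g ≫ base)
  app : ∀ ⦃T : C⦄ (g : T ⟶ x.base) (g' : T ⟶ y.base) (_ : g ≫ base = g') (_ : Q g)
    (hx : x.R g) (hy : y.R g'), x.obj g hx ⟶ y.obj g' hy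
  isHomLift_app : ∀ ⦃T : C⦄ (g : T ⟶ x.base) (g' : T ⟶ y.base) (w : g ≫ base = g') (hg : Q g)
    (hx : x.R g) (hy : y.R g'), p.IsHomLift (𝟙 T) (app g g' w hg hx hy)
  naturality : ∀ ⦃T T' : C⦄ (h : T' ⟶ T) (g : T ⟶ x.base) (g₁ : T' ⟶ x.base) (w₁ : h ≫ g = g₁)
    (g' : T ⟶ y.base) (g₁' : T' ⟶ y.base) (w₁' : h ≫ g' = g₁')
    (w : g ≫ base = g') (w' : g₁ ≫ base = g₁') (hg : Q g) (hg₁ : Q g₁)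
    (hx : x.R g) (hy : y.R g') (hx₁ : x.R g₁) (hy₁ : y.R g₁'),
    x.map h g g₁ w₁ hx hx₁ ≫ app g g' w hg hx hy =
      app g₁ g₁' w' hg₁ hx₁ hy₁ ≫ y.map h g' g₁' w₁' hy hy₁

namespace PreHom

variable {x y z : Plus J p}

/-- Two such morphisms are identified if they agree on a smaller covering sieve. -/
def Rel (A B : PreHom x y) : Prop :=
  A.base = B.base ∧ ∃ Q ∈ J x.base, ∀ ⦃T : C⦄ (g : T ⟶ x.base) (g' : T ⟶ y.base)
    (wA : g ≫ A.base = g') (wB : g ≫ B.base = g') (_ : Q g) (hA : A.Q g) (hB : B.Q g)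
    (hx : x.R g) (hy : y.R g'), A.app g g' wA hA hx hy = B.app g g' wB hB hx hy

instance setoid (x y : Plus J p) : Setoid (PreHom x y) where
  r := Rel
  iseqv :=
    { refl := fun _ ↦ ⟨rfl, ⊤, J.top_mem _, fun _ _ _ _ _ _ _ _ _ _ ↦ rfl⟩
      symm := fun ⟨h, Q, hQ, e⟩ ↦ ⟨h.symm, Q, hQ, fun _ g g' wA wB hg hA hB hx hy ↦
        (e g g' wB wA hg hB hA hx hy).symm⟩
      trans := fun {_ B _} ⟨h, Q, hQ, e⟩ ⟨h', Q', hQ', e'⟩ ↦ ⟨h.trans h', Q ⊓ Q' ⊓ B.Q,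
        J.intersection_covering (J.intersection_covering hQ hQ') B.mem,
        fun _ g g' wA wC hg hA hC hx hy ↦
          (e g g' wA (h ▸ wA) hg.1.1 hA hg.2 hx hy).trans
            (e' g g' (h ▸ wA) wC hg.1.2 hg.2 hC hx hy)⟩ }

/-- The identity. -/
def id (x : Plus J p) : PreHom x x where
  base := 𝟙 _
  Q := x.R
  mem := x.mem
  le_left _ _ h := h
  le_right _ _ h := by rwa [Category.comp_id]
  app T g g' w hg hx hy := x.map (𝟙 T) g' g (by rw [← w]; simp) hy hx
  isHomLift_app _ _ _ _ _ _ _ := x.isHomLift_map _ _ _ _ _ _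
  naturality T T' h g g₁ w₁ g' g₁' w₁' w w' hg hg₁ hx hy hx₁ hy₁ := by
    rw [Category.comp_id] at w w'
    subst w w'
    rw [x.map_id, x.map_id, Category.id_comp, Category.comp_id]

theorem comp_aux {a b c b' c' : P} {f : a ⟶ b} {g : b ⟶ c} {g' : a ⟶ b'} {f' : b' ⟶ c}
    {d : P} {h : c ⟶ d} {h' : b' ⟶ c'} {k : c' ⟶ d} (h1 : f ≫ g = g' ≫ f')
    (h2 : f' ≫ h = h' ≫ k) : f ≫ g ≫ h = (g' ≫ h') ≫ k := by
  rw [reassoc_of% h1, h2, Category.assoc]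

/-- The composition. -/
def comp (A : PreHom x y) (B : PreHom y z) : PreHom x z where
  base := A.base ≫ B.base
  Q := A.Q ⊓ B.Q.pullback A.base
  mem := J.intersection_covering A.mem (J.pullback_stable A.base B.mem)
  le_left _ g h := A.le_left g h.1
  le_right _ g h := by simpa using B.le_right _ h.2
  app T g g' w hg hx hy := A.app g (g ≫ A.base) rfl hg.1 hx (A.le_right g hg.1) ≫
    B.app (g ≫ A.base) g' (by simpa using w) hg.2 (A.le_right g hg.1) hy
  isHomLift_app _ g g' _ hg hx hy := by
    have := A.isHomLift_app g _ rfl hg.1 hx (A.le_right g hg.1)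
    have := B.isHomLift_app (g ≫ A.base) g' (by simpa using ‹_›) hg.2 (A.le_right g hg.1) hy
    infer_instance
  naturality T T' h g g₁ w₁ g' g₁' w₁' w w' hg hg₁ hx hy hx₁ hy₁ := by
    have e : h ≫ g ≫ A.base = g₁ ≫ A.base := by rw [← Category.assoc, w₁]
    have h1 := A.naturality h g g₁ w₁ _ (g₁ ≫ A.base) e rfl rfl hg.1 hg₁.1 hx
      (A.le_right g hg.1) hx₁ (A.le_right g₁ hg₁.1)
    have h2 := B.naturality h (g ≫ A.base) (g₁ ≫ A.base) e g' g₁' w₁' (by simpa using w)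
      (by simpa using w') hg.2 hg₁.2 (A.le_right g hg.1) hy (A.le_right g₁ hg₁.1) hy₁
    have h3 := comp_aux h1 h2
    exact h3

theorem comp_app (A : PreHom x y) (B : PreHom y z) {T : C} (g : T ⟶ x.base) (u : T ⟶ y.base)
    (g' : T ⟶ z.base) (w : g ≫ (A.comp B).base = g') (hg : (A.comp B).Q g) (hx : x.R g)
    (hz : z.R g') (hu : g ≫ A.base = u) (w' : u ≫ B.base = g') (hA : A.Q g) (hB : B.Q u)
    (hy : y.R u) : (A.comp B).app g g' w hg hx hz = A.app g u hu hA hx hy ≫ B.app u g' w' hB hy hz := by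
  subst hu
  rfl

end PreHom

instance : Category (Plus J p) where
  Hom x y := Quotient (PreHom.setoid x y)
  id x := Quotient.mk _ (PreHom.id x)
  comp f g := Quotient.map₂ PreHom.comp (by
    rintro A A' ⟨h, Q, hQ, e⟩ B B' ⟨h', Q', hQ', e'⟩
    obtain ⟨b, QA, mA, l1, l2, a, i, nat⟩ := A
    dsimp only at h
    subst h
    refine ⟨congrArg (_ ≫ ·) h', Q ⊓ Q'.pullback A'.base,
      J.intersection_covering hQ (J.pullback_stable _ hQ'), ?_⟩
    intro T g g' wA wB hg hA hB hx hy
    change _ ≫ _ = _ ≫ _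
    rw [e g _ rfl rfl hg.1 hA.1 hB.1, e' _ g' _ (by simpa [PreHom.comp] using wB) hg.2 hA.2 hB.2]) f g
  id_comp {x y} f := by
    induction f using Quotient.inductionOn with | _ A
    refine Quotient.sound ⟨Category.id_comp _, ⊤, J.top_mem _, ?_⟩
    intro T g g' wA wB _ hA hB hx hy
    change x.map (𝟙 T) (g ≫ 𝟙 _) g _ _ _ ≫ A.app _ g' _ _ _ _ = _
    have hR : x.R (g ≫ 𝟙 _) := by rwa [Category.comp_id]
    have hQ : A.Q (g ≫ 𝟙 _) := by rwa [Category.comp_id]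
    have h1 := A.naturality (𝟙 T) (g ≫ 𝟙 _) g (by simp) g' g' (by simp) (by simpa using wB) wB
      hQ hB hR hy hx hy
    exact h1.trans ((congrArg (_ ≫ ·) (y.map_id _ _ _)).trans (Category.comp_id _))
  comp_id {x y} f := by
    induction f using Quotient.inductionOn with | _ A
    refine Quotient.sound ⟨Category.comp_id _, ⊤, J.top_mem _, ?_⟩
    intro T g g' wA wB _ hA hB hx hy
    obtain rfl := wB
    change A.app _ _ _ _ _ _ ≫ y.map (𝟙 T) (g ≫ A.base) (g ≫ A.base) _ _ _ = _
    rw [y.map_id, Category.comp_id]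
  assoc {x y z w} f g h := by
    induction f using Quotient.inductionOn with | _ A
    induction g using Quotient.inductionOn with | _ B
    induction h using Quotient.inductionOn with | _ D
    refine Quotient.sound ⟨Category.assoc _ _ _, ⊤, J.top_mem _, ?_⟩
    intro T g g' wA wB _ hA hB hx hy
    have e : (g ≫ A.base) ≫ B.base = g ≫ (A.base ≫ B.base) := Category.assoc _ _ _
    have hQ : B.Q (g ≫ A.base) := hA.1.2
    have hy' : z.R (g ≫ (A.base ≫ B.base)) := e ▸ B.le_right _ hQ
    have h1 := PreHom.comp_app B D (g ≫ A.base) (g ≫ (A.base ≫ B.base)) g'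
      (by simpa [PreHom.comp] using wB) hB.2 (A.le_right _ hA.1.1) hy e
      (by simpa [PreHom.comp] using wB) hQ hA.2 hy'
    exact (Category.assoc _ _ _).trans (congrArg (_ ≫ ·) h1.symm)

/-- The functor to the base category. -/
def proj (J : GrothendieckTopology C) (p : P ⥤ C) : Plus J p ⥤ C where
  obj x := x.base
  map f := Quotient.lift PreHom.base (fun _ _ h ↦ (h : PreHom.Rel _ _).1) f
  map_id _ := rfl
  map_comp f g := by
    induction f using Quotient.inductionOn with | _ A
    induction g using Quotient.inductionOn with | _ B
    rfl

/-- The restriction of an object of the plus construction along a morphism of the base category. -/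
def restrict (y : Plus J p) {S : C} (f : S ⟶ y.base) : Plus J p where
  base := S
  R := y.R.pullback f
  mem := J.pullback_stable f y.mem
  obj _ g hg := y.obj (g ≫ f) hg
  map _ _ h g g' w hg hg' := y.map h (g ≫ f) (g' ≫ f) (by rw [← w, Category.assoc]) hg hg'
  isHomLift_map _ _ _ _ _ _ _ _ := y.isHomLift_map _ _ _ _ _ _
  map_id _ _ _ _ := y.map_id _ _ _
  map_comp _ _ _ _ _ _ _ _ _ _ _ _ _ _ := y.map_comp _ _ _ _ _ _ _ _ _ _ _

/-- The morphism from the restriction. -/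
def restrictHom (y : Plus J p) {S : C} (f : S ⟶ y.base) : PreHom (y.restrict f) y where
  base := f
  Q := y.R.pullback f
  mem := J.pullback_stable f y.mem
  le_left _ _ h := h
  le_right _ _ h := h
  app _ g g' w _ hx hy := y.map (𝟙 _) g' (g ≫ f) (by rw [w, Category.id_comp]) hy hx
  isHomLift_app _ _ _ _ _ _ _ := y.isHomLift_map _ _ _ _ _ _
  naturality _ _ h g g₁ w₁ g' g₁' w₁' w w' _ _ hx hy hx₁ hy₁ := by
    subst w w'
    exact (congrArg (_ ≫ ·) (y.map_id _ _ _)).trans ((Category.comp_id _).trans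
      ((Category.id_comp _).symm.trans (congrArg (· ≫ _) (y.map_id _ _ _).symm)))

theorem restrict_aux {S T U V : C} {f : S ⟶ V} {g : U ⟶ S} {a : U ⟶ V} {u : T ⟶ U} {u' : T ⟶ S}
    (h : a = g ≫ f) (w : u ≫ g = u') : u ≫ a = u' ≫ f := by
  rw [h, ← w, Category.assoc]

theorem restrict_aux' {S T U V : C} {f : S ⟶ V} {u : U ⟶ S} {h : T ⟶ U} {u₁ : T ⟶ S}
    (w : h ≫ u = u₁) : h ≫ u ≫ f = u₁ ≫ f := by
  rw [← w, Category.assoc]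

/-- The factorization of a morphism through the restriction. -/
def restrictLift {y : Plus J p} {S : C} (f : S ⟶ y.base) {z : Plus J p} (g : z.base ⟶ S)
    (A : PreHom z y) (hA : A.base = g ≫ f) : PreHom z (y.restrict f) where
  base := g
  Q := A.Q
  mem := A.mem
  le_left := A.le_left
  le_right T u hu := by
    have := A.le_right u hu
    rw [hA] at this
    change y.R ((u ≫ g) ≫ f)
    rwa [Category.assoc]
  app T u u' w hu hx hy := A.app u (u' ≫ f) (restrict_aux hA w) hu hx hy
  isHomLift_app _ _ _ _ _ _ _ := A.isHomLift_app _ _ _ _ _ _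
  naturality T T' h u u₁ w₁ u' u₁' w₁' w w' hu hu₁ hx hy hx₁ hy₁ :=
    A.naturality h u u₁ w₁ (u' ≫ f) (u₁' ≫ f) (restrict_aux' w₁') _ _ hu hu₁ hx hy
      hx₁ hy₁

theorem restrictLift_comp {y : Plus J p} {S : C} (f : S ⟶ y.base) {z : Plus J p} (g : z.base ⟶ S)
    (A : PreHom z y) (hA : A.base = g ≫ f) :
    ((restrictLift f g A hA).comp (y.restrictHom f)).Rel A := by
  refine ⟨hA.symm, ⊤, J.top_mem _, fun T u u' w w' _ h1 h2 hx hy ↦ ?_⟩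
  obtain rfl : (u ≫ g) ≫ f = u' := (Category.assoc _ _ _).trans w
  exact (congrArg (A.app u _ _ _ _ _ ≫ ·) (y.map_id _ _ _)).trans (Category.comp_id _)

theorem restrictHom_cancel {y : Plus J p} {S : C} (f : S ⟶ y.base) {z : Plus J p}
    {A B : PreHom z (y.restrict f)} (hb : A.base = B.base)
    (h : (A.comp (y.restrictHom f)).Rel (B.comp (y.restrictHom f))) : A.Rel B := by
  obtain ⟨-, Q, hQ, e⟩ := h
  refine ⟨hb, Q, hQ, fun T u u' wA wB hu hA hB hx hy ↦ ?_⟩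
  have hA' : ((A.comp (y.restrictHom f)).Q) u := ⟨hA, A.le_right u hA⟩
  have hB' : ((B.comp (y.restrictHom f)).Q) u := ⟨hB, B.le_right u hB⟩
  have e1 := e u (u' ≫ f) (by rw [← wA]; exact (Category.assoc _ _ _).symm)
    (by rw [← wB]; exact (Category.assoc _ _ _).symm) hu hA' hB' hx hy
  have hq : (y.R.pullback f) u' := hy
  rw [PreHom.comp_app A (y.restrictHom f) u u' (u' ≫ f) _ hA' hx hy wA rfl hA hq hy,
    PreHom.comp_app B (y.restrictHom f) u u' (u' ≫ f) _ hB' hx hy wB rfl hB hq hy] at e1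
  have e2 : (y.restrictHom f).app u' (u' ≫ f) rfl hq hy hy = 𝟙 _ := y.map_id _ _ _
  rw [e2] at e1
  exact (Category.comp_id _).symm.trans (e1.trans (Category.comp_id _))

theorem eq_of_isHomLift_proj {x y : Plus J p} {f : (proj J p).obj x ⟶ (proj J p).obj y} {φ : x ⟶ y}
    (h : (proj J p).IsHomLift f φ) : f = (proj J p).map φ :=
  IsHomLift.eq_of_isHomLift (p := proj J p) (a := x) (b := y) f φ

instance : (proj J p).IsFibered := by
  refine Functor.IsFibered.of_exists_isStronglyCartesian fun y S f ↦
    ⟨y.restrict f, Quotient.mk _ (y.restrictHom f), ?_⟩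
  have : (proj J p).IsHomLift f (Quotient.mk _ (y.restrictHom f) : y.restrict f ⟶ y) :=
    Functor.IsHomLift.map (p := proj J p) (Quotient.mk _ (y.restrictHom f) : y.restrict f ⟶ y)
  constructor
  intro z g φ hφ
  obtain ⟨A, rfl⟩ := Quotient.exists_rep φ
  have hA : A.base = g ≫ f := (eq_of_isHomLift_proj hφ).symm
  refine ⟨Quotient.mk _ (restrictLift f g A hA), ⟨?_, ?_⟩, ?_⟩
  · exact Functor.IsHomLift.map (p := proj J p)
      (Quotient.mk _ (restrictLift f g A hA) : z ⟶ y.restrict f)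
  · exact Quotient.sound (restrictLift_comp f g A hA)
  · rintro χ ⟨h1, h2⟩
    obtain ⟨B, rfl⟩ := Quotient.exists_rep χ
    have hB : B.base = g := (eq_of_isHomLift_proj h1).symm
    have h3 : (B.comp (y.restrictHom f)).Rel A := Quotient.exact h2
    exact Quotient.sound (restrictHom_cancel f hB
      ((PreHom.setoid _ _).trans h3 ((PreHom.setoid _ _).symm (restrictLift_comp f g A hA))))

section Unit

theorem pb_aux {x : P} {T T' : C} {h : T' ⟶ T} {g : T ⟶ p.obj x} {g' : T' ⟶ p.obj x}
    (w : h ≫ g = g') : g' ≫ p.map (𝟙 x) = h ≫ g := by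
  rw [p.map_id, Category.comp_id, w]

variable [p.IsFibered]

open Functor.IsPreFibered

/-- A chosen pullback of `x` along `g`. -/
def pb (x : P) {T : C} (g : T ⟶ p.obj x) : P := pullbackObj (p := p) (a := x) rfl g

/-- The cartesian morphism from the chosen pullback. -/
def pbMap (x : P) {T : C} (g : T ⟶ p.obj x) : pb x g ⟶ x := pullbackMap (p := p) (a := x) rfl g

instance (x : P) {T : C} (g : T ⟶ p.obj x) : p.IsCartesian g (pbMap x g) :=
  inferInstanceAs (p.IsCartesian g (pullbackMap (p := p) (a := x) rfl g))

/-- The morphism between chosen pullbacks over `h` induced by `φ`. -/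
def pbLift {x y : P} (φ : x ⟶ y) {T T' : C} (h : T' ⟶ T) (g' : T' ⟶ p.obj x) (g : T ⟶ p.obj y)
    (w : g' ≫ p.map φ = h ≫ g) : pb x g' ⟶ pb y g :=
  Functor.IsStronglyCartesian.map p g (pbMap y g) w (pbMap x g' ≫ φ)

instance isHomLift_pbLift {x y : P} (φ : x ⟶ y) {T T' : C} (h : T' ⟶ T) (g' : T' ⟶ p.obj x) (g : T ⟶ p.obj y)
    (w : g' ≫ p.map φ = h ≫ g) : p.IsHomLift h (pbLift φ h g' g w) :=
  Functor.IsStronglyCartesian.map_isHomLift p g (pbMap y g) w (pbMap x g' ≫ φ)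

theorem pbLift_fac {x y : P} (φ : x ⟶ y) {T T' : C} (h : T' ⟶ T) (g' : T' ⟶ p.obj x)
    (g : T ⟶ p.obj y) (w : g' ≫ p.map φ = h ≫ g) :
    pbLift φ h g' g w ≫ pbMap y g = pbMap x g' ≫ φ :=
  Functor.IsStronglyCartesian.fac p g (pbMap y g) w (pbMap x g' ≫ φ)

theorem pb_ext {y : P} {T T' : C} (h : T' ⟶ T) (g : T ⟶ p.obj y) {z : P} {a b : z ⟶ pb y g}
    (ha : p.IsHomLift h a) (hb : p.IsHomLift h b) (e : a ≫ pbMap y g = b ≫ pbMap y g) : a = b :=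
  Functor.IsStronglyCartesian.ext p g (pbMap y g) h e

theorem pbLift_id {x : P} {φ : x ⟶ x} (hφ : φ = 𝟙 x) {T : C} (h : T ⟶ T) (g : T ⟶ p.obj x)
    (w : g ≫ p.map φ = h ≫ g) (hh : h = 𝟙 T) : pbLift φ h g g w = 𝟙 _ := by
  subst hφ hh
  refine pb_ext (𝟙 T) g inferInstance
    (IsHomLift.id (pullbackObj_proj (p := p) (a := x) rfl g)) ?_
  rw [pbLift_fac, Category.comp_id, Category.id_comp]

theorem pbLift_comp {x y z : P} {φ : x ⟶ y} {ψ : y ⟶ z} {χ : x ⟶ z} (e : χ = φ ≫ ψ)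
    {T T' T'' : C} {h : T' ⟶ T} {h' : T'' ⟶ T'} {k : T'' ⟶ T} (hk : k = h' ≫ h)
    (g : T ⟶ p.obj z) (g' : T' ⟶ p.obj y) (g'' : T'' ⟶ p.obj x)
    (w : g' ≫ p.map ψ = h ≫ g) (w' : g'' ≫ p.map φ = h' ≫ g') (w'' : g'' ≫ p.map χ = k ≫ g) :
    pbLift χ k g'' g w'' = pbLift φ h' g'' g' w' ≫ pbLift ψ h g' g w := by
  subst e hk
  refine pb_ext (h' ≫ h) g inferInstance inferInstance ?_
  rw [pbLift_fac, Category.assoc, pbLift_fac, reassoc_of% (pbLift_fac φ h' g'' g' w')]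

variable (J p)

/-- The object of the plus construction defined by `x`, given by a choice of its pullbacks. -/
def unitObj (x : P) : Plus J p where
  base := p.obj x
  R := ⊤
  mem := J.top_mem _
  obj _ g _ := pb x g
  map _ _ h g g' w _ _ := pbLift (𝟙 x) h g' g (pb_aux w)
  isHomLift_map _ _ _ _ _ _ _ _ := inferInstance
  map_id _ _ _ _ := pbLift_id rfl _ _ _ rfl
  map_comp _ _ _ _ _ _ _ _ _ _ _ _ _ _ := pbLift_comp (Category.comp_id _).symm rfl _ _ _ _ _ _

/-- The morphism of the plus construction defined by `φ`. -/
def unitHom {x y : P} (φ : x ⟶ y) : PreHom (unitObj J p x) (unitObj J p y) where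
  base := p.map φ
  Q := ⊤
  mem := J.top_mem _
  le_left _ _ _ := trivial
  le_right _ _ _ := trivial
  app T g g' w _ _ _ := pbLift φ (𝟙 T) g g' (w.trans (Category.id_comp g').symm)
  isHomLift_app T g g' w _ _ _ :=
    isHomLift_pbLift φ (𝟙 T) g g' (w.trans (Category.id_comp g').symm)
  naturality T T' h g g₁ w₁ g' g₁' w₁' w w' _ _ _ _ _ _ :=
    have e : g₁ ≫ p.map φ = h ≫ g' := w'.trans w₁'.symm
    (pbLift_comp (χ := φ) (Category.id_comp φ).symm (Category.comp_id h).symm _ _ _ _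
      (pb_aux w₁) e).symm.trans
      (pbLift_comp (χ := φ) (Category.comp_id φ).symm (Category.id_comp h).symm _ _ _
        (pb_aux w₁') _ e)

/-- The canonical functor from a fibred category to its plus construction. -/
def unit : P ⥤ Plus J p where
  obj := unitObj J p
  map φ := Quotient.mk _ (unitHom J p φ)
  map_id x := by
    refine Quotient.sound ⟨p.map_id x, ⊤, J.top_mem _, fun T g g' wA wB _ _ _ _ _ ↦ ?_⟩
    rfl
  map_comp φ ψ := by
    refine Quotient.sound ⟨p.map_comp φ ψ, ⊤, J.top_mem _, fun T g g' wA wB _ _ _ _ _ ↦ ?_⟩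
    exact pbLift_comp rfl (Category.id_comp _).symm _ _ _
      ((Category.assoc _ _ _).trans (wB.trans (Category.id_comp _).symm))
      (Category.id_comp _).symm (wA.trans (Category.id_comp _).symm)

/-- The canonical functor is a functor over the base category. -/
def unitCompProj : unit J p ⋙ proj J p ≅ p := Iso.refl _

end Unit

end Plus

end PlusConstruction

section AffineSpace

theorem isStandardSmooth_mvPolynomial (n : ℕ) (R : Type u) [CommRing R] :
    Algebra.IsStandardSmoothOfRelativeDimension n R (MvPolynomial (ULift.{u} (Fin n)) R) := by
  let f : MvPolynomial (Fin n) R ≃ₐ[R] MvPolynomial (ULift.{u} (Fin n)) R :=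
    MvPolynomial.renameEquiv R Equiv.ulift.symm
  have hf : (MvPolynomial.aeval fun i : Fin n ↦
      (MvPolynomial.X (ULift.up i) : MvPolynomial (ULift.{u} (Fin n)) R)) = f.toAlgHom := by
    ext i
    simp [f]
  let P : Algebra.PreSubmersivePresentation R (MvPolynomial (ULift.{u} (Fin n)) R) (Fin n)
      PEmpty.{1} :=
    { toGenerators := .ofSurjective (fun i ↦ MvPolynomial.X (ULift.up i))
        (by rw [hf]; exact f.surjective)
      relation := PEmpty.elim
      span_range_relation_eq_ker := by
        rw [Set.range_eq_empty, Ideal.span_empty, eq_comm, Algebra.Generators.ker_eq_ker_aeval_val,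
          RingHom.ker_eq_bot_iff_eq_zero]
        intro x hx
        refine f.injective ((?_ : f x = 0).trans (map_zero f).symm)
        have h2 : f.toAlgHom x = 0 := by rw [← hf]; exact hx
        exact h2
      map := PEmpty.elim
      map_inj := fun x ↦ x.elim }
  let P' : Algebra.SubmersivePresentation R (MvPolynomial (ULift.{u} (Fin n)) R) (Fin n)
      PEmpty.{1} :=
    { __ := P
      jacobian_isUnit := by
        rw [Algebra.PreSubmersivePresentation.jacobian_eq_jacobiMatrix_det]
        simp }
  exact ⟨_, _, inferInstance, inferInstance, P', by simp [Algebra.Presentation.dimension]⟩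

theorem smooth_affineSpace (n : ℕ) (S : Scheme.{u}) :
    SmoothOfRelativeDimension n (𝔸(ULift.{u} (Fin n); S) ↘ S) := by
  have h := smoothOfRelativeDimension_isStableUnderBaseChange.{u} n
  have e := AffineSpace.isPullback_map (n := ULift.{u} (Fin n)) (specULiftZIsTerminal.{u}.from S)
  refine h.of_isPullback e ?_
  have h2 : SmoothOfRelativeDimension n (Spec.map (CommRingCat.ofHom
      (MvPolynomial.C : ULift.{u} ℤ →+* MvPolynomial (ULift.{u} (Fin n)) (ULift.{u} ℤ)))) := by
    rw [HasRingHomProperty.Spec_iff (P := @SmoothOfRelativeDimension.{u} n)]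
    refine RingHom.locally_of RingHom.isStandardSmoothOfRelativeDimension_respectsIso _ ?_
    have := isStandardSmooth_mvPolynomial.{u} n (ULift.{u} ℤ)
    exact (RingHom.isStandardSmoothOfRelativeDimension_algebraMap n).mpr this
  have h3 := smooth_etale_comp
    (etale_of_iso (AffineSpace.SpecIso (ULift.{u} (Fin n)) (.of (ULift.{u} ℤ)))) h2
  have e2 := (Iso.inv_comp_eq _).mp
    (AffineSpace.SpecIso_inv_over (n := ULift.{u} (Fin n)) (.of (ULift.{u} ℤ)))
  rw [e2]
  exact h3

/-- The affine space of dimension `n` over `S`, with the zero section. -/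
def trivialFamily (n : ℕ) (S : Scheme.{u}) : PointedFamily n S where
  total := 𝔸(ULift.{u} (Fin n); S)
  π := 𝔸(ULift.{u} (Fin n); S) ↘ S
  smooth := smooth_affineSpace n S
  σ := AffineSpace.homOfVector (𝟙 S) 0
  σ_π := AffineSpace.homOfVector_over _ _

theorem zero_map (n : ℕ) {S T : Scheme.{u}} (f : S ⟶ T) :
    (AffineSpace.homOfVector (𝟙 S) 0 : S ⟶ 𝔸(ULift.{u} (Fin n); S)) ≫ AffineSpace.map _ f =
      f ≫ AffineSpace.homOfVector (𝟙 T) 0 := by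
  apply AffineSpace.hom_ext
  · rw [Category.assoc, AffineSpace.map_over, AffineSpace.homOfVector_over_assoc, Category.assoc,
      AffineSpace.homOfVector_over, Category.id_comp, Category.comp_id]
  · intro i
    rw [Scheme.Hom.comp_appTop, Scheme.Hom.comp_appTop, CommRingCat.comp_apply,
      CommRingCat.comp_apply, AffineSpace.map_appTop_coord, AffineSpace.homOfVector_appTop_coord,
      AffineSpace.homOfVector_appTop_coord]
    simp

end AffineSpace

section TrivialGerms

variable {k : Type u} [Field k] {n : ℕ}

namespace EtaleNbhd

variable {X Y Z : PtFam k n}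

theorem comp_ofHom (A : EtaleNbhd Z Y) (m : X ⟶ Y) (P : IsPullback (PtFam.Hom.total m) X.fam.π
    Y.fam.π (PtFam.Hom.base m).left) (g : Z.base ⟶ X.base) (hA : A.base = g ≫ PtFam.Hom.base m) :
    ∃ B : EtaleNbhd Z X, B.base = g ∧ (B.comp (ofHom m)).Equivalent A := by
  have w : A.ψ ≫ Y.fam.π = (A.V.π ≫ g.left) ≫ (PtFam.Hom.base m).left := by
    rw [A.etSq_ψ.1, hA, Over.comp_left, Category.assoc]
  let B : EtaleNbhd Z X :=
    { base := g
      V := A.V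
      φ := A.φ
      etale_φ := A.etale_φ
      φ_π := A.φ_π
      σ_φ := A.σ_φ
      ψ := P.lift A.ψ (A.V.π ≫ g.left) w
      etSq_ψ := by
        refine EtSq.cancel (gX := PtFam.Hom.total m) (gS := (PtFam.Hom.base m).left)
          (π'' := Y.fam.π) ?_ (by simp) P
        have h := A.etSq_ψ
        rw [hA, Over.comp_left] at h
        rwa [P.lift_fst]
      σ_ψ := by
        apply P.hom_ext
        · rw [Category.assoc, P.lift_fst, A.σ_ψ, hA, Over.comp_left, Category.assoc,
            Category.assoc, PtFam.Hom.σ_total m]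
        · rw [Category.assoc, P.lift_snd, reassoc_of% A.V.σ_π, Category.assoc, X.fam.σ_π,
            Category.comp_id] }
  refine ⟨B, rfl, equivalent_of_map hA.symm (pullback.fst _ _) (etale_fst (ofHom m).etale_φ)
    (pullback.lift_fst _ _ _) rfl ?_⟩
  have e : pullback.fst B.ψ (ofHom m).φ ≫ B.ψ ≫ PtFam.Hom.total m =
      pullback.snd B.ψ (ofHom m).φ ≫ PtFam.Hom.total m :=
    FamilyGerm.ofPtFam_aux _ _ _ pullback.condition
  refine Eq.trans ?_ e
  exact congrArg (_ ≫ ·) (P.lift_fst _ _ _).symm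

theorem comp_ofHom_aux {U W P V S : Scheme.{u}} {τ : U ⟶ W} {a : W ⟶ P} {i : U ⟶ S} {σ : S ⟶ P}
    {f : P ⟶ V} {σ' : S ⟶ V} (h : τ ≫ a = i ≫ σ) (h' : σ ≫ f = σ') : τ ≫ a ≫ f = i ≫ σ' := by
  rw [reassoc_of% h, h']

theorem comp_ofHom_cancel {A B : EtaleNbhd Z X} (m : X ⟶ Y)
    (P : IsPullback (PtFam.Hom.total m) X.fam.π Y.fam.π (PtFam.Hom.base m).left)
    (hb : A.base = B.base) (h : (A.comp (ofHom m)).Equivalent (B.comp (ofHom m))) :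
    A.Equivalent B := by
  refine equivalent_of A B hb fun s ↦ ?_
  obtain ⟨U, hU, W, a, b, τ, ha, hb', h1, h2, h3, h4⟩ := h.exists s
  have key (D : EtaleNbhd Z X) (d : W ⟶ pullback D.ψ (ofHom m).φ) :
      (d ≫ pullback.fst _ _) ≫ D.ψ ≫ PtFam.Hom.total m = d ≫ (D.comp (ofHom m)).ψ := by
    rw [Category.assoc]
    exact congrArg (d ≫ ·) (FamilyGerm.ofPtFam_aux _ _ _ pullback.condition)
  obtain ⟨a', b', ea, eb, e1, e2, e3, e4⟩ : ∃ (a' : W ⟶ A.V.total) (b' : W ⟶ B.V.total),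
      Etale a' ∧ Etale b' ∧ τ ≫ a' = U.ι ≫ A.V.σ ∧ τ ≫ b' = U.ι ≫ B.V.σ ∧
      a' ≫ A.φ = b' ≫ B.φ ∧ a' ≫ A.ψ ≫ PtFam.Hom.total m = b' ≫ B.ψ ≫ PtFam.Hom.total m :=
    ⟨a ≫ pullback.fst _ _, b ≫ pullback.fst _ _, etale_comp_mem ha (etale_fst (ofHom m).etale_φ),
      etale_comp_mem hb' (etale_fst (ofHom m).etale_φ),
      comp_ofHom_aux h1 (pullback.lift_fst _ _ _), comp_ofHom_aux h2 (pullback.lift_fst _ _ _),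
      (Category.assoc _ _ _).trans (h3.trans (Category.assoc _ _ _).symm),
      (key A a).trans (h4.trans (key B b).symm)⟩
  refine ⟨U, hU, W, a', b', τ, ea, eb, e1, e2, e3, P.hom_ext ?_ ?_⟩
  · rw [Category.assoc, Category.assoc, e4]
  · rw [Category.assoc, Category.assoc, A.etSq_ψ.1, B.etSq_ψ.1, hb, ← A.φ_π, ← B.φ_π,
      Category.assoc, Category.assoc, reassoc_of% e3]

end EtaleNbhd

/-- The full subcategory of the germs of the trivial families `𝔸ⁿ_S ⇄ S`, with the zero section. -/
structure TrivialGerm (k : Type u) [Field k] (_ : ℕ) where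
  base : SchOver k

namespace TrivialGerm

/-- The pointed family `𝔸ⁿ_S ⇄ S`. -/
def pt (X : TrivialGerm k n) : PtFam k n := ⟨X.base, trivialFamily n X.base.left⟩

instance : Category (TrivialGerm k n) where
  Hom X Y := (⟨X.pt⟩ : FamilyGerm k n) ⟶ ⟨Y.pt⟩
  id X := 𝟙 (⟨X.pt⟩ : FamilyGerm k n)
  comp {X Y Z} f g := CategoryStruct.comp (X := (⟨X.pt⟩ : FamilyGerm k n)) (Y := ⟨Y.pt⟩)
    (Z := ⟨Z.pt⟩) f g
  id_comp {X Y} f := Category.id_comp (X := (⟨X.pt⟩ : FamilyGerm k n)) (Y := ⟨Y.pt⟩) f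
  comp_id {X Y} f := Category.comp_id (X := (⟨X.pt⟩ : FamilyGerm k n)) (Y := ⟨Y.pt⟩) f
  assoc {X Y Z W} f g h := Category.assoc (W := (⟨X.pt⟩ : FamilyGerm k n)) (X := ⟨Y.pt⟩)
    (Y := ⟨Z.pt⟩) (Z := ⟨W.pt⟩) f g h

/-- The inclusion of the trivial germs into all germs. -/
def incl : TrivialGerm k n ⥤ FamilyGerm k n where
  obj X := ⟨X.pt⟩
  map f := f

/-- The functor to `k`-schemes. -/
def proj : TrivialGerm k n ⥤ SchOver k := incl ⋙ FamilyGerm.proj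

/-- The morphism `𝔸ⁿ_S ⟶ 𝔸ⁿ_T` induced by `S ⟶ T`. -/
def baseChangeHom (Y : TrivialGerm k n) {S : SchOver k} (f : S ⟶ Y.base) :
    (⟨S⟩ : TrivialGerm k n).pt ⟶ Y.pt :=
  PtFam.Hom.mk (X := (⟨S⟩ : TrivialGerm k n).pt) (Y := Y.pt) f (AffineSpace.map _ f.left)
    (by
      have h1 := smooth_affineSpace n S.left
      have h2 := smooth_affineSpace n Y.base.left
      exact (fibrewiseEtale_iff n).mpr (EtSq.of_isPullback (AffineSpace.isPullback_map f.left)))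
    (zero_map n f.left)

theorem base_eq_of_isHomLift {X Y : TrivialGerm k n} {A : EtaleNbhd X.pt Y.pt}
    {f : proj.obj X ⟶ proj.obj Y} (h : proj.IsHomLift f (Quotient.mk _ A : X ⟶ Y)) : A.base = f :=
  (IsHomLift.eq_of_isHomLift (p := proj) (a := X) (b := Y) f (Quotient.mk _ A)).symm

theorem isHomLift {X Y : TrivialGerm k n} (A : EtaleNbhd X.pt Y.pt) :
    proj.IsHomLift A.base (Quotient.mk _ A : X ⟶ Y) :=
  Functor.IsHomLift.map (p := proj) (a := X) (b := Y) (Quotient.mk _ A)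

instance : (proj : TrivialGerm k n ⥤ SchOver k).IsFibered := by
  refine Functor.IsFibered.of_exists_isStronglyCartesian fun Y S f ↦
    ⟨⟨S⟩, Quotient.mk _ (EtaleNbhd.ofHom (baseChangeHom Y f)), ?_⟩
  have hl := isHomLift (X := ⟨S⟩) (Y := Y) (EtaleNbhd.ofHom (baseChangeHom Y f))
  have P := AffineSpace.isPullback_map (n := ULift.{u} (Fin n)) f.left
  refine @Functor.IsStronglyCartesian.mk _ _ _ _ _ _ _ _ _ _ _ hl ?_
  intro Z g φ hφ
  obtain ⟨A, rfl⟩ := Quotient.exists_rep φ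
  have hA : A.base = g ≫ f := base_eq_of_isHomLift (X := Z) (Y := Y) hφ
  obtain ⟨B, hB, e⟩ := EtaleNbhd.comp_ofHom A (baseChangeHom Y f) P g hA
  refine ⟨Quotient.mk _ B, ⟨?_, Quotient.sound e⟩, ?_⟩
  · subst hB
    exact isHomLift (X := Z) (Y := ⟨S⟩) B
  · rintro χ ⟨h1, h2⟩
    obtain ⟨B', rfl⟩ := Quotient.exists_rep χ
    have hB' : B'.base = g := base_eq_of_isHomLift (X := Z) (Y := ⟨S⟩) h1
    refine Quotient.sound (EtaleNbhd.comp_ofHom_cancel (baseChangeHom Y f) P (hB'.trans hB.symm) ?_)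
    have h3 : (B'.comp (EtaleNbhd.ofHom (baseChangeHom Y f))).Equivalent A := Quotient.exact h2
    exact h3.trans e.symm

end TrivialGerm

end TrivialGerms

/-! ### Systems of quasi-coherent sheaves -/

section ModuleSystems

/-- The components of the isomorphism `H ≅ G ⋙ F` given by `H ≅ K` and `G ⋙ F ≅ K`. -/
def appIso {A B D : Type*} [Category* A] [Category* B] [Category* D] {F : B ⥤ A} {G : D ⥤ B}
    {H K : D ⥤ A} (i : H ≅ K) (j : G ⋙ F ≅ K) (M : D) : H.obj M ≅ F.obj (G.obj M) :=
  i.app M ≪≫ j.symm.app M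

theorem appIso_hom {A B D : Type*} [Category* A] [Category* B] [Category* D] {F : B ⥤ A}
    {G : D ⥤ B} {H K : D ⥤ A} (i : H ≅ K) (j : G ⋙ F ≅ K) (M : D) :
    (appIso i j M).hom = i.hom.app M ≫ j.inv.app M := rfl

theorem appIso_naturality {A B D : Type*} [Category* A] [Category* B] [Category* D] {F : B ⥤ A}
    {G : D ⥤ B} {H K : D ⥤ A} (i : H ≅ K) (j : G ⋙ F ≅ K) {M N : D} (φ : M ⟶ N) :
    H.map φ ≫ (appIso i j N).hom = (appIso i j M).hom ≫ F.map (G.map φ) := by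
  simp [appIso]

/-- The canonical isomorphism `h^* M ≅ f^* (g^* M)` for `h = f ≫ g`. -/
def pullbackIso {X Y Z : Scheme.{u}} (f : X ⟶ Y) (g : Y ⟶ Z) (h : X ⟶ Z) (w : f ≫ g = h)
    (M : Z.Modules) : (Scheme.Modules.pullback h).obj M ≅
      (Scheme.Modules.pullback f).obj ((Scheme.Modules.pullback g).obj M) :=
  appIso (Scheme.Modules.pullbackCongr w.symm) (Scheme.Modules.pullbackComp f g) M

theorem pullbackCongr_hom {X Y : Scheme.{u}} {f g : X ⟶ Y} (h : f = g) :
    (Scheme.Modules.pullbackCongr h).hom = eqToHom (h ▸ rfl) := by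
  rw [Scheme.Modules.pullbackCongr, eqToIso.hom]

theorem pullbackIso_naturality {X Y Z : Scheme.{u}} (f : X ⟶ Y) (g : Y ⟶ Z) (h : X ⟶ Z)
    (w : f ≫ g = h) {M N : Z.Modules} (φ : M ⟶ N) :
    (Scheme.Modules.pullback h).map φ ≫ (pullbackIso f g h w N).hom =
      (pullbackIso f g h w M).hom ≫
        (Scheme.Modules.pullback f).map ((Scheme.Modules.pullback g).map φ) := by
  exact appIso_naturality _ _ φ

theorem pullback_associativity {X Y Z W : Scheme.{u}} (a : X ⟶ Y) (b : Y ⟶ Z) (c : Z ⟶ W)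
    (h : a ≫ b ≫ c = (a ≫ b) ≫ c) : (Scheme.Modules.pullbackComp a (b ≫ c)).inv ≫
      Functor.whiskerRight (Scheme.Modules.pullbackComp b c).inv _ ≫
        (Functor.associator _ _ _).hom ≫
          Functor.whiskerLeft _ (Scheme.Modules.pullbackComp a b).hom ≫
            (Scheme.Modules.pullbackComp (a ≫ b) c).hom = (Scheme.Modules.pullbackCongr h).hom := by
  rw [Scheme.Modules.pseudofunctor_associativity, pullbackCongr_hom]

theorem appIso_assoc {A B C D : Type*} [Category* A] [Category* B] [Category* C]
    [Category* D] {Fc : D ⥤ C} {Fb : C ⥤ B} {Fa : B ⥤ A} {Fbc : D ⥤ B} {Fab : C ⥤ A} {F1 F2 : D ⥤ A}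
    (j1 : Fbc ⋙ Fa ≅ F1) (j2 : Fc ⋙ Fb ≅ Fbc) (j3 : Fc ⋙ Fab ≅ F2) (j4 : Fb ⋙ Fa ≅ Fab)
    {i1 : F1 ≅ F1} {i2 : Fbc ≅ Fbc} {i3 : F1 ≅ F2} {i4 : Fab ≅ Fab} (h1 : i1.hom = 𝟙 _)
    (h2 : i2.hom = 𝟙 _) (h4 : i4.hom = 𝟙 _)
    (h : j1.inv ≫ Functor.whiskerRight j2.inv Fa ≫ (Functor.associator _ _ _).hom ≫
      Functor.whiskerLeft _ j4.hom ≫ j3.hom = i3.hom) (M : D) :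
    (appIso i1 j1 M).hom ≫ Fa.map (appIso i2 j2 M).hom =
      (appIso i3 j3 M).hom ≫ (appIso i4 j4 (Fc.obj M)).hom := by
  rw [appIso_hom, appIso_hom, appIso_hom, appIso_hom, ← h, h1, h2, h4]
  simp

theorem pullbackIso_assoc' {X Y Z W : Scheme.{u}} (a : X ⟶ Y) (b : Y ⟶ Z) (c : Z ⟶ W)
    (h : (a ≫ b) ≫ c = a ≫ b ≫ c) (M : W.Modules) :
    (pullbackIso a (b ≫ c) (a ≫ b ≫ c) rfl M).hom ≫
        (Scheme.Modules.pullback a).map (pullbackIso b c (b ≫ c) rfl M).hom =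
      (pullbackIso (a ≫ b) c (a ≫ b ≫ c) h M).hom ≫
        (pullbackIso a b (a ≫ b) rfl ((Scheme.Modules.pullback c).obj M)).hom :=
  appIso_assoc _ _ _ _ (pullbackCongr_hom _) (pullbackCongr_hom _) (pullbackCongr_hom _)
    (pullback_associativity a b c h.symm) M

theorem pullbackIso_assoc {X Y Z W : Scheme.{u}} {a : X ⟶ Y} {b : Y ⟶ Z} {c : Z ⟶ W} {t : X ⟶ W}
    {m : Y ⟶ W} {k : X ⟶ Z} (h1 : a ≫ m = t) (h2 : b ≫ c = m) (h3 : k ≫ c = t) (h4 : a ≫ b = k)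
    (M : W.Modules) :
    (pullbackIso a m t h1 M).hom ≫ (Scheme.Modules.pullback a).map (pullbackIso b c m h2 M).hom =
      (pullbackIso k c t h3 M).hom ≫
        (pullbackIso a b k h4 ((Scheme.Modules.pullback c).obj M)).hom := by
  subst h2
  subst h4
  subst h1
  exact pullbackIso_assoc' _ _ _ _ _

theorem along_comp_aux {A B C : Type*} [Category* A] [Category* B] [Category* C] {F : B ⥤ A}
    {G : C ⥤ A} {T a₁ a₃ a₄ : A} {b₀ b₁ b₂ b₃ : B} {c₀ c₁ c₂ c₃ : C} (P₁ : T ≅ a₁)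
    (P₂ : T ≅ G.obj c₁) {Mk : c₁ ⟶ c₀} (P₃ : a₁ ≅ F.obj b₁) (P₄ : b₀ ≅ b₁) (P₅ : b₀ ≅ b₂)
    {Mg : b₂ ⟶ b₃} (P₆ : a₃ ≅ F.obj b₃) (P₇ : a₃ ≅ G.obj c₃) {Mf : c₃ ⟶ c₀} (P₈ : T ≅ F.obj b₀)
    (P₉ : T ≅ a₄) (P₁₀ : a₄ ≅ F.obj b₂) (P₁₁ : c₁ ≅ c₂) (P₁₂ : a₄ ≅ G.obj c₂) {N : a₄ ⟶ a₃}
    {Mg' : c₂ ⟶ c₃} (h₁ : P₈.hom ≫ F.map P₄.hom = P₁.hom ≫ P₃.hom)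
    (h₂ : P₈.hom ≫ F.map P₅.hom = P₉.hom ≫ P₁₀.hom)
    (h₃ : P₂.hom ≫ G.map P₁₁.hom = P₉.hom ≫ P₁₂.hom) (h₄ : N ≫ P₆.hom = P₁₀.hom ≫ F.map Mg)
    (h₅ : N ≫ P₇.hom = P₁₂.hom ≫ G.map Mg') (h₆ : Mk = P₁₁.hom ≫ Mg' ≫ Mf) :
    P₁.inv ≫ P₂.hom ≫ G.map Mk =
      P₃.hom ≫ F.map (P₄.inv ≫ P₅.hom ≫ Mg) ≫ P₆.inv ≫ P₇.hom ≫ G.map Mf := by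
  have e₁ : P₃.hom = P₁.inv ≫ P₈.hom ≫ F.map P₄.hom := by rw [h₁, Iso.inv_hom_id_assoc]
  have e₂ : F.map P₅.hom = P₈.inv ≫ P₉.hom ≫ P₁₀.hom := by rw [← h₂, Iso.inv_hom_id_assoc]
  have e₄ : F.map Mg = P₁₀.inv ≫ N ≫ P₆.hom := by rw [h₄, Iso.inv_hom_id_assoc]
  have e₅ : G.map Mg' = P₁₂.inv ≫ N ≫ P₇.hom := by rw [h₅, Iso.inv_hom_id_assoc]
  have e₃ : G.map P₁₁.hom = P₂.inv ≫ P₉.hom ≫ P₁₂.hom := by rw [← h₃, Iso.inv_hom_id_assoc]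
  subst h₆
  simp only [Functor.map_comp, e₁, e₂, e₃, e₄, e₅, Category.assoc,
    Iso.hom_inv_id_assoc]
  rw [← F.map_comp_assoc, P₄.hom_inv_id, F.map_id, Category.id_comp]
  simp only [Iso.hom_inv_id_assoc]

theorem along_map_aux {A B C : Type*} [Category* A] [Category* B] [Category* C] {F : B ⥤ A}
    {G : C ⥤ A} {a a' : A} {b b' : B} {c c' c₀ c₀' : C} (P : a ≅ F.obj b) (P' : a' ≅ F.obj b')
    (Q : a ≅ G.obj c) (Q' : a' ≅ G.obj c') {i : c ⟶ c₀} {i' : c' ⟶ c₀'} {φ : b ⟶ b'} {ψ : c ⟶ c'}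
    {χ : c₀ ⟶ c₀'} {ω : a ⟶ a'} (h₁ : ω ≫ P'.hom = P.hom ≫ F.map φ)
    (h₂ : ω ≫ Q'.hom = Q.hom ≫ G.map ψ) (h₃ : ψ ≫ i' = i ≫ χ) :
    F.map φ ≫ P'.inv ≫ Q'.hom ≫ G.map i' = (P.inv ≫ Q.hom ≫ G.map i) ≫ G.map χ := by
  have e : F.map φ = P.inv ≫ ω ≫ P'.hom := by rw [h₁, Iso.inv_hom_id_assoc]
  rw [e, Category.assoc, Category.assoc, Category.assoc, Category.assoc, ← Functor.map_comp, ← h₃,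
    Functor.map_comp, Iso.hom_inv_id_assoc, reassoc_of% h₂]

universe v w

variable {C : Type w} [Category.{v} C]

theorem map_comp_symm (p : C ⥤ Scheme.{u}) {c d e : C} (f : c ⟶ d) (g : d ⟶ e) :
    p.map f ≫ p.map g = p.map (f ≫ g) := (p.map_comp f g).symm

theorem naturality_symm {p q : C ⥤ Scheme.{u}} (α : p ⟶ q) {c d : C} (f : c ⟶ d) :
    α.app c ≫ q.map f = p.map f ≫ α.app d := (α.naturality f).symm

/-- A compatible system of sheaves of modules, for a functor `p` to schemes: a sheaf of modules on
`p c` for each object `c`, and for each morphism `f : c ⟶ d` an isomorphism `(p f)^* M_d ≅ M_c`,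
compatible with composition. -/
structure ModuleSystem (p : C ⥤ Scheme.{u}) where
  obj : ∀ c, (p.obj c).Modules
  iso : ∀ {c d : C} (f : c ⟶ d), (Scheme.Modules.pullback (p.map f)).obj (obj d) ≅ obj c
  iso_comp : ∀ {c d e : C} (f : c ⟶ d) (g : d ⟶ e), (iso (f ≫ g)).hom =
    (pullbackIso (p.map f) (p.map g) (p.map (f ≫ g)) (map_comp_symm p f g) (obj e)).hom ≫
      (Scheme.Modules.pullback (p.map f)).map (iso g).hom ≫ (iso f).hom

namespace ModuleSystem

variable {p q : C ⥤ Scheme.{u}}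

theorem iso_comp' (M : ModuleSystem p) {c d e : C} {f : c ⟶ d} {g : d ⟶ e} {k : c ⟶ e}
    (hk : f ≫ g = k) (w : p.map f ≫ p.map g = p.map k) : (M.iso k).hom =
      (pullbackIso (p.map f) (p.map g) (p.map k) w (M.obj e)).hom ≫
        (Scheme.Modules.pullback (p.map f)).map (M.iso g).hom ≫ (M.iso f).hom := by
  subst hk
  rw [show pullbackIso _ _ _ w (M.obj e) = pullbackIso _ _ _ (map_comp_symm p f g) (M.obj e) from rfl]
  exact M.iso_comp f g

/-- Morphisms of systems of sheaves of modules. -/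
@[ext]
structure Hom (M N : ModuleSystem p) where
  app : ∀ c, M.obj c ⟶ N.obj c
  comm : ∀ {c d : C} (f : c ⟶ d),
    (Scheme.Modules.pullback (p.map f)).map (app d) ≫ (N.iso f).hom = (M.iso f).hom ≫ app c

instance : Category (ModuleSystem p) where
  Hom := Hom
  id M := ⟨fun _ ↦ 𝟙 _, fun f ↦ by
    rw [CategoryTheory.Functor.map_id, Category.id_comp, Category.comp_id]⟩
  comp φ ψ := ⟨fun c ↦ φ.app c ≫ ψ.app c, fun f ↦ by
    rw [Functor.map_comp, Category.assoc, ψ.comm, reassoc_of% (φ.comm f)]⟩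
  id_comp _ := Hom.ext (funext fun _ ↦ Category.id_comp _)
  comp_id _ := Hom.ext (funext fun _ ↦ Category.comp_id _)
  assoc _ _ _ := Hom.ext (funext fun _ ↦ Category.assoc _ _ _)

section Precomp

variable {D : Type*} [Category* D] (G : D ⥤ C) (p)

/-- The sheaves of the restriction of a system of sheaves along a functor. -/
def precompObj (M : ModuleSystem p) (d : D) : ((G ⋙ p).obj d).Modules := M.obj (G.obj d)

/-- The isomorphisms of the restriction of a system of sheaves along a functor. -/
def precompIso (M : ModuleSystem p) {d e : D} (f : d ⟶ e) :
    (Scheme.Modules.pullback ((G ⋙ p).map f)).obj (precompObj p G M e) ≅ precompObj p G M d :=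
  M.iso (G.map f)

theorem precompIso_comp (M : ModuleSystem p) {c d e : D} (f : c ⟶ d) (g : d ⟶ e) :
    (precompIso p G M (f ≫ g)).hom =
      (pullbackIso ((G ⋙ p).map f) ((G ⋙ p).map g) ((G ⋙ p).map (f ≫ g))
        (map_comp_symm (G ⋙ p) f g) (precompObj p G M e)).hom ≫
        (Scheme.Modules.pullback ((G ⋙ p).map f)).map (precompIso p G M g).hom ≫
          (precompIso p G M f).hom := by
  exact M.iso_comp' (G.map_comp f g).symm (map_comp_symm (G ⋙ p) f g)

/-- The morphisms of the restriction along a functor of a morphism of systems of sheaves. -/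
def precompHom {M N : ModuleSystem p} (φ : M ⟶ N) (d : D) : precompObj p G M d ⟶ precompObj p G N d :=
  Hom.app φ (G.obj d)

theorem precompHom_comm {M N : ModuleSystem p} (φ : M ⟶ N) {d e : D} (f : d ⟶ e) :
    (Scheme.Modules.pullback ((G ⋙ p).map f)).map (precompHom p G φ e) ≫ (precompIso p G N f).hom =
      (precompIso p G M f).hom ≫ precompHom p G φ d := by
  exact Hom.comm φ (G.map f)

/-- Restriction of systems of sheaves along a functor between the indexing categories. -/
def precomp (p : C ⥤ Scheme.{u}) : ModuleSystem p ⥤ ModuleSystem (G ⋙ p) where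
  obj M := ⟨precompObj p G M, precompIso p G M, precompIso_comp p G M⟩
  map φ := ⟨precompHom p G φ, precompHom_comm p G φ⟩

end Precomp

section PullbackAlong

variable (α : p ⟶ q)

/-- The isomorphisms of the pullback of a system of sheaves along a natural transformation. -/
def alongIso (M : ModuleSystem q) {c d : C} (f : c ⟶ d) :
    (Scheme.Modules.pullback (p.map f)).obj ((Scheme.Modules.pullback (α.app d)).obj (M.obj d)) ≅
      (Scheme.Modules.pullback (α.app c)).obj (M.obj c) :=
  (pullbackIso (p.map f) (α.app d) (p.map f ≫ α.app d) rfl (M.obj d)).symm ≪≫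
    pullbackIso (α.app c) (q.map f) (p.map f ≫ α.app d) (naturality_symm α f) (M.obj d) ≪≫
      (Scheme.Modules.pullback (α.app c)).mapIso (M.iso f)

theorem alongIso_hom (M : ModuleSystem q) {c d : C} (f : c ⟶ d) : (alongIso α M f).hom =
    (pullbackIso (p.map f) (α.app d) (p.map f ≫ α.app d) rfl (M.obj d)).inv ≫
    (pullbackIso (α.app c) (q.map f) (p.map f ≫ α.app d) (naturality_symm α f) (M.obj d)).hom ≫
      (Scheme.Modules.pullback (α.app c)).map (M.iso f).hom := by
  rw [alongIso, Iso.trans_hom, Iso.trans_hom, Iso.symm_hom, Functor.mapIso_hom]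

theorem alongIso_comp (M : ModuleSystem q) {c d e : C} (f : c ⟶ d) (g : d ⟶ e) :
    (alongIso α M (f ≫ g)).hom =
      (pullbackIso (p.map f) (p.map g) (p.map (f ≫ g)) (map_comp_symm p f g)
        ((Scheme.Modules.pullback (α.app e)).obj (M.obj e))).hom ≫
        (Scheme.Modules.pullback (p.map f)).map (alongIso α M g).hom ≫ (alongIso α M f).hom := by
  have w : p.map f ≫ p.map g ≫ α.app e = p.map (f ≫ g) ≫ α.app e := by
    rw [p.map_comp, Category.assoc]
  have w' : (p.map f ≫ α.app d) ≫ q.map g = p.map (f ≫ g) ≫ α.app e := by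
    rw [p.map_comp, Category.assoc, Category.assoc, α.naturality]
  rw [alongIso_hom, alongIso_hom, alongIso_hom]
  exact along_comp_aux _ _ _ _ _ _ _ _ _ _ _ _
    (pullbackIso_assoc w rfl rfl (map_comp_symm p f g) (M.obj e))
    (pullbackIso_assoc w (naturality_symm α g) w' rfl (M.obj e))
    (pullbackIso_assoc (naturality_symm α (f ≫ g)) (map_comp_symm q f g) w'
      (naturality_symm α f) (M.obj e))
    (pullbackIso_naturality _ _ _ rfl (M.iso g).hom)
    (pullbackIso_naturality _ _ _ (naturality_symm α f) (M.iso g).hom)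
    (M.iso_comp f g)

theorem alongIso_naturality {M N : ModuleSystem q} (φ : M ⟶ N) {c d : C} (f : c ⟶ d) :
    (Scheme.Modules.pullback (p.map f)).map
        ((Scheme.Modules.pullback (α.app d)).map (Hom.app φ d)) ≫ (alongIso α N f).hom =
      (alongIso α M f).hom ≫ (Scheme.Modules.pullback (α.app c)).map (Hom.app φ c) := by
  rw [alongIso_hom, alongIso_hom]
  exact along_map_aux _ _ _ _ (pullbackIso_naturality _ _ _ rfl (Hom.app φ d))
    (pullbackIso_naturality _ _ _ (naturality_symm α f) (Hom.app φ d)) (Hom.comm φ f)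

/-- The pullback of systems of sheaves along a natural transformation. -/
def pullbackAlong : ModuleSystem q ⥤ ModuleSystem p where
  obj M :=
    { obj := fun c ↦ (Scheme.Modules.pullback (α.app c)).obj (M.obj c)
      iso := alongIso α M
      iso_comp := alongIso_comp α M }
  map φ := ⟨fun c ↦ (Scheme.Modules.pullback (α.app c)).map (Hom.app φ c), alongIso_naturality α φ⟩
  map_id M := Hom.ext (funext fun c ↦ (Scheme.Modules.pullback (α.app c)).map_id (M.obj c))
  map_comp φ ψ := Hom.ext (funext fun c ↦
    (Scheme.Modules.pullback (α.app c)).map_comp (Hom.app φ c) (Hom.app ψ c))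

end PullbackAlong

end ModuleSystem

/-- Systems of quasi-coherent sheaves. -/
def isQCoh (p : C ⥤ Scheme.{u}) : ObjectProperty (ModuleSystem p) :=
  fun M ↦ ∀ c, (M.obj c).IsQuasicoherent

/-- The category of systems of quasi-coherent sheaves for a functor `p` to schemes. If `p` is the
functor underlying a category fibred in groupoids over schemes, these are the quasi-coherent sheaves
on this category. -/
abbrev QCoh (p : C ⥤ Scheme.{u}) := (isQCoh p).FullSubcategory

end ModuleSystems

section Stackification

universe v₁ u₁ v₂ u₂

variable {C : Type u₁} [Category.{v₁} C] (J : GrothendieckTopology C)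
  {P : Type u₂} [Category.{v₂} P] (p : P ⥤ C)

/-- The stackification of a category `p : P ⥤ C` fibred in groupoids: the plus construction, applied
three times. -/
abbrev Stackification := Plus J (Plus.proj J (Plus.proj J p))

/-- The functor to the base category. -/
def Stackification.proj : Stackification J p ⥤ C := Plus.proj J (Plus.proj J (Plus.proj J p))

/-- The canonical functor from a fibred category to its stackification. -/
def Stackification.unit [p.IsFibered] : P ⥤ Stackification J p :=
  Plus.unit J p ⋙ Plus.unit J (Plus.proj J p) ⋙ Plus.unit J (Plus.proj J (Plus.proj J p))

end Stackification

section Main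

variable (k : Type u) [Field k] (n : ℕ)

/-- Restriction of systems of quasi-coherent sheaves along a functor between the indexing
categories. -/
def QCoh.precomp {C D : Type*} [Category* C] [Category* D] (G : D ⥤ C) (p : C ⥤ Scheme.{u}) :
    QCoh p ⥤ QCoh (G ⋙ p) :=
  (isQCoh (G ⋙ p)).lift ((isQCoh p).ι ⋙ ModuleSystem.precomp G p) fun M d ↦ M.property (G.obj d)

/-- Universal `𝒪`-modules of dimension `n`: a quasi-coherent sheaf `F_{X/S}` on `X` for each family
`X/S` of smooth schemes of dimension `n`, and compatible isomorphisms `f_X^* F_{X'/S'} ≅ F_{X/S}`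
for the fibrewise étale morphisms `X/S ⟶ X'/S'`. -/
abbrev UniversalOModule := QCoh (Fam.totalFunctor : Fam k n ⥤ Scheme.{u})

variable {k n}

/-- The functor `(X ⇄ S) ↦ S` from germs of pointed families to schemes. -/
def FamilyGerm.toScheme : FamilyGerm k n ⥤ Scheme.{u} := FamilyGerm.proj ⋙ Over.forget _

/-- The functor `(𝔸ⁿ_S ⇄ S) ↦ S` from germs of trivial families to schemes. -/
def TrivialGerm.toScheme : TrivialGerm k n ⥤ Scheme.{u} := TrivialGerm.proj ⋙ Over.forget _

variable (k n)

/-- The étale topology on `k`-schemes. -/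
abbrev etaleTopologyOver : GrothendieckTopology (SchOver k) :=
  Scheme.etaleTopology.{u}.over (Spec (CommRingCat.of k))

/-- The stack of pointed étale germs: the étale stackification of the category of germs of the
trivial families. -/
abbrev PointedEtaleGerm :=
  Stackification (etaleTopologyOver k) (TrivialGerm.proj : TrivialGerm k n ⥤ SchOver k)

variable {k n}

/-- The functor to schemes. -/
def PointedEtaleGerm.toScheme : PointedEtaleGerm k n ⥤ Scheme.{u} :=
  Stackification.proj _ _ ⋙ Over.forget _

/-- The stackification functor. -/
def TrivialGerm.toStack : TrivialGerm k n ⥤ PointedEtaleGerm k n :=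
  Stackification.unit _ _

/-- Restriction of quasi-coherent sheaves on germs to trivial germs. -/
def FamilyGerm.restrictTrivial :
    QCoh (FamilyGerm.toScheme : FamilyGerm k n ⥤ Scheme.{u}) ⥤
      QCoh (TrivialGerm.toScheme : TrivialGerm k n ⥤ Scheme.{u}) :=
  QCoh.precomp TrivialGerm.incl FamilyGerm.toScheme

/-- Restriction of quasi-coherent sheaves on the stack of pointed étale germs to trivial germs. -/
def PointedEtaleGerm.restrictTrivial :
    QCoh (PointedEtaleGerm.toScheme : PointedEtaleGerm k n ⥤ Scheme.{u}) ⥤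
      QCoh (TrivialGerm.toScheme : TrivialGerm k n ⥤ Scheme.{u}) :=
  QCoh.precomp TrivialGerm.toStack PointedEtaleGerm.toScheme

/-- The functor `M ↦ (X/S ↦ M_{X ×_S X ⇄ X})`, from quasi-coherent sheaves on germs to universal
`𝒪`-modules. -/
def FamilyGerm.restrictDiagonal :
    QCoh (FamilyGerm.toScheme : FamilyGerm k n ⥤ Scheme.{u}) ⥤ UniversalOModule k n :=
  QCoh.precomp (Fam.diagonal ⋙ FamilyGerm.ofPtFam) FamilyGerm.toScheme

/-- The system of sheaves underlying a quasi-coherent sheaf on germs, restricted to pointed families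
and their fibrewise étale morphisms. -/
def FamilyGerm.restrictPtFam :
    QCoh (FamilyGerm.toScheme : FamilyGerm k n ⥤ Scheme.{u}) ⥤
      ModuleSystem (PtFam.baseFunctor ⋙ Over.forget _ : PtFam k n ⥤ Scheme.{u}) :=
  (isQCoh _).ι ⋙ ModuleSystem.precomp FamilyGerm.ofPtFam FamilyGerm.toScheme

/-- The functor `F ↦ ((σ : S ⟶ X) ↦ σ^* F_{X/S})`, with values in systems of sheaves on pointed
families. -/
def UniversalOModule.pullbackSection :
    UniversalOModule k n ⥤
      ModuleSystem (PtFam.baseFunctor ⋙ Over.forget _ : PtFam k n ⥤ Scheme.{u}) :=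
  (isQCoh _).ι ⋙ ModuleSystem.precomp PtFam.forget Fam.totalFunctor ⋙
    ModuleSystem.pullbackAlong PtFam.σ

end Main

end

end UniversalModule

open UniversalModule

/-!
A sheaf of modules on a scheme `S` is treated as an object `(S, M)` of the category `ModScheme`, whose
morphisms `(T, N) ⟶ (S, M)` are pairs of a morphism `f : T ⟶ S` and a morphism `f^* M ⟶ N`; such a
morphism is *cartesian* (`Cart`) if `f^* M ⟶ N` is an isomorphism. A system of sheaves on a category
over schemes then becomes a functor with values in cartesian morphisms
(`ModuleSystem.exists_of_arrow`), and all coherence conditions between pullbacks become equations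
between compositions.

*Restriction to trivial germs.* Quasi-coherent sheaves satisfy étale descent: sections by
`EtaleCovering.secDescent`, morphisms by `EtaleCovering.existsUnique_hom`, and the sheaves themselves by
`DescentDatum.nonempty_gluing_of_scheme`. Descent for sections is the exactness of the Amitsur complex
of a faithfully flat algebra together with the Zariski case. A sheaf is glued as the sheaf of compatible
families of sections; on affine schemes this is the kernel of a map between finite products of modules,
which commutes with flat base change.

As a consequence, a functor between categories fibred over schemes which is an equivalence
étale-locally on the base (`IsLocalEquivalence`) induces an equivalence on quasi-coherent sheaves
(`IsLocalEquivalence.isEquivalence_precomp`): the value at an object of the target is glued from the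
values at its charts. This applies to each plus construction (`Plus.isLocalEquivalence`), hence to the
stackification, and to the inclusion of the trivial germs (`TrivialGerm.isLocalEquivalence`). The latter
is locally essentially surjective because a smooth morphism has étale coordinates
(`exists_etale_affineSpace`): near a point of the base, the section lies in the domain of the
coordinates, and after a translation it goes to the zero section (`exists_trivial`).

*Germs and pointed families.* A germ is a fraction `V ⟶ X`, `V ⟶ Y` of morphisms of pointed families,
the first of which is étale over the identity of the base. Any compatible system of sheaves on pointed
families takes the first morphism to an isomorphism, since the sheaf lives on the base; therefore common
étale neighbourhoods act on it, and equivalent ones act in the same way because this can be tested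
Zariski-locally on the base (`FamilyGerm.nbhdArrow_congr`). So quasi-coherent sheaves on germs are the
same as quasi-coherent systems on pointed families and fibrewise étale morphisms
(`FamilyGerm.isEquivalence_precomp_ofPtFam`).

*Universal modules and pointed families.* The functors are `F ↦ σ^* F` and
`M ↦ M_{X ×_S X ⇄ X}`. They are quasi-inverse by two natural cartesian squares: the second projection
`(X ×_S X)/X ⟶ X/S` over `X ⟶ S` (`sndDiagonal`) gives `Δ^* F_{X ×_S X/X} ≅ Δ^* pr_2^* F_{X/S} = F_{X/S}`,
and the morphism `x ↦ (σ (π x), x)` from `X ⇄ S` to `X ×_S X ⇄ X` over `σ` (`toDiagonal`) gives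
`σ^* M_{X ×_S X ⇄ X} ≅ M_{X ⇄ S}`; see `UniversalOModule.exists_equivalence`.
-/

namespace UniversalModule

noncomputable section

/-! ### The category of schemes with a sheaf of modules -/

/-- The restriction of the sections of a sheaf of modules. -/
def secRes {S : Scheme.{u}} (M : S.Modules) {U V : S.Opens} (h : U ≤ V) : Γ(M, V) →+ Γ(M, U) :=
  (M.presheaf.map (homOfLE h).op).hom

theorem secRes_secRes {S : Scheme.{u}} (M : S.Modules) {U V W : S.Opens} (h : U ≤ V) (h' : V ≤ W)
    (m : Γ(M, W)) : secRes M h (secRes M h' m) = secRes M (h.trans h') m := by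
  have := M.presheaf.map_comp (homOfLE h').op (homOfLE h).op
  exact (ConcreteCategory.congr_hom this m).symm

@[simp] theorem secRes_self {S : Scheme.{u}} (M : S.Modules) {U : S.Opens} (h : U ≤ U)
    (m : Γ(M, U)) : secRes M h m = m := by
  have := M.presheaf.map_id (Opposite.op U)
  exact ConcreteCategory.congr_hom this m

theorem secRes_app {S : Scheme.{u}} {M N : S.Modules} (a : M ⟶ N) {U V : S.Opens} (h : U ≤ V)
    (m : Γ(M, V)) : a.app U (secRes M h m) = secRes N h (a.app V m) :=
  ConcreteCategory.congr_hom (a.mapPresheaf.naturality (homOfLE h).op) m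

theorem secRes_smul {S : Scheme.{u}} (M : S.Modules) {U V : S.Opens} (h : U ≤ V) (r : Γ(S, V))
    (m : Γ(M, V)) : secRes M h (r • m) = S.presheaf.map (homOfLE h).op r • secRes M h m :=
  Scheme.Modules.map_smul M (homOfLE h) r m

/-- A scheme together with a sheaf of modules on it. -/
structure ModScheme where
  scheme : Scheme.{u}
  sheaf : scheme.Modules

namespace ModScheme

/-- A morphism `(T, N) ⟶ (S, M)` is a morphism of schemes `f : T ⟶ S` and a morphism `M ⟶ f_* N`.
The direct image is used instead of `f^* M ⟶ N` because its sections are given by a formula, so that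
two morphisms can be compared by their actions on sections. -/
structure Hom (X Y : ModScheme.{u}) where
  base : X.scheme ⟶ Y.scheme
  map : Y.sheaf ⟶ (Scheme.Modules.pushforward base).obj X.sheaf

namespace Hom

variable {X Y Z : ModScheme.{u}}

/-- The action on sections. -/
def sec (φ : Hom X Y) (V : Y.scheme.Opens) : Γ(Y.sheaf, V) →+ Γ(X.sheaf, φ.base ⁻¹ᵁ V) :=
  (φ.map.app V).hom

/-- The sections over `U` of the pullback of a section over `V`, if `U` maps to `V`. -/
def res (φ : Hom X Y) (V : Y.scheme.Opens) (U : X.scheme.Opens) (h : U ≤ φ.base ⁻¹ᵁ V) :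
    Γ(Y.sheaf, V) →+ Γ(X.sheaf, U) :=
  (secRes X.sheaf h).comp (φ.sec V)

theorem res_apply (φ : Hom X Y) (V : Y.scheme.Opens) (U : X.scheme.Opens) (h : U ≤ φ.base ⁻¹ᵁ V)
    (m : Γ(Y.sheaf, V)) : φ.res V U h m = secRes X.sheaf h (φ.sec V m) := rfl

theorem res_eq_sec (φ : Hom X Y) (V : Y.scheme.Opens) (m : Γ(Y.sheaf, V)) :
    φ.res V (φ.base ⁻¹ᵁ V) le_rfl m = φ.sec V m := secRes_self _ _ _

theorem ext_res {φ ψ : Hom X Y} (hb : φ.base = ψ.base)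
    (h : ∀ V (m : Γ(Y.sheaf, V)), φ.res V (φ.base ⁻¹ᵁ V) le_rfl m =
      ψ.res V (φ.base ⁻¹ᵁ V) (by rw [hb]) m) : φ = ψ := by
  obtain ⟨f, a⟩ := φ
  obtain ⟨g, b⟩ := ψ
  dsimp only at hb
  subst hb
  congr 1
  apply Scheme.Modules.hom_ext
  intro V
  ext m
  have h1 := h V m
  have h2 := res_eq_sec (⟨f, a⟩ : Hom X Y) V m
  have h3 := res_eq_sec (⟨f, b⟩ : Hom X Y) V m
  exact h2.symm.trans (h1.trans h3)

theorem map_res (φ : Hom X Y) {V : Y.scheme.Opens} {U U' : X.scheme.Opens} (h : U ≤ φ.base ⁻¹ᵁ V)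
    (i : U' ≤ U) (m : Γ(Y.sheaf, V)) :
    secRes X.sheaf i (φ.res V U h m) = φ.res V U' (i.trans h) m :=
  secRes_secRes _ _ _ _

theorem sec_secRes (φ : Hom X Y) {V V' : Y.scheme.Opens} (i : V' ≤ V) (m : Γ(Y.sheaf, V)) :
    φ.sec V' (secRes Y.sheaf i m) =
      secRes X.sheaf (φ.base.preimage_mono i) (φ.sec V m) :=
  secRes_app φ.map i m

theorem res_map (φ : Hom X Y) {V V' : Y.scheme.Opens} {U : X.scheme.Opens} (i : V' ≤ V)
    (h : U ≤ φ.base ⁻¹ᵁ V') (m : Γ(Y.sheaf, V)) :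
    φ.res V' U h (secRes Y.sheaf i m) = φ.res V U (h.trans (φ.base.preimage_mono i)) m := by
  rw [res_apply, res_apply, sec_secRes, secRes_secRes]

theorem sec_smul (φ : Hom X Y) {V : Y.scheme.Opens} (r : Γ(Y.scheme, V)) (m : Γ(Y.sheaf, V)) :
    φ.sec V (r • m) = φ.base.app V r • φ.sec V m :=
  Scheme.Modules.Hom.app_smul φ.map r m

theorem res_smul (φ : Hom X Y) {V : Y.scheme.Opens} {U : X.scheme.Opens} (h : U ≤ φ.base ⁻¹ᵁ V)
    (r : Γ(Y.scheme, V)) (m : Γ(Y.sheaf, V)) :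
    φ.res V U h (r • m) = φ.base.appLE V U h r • φ.res V U h m := by
  rw [res_apply, sec_smul, secRes_smul]
  rfl

/-- The identity. -/
def id (X : ModScheme.{u}) : Hom X X := ⟨𝟙 _, (Scheme.Modules.pushforwardId X.scheme).inv.app _⟩

/-- The composition. -/
def comp (φ : Hom X Y) (ψ : Hom Y Z) : Hom X Z :=
  ⟨φ.base ≫ ψ.base, ψ.map ≫ (Scheme.Modules.pushforward ψ.base).map φ.map ≫
    (Scheme.Modules.pushforwardComp φ.base ψ.base).hom.app X.sheaf⟩

theorem comp_res (φ : Hom X Y) (ψ : Hom Y Z) {W : Z.scheme.Opens} {V : Y.scheme.Opens}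
    {U : X.scheme.Opens} (h : U ≤ (φ.comp ψ).base ⁻¹ᵁ W) (h1 : U ≤ φ.base ⁻¹ᵁ V)
    (h2 : V ≤ ψ.base ⁻¹ᵁ W) (m : Γ(Z.sheaf, W)) :
    (φ.comp ψ).res W U h m = φ.res V U h1 (ψ.res W V h2 m) := by
  have e1 : (φ.comp ψ).res W U h m = φ.res (ψ.base ⁻¹ᵁ W) U h (ψ.sec W m) := rfl
  rw [e1, res_apply ψ, res_map]

end Hom

instance : Category ModScheme.{u} where
  Hom := Hom
  id := Hom.id
  comp := Hom.comp
  id_comp {X Y} f := by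
    refine Hom.ext_res (Category.id_comp _) fun V m ↦ ?_
    exact (Hom.comp_res (Hom.id X) f (V := f.base ⁻¹ᵁ V) le_rfl le_rfl le_rfl m).trans
      (Hom.map_res f _ _ m)
  comp_id {X Y} f := by
    refine Hom.ext_res (Category.comp_id _) fun V m ↦ ?_
    exact (Hom.comp_res f (Hom.id Y) (V := V) le_rfl le_rfl le_rfl m).trans
      (Hom.res_map f _ _ m)
  assoc {X Y Z W} f g h := by
    refine Hom.ext_res (Category.assoc _ _ _) fun V m ↦ ?_
    refine (Hom.comp_res (f.comp g) h (V := h.base ⁻¹ᵁ V) le_rfl le_rfl le_rfl m).trans ?_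
    refine (Hom.comp_res f g (V := g.base ⁻¹ᵁ (h.base ⁻¹ᵁ V)) le_rfl le_rfl le_rfl _).trans ?_
    refine Eq.trans ?_ (Hom.comp_res f (g.comp h) (V := g.base ⁻¹ᵁ (h.base ⁻¹ᵁ V))
      le_rfl le_rfl le_rfl m).symm
    exact congrArg _ (Hom.comp_res g h (V := h.base ⁻¹ᵁ V) le_rfl le_rfl le_rfl m).symm

variable {X Y Z W : ModScheme.{u}}

/-- The underlying morphism of schemes. -/
abbrev base (φ : X ⟶ Y) : X.scheme ⟶ Y.scheme := Hom.base φ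

/-- The action on sections. -/
abbrev res (φ : X ⟶ Y) (V : Y.scheme.Opens) (U : X.scheme.Opens) (h : U ≤ base φ ⁻¹ᵁ V) :
    Γ(Y.sheaf, V) →+ Γ(X.sheaf, U) := Hom.res φ V U h

@[simp] theorem base_id (X : ModScheme.{u}) : base (𝟙 X) = 𝟙 _ := rfl

@[simp] theorem base_comp (φ : X ⟶ Y) (ψ : Y ⟶ Z) : base (φ ≫ ψ) = base φ ≫ base ψ := rfl

theorem comp_res (φ : X ⟶ Y) (ψ : Y ⟶ Z) {W : Z.scheme.Opens} {V : Y.scheme.Opens}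
    {U : X.scheme.Opens} (h : U ≤ base (φ ≫ ψ) ⁻¹ᵁ W) (h1 : U ≤ base φ ⁻¹ᵁ V)
    (h2 : V ≤ base ψ ⁻¹ᵁ W) (m : Γ(Z.sheaf, W)) :
    res (φ ≫ ψ) W U h m = res φ V U h1 (res ψ W V h2 m) :=
  Hom.comp_res φ ψ h h1 h2 m

theorem hom_ext {φ ψ : X ⟶ Y} (hb : base φ = base ψ)
    (h : ∀ V (m : Γ(Y.sheaf, V)), res φ V (base φ ⁻¹ᵁ V) le_rfl m =
      res ψ V (base φ ⁻¹ᵁ V) (by rw [hb]) m) : φ = ψ :=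
  Hom.ext_res hb h

/-- The functor to schemes. -/
def toScheme : ModScheme.{u} ⥤ Scheme.{u} where
  obj X := X.scheme
  map φ := base φ

/-- A morphism is cartesian if all morphisms to its target factor uniquely through it as soon
as the underlying morphism of schemes does. -/
def Cart (φ : X ⟶ Y) : Prop :=
  ∀ ⦃Z : ModScheme.{u}⦄ (ψ : Z ⟶ Y) (g : Z.scheme ⟶ X.scheme), g ≫ base φ = base ψ →
    ∃! χ : Z ⟶ X, base χ = g ∧ χ ≫ φ = ψ

namespace Cart

variable {φ : X ⟶ Y}

/-- The factorization through a cartesian morphism. -/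
def lift (h : Cart φ) (ψ : Z ⟶ Y) (g : Z.scheme ⟶ X.scheme) (w : g ≫ base φ = base ψ) : Z ⟶ X :=
  (h ψ g w).choose

@[simp] theorem base_lift (h : Cart φ) (ψ : Z ⟶ Y) (g : Z.scheme ⟶ X.scheme)
    (w : g ≫ base φ = base ψ) : base (h.lift ψ g w) = g :=
  (h ψ g w).choose_spec.1.1

@[simp] theorem lift_comp (h : Cart φ) (ψ : Z ⟶ Y) (g : Z.scheme ⟶ X.scheme)
    (w : g ≫ base φ = base ψ) : h.lift ψ g w ≫ φ = ψ :=
  (h ψ g w).choose_spec.1.2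

@[simp] theorem lift_comp_assoc (h : Cart φ) (ψ : Z ⟶ Y) (g : Z.scheme ⟶ X.scheme)
    (w : g ≫ base φ = base ψ) {W : ModScheme.{u}} (χ : Y ⟶ W) : h.lift ψ g w ≫ φ ≫ χ = ψ ≫ χ := by
  rw [← Category.assoc, lift_comp]

theorem hom_ext (h : Cart φ) {a b : Z ⟶ X} (hb : base a = base b) (e : a ≫ φ = b ≫ φ) : a = b :=
  (h (b ≫ φ) (base b) rfl).unique ⟨hb, e⟩ ⟨rfl, rfl⟩

theorem comp (h : Cart φ) {ψ : Y ⟶ Z} (h' : Cart ψ) : Cart (φ ≫ ψ) := by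
  intro W χ g w
  refine ⟨h.lift (h'.lift χ (g ≫ base φ) ((Category.assoc _ _ _).trans w)) g (by simp),
    ⟨by simp, by rw [lift_comp_assoc, lift_comp]⟩, ?_⟩
  rintro a ⟨h1, h2⟩
  exact h.hom_ext (by simp [h1]) (h'.hom_ext (by simp [h1]) (by simp [h2]))

theorem of_comp {ψ : Y ⟶ Z} (h : Cart (φ ≫ ψ)) (h' : Cart ψ) : Cart φ := by
  intro W χ g w
  have w' : g ≫ base (φ ≫ ψ) = base (χ ≫ ψ) := by
    rw [base_comp, base_comp, ← w, Category.assoc]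
  refine ⟨h.lift (χ ≫ ψ) g w', ⟨base_lift _ _ _ _,
    h'.hom_ext ?_ ?_⟩, ?_⟩
  · rw [base_comp, base_lift, w]
  · rw [Category.assoc, lift_comp]
  · rintro a ⟨h1, h2⟩
    exact h.hom_ext (by rw [h1, base_lift]) (by rw [lift_comp, ← h2, Category.assoc])

theorem of_isIso (φ : X ⟶ Y) [IsIso φ] : Cart φ := by
  intro Z ψ g w
  refine ⟨ψ ≫ inv φ, ⟨?_, by simp⟩, ?_⟩
  · have h1 : base φ ≫ base (inv φ) = 𝟙 _ := by rw [← base_comp, IsIso.hom_inv_id]; rfl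
    rw [base_comp, ← w, Category.assoc, h1, Category.comp_id]
  · rintro a ⟨-, rfl⟩
    simp

theorem isIso (h : Cart φ) [IsIso (base φ)] : IsIso φ := by
  have w : inv (base φ) ≫ base φ = base (𝟙 Y) := IsIso.inv_hom_id _
  refine ⟨h.lift (𝟙 Y) (inv (base φ)) w, h.hom_ext ?_ ?_, lift_comp _ _ _ _⟩
  · rw [base_comp, base_lift, IsIso.hom_inv_id, base_id]
  · rw [Category.assoc, lift_comp, Category.comp_id, Category.id_comp]

end Cart

/-- The morphism `(T, N) ⟶ (S, M)` over `f` defined by a morphism `f^* M ⟶ N`. -/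
def homOfPullback {S T : Scheme.{u}} (f : T ⟶ S) {M : S.Modules} {N : T.Modules}
    (a : (Scheme.Modules.pullback f).obj M ⟶ N) : (⟨T, N⟩ : ModScheme.{u}) ⟶ ⟨S, M⟩ :=
  ⟨f, (Scheme.Modules.pullbackPushforwardAdjunction f).homEquiv _ _ a⟩

/-- The morphism `f^* M ⟶ N` that defines a morphism `(T, N) ⟶ (S, M)` over `f`. -/
def pullbackHom (φ : X ⟶ Y) : (Scheme.Modules.pullback (base φ)).obj Y.sheaf ⟶ X.sheaf :=
  ((Scheme.Modules.pullbackPushforwardAdjunction (base φ)).homEquiv _ _).symm φ.map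

theorem homOfPullback_pullbackHom (φ : X ⟶ Y) : homOfPullback (base φ) (pullbackHom φ) = φ := by
  unfold homOfPullback pullbackHom
  rw [Equiv.apply_symm_apply]
  rfl

/-- The morphism `(S, N) ⟶ (S, M)` defined by a morphism `M ⟶ N`. -/
def vert {S : Scheme.{u}} {M N : S.Modules} (a : M ⟶ N) : (⟨S, N⟩ : ModScheme.{u}) ⟶ ⟨S, M⟩ :=
  ⟨𝟙 S, a ≫ (Scheme.Modules.pushforwardId S).inv.app N⟩

@[simp] theorem base_vert {S : Scheme.{u}} {M N : S.Modules} (a : M ⟶ N) : base (vert a) = 𝟙 S := rfl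

theorem vert_res {S : Scheme.{u}} {M N : S.Modules} (a : M ⟶ N) (V : S.Opens) (m : Γ(M, V)) :
    res (vert a) V V le_rfl m = a.app V m :=
  Hom.res_eq_sec (vert a) V m

theorem vert_injective {S : Scheme.{u}} {M N : S.Modules} {a b : M ⟶ N} (h : vert a = vert b) :
    a = b := by
  apply Scheme.Modules.hom_ext
  intro V
  ext m
  exact (vert_res a V m).symm.trans ((congrArg
    (fun ψ : {ψ : (⟨S, N⟩ : ModScheme.{u}) ⟶ ⟨S, M⟩ // base ψ = 𝟙 S} ↦
      res ψ.1 V V (by rw [ψ.2]; rfl) m) (Subtype.ext h :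
        (⟨vert a, rfl⟩ : {ψ : (⟨S, N⟩ : ModScheme.{u}) ⟶ ⟨S, M⟩ // base ψ = 𝟙 S}) =
          ⟨vert b, rfl⟩)).trans (vert_res b V m))

@[simp] theorem vert_id {S : Scheme.{u}} (M : S.Modules) : vert (𝟙 M) = 𝟙 _ := by
  refine hom_ext rfl fun V m ↦ ?_
  rfl

theorem vert_comp {S : Scheme.{u}} {M N K : S.Modules} (a : M ⟶ N) (b : N ⟶ K) :
    vert (a ≫ b) = vert b ≫ vert a := by
  refine hom_ext (Category.id_comp _).symm fun V m ↦ ?_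
  exact (vert_res (a ≫ b) V m).trans ((comp_res (vert b) (vert a) (V := V) le_rfl le_rfl le_rfl
    m).trans ((congrArg _ (vert_res a V m)).trans (vert_res b V _))).symm

theorem exists_vert {S : Scheme.{u}} {M N : S.Modules} (φ : (⟨S, N⟩ : ModScheme.{u}) ⟶ ⟨S, M⟩)
    (h : base φ = 𝟙 S) : ∃ a : M ⟶ N, vert a = φ := by
  obtain ⟨f, b⟩ := φ
  change f = _ at h
  subst h
  refine ⟨b ≫ (Scheme.Modules.pushforwardId S).hom.app N, ?_⟩
  unfold vert
  rw [Category.assoc, Iso.hom_inv_id_app]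
  congr 1

/-- The morphism of sheaves that defines a morphism over the identity. -/
def toVert {S : Scheme.{u}} {M N : S.Modules} (φ : (⟨S, N⟩ : ModScheme.{u}) ⟶ ⟨S, M⟩)
    (h : base φ = 𝟙 S) : M ⟶ N := (exists_vert φ h).choose

@[simp] theorem vert_toVert {S : Scheme.{u}} {M N : S.Modules}
    (φ : (⟨S, N⟩ : ModScheme.{u}) ⟶ ⟨S, M⟩) (h : base φ = 𝟙 S) : vert (toVert φ h) = φ :=
  (exists_vert φ h).choose_spec

theorem isIso_vert_iff {S : Scheme.{u}} {M N : S.Modules} (a : M ⟶ N) :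
    IsIso (vert a) ↔ IsIso a := by
  constructor
  · intro h
    have h1 : base (inv (vert a)) = 𝟙 S := by
      have : base (inv (vert a)) ≫ base (vert a) = 𝟙 _ := by
        rw [← base_comp, IsIso.inv_hom_id]; rfl
      rw [base_vert] at this
      exact (Category.comp_id _).symm.trans this
    refine ⟨toVert _ h1, vert_injective ?_, vert_injective ?_⟩
    · rw [vert_comp, vert_toVert, IsIso.inv_hom_id, vert_id]
    · rw [vert_comp, vert_toVert, IsIso.hom_inv_id, vert_id]
  · intro h
    exact ⟨vert (inv a), by rw [← vert_comp, IsIso.inv_hom_id, vert_id],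
      by rw [← vert_comp, IsIso.hom_inv_id, vert_id]⟩

theorem vert_comp_homOfPullback {S T : Scheme.{u}} (f : T ⟶ S) {M : S.Modules} {N N' : T.Modules}
    (a : (Scheme.Modules.pullback f).obj M ⟶ N) (b : N ⟶ N') :
    vert b ≫ homOfPullback f a = homOfPullback f (a ≫ b) := by
  refine hom_ext (Category.id_comp _) fun V m ↦ ?_
  refine (comp_res (vert b) (homOfPullback f a) (V := f ⁻¹ᵁ V) le_rfl le_rfl le_rfl m).trans ?_
  refine (vert_res b (f ⁻¹ᵁ V) _).trans ?_
  have h1 := Hom.res_eq_sec (homOfPullback f a) V m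
  have h2 := Hom.res_eq_sec (homOfPullback f (a ≫ b)) V m
  refine Eq.trans (congrArg _ h1) (Eq.trans ?_ h2.symm)
  have h3 := Adjunction.homEquiv_naturality_right
    (Scheme.Modules.pullbackPushforwardAdjunction f) a b
  change _ = ((Scheme.Modules.pullbackPushforwardAdjunction f).homEquiv _ _ (a ≫ b)).app V m
  rw [h3]
  rfl

theorem homOfPullback_comp_vert {S T : Scheme.{u}} (f : T ⟶ S) {M M' : S.Modules} {N : T.Modules}
    (a : (Scheme.Modules.pullback f).obj M ⟶ N) (b : M' ⟶ M) :
    homOfPullback f a ≫ vert b = homOfPullback f ((Scheme.Modules.pullback f).map b ≫ a) := by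
  refine hom_ext (Category.comp_id _) fun V m ↦ ?_
  refine (comp_res (homOfPullback f a) (vert b) (V := V) le_rfl le_rfl le_rfl m).trans ?_
  have h1 := Hom.res_eq_sec (homOfPullback f a) V (b.app V m)
  have h2 := Hom.res_eq_sec (homOfPullback f ((Scheme.Modules.pullback f).map b ≫ a)) V m
  refine Eq.trans (congrArg _ (vert_res b V m)) (h1.trans (Eq.trans ?_ h2.symm))
  have h3 := Adjunction.homEquiv_naturality_left
    (Scheme.Modules.pullbackPushforwardAdjunction f) b a
  change _ = ((Scheme.Modules.pullbackPushforwardAdjunction f).homEquiv _ _ _).app V m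
  rw [h3]
  rfl

/-- The pullback `(T, f^* M)` of `(S, M)`. -/
def pb (Y : ModScheme.{u}) {T : Scheme.{u}} (f : T ⟶ Y.scheme) : ModScheme.{u} :=
  ⟨T, (Scheme.Modules.pullback f).obj Y.sheaf⟩

/-- The canonical morphism `(T, f^* M) ⟶ (S, M)`. -/
def pbMap (Y : ModScheme.{u}) {T : Scheme.{u}} (f : T ⟶ Y.scheme) : Y.pb f ⟶ Y :=
  homOfPullback f (𝟙 _)

theorem eq_homOfPullback (φ : X ⟶ Y) {f : X.scheme ⟶ Y.scheme} (h : base φ = f) :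
    ∃ a : (Scheme.Modules.pullback f).obj Y.sheaf ⟶ X.sheaf, homOfPullback f a = φ := by
  subst h
  exact ⟨pullbackHom φ, homOfPullback_pullbackHom φ⟩

theorem homOfPullback_injective {S T : Scheme.{u}} (f : T ⟶ S) {M : S.Modules} {N : T.Modules}
    {a b : (Scheme.Modules.pullback f).obj M ⟶ N} (h : homOfPullback f a = homOfPullback f b) :
    a = b := by
  -- The types of the second components agree only up to the equality of the first ones.
  have h1 : ∀ (φ ψ : Hom (⟨T, N⟩ : ModScheme.{u}) ⟨S, M⟩), φ = ψ → HEq φ.map ψ.map := by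
    rintro φ _ rfl
    rfl
  exact Equiv.injective _ (eq_of_heq (h1 _ _ h))

/-- The canonical morphism `(X, N) ⟶ (T, g_* N)`. -/
def toPushforward (X : ModScheme.{u}) {T : Scheme.{u}} (g : X.scheme ⟶ T) :
    X ⟶ ⟨T, (Scheme.Modules.pushforward g).obj X.sheaf⟩ := ⟨g, 𝟙 _⟩

/-- A morphism over `g ≫ f` factors through the canonical morphism to the direct image under `g`,
which reduces the universal property of `(T, f^* M) ⟶ (S, M)` to the adjunction for `f` alone. -/
theorem exists_pushforward (φ : X ⟶ Y) {T : Scheme.{u}} (g : X.scheme ⟶ T) (f : T ⟶ Y.scheme)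
    (h : g ≫ f = base φ) :
    ∃ (a : (⟨T, (Scheme.Modules.pushforward g).obj X.sheaf⟩ : ModScheme.{u}) ⟶ Y),
      base a = f ∧ toPushforward X g ≫ a = φ := by
  obtain ⟨b, m⟩ := φ
  change g ≫ f = b at h
  subst h
  refine ⟨⟨f, m ≫ (Scheme.Modules.pushforwardComp g f).inv.app X.sheaf⟩, rfl, ?_⟩
  refine hom_ext rfl fun V x ↦ ?_
  rfl

theorem pushforward_factor {T : Scheme.{u}} (g : X.scheme ⟶ T) {N : T.Modules}
    (φ : X ⟶ (⟨T, N⟩ : ModScheme.{u})) (h : base φ = g) :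
    ∃ a : N ⟶ (Scheme.Modules.pushforward g).obj X.sheaf,
      toPushforward X g ≫ vert a = φ := by
  obtain ⟨b, m⟩ := φ
  change b = g at h
  subst h
  refine ⟨m, hom_ext (Category.comp_id _) fun V x ↦ ?_⟩
  rfl

theorem pushforward_cancel {T : Scheme.{u}} (g : X.scheme ⟶ T)
    {a b : (⟨T, (Scheme.Modules.pushforward g).obj X.sheaf⟩ : ModScheme.{u}) ⟶ Y}
    (hb : base a = base b) (h : toPushforward X g ≫ a = toPushforward X g ≫ b) : a = b := by
  obtain ⟨f, m⟩ := a
  obtain ⟨f', m'⟩ := b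
  change f = f' at hb
  subst hb
  congr 1
  have h1 : ∀ (φ ψ : X ⟶ Y), φ = ψ → HEq (Hom.map φ) (Hom.map ψ) := by
    rintro φ _ rfl
    rfl
  have h3 := h1 _ _ h
  have h2 := eq_of_heq h3
  apply Scheme.Modules.hom_ext
  intro V
  ext x
  exact congrArg (fun c : Y.sheaf ⟶ (Scheme.Modules.pushforward (g ≫ f)).obj X.sheaf ↦ c.app V x) h2

/-- The morphism `(T, f^* M) ⟶ (S, M)` is cartesian. -/
theorem cart_pbMap (Y : ModScheme.{u}) {T : Scheme.{u}} (f : T ⟶ Y.scheme) :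
    Cart (Y.pbMap f) := by
  intro Z ψ g w
  change Z.scheme ⟶ T at g
  change g ≫ f = _ at w
  obtain ⟨a, ha, ea⟩ := exists_pushforward ψ g f w
  obtain ⟨c, hc⟩ := eq_homOfPullback a ha
  have e (d : (Scheme.Modules.pullback f).obj Y.sheaf ⟶
      (Scheme.Modules.pushforward g).obj Z.sheaf) : vert d ≫ Y.pbMap f = homOfPullback f d :=
    (vert_comp_homOfPullback f (𝟙 _) d).trans (by rw [Category.id_comp])
  refine ⟨toPushforward Z g ≫ vert c, ⟨Category.comp_id _, ?_⟩, ?_⟩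
  · exact (Category.assoc _ _ _).trans ((congrArg (toPushforward Z g ≫ ·) ((e c).trans hc)).trans ea)
  · rintro χ ⟨h1, h2⟩
    obtain ⟨d, hd⟩ := pushforward_factor g χ h1
    refine hd.symm.trans (congrArg (fun d ↦ toPushforward Z g ≫ vert d) ?_)
    apply homOfPullback_injective f
    refine Eq.trans ?_ hc.symm
    refine pushforward_cancel g ha.symm (Eq.trans ?_ ea.symm)
    refine (congrArg (toPushforward Z g ≫ ·) (e d).symm).trans (Eq.trans ?_ h2)
    exact (Category.assoc _ _ _).symm.trans (congrArg (· ≫ Y.pbMap f) hd)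

/-- The cartesian morphisms are those for which the morphism `f^* M ⟶ N` is an isomorphism. -/
theorem cart_homOfPullback_iff {S T : Scheme.{u}} (f : T ⟶ S) {M : S.Modules} {N : T.Modules}
    (a : (Scheme.Modules.pullback f).obj M ⟶ N) : Cart (homOfPullback f a) ↔ IsIso a := by
  have e : vert a ≫ pbMap ⟨S, M⟩ f = homOfPullback f a :=
      (vert_comp_homOfPullback f (𝟙 _) a).trans (by rw [Category.id_comp])
  rw [← isIso_vert_iff, ← e]
  constructor
  · intro h
    have h1 := h.of_comp (cart_pbMap ⟨S, M⟩ f)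
    have : IsIso (base (vert a)) := inferInstanceAs (IsIso (𝟙 T))
    exact h1.isIso
  · intro h
    exact (Cart.of_isIso _).comp (cart_pbMap ⟨S, M⟩ f)

end ModScheme

end

noncomputable section

/-! ### Quasi-coherent sheaves: local nature and universal property -/

/-- The equivalence between sheaves of modules on the slice site over `U` and on the scheme `U`
matches the structure sheaves. -/
def overUnitIso {X : Scheme.{u}} (U : X.Opens) :
    SheafOfModules.unit (X.ringCatSheaf.over U) ≅
    (Scheme.Modules.overEquiv U).inverse.obj (SheafOfModules.unit U.toScheme.ringCatSheaf) :=
  let e1 : (Scheme.Modules.overEquiv U).functor.obj (SheafOfModules.unit (X.ringCatSheaf.over U)) ≅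
    (SheafOfModules.unit U.toScheme.ringCatSheaf : SheafOfModules _) :=
    (Scheme.Modules.overFunctorEquiv U).app (SheafOfModules.unit X.ringCatSheaf : SheafOfModules _) ≪≫ Scheme.Modules.restrictUnitIso U.ι
  (Scheme.Modules.overEquiv U).unitIso.app _ ≪≫ (Scheme.Modules.overEquiv U).inverse.mapIso e1

/-- A presentation of the restriction of `M` to the scheme `U` gives one of its restriction to the
slice site over `U`, in terms of which quasi-coherence is defined. -/
def presentationOver {X : Scheme.{u}} (U : X.Opens) (M : X.Modules) (p : (M.restrict U.ι).Presentation) :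
   (SheafOfModules.over M U).Presentation := by
  let F : SheafOfModules U.toScheme.ringCatSheaf ⥤ SheafOfModules (X.ringCatSheaf.over U) :=
    (Scheme.Modules.overEquiv U).inverse
  have : PreservesColimitsOfSize.{u, u} F :=
    (Scheme.Modules.overEquiv U).symm.toAdjunction.leftAdjoint_preservesColimits
  let q := SheafOfModules.Presentation.map p F (overUnitIso U)
  let e : (Scheme.Modules.overEquiv U).inverse.obj (M.restrict U.ι) ≅ SheafOfModules.over M U :=
    (Scheme.Modules.overEquiv U).inverse.mapIso ((Scheme.Modules.overFunctorEquiv U).app M).symm ≪≫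
    ((Scheme.Modules.overEquiv U).unitIso.app _).symm
  exact SheafOfModules.Presentation.ofIsIso e.hom q

theorem isQuasicoherent_of_iso {X : Scheme.{u}} {M N : X.Modules} (e : M ≅ N) (h : M.IsQuasicoherent) : N.IsQuasicoherent := by
  exact (SheafOfModules.isQuasicoherent X.ringCatSheaf).prop_of_iso e h

/-- On an affine open subset a quasi-coherent sheaf has a global presentation, since it is of the
form `tilde`. -/
theorem exists_presentation_of_isAffineOpen {X : Scheme.{u}} {U : X.Opens} (hU : IsAffineOpen U) (M : X.Modules)
   (h : (M.restrict U.ι).IsQuasicoherent) : Nonempty (M.restrict U.ι).Presentation := by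
  let N := (M.restrict U.ι).restrict hU.isoSpec.inv
  have : N.IsQuasicoherent := inferInstance
  have : IsIso N.fromTildeΓ := @Scheme.Modules.isIso_fromTildeΓ_of_isQuasicoherent Γ(X, U) N this
  let e : tilde ((modulesSpecToSheaf.obj N).presheaf.obj (.op ⊤)) ≅ N := asIso N.fromTildeΓ
  let p1 := presentationTilde (R := Γ(X,U)) ((modulesSpecToSheaf.obj N).presheaf.obj (.op ⊤)) .univ (by simp) _ (Submodule.span_eq _)
  let p2 : N.Presentation := @SheafOfModules.Presentation.ofIsIso.{u, u, u} _ _ _ _ _ _ _ _ e.hom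
    (Iso.isIso_hom e) p1
  let p3 := Scheme.Modules.presentationRestrict hU.isoSpec.hom p2
  let e' : N.restrict hU.isoSpec.hom ≅ M.restrict U.ι :=
     (Scheme.Modules.restrictFunctorComp hU.isoSpec.hom hU.isoSpec.inv).symm.app _ ≪≫
     (Scheme.Modules.restrictFunctorCongr hU.isoSpec.hom_inv_id).app _ ≪≫ Scheme.Modules.restrictFunctorId.app _
  exact ⟨@SheafOfModules.Presentation.ofIsIso.{u, u, u} _ _ _ _ _ _ _ _ e'.hom (Iso.isIso_hom e') p3⟩

/-- Quasi-coherence can be checked on an affine open cover. -/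
theorem isQuasicoherent_of_isOpenCover {X : Scheme.{u}} {ι : Type u} (U : ι → X.Opens)
    (hU : TopologicalSpace.IsOpenCover U) (ha : ∀ i, IsAffineOpen (U i)) (M : X.Modules)
    (h : ∀ i, (M.restrict (U i).ι).IsQuasicoherent) : M.IsQuasicoherent := by
  have hc : (Opens.grothendieckTopology X).CoversTop U := by
    rw [Opens.coversTop_iff]
    exact hU
  let d : SheafOfModules.QuasicoherentData.{u, u, u, u} (M : SheafOfModules X.ringCatSheaf) :=
    @SheafOfModules.QuasicoherentData.mk.{u, u, u, u} _ _ _ _ _ _ _ ι U hc fun i ↦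
      presentationOver (U i) M (exists_presentation_of_isAffineOpen (ha i) M (h i)).some
  exact d.isQuasicoherent

theorem exists_moduleCat_hom {R : Type*} [Ring R] {P Q : ModuleCat R} (l : P →+ Q)
    (hl : ∀ (r : R) (m : P), l (r • m) = r • l m) : ∃ l' : P ⟶ Q, ∀ m, l'.hom m = l m :=
  ⟨ModuleCat.ofHom { l with map_smul' := hl }, fun _ ↦ rfl⟩

/-- A right adjoint is fully faithful on morphisms out of an object with invertible counit. -/
theorem bijective_map_of_isIso_counit {C D : Type*} [Category* C] [Category* D] {F : C ⥤ D}
    {G : D ⥤ C} (adj : F ⊣ G) (M N : D) [IsIso (adj.counit.app M)] :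
    Function.Bijective (fun f : M ⟶ N ↦ G.map f) := by
  have h : (fun f : M ⟶ N ↦ G.map f) =
      (adj.homEquiv (G.obj M) N) ∘ fun f ↦ adj.counit.app M ≫ f := by
    ext f
    simp [Adjunction.homEquiv_unit]
  rw [h]
  refine (Equiv.bijective _).comp ⟨fun f g e ↦ ?_, fun f ↦ ⟨inv (adj.counit.app M) ≫ f, by simp⟩⟩
  exact (cancel_epi _).mp e

namespace ModScheme

variable {X Y Z W : ModScheme.{u}}

/-- A scheme with a quasi-coherent sheaf. -/
def QC (X : ModScheme.{u}) : Prop := X.sheaf.IsQuasicoherent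

/-- The action on global sections. -/
def glob (φ : X ⟶ Y) : Γ(Y.sheaf, ⊤) →+ Γ(X.sheaf, ⊤) := Hom.sec φ ⊤

theorem glob_smul (φ : X ⟶ Y) (r : Γ(Y.scheme, ⊤)) (m : Γ(Y.sheaf, ⊤)) :
    glob φ (r • m) = (base φ).appTop r • glob φ m := Hom.sec_smul φ r m

theorem glob_comp (φ : X ⟶ Y) (ψ : Y ⟶ Z) (m : Γ(Z.sheaf, ⊤)) :
    glob (φ ≫ ψ) m = glob φ (glob ψ m) := by
  have h := comp_res φ ψ (W := ⊤) (V := ⊤) (U := ⊤) le_rfl le_rfl le_rfl m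
  exact (Hom.res_eq_sec (φ ≫ ψ) ⊤ m).symm.trans (h.trans ((Hom.res_eq_sec φ ⊤ _).trans
    (congrArg _ (Hom.res_eq_sec ψ ⊤ m))))

theorem glob_id (m : Γ(X.sheaf, ⊤)) : glob (𝟙 X) m = m := rfl

/-- Morphisms to `Y` correspond to morphisms of schemes and semilinear maps of the global
sections. -/
def GlobUniv (Y : ModScheme.{u}) : Prop :=
  ∀ ⦃X : ModScheme.{u}⦄ (f : X.scheme ⟶ Y.scheme) (l : Γ(Y.sheaf, ⊤) →+ Γ(X.sheaf, ⊤)),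
    (∀ (r : Γ(Y.scheme, ⊤)) m, l (r • m) = f.appTop r • l m) →
    ∃! φ : X ⟶ Y, base φ = f ∧ glob φ = l

theorem GlobUniv.hom_ext (h : GlobUniv Y) {a b : X ⟶ Y} (hb : base a = base b)
    (hg : ∀ m, glob a m = glob b m) : a = b :=
  (h (base b) (glob b) (glob_smul b)).unique ⟨hb, AddMonoidHom.ext hg⟩ ⟨rfl, rfl⟩

/-- On a spectrum the universal property is the adjunction between `tilde` and global sections,
whose counit is invertible at quasi-coherent sheaves. -/
theorem globUniv_spec {R : CommRingCat.{u}} (M : (Spec R).Modules) (h : M.IsQuasicoherent) :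
    GlobUniv ⟨Spec R, M⟩ := by
  intro X f l hl
  change X.scheme ⟶ Spec R at f
  let N : (Spec R).Modules := (Scheme.Modules.pushforward f).obj X.sheaf
  have : IsIso (tilde.adjunction.counit.app M) :=
    @Scheme.Modules.isIso_fromTildeΓ_of_isQuasicoherent R M h
  have hbij := bijective_map_of_isIso_counit tilde.adjunction M N
  obtain ⟨l', hl'⟩ := exists_moduleCat_hom (P := moduleSpecΓFunctor.obj M)
    (Q := moduleSpecΓFunctor.obj N) l fun r m ↦
      hl (((Spec R).presheaf.map (⊤ : (Spec R).Opens).leTop.op) ((Scheme.ΓSpecIso R).inv r)) m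
  obtain ⟨a, ha⟩ := hbij.2 l'
  refine ⟨⟨f, a⟩, ⟨rfl, ?_⟩, ?_⟩
  · ext m
    exact (congrArg (fun c : moduleSpecΓFunctor.obj M ⟶ moduleSpecΓFunctor.obj N ↦ c.hom m)
      ha).trans (hl' m)
  · rintro ⟨f', b⟩ ⟨h1, h2⟩
    change f' = f at h1
    subst h1
    congr 1
    apply hbij.1
    refine Eq.trans ?_ ha.symm
    ext m
    exact (DFunLike.congr_fun h2 m).trans (hl' m).symm

theorem GlobUniv.of_iso (e : X ⟶ Y) [IsIso e] (h : GlobUniv Y) : GlobUniv X := by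
  intro Z f l hl
  have w (r) : (f ≫ base e).appTop r = f.appTop ((base e).appTop r) := by
    rw [Scheme.Hom.comp_appTop]; rfl
  obtain ⟨φ, ⟨h1, h2⟩, h3⟩ := h (f ≫ base e) (l.comp (glob e)) (fun r m ↦ by
    rw [AddMonoidHom.comp_apply, glob_smul, hl, w]; rfl)
  have h4 : base e ≫ base (inv e) = 𝟙 _ := congrArg base (IsIso.hom_inv_id e)
  refine ⟨φ ≫ inv e, ⟨?_, ?_⟩, ?_⟩
  · exact (congrArg (· ≫ base (inv e)) h1).trans ((Category.assoc _ _ _).trans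
      ((congrArg (f ≫ ·) h4).trans (Category.comp_id _)))
  · ext m
    refine (glob_comp φ (inv e) m).trans ?_
    rw [h2]
    refine congrArg l ?_
    exact (glob_comp e (inv e) m).symm.trans (congrArg (fun c : X ⟶ X ↦ glob c m) (IsIso.hom_inv_id e))
  · rintro χ ⟨h5, h6⟩
    rw [IsIso.eq_comp_inv]
    refine h3 _ ⟨congrArg (· ≫ base e) h5, ?_⟩
    ext m
    rw [glob_comp, h6]
    rfl

/-- The restriction to an open subscheme. -/
def restr (Y : ModScheme.{u}) {T : Scheme.{u}} (j : T ⟶ Y.scheme) [IsOpenImmersion j] :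
    ModScheme.{u} := ⟨T, Y.sheaf.restrict j⟩

/-- The inclusion of the restriction to an open subscheme. -/
def restrMap (Y : ModScheme.{u}) {T : Scheme.{u}} (j : T ⟶ Y.scheme) [IsOpenImmersion j] :
    Y.restr j ⟶ Y := ⟨j, (Scheme.Modules.restrictAdjunction j).unit.app Y.sheaf⟩

theorem cart_restrMap (Y : ModScheme.{u}) {T : Scheme.{u}} (j : T ⟶ Y.scheme)
    [IsOpenImmersion j] : Cart (Y.restrMap j) := by
  let a := (Scheme.Modules.restrictFunctorIsoPullback j).inv.app Y.sheaf
  have ha : homOfPullback j a = Y.restrMap j := by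
    have h : (Scheme.Modules.pullbackPushforwardAdjunction j).homEquiv _ _ a =
        (Scheme.Modules.restrictAdjunction j).unit.app Y.sheaf := by
      rw [Adjunction.homEquiv_unit]
      have h1 := Adjunction.unit_leftAdjointUniq_hom_app
        (Scheme.Modules.pullbackPushforwardAdjunction j) (Scheme.Modules.restrictAdjunction j)
        Y.sheaf
      exact h1
    exact congrArg (Hom.mk (X := Y.restr j) (Y := Y) j) h
  rw [← ha]
  exact (cart_homOfPullback_iff j a).mpr (by exact inferInstanceAs (IsIso ((Scheme.Modules.restrictFunctorIsoPullback j).symm.app Y.sheaf).hom))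

theorem restrMap_res (Y : ModScheme.{u}) {T : Scheme.{u}} (j : T ⟶ Y.scheme)
    [IsOpenImmersion j] (U : T.Opens) (m : Γ(Y.sheaf, j ''ᵁ U)) (h : U ≤ j ⁻¹ᵁ (j ''ᵁ U)) :
    res (Y.restrMap j) (j ''ᵁ U) U h m = m := by
  refine (secRes_secRes Y.sheaf (U := j ''ᵁ U) (V := j ''ᵁ (j ⁻¹ᵁ (j ''ᵁ U))) (W := j ''ᵁ U)
    (j.image_mono h) (j.image_preimage_le _) m).trans ?_
  exact secRes_self _ _ _

theorem res_congr {φ ψ : X ⟶ Y} (e : φ = ψ) (V : Y.scheme.Opens) {U : X.scheme.Opens}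
    (h : U ≤ base φ ⁻¹ᵁ V) (m : Γ(Y.sheaf, V)) :
    res φ V U h m = res ψ V U (e ▸ h) m := by
  subst e
  rfl

/-- A morphism over an open immersion is cartesian if and only if it is bijective on sections over
all open subsets. -/
theorem cart_iff_of_isOpenImmersion (φ : X ⟶ Y) [IsOpenImmersion (base φ)] :
    Cart φ ↔ ∀ U : X.scheme.Opens, Function.Bijective
      (res φ (base φ ''ᵁ U) U ((base φ).preimage_image_eq U).ge) := by
  obtain ⟨v, ⟨hv, hφ⟩, -⟩ := cart_restrMap Y (base φ) φ (𝟙 _) (Category.id_comp _)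
  obtain ⟨a, ha⟩ := exists_vert (S := X.scheme) (M := Y.sheaf.restrict (base φ)) (N := X.sheaf) v hv
  have h1 (U : X.scheme.Opens) (m : Γ(Y.sheaf, base φ ''ᵁ U)) :
      res φ (base φ ''ᵁ U) U ((base φ).preimage_image_eq U).ge m = a.app U m := by
    refine (res_congr hφ.symm _ _ m).trans ?_
    refine (comp_res v (Y.restrMap (base φ)) (V := U) _ ?_ ((base φ).preimage_image_eq U).ge m).trans ?_
    · rw [hv]; exact le_rfl
    · refine (congrArg _ (restrMap_res Y (base φ) U m _)).trans ?_
      refine (res_congr ha.symm _ _ m).trans ?_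
      exact vert_res a U m
  have h3 : Cart φ ↔ IsIso a := by
    rw [← isIso_vert_iff, ha]
    constructor
    · intro h
      rw [← hφ] at h
      have h4 := h.of_comp (cart_restrMap Y (base φ))
      have : IsIso (base v) := by rw [hv]; exact inferInstanceAs (IsIso (𝟙 X.scheme))
      exact h4.isIso
    · intro h
      rw [← hφ]
      have : IsIso v := h
      exact (Cart.of_isIso v).comp (cart_restrMap Y (base φ))
  rw [h3, Scheme.Modules.Hom.isIso_iff_isIso_app]
  refine forall_congr' fun U ↦ ?_
  rw [ConcreteCategory.isIso_iff_bijective]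
  have h5 : (fun m ↦ a.app U m) = fun m ↦ res φ (base φ ''ᵁ U) U ((base φ).preimage_image_eq U).ge m :=
    funext fun m ↦ (h1 U m).symm
  exact iff_of_eq (congrArg Function.Bijective h5)

theorem QC.restr (h : QC Y) {T : Scheme.{u}} (j : T ⟶ Y.scheme) [IsOpenImmersion j] :
    QC (Y.restr j) := by
  have : Y.sheaf.IsQuasicoherent := h
  exact Scheme.Modules.isQuasicoherent_restrictFunctor j Y.sheaf

theorem qc_of_iso_of_vert {S : Scheme.{u}} {M N : S.Modules} (φ : (⟨S, N⟩ : ModScheme.{u}) ⟶ ⟨S, M⟩)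
    (hb : base φ = 𝟙 S) (hφ : Cart φ) (h : M.IsQuasicoherent) : N.IsQuasicoherent := by
  obtain ⟨a, rfl⟩ := exists_vert φ hb
  have : IsIso (base (vert a)) := inferInstanceAs (IsIso (𝟙 S))
  have := hφ.isIso
  have : IsIso a := (isIso_vert_iff a).mp this
  exact isQuasicoherent_of_iso (asIso a) h

theorem Cart.qc_of_isOpenImmersion {φ : X ⟶ Y} (hφ : Cart φ) [IsOpenImmersion (base φ)] (h : QC Y) :
    QC X := by
  obtain ⟨v, ⟨hv, e⟩, -⟩ := cart_restrMap Y (base φ) φ (𝟙 _) (Category.id_comp _)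
  refine qc_of_iso_of_vert (M := Y.sheaf.restrict (base φ)) v hv ?_ (h.restr _)
  rw [← e] at hφ
  exact hφ.of_comp (cart_restrMap Y (base φ))

/-- A morphism to a quasi-coherent sheaf on an affine scheme is determined by its action on global
sections, and every semilinear map occurs. -/
theorem GlobUniv.of_qc [IsAffine X.scheme] (h : QC X) : GlobUniv X := by
  let j : Spec Γ(X.scheme, ⊤) ⟶ X.scheme := X.scheme.isoSpec.inv
  have : IsIso (base (X.restrMap j)) := inferInstanceAs (IsIso j)
  have := (cart_restrMap X j).isIso
  exact (globUniv_spec (X.restr j).sheaf (h.restr j)).of_iso (inv (X.restrMap j))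

end ModScheme

end

noncomputable section

/-! ### Quasi-coherent sheaves on affine schemes -/

/-- The semilinear map with a given underlying additive map. -/
def mkSemilinear {A B : Type u} [CommRing A] [CommRing B] (f : A →+* B) {M N : Type u}
    [AddCommGroup M] [AddCommGroup N] [Module A M] [Module B N] (l : M →+ N)
    (hl : ∀ (r : A) (m : M), l (r • m) = f r • l m) : M →ₛₗ[f] N :=
  { l with map_smul' := hl }

/-- A semilinear map `M → N` over `f : A → B` that exhibits `N` as the base change `B ⊗ M`. -/
def IsBC {A B : Type u} [CommRing A] [CommRing B] {f : A →+* B} {M N : Type u} [AddCommGroup M]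
    [AddCommGroup N] [Module A M] [Module B N] (l : M →ₛₗ[f] N) : Prop :=
  ∀ (Q : Type u) [AddCommGroup Q] [Module B Q] (g : M →ₛₗ[f] Q),
    ∃! h : N →ₗ[B] Q, ∀ m, h (l m) = g m

namespace ModScheme

variable {X Y Z W : ModScheme.{u}}

/-- The action on global sections, as a semilinear map. -/
def globₗ (φ : X ⟶ Y) : Γ(Y.sheaf, ⊤) →ₛₗ[(base φ).appTop.hom] Γ(X.sheaf, ⊤) :=
  mkSemilinear _ (glob φ) (glob_smul φ)

theorem cart_toPushforward (X : ModScheme.{u}) {T : Scheme.{u}} (g : X.scheme ⟶ T) [IsIso g] :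
    Cart (toPushforward X g) := by
  have : IsOpenImmersion (base (toPushforward X g)) := inferInstanceAs (IsOpenImmersion g)
  refine (cart_iff_of_isOpenImmersion _).mpr fun U ↦ ?_
  have e : U = g ⁻¹ᵁ (g ''ᵁ U) := (g.preimage_image_eq U).symm
  have key : ∀ (V : X.scheme.Opens) (h : U = V), Function.Bijective (secRes X.sheaf h.le) := by
    rintro _ rfl
    have : ⇑(secRes X.sheaf (le_refl U)) = id := funext fun m ↦ secRes_self _ _ _
    rw [this]
    exact Function.bijective_id
  exact key _ e

theorem appTop_isoSpec_inv (S : Scheme.{u}) [IsAffine S] :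
    S.isoSpec.inv.appTop = (Scheme.ΓSpecIso Γ(S, ⊤)).inv := by
  have h2 : S.isoSpec.hom.appTop = (Scheme.ΓSpecIso Γ(S, ⊤)).hom := S.toSpecΓ_appTop
  have h3 : S.isoSpec.inv.appTop ≫ S.isoSpec.hom.appTop = 𝟙 _ := by
    have := Scheme.Hom.comp_appTop S.isoSpec.hom S.isoSpec.inv
    rw [← this, Iso.hom_inv_id]
    rfl
  rw [h2] at h3
  exact (Iso.eq_comp_inv _).mpr h3 |>.trans (Category.id_comp _)

/-- Every module of global functions on an affine scheme is the module of global sections of a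
quasi-coherent sheaf. -/
theorem exists_qc_of_module (S : Scheme.{u}) [IsAffine S] (Q : Type u) [AddCommGroup Q]
    [Module Γ(S, ⊤) Q] : ∃ N : S.Modules, N.IsQuasicoherent ∧
      ∃ e : Q ≃+ Γ(N, ⊤), ∀ (r : Γ(S, ⊤)) q, e (r • q) = r • e q := by
  let K : ModScheme.{u} := ⟨Spec Γ(S, ⊤), tilde (ModuleCat.of Γ(S, ⊤) Q)⟩
  have hK : QC K := inferInstanceAs (tilde (ModuleCat.of Γ(S, ⊤) Q)).IsQuasicoherent
  have hc := cart_toPushforward K (T := S) S.isoSpec.inv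
  have : IsIso (base (toPushforward K (T := S) S.isoSpec.inv)) :=
    inferInstanceAs (IsIso S.isoSpec.inv)
  have := hc.isIso
  have : IsIso (base (inv (toPushforward K (T := S) S.isoSpec.inv))) :=
    inferInstanceAs (IsIso (toScheme.map (inv (toPushforward K (T := S) S.isoSpec.inv))))
  refine ⟨(Scheme.Modules.pushforward S.isoSpec.inv).obj K.sheaf, (Cart.of_isIso
    (inv (toPushforward K (T := S) S.isoSpec.inv))).qc_of_isOpenImmersion hK, ?_⟩
  have e1 := ConcreteCategory.bijective_of_isIso (tilde.toOpen (ModuleCat.of Γ(S, ⊤) Q) ⊤)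
  refine ⟨AddEquiv.ofBijective (tilde.toOpen (ModuleCat.of Γ(S, ⊤) Q) ⊤).hom.toAddMonoidHom e1, ?_⟩
  intro r q
  refine ((tilde.toOpen (ModuleCat.of Γ(S, ⊤) Q) ⊤).hom.map_smul r q).trans ?_
  have h4 : ((Spec Γ(S, ⊤)).presheaf.map (⊤ : (Spec Γ(S, ⊤)).Opens).leTop.op)
      ((Scheme.ΓSpecIso Γ(S, ⊤)).inv r) = S.isoSpec.inv.appTop r := by
    rw [appTop_isoSpec_inv]
    exact ConcreteCategory.congr_hom ((Spec Γ(S, ⊤)).presheaf.map_id _) _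
  let q' : Γ(tilde (ModuleCat.of Γ(S, ⊤) Q), ⊤) := (tilde.toOpen (ModuleCat.of Γ(S, ⊤) Q) ⊤).hom q
  exact congrArg (fun t : Γ(Spec Γ(S, ⊤), ⊤) ↦ t • q') h4

/-- On affine schemes, cartesian morphisms of quasi-coherent sheaves are base changes of modules. -/
theorem Cart.isBC {φ : X ⟶ Y} (h : Cart φ) [IsAffine X.scheme] [IsAffine Y.scheme] (hX : QC X)
    (hY : QC Y) : IsBC (globₗ φ) := by
  intro Q _ _ g
  have uX := GlobUniv.of_qc hX
  have uY := GlobUniv.of_qc hY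
  obtain ⟨N, hN, e, he⟩ := exists_qc_of_module X.scheme Q
  let b : X.scheme ⟶ Y.scheme := base φ
  obtain ⟨ψ, ⟨h1, h2⟩, -⟩ := uY (X := ⟨X.scheme, N⟩) b (e.toAddMonoidHom.comp g.toAddMonoidHom)
    (fun r m ↦ (congrArg e (g.map_smulₛₗ r m)).trans (he _ _))
  obtain ⟨χ, ⟨h3, h4⟩, h5⟩ := h ψ (𝟙 _) ((Category.id_comp _).trans h1.symm)
  have h6 (r : Γ(X.scheme, ⊤)) (m : Γ(X.sheaf, ⊤)) : glob χ (r • m) = r • glob χ m := by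
    rw [glob_smul, h3]
    exact congrArg (fun t : Γ(X.scheme, ⊤) ↦ t • glob χ m)
      (ConcreteCategory.congr_hom (Scheme.Hom.id_appTop (X := X.scheme)) r)
  have h6' (r : Γ(X.scheme, ⊤)) (q : Γ(N, ⊤)) : e.symm (r • q) = r • e.symm q := by
    apply e.injective
    rw [he, AddEquiv.apply_symm_apply, AddEquiv.apply_symm_apply]
  refine ⟨mkSemilinear _ (e.symm.toAddMonoidHom.comp (glob χ)) fun r m ↦
    (congrArg e.symm (h6 r m)).trans (h6' _ _), fun m ↦ ?_, ?_⟩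
  · refine (congrArg e.symm ?_).trans (e.symm_apply_apply (g m))
    exact (glob_comp χ φ m).symm.trans ((congrArg (fun c : (⟨X.scheme, N⟩ : ModScheme.{u}) ⟶ Y ↦
      glob c m) h4).trans (DFunLike.congr_fun h2 m))
  · intro k hk
    obtain ⟨χ', ⟨h7, h8⟩, -⟩ := uX (X := ⟨X.scheme, N⟩) (𝟙 _)
      (e.toAddMonoidHom.comp k.toAddMonoidHom) (fun r m ↦ by
        refine ((congrArg e (k.map_smul r m)).trans (he _ _)).trans ?_
        exact congrArg (fun t : Γ(X.scheme, ⊤) ↦ t • e (k m))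
          (ConcreteCategory.congr_hom (Scheme.Hom.id_appTop (X := X.scheme)) r).symm)
    have h9 : χ' ≫ φ = ψ := by
      refine uY.hom_ext ((congrArg (· ≫ base φ) h7).trans ((Category.id_comp _).trans h1.symm))
        fun m ↦ ?_
      rw [glob_comp, h8, h2]
      exact congrArg e (hk m)
    have h10 := h5 χ' ⟨h7, h9⟩
    ext m
    apply e.injective
    refine Eq.trans ?_ (e.apply_symm_apply (glob χ m)).symm
    rw [← h10, h8]
    rfl

/-- Over affine schemes a morphism of quasi-coherent sheaves that is a base change on global
sections is cartesian. -/
theorem cart_of_isBC {φ : X ⟶ Y} [IsAffine X.scheme] [IsAffine Y.scheme] (hX : QC X)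
    (hY : QC Y) (h : IsBC (globₗ φ)) : Cart φ := by
  intro Z ψ g w
  have uX := GlobUniv.of_qc hX
  have uY := GlobUniv.of_qc hY
  let : Module Γ(X.scheme, ⊤) Γ(Z.sheaf, ⊤) := Module.compHom _ g.appTop.hom
  have hw (r) : (base ψ).appTop r = g.appTop ((base φ).appTop r) := by
    rw [← w, Scheme.Hom.comp_appTop]; rfl
  obtain ⟨k, hk, hk'⟩ := h Γ(Z.sheaf, ⊤)
    (mkSemilinear _ (glob ψ) fun r m ↦ (glob_smul ψ r m).trans
      (congrArg (fun t : Γ(Z.scheme, ⊤) ↦ t • glob ψ m) (hw r)))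
  obtain ⟨χ, ⟨h1, h2⟩, -⟩ := uX (X := Z) g k.toAddMonoidHom (fun r m ↦ k.map_smul r m)
  refine ⟨χ, ⟨h1, uY.hom_ext ((congrArg (· ≫ base φ) h1).trans w) fun m ↦ ?_⟩, ?_⟩
  · rw [glob_comp, h2]
    exact hk m
  · rintro χ' ⟨h3, h4⟩
    refine uX.hom_ext (h3.trans h1.symm) fun m ↦ ?_
    rw [h2]
    refine DFunLike.congr_fun (hk' (mkSemilinear _ (glob χ') fun r m ↦ ?_) fun m ↦ ?_) m
    · exact (glob_smul χ' r m).trans (congrArg (fun t : Z.scheme ⟶ X.scheme ↦ t.appTop r • glob χ' m) h3)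
    · exact (glob_comp χ' φ m).symm.trans (congrArg (fun c : Z ⟶ Y ↦ glob c m) h4)

end ModScheme

theorem isBC_tensorProduct {A B : Type u} [CommRing A] [CommRing B] (f : A →+* B) (M : Type u)
    [AddCommGroup M] [Module A M] : ∃ (N : Type u) (_ : AddCommGroup N) (_ : Module B N)
      (l : M →ₛₗ[f] N), IsBC l := by
  let := f.toAlgebra
  refine ⟨B ⊗[A] M, inferInstance, inferInstance,
    mkSemilinear f (TensorProduct.mk A B M 1).toAddMonoidHom fun r m ↦ ?_, ?_⟩
  · exact (TensorProduct.tmul_smul r (1 : B) m).trans (algebraMap_smul B r _).symm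
  intro Q _ _ g
  let : Module A Q := Module.compHom Q f
  have : IsScalarTower A B Q := IsScalarTower.of_algebraMap_smul fun _ _ ↦ rfl
  let g' : M →ₗ[A] Q := { g with map_smul' := g.map_smulₛₗ }
  refine ⟨(IsBaseChange.lift (TensorProduct.isBaseChange A M B) g'), fun m ↦ ?_, fun k hk ↦ ?_⟩
  · exact IsBaseChange.lift_eq (TensorProduct.isBaseChange A M B) g' m
  · apply (TensorProduct.isBaseChange A M B).algHom_ext
    intro m
    exact (hk m).trans (IsBaseChange.lift_eq (TensorProduct.isBaseChange A M B) g' m).symm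

namespace ModScheme

variable {X Y Z W : ModScheme.{u}}

/-- The pullback is identified with the quasi-coherent sheaf of the tensor product. -/
theorem Cart.qc_of_isAffine {φ : X ⟶ Y} (h : Cart φ) [IsAffine X.scheme] [IsAffine Y.scheme]
    (hY : QC Y) : QC X := by
  obtain ⟨N₀, _, _, l, hl⟩ := isBC_tensorProduct (base φ).appTop.hom Γ(Y.sheaf, ⊤)
  obtain ⟨N, hN, e, he⟩ := exists_qc_of_module X.scheme N₀
  let b : X.scheme ⟶ Y.scheme := base φ
  obtain ⟨ψ, ⟨h1, h2⟩, -⟩ := (GlobUniv.of_qc hY) (X := ⟨X.scheme, N⟩) b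
    (e.toAddMonoidHom.comp l.toAddMonoidHom)
    (fun r m ↦ (congrArg e (l.map_smulₛₗ r m)).trans (he _ _))
  have hψ : Cart ψ := by
    have : IsAffine (⟨X.scheme, N⟩ : ModScheme.{u}).scheme := inferInstanceAs (IsAffine X.scheme)
    refine cart_of_isBC hN hY fun Q _ _ g ↦ ?_
    have hb (r : Γ(Y.scheme, ⊤)) : (base ψ).appTop r = (base φ).appTop r := by rw [h1]
    have hm (m : Γ(Y.sheaf, ⊤)) : globₗ ψ m = e (l m) := DFunLike.congr_fun h2 m
    obtain ⟨k, hk, hk'⟩ := hl Q (mkSemilinear _ g.toAddMonoidHom fun r m ↦ (g.map_smulₛₗ r m).trans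
      (congrArg (fun t : Γ(X.scheme, ⊤) ↦ t • g m) (hb r)))
    have h6' (r : Γ(X.scheme, ⊤)) (q : Γ(N, ⊤)) : e.symm (r • q) = r • e.symm q := by
      apply e.injective
      rw [he, AddEquiv.apply_symm_apply, AddEquiv.apply_symm_apply]
    refine ⟨mkSemilinear _ (k.toAddMonoidHom.comp e.symm.toAddMonoidHom) fun r m ↦
      (congrArg k (h6' r m)).trans (k.map_smul _ _), fun m ↦ ?_,
      fun k' hk₂ ↦ ?_⟩
    · refine Eq.trans ?_ (hk m)
      refine congrArg k ((congrArg e.symm (hm m)).trans (e.symm_apply_apply _))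
    · have h3 := hk' (mkSemilinear _ (k'.toAddMonoidHom.comp e.toAddMonoidHom) fun r m ↦
        (congrArg k' (he r m)).trans (k'.map_smul _ _)) fun m ↦
          (congrArg k' (hm m)).symm.trans (hk₂ m)
      ext q
      refine Eq.trans ?_ (DFunLike.congr_fun h3 (e.symm q))
      exact congrArg k' (e.apply_symm_apply q).symm
  obtain ⟨v, ⟨h3, h4⟩, -⟩ := hψ φ (𝟙 X.scheme) ((Category.id_comp _).trans h1)
  rw [← h4] at h
  exact qc_of_iso_of_vert (M := N) v h3 (h.of_comp hψ) hN

theorem qc_of_forall_exists (h : ∀ x : X.scheme, ∃ U : X.scheme.Opens, x ∈ U ∧ IsAffineOpen U ∧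
    QC (X.restr U.ι)) : QC X := by
  refine isQuasicoherent_of_isOpenCover
    (fun U : {U : X.scheme.Opens // IsAffineOpen U ∧ QC (X.restr U.ι)} ↦ U.1) ?_
    (fun U ↦ U.2.1) X.sheaf fun U ↦ U.2.2
  refine top_unique fun x _ ↦ ?_
  obtain ⟨U, hx, h1, h2⟩ := h x
  exact TopologicalSpace.Opens.mem_iSup.mpr ⟨⟨U, h1, h2⟩, hx⟩

theorem exists_affine_nbhds {S T : Scheme.{u}} (f : S ⟶ T) (x : S) :
    ∃ (V : T.Opens) (U : S.Opens), IsAffineOpen V ∧ IsAffineOpen U ∧ x ∈ U ∧ U ≤ f ⁻¹ᵁ V := by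
  obtain ⟨V, hV, hxV, -⟩ := TopologicalSpace.Opens.isBasis_iff_nbhd.mp T.isBasis_affineOpens
    (TopologicalSpace.Opens.mem_top (f x))
  obtain ⟨U, hU, hxU, hUV⟩ := TopologicalSpace.Opens.isBasis_iff_nbhd.mp S.isBasis_affineOpens
    (show x ∈ f ⁻¹ᵁ V from hxV)
  exact ⟨V, U, hV, hU, hxU, hUV⟩

/-- The pullback of a quasi-coherent sheaf is quasi-coherent. -/
theorem Cart.qc {φ : X ⟶ Y} (h : Cart φ) (hY : QC Y) : QC X := by
  refine qc_of_forall_exists fun x ↦ ?_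
  obtain ⟨V, U, hV, hU, hx, hUV⟩ := exists_affine_nbhds (base φ) x
  refine ⟨U, hx, hU, ?_⟩
  have : IsAffine (X.restr U.ι).scheme := hU
  have : IsAffine (Y.restr V.ι).scheme := hV
  let g : U.toScheme ⟶ V.toScheme := (base φ).resLE V U hUV
  obtain ⟨v, ⟨h1, h2⟩, -⟩ := cart_restrMap Y V.ι (X.restrMap U.ι ≫ φ) g
    (Scheme.Hom.resLE_comp_ι _ _)
  refine Cart.qc_of_isAffine (φ := v) ?_ (hY.restr V.ι)
  have := (cart_restrMap X U.ι).comp h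
  rw [← h2] at this
  exact this.of_comp (cart_restrMap Y V.ι)

theorem QC.pb (hY : QC Y) {T : Scheme.{u}} (f : T ⟶ Y.scheme) : QC (Y.pb f) :=
  (cart_pbMap Y f).qc hY

end ModScheme

end

noncomputable section

/-! ### Faithfully flat descent for sections -/

/-- The exactness of `M → S ⊗ M ⇉ S ⊗ S ⊗ M` for a faithfully flat algebra `S`: after tensoring with
`S` there is a contraction. -/
theorem exists_one_tmul_of_faithfullyFlat {R S M : Type u} [CommRing R] [CommRing S] [Algebra R S]
    [Module.FaithfullyFlat R S] [AddCommGroup M] [Module R M] (x : S ⊗[R] M)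
    (h : LinearMap.rTensor M (Algebra.TensorProduct.includeLeft (R := R) (S := R) (A := S)
        (B := S)).toLinearMap x =
      LinearMap.rTensor M (Algebra.TensorProduct.includeRight (R := R) (A := S)
        (B := S)).toLinearMap x) : ∃ m : M, 1 ⊗ₜ m = x := by
  let dL := LinearMap.rTensor M (Algebra.TensorProduct.includeLeft (R := R) (S := R) (A := S)
        (B := S)).toLinearMap
  let dR := LinearMap.rTensor M (Algebra.TensorProduct.includeRight (R := R) (A := S)
        (B := S)).toLinearMap
  let η : M →ₗ[R] S ⊗[R] M := TensorProduct.mk R S M 1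
  suffices hex : Function.Exact η (dL - dR) by
    exact (hex x).mp (by rw [LinearMap.sub_apply, sub_eq_zero]; exact h)
  rw [← Module.FaithfullyFlat.lTensor_exact_iff_exact R S]
  -- By faithful flatness exactness can be checked after tensoring with `S`, where `c` is a
  -- contraction built from the multiplication `μ`: `c ∘ (S ⊗ (dL - dR)) = (S ⊗ η) ∘ μ - id`.
  let μ : S ⊗[R] (S ⊗[R] M) →ₗ[R] S ⊗[R] M :=
    (LinearMap.rTensor M (LinearMap.mul' R S)) ∘ₗ (TensorProduct.assoc R S S M).symm.toLinearMap
  let c : S ⊗[R] ((S ⊗[R] S) ⊗[R] M) →ₗ[R] S ⊗[R] (S ⊗[R] M) :=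
    (TensorProduct.assoc R S S M).toLinearMap ∘ₗ
    LinearMap.rTensor M (LinearMap.rTensor S (LinearMap.mul' R S) ∘ₗ
      (TensorProduct.assoc R S S S).symm.toLinearMap) ∘ₗ
    (TensorProduct.assoc R S (S ⊗[R] S) M).symm.toLinearMap
  have key (z : S ⊗[R] (S ⊗[R] M)) :
      c (LinearMap.lTensor S (dL - dR) z) = LinearMap.lTensor S η (μ z) - z := by
    induction z with
    | zero => simp
    | add a b ha hb => rw [map_add, map_add, ha, hb, map_add, map_add]; abel
    | tmul s y =>
      induction y with
      | zero => simp
      | add a b ha hb =>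
        rw [TensorProduct.tmul_add, map_add, map_add, ha, hb, map_add, map_add]; abel
      | tmul a m => simp [c, μ, η, dL, dR]
  intro z
  constructor
  · intro hz
    have := key z
    rw [hz, map_zero, eq_comm, sub_eq_zero] at this
    exact ⟨_, this⟩
  · rintro ⟨w, rfl⟩
    rw [← LinearMap.comp_apply, ← LinearMap.lTensor_comp]
    have : (dL - dR) ∘ₗ η = 0 := by
      ext m
      simp [dL, dR, η]
    rw [this, LinearMap.lTensor_zero, LinearMap.zero_apply]

theorem IsBC.exists_equiv {A B : Type u} [CommRing A] [CommRing B] {f : A →+* B} {M N : Type u}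
    [AddCommGroup M] [AddCommGroup N] [Module A M] [Module B N] {l : M →ₛₗ[f] N} (h : IsBC l) :
    letI := f.toAlgebra
    ∃ e : B ⊗[A] M ≃+ N, ∀ b m, e (b ⊗ₜ m) = b • l m := by
  let := f.toAlgebra
  let : Module A N := Module.compHom N f
  have : IsScalarTower A B N := IsScalarTower.of_algebraMap_smul fun _ _ ↦ rfl
  let l' : M →ₗ[A] N := { l with map_smul' := l.map_smulₛₗ }
  have hb : IsBaseChange B l' := by
    refine IsBaseChange.of_lift_unique _ fun Q _ _ _ _ g ↦ ?_
    let : AddCommGroup Q := Module.addCommMonoidToAddCommGroup B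
    obtain ⟨k, hk, hk'⟩ := h Q (mkSemilinear f g.toAddMonoidHom fun r m ↦
      (g.map_smul r m).trans (algebraMap_smul B r (g m)).symm)
    refine ⟨k, LinearMap.ext hk, fun k' h' ↦ hk' k' fun m ↦ LinearMap.congr_fun h' m⟩
  exact ⟨hb.equiv.toAddEquiv, fun b m ↦ IsBaseChange.equiv_tmul hb b m⟩

namespace ModScheme

variable {X Y Z W : ModScheme.{u}}

/-- Compatible global sections descend uniquely along a family of morphisms. Compatibility is tested
on all cartesian morphisms to two members instead of on fibre products. -/
def SecDescent {I : Type*} {X : I → ModScheme.{u}} (κ : ∀ i, X i ⟶ Y) : Prop :=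
  ∀ x : ∀ i, Γ((X i).sheaf, ⊤),
    (∀ (i j : I) (Z : ModScheme.{u}) (a : Z ⟶ X i) (b : Z ⟶ X j), Cart a → Cart b →
      a ≫ κ i = b ≫ κ j → glob a (x i) = glob b (x j)) →
    ∃! y : Γ(Y.sheaf, ⊤), ∀ i, glob (κ i) y = x i

theorem glob_congr {a b : X ⟶ Y} (h : a = b) (m : Γ(Y.sheaf, ⊤)) : glob a m = glob b m :=
  congrArg (fun c : X ⟶ Y ↦ glob c m) h

/-- Sections of a quasi-coherent sheaf on an affine scheme descend along faithfully flat morphisms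
from affine schemes. -/
theorem secDescent_of_faithfullyFlat (κ : X ⟶ Y) (hκ : Cart κ) [IsAffine X.scheme]
    [IsAffine Y.scheme] (hX : QC X) (hY : QC Y) (hf : (base κ).appTop.hom.FaithfullyFlat) :
    SecDescent (fun _ : Unit ↦ κ) := by
  intro x hx
  let R := Γ(Y.scheme, ⊤)
  let S := Γ(X.scheme, ⊤)
  let M := Γ(Y.sheaf, ⊤)
  let f : R →+* S := (base κ).appTop.hom
  let : Algebra R S := f.toAlgebra
  have : Module.FaithfullyFlat R S := hf
  obtain ⟨e, he⟩ := (hκ.isBC hX hY).exists_equiv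
  change (S : Type u) ⊗[R] M ≃+ _ at e
  have he' (m : M) : glob κ m = e (1 ⊗ₜ m) := ((he 1 m).trans (one_smul _ _)).symm
  obtain ⟨w, hw⟩ := e.surjective (x ())
  -- Compatibility is tested on the pullback to `Spec (S ⊗ S)` along the two projections.
  let T : Type u := S ⊗[R] S
  let i₁ : S →+* T := Algebra.TensorProduct.includeLeftRingHom
  let i₂ : S →+* T := Algebra.TensorProduct.includeRight.toRingHom
  have hi (r : R) : i₁ (f r) = i₂ (f r) :=
    (Algebra.TensorProduct.includeLeft (R := R) (S := R) (A := S) (B := S)).commutes r |>.trans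
      ((Algebra.TensorProduct.includeRight (R := R) (A := S) (B := S)).commutes r).symm
  let a₀ (i : S →+* T) : Spec (.of T) ⟶ X.scheme :=
    Spec.map (CommRingCat.ofHom i) ≫ X.scheme.isoSpec.inv
  have hT (i : S →+* T) (s : S) : (Scheme.ΓSpecIso (.of T)).hom ((a₀ i).appTop s) = i s := by
    have h1 : (a₀ i).appTop = X.scheme.isoSpec.inv.appTop ≫ (Spec.map (CommRingCat.ofHom i)).appTop :=
      Scheme.Hom.comp_appTop _ _
    have h2 := Scheme.ΓSpecIso_naturality (CommRingCat.ofHom i)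
    have h3 : X.scheme.isoSpec.inv.appTop = (Scheme.ΓSpecIso S).inv := appTop_isoSpec_inv _
    have h4 : (a₀ i).appTop ≫ (Scheme.ΓSpecIso (.of T)).hom = CommRingCat.ofHom i := by
      rw [h1, h3, Category.assoc, h2]
      exact Iso.inv_hom_id_assoc (Scheme.ΓSpecIso S) _
    exact ConcreteCategory.congr_hom h4 s
  have ha₀ : a₀ i₁ ≫ base κ = a₀ i₂ ≫ base κ := by
    apply ext_of_isAffine
    rw [Scheme.Hom.comp_appTop, Scheme.Hom.comp_appTop]
    ext r
    apply (ConcreteCategory.bijective_of_isIso (Scheme.ΓSpecIso (.of T)).hom).1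
    exact (hT i₁ (f r)).trans ((hi r).trans (hT i₂ (f r)).symm)
  let Z := Y.pb (a₀ i₁ ≫ base κ)
  let a := hκ.lift (Y.pbMap (a₀ i₁ ≫ base κ)) (a₀ i₁) rfl
  let b := hκ.lift (Y.pbMap (a₀ i₁ ≫ base κ)) (a₀ i₂) ha₀.symm
  have haκ : a ≫ κ = Y.pbMap _ := Cart.lift_comp _ _ _ _
  have hbκ : b ≫ κ = Y.pbMap _ := Cart.lift_comp _ _ _ _
  have : IsAffine Z.scheme := inferInstanceAs (IsAffine (Spec (.of T)))
  have hZ : QC Z := hY.pb _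
  have hab : glob a (x ()) = glob b (x ()) :=
    hx () () Z a b (Cart.of_comp (haκ ▸ cart_pbMap _ _) hκ)
      (Cart.of_comp (hbκ ▸ cart_pbMap _ _) hκ) (haκ.trans hbκ.symm)
  let τ : Γ(Z.scheme, ⊤) →+* T := (Scheme.ΓSpecIso (.of T)).hom.hom
  let : Module Γ(Z.scheme, ⊤) (T ⊗[R] M) := Module.compHom _ τ
  -- The map `k` identifies the sections over `Spec (S ⊗ S)` with `(S ⊗ S) ⊗ M`; under it the two
  -- pullbacks of `w : S ⊗ M` become its images under the two inclusions.
  obtain ⟨k, hk, -⟩ := (cart_pbMap Y (a₀ i₁ ≫ base κ)).isBC hZ hY (T ⊗[R] M)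
    (mkSemilinear _ (TensorProduct.mk R T M 1).toAddMonoidHom fun r m ↦ by
      refine (TensorProduct.tmul_smul r (1 : T) m).trans ?_
      have h1 : (a₀ i₁ ≫ base κ).appTop r = (a₀ i₁).appTop (f r) := by
        rw [Scheme.Hom.comp_appTop]; rfl
      have h2 : τ ((a₀ i₁ ≫ base κ).appTop r) = algebraMap R T r :=
        (congrArg τ h1).trans (hT i₁ (f r))
      exact (algebraMap_smul T r _).symm.trans
        (congrArg (fun t : T ↦ t • ((1 : T) ⊗ₜ[R] m)) h2.symm))
  have hka (i : S →+* T) (c : Z ⟶ X) (hc : base c = a₀ i) (hcκ : c ≫ κ = Y.pbMap _) (s : S) (m : M) :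
      k (glob c (e (s ⊗ₜ m))) = i s ⊗ₜ m := by
    rw [he]
    refine (congrArg k (glob_smul c s _)).trans ?_
    refine (k.map_smul _ _).trans ?_
    have h1 : glob c (globₗ κ m) = globₗ (Y.pbMap (a₀ i₁ ≫ base κ)) m :=
      (glob_comp c κ m).symm.trans (glob_congr hcκ m)
    rw [h1, hk, hc]
    change τ ((a₀ i).appTop s) • ((1 : T) ⊗ₜ[R] m) = _
    have h2 : τ ((a₀ i).appTop s) = i s := hT i s
    rw [h2, TensorProduct.smul_tmul', smul_eq_mul, mul_one]
  have hka' (i : S →ₐ[R] T) (c : Z ⟶ X) (hc : base c = a₀ i.toRingHom) (hcκ : c ≫ κ = Y.pbMap _)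
      (w : S ⊗[R] M) : k (glob c (e w)) = LinearMap.rTensor M i.toLinearMap w := by
    induction w with
    | zero => simp
    | add y z hy hz => rw [map_add, map_add, map_add, map_add, hy, hz]
    | tmul s m => exact hka i.toRingHom c hc hcκ s m
  obtain ⟨m, hm⟩ := exists_one_tmul_of_faithfullyFlat w (by
    rw [← hka' Algebra.TensorProduct.includeLeft a (Cart.base_lift _ _ _ _) (Cart.lift_comp _ _ _ _),
      ← hka' Algebra.TensorProduct.includeRight b (Cart.base_lift _ _ _ _) (Cart.lift_comp _ _ _ _),
      hw, hab])
  refine ⟨m, fun _ ↦ ?_, fun m' hm' ↦ ?_⟩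
  · exact (he' m).trans ((congrArg e hm).trans hw)
  · have h1 : e ((1 : S) ⊗ₜ[R] (m' - m)) = 0 := by
      rw [← he', map_sub, hm' (), he', hm, hw, sub_self]
    have h2 := (map_eq_zero_iff e e.injective).mp h1
    exact sub_eq_zero.mp ((Module.FaithfullyFlat.one_tmul_eq_zero_iff R _ _).mp h2)

end ModScheme

end

noncomputable section

namespace ModScheme

variable {X Y Z W : ModScheme.{u}}

/-! ### The sheaf of sections -/

theorem bijective_res_opensRange (κ : X ⟶ Y) [IsOpenImmersion (base κ)] (hκ : Cart κ)
    (V : Y.scheme.Opens) (hV : V = (base κ).opensRange) (h : ⊤ ≤ base κ ⁻¹ᵁ V) :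
    Function.Bijective (res κ V ⊤ h) := by
  have h0 := (cart_iff_of_isOpenImmersion κ).mp hκ ⊤
  have h1 : V = base κ ''ᵁ ⊤ := hV.trans ((base κ).image_top_eq_opensRange).symm
  subst h1
  exact h0

/-- Zariski descent for sections: the sheaf condition of the sheaf of modules. -/
theorem secDescent_of_isOpenImmersion {I : Type u} {X : I → ModScheme.{u}} (κ : ∀ i, X i ⟶ Y)
    (hκ : ∀ i, Cart (κ i)) (ho : ∀ i, IsOpenImmersion (base (κ i)))
    (hs : ∀ y : Y.scheme, ∃ i, y ∈ Set.range (base (κ i))) : SecDescent κ := by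
  intro x hx
  let U (i : I) : Y.scheme.Opens := (base (κ i)).opensRange
  have hU (i : I) : ⊤ ≤ base (κ i) ⁻¹ᵁ U i := fun y _ ↦ ⟨y, rfl⟩
  have hb (i) := bijective_res_opensRange (κ i) (hκ i) (U i) rfl (hU i)
  choose y hy using fun i ↦ (hb i).2 (x i)
  let F : TopCat.Sheaf Ab.{u} Y.scheme := ⟨Y.sheaf.presheaf, Y.sheaf.isSheaf⟩
  obtain ⟨z, hz, hz'⟩ := F.existsUnique_gluing' U ⊤ (fun i ↦ homOfLE le_top)
    (fun y _ ↦ by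
      obtain ⟨i, hi⟩ := hs y
      exact TopologicalSpace.Opens.mem_iSup.mpr ⟨i, hi⟩)
    y (by
      intro i j
      change secRes Y.sheaf (inf_le_left : U i ⊓ U j ≤ U i) (y i) =
        secRes Y.sheaf (inf_le_right : U i ⊓ U j ≤ U j) (y j)
      have ht : ⊤ ≤ base (Y.restrMap (U i ⊓ U j).ι) ⁻¹ᵁ (U i ⊓ U j) := fun y _ ↦ y.2
      have : IsOpenImmersion (base (Y.restrMap (U i ⊓ U j).ι)) :=
        inferInstanceAs (IsOpenImmersion (U i ⊓ U j).ι)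
      have hV : U i ⊓ U j = (base (Y.restrMap (U i ⊓ U j).ι)).opensRange :=
        (Scheme.Opens.opensRange_ι _).symm
      apply (bijective_res_opensRange (Y.restrMap (U i ⊓ U j).ι) (cart_restrMap Y _) _ hV ht).1
      have key (k : I) (hk : U i ⊓ U j ≤ U k) : ∃ a : Y.restr (U i ⊓ U j).ι ⟶ X k, Cart a ∧
          a ≫ κ k = Y.restrMap (U i ⊓ U j).ι ∧ glob a (x k) =
            res (Y.restrMap (U i ⊓ U j).ι) (U i ⊓ U j) ⊤ ht (secRes Y.sheaf hk (y k)) := by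
        let a := (hκ k).lift (Y.restrMap (U i ⊓ U j).ι)
          (IsOpenImmersion.lift (base (κ k)) (U i ⊓ U j).ι (by
            rintro _ ⟨w, rfl⟩
            exact hk w.2)) (IsOpenImmersion.lift_fac _ _ _)
        have ha : a ≫ κ k = Y.restrMap (U i ⊓ U j).ι := Cart.lift_comp _ _ _ _
        refine ⟨a, Cart.of_comp (ha ▸ cart_restrMap _ _) (hκ k), ha, ?_⟩
        refine Eq.trans ?_ (Hom.res_map _ hk ht (y k)).symm
        rw [← hy k]
        refine (Hom.res_eq_sec a ⊤ _).symm.trans ?_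
        have h1 : ⊤ ≤ base (a ≫ κ k) ⁻¹ᵁ U k := by
          rw [ha]
          exact ht.trans ((base (Y.restrMap (U i ⊓ U j).ι)).preimage_mono hk)
        exact (comp_res a (κ k) (V := ⊤) h1 le_rfl (hU k) (y k)).symm.trans (res_congr ha _ _ _)
      obtain ⟨a, ca, ha, ha'⟩ := key i inf_le_left
      obtain ⟨b, cb, hb, hb'⟩ := key j inf_le_right
      exact ha'.symm.trans ((hx i j _ a b ca cb (ha.trans hb.symm)).trans hb'))
  have key (y' : Γ(Y.sheaf, ⊤)) (i : I) : secRes Y.sheaf le_top y' = y i ↔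
      glob (κ i) y' = x i := by
    rw [← hy i, ← (hb i).1.eq_iff]
    exact iff_of_eq (congrArg (· = _) ((Hom.res_map (κ i) _ _ y').trans (Hom.res_eq_sec (κ i) ⊤ y')))
  refine ⟨z, fun i ↦ (key z i).mp (hz i), fun w hw ↦ hz' w fun i ↦ (key w i).mpr (hw i)⟩

/-- The sections over `T` of the pullbacks of a sheaf along all morphisms from `T`. -/
abbrev Sec (Y : ModScheme.{u}) (T : Scheme.{u}) : Type u :=
  Σ g : T ⟶ Y.scheme, Γ((Y.pb g).sheaf, ⊤)

theorem sec_ext {T : Scheme.{u}} {g g' : T ⟶ Y.scheme} (h : g = g') {x : Γ((Y.pb g).sheaf, ⊤)}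
    {x' : Γ((Y.pb g').sheaf, ⊤)} (e : Y.pb g' ⟶ Y.pb g) (hb : base e = 𝟙 T)
    (he : e ≫ Y.pbMap g = Y.pbMap g') (hx : glob e x = x') :
    (⟨g, x⟩ : Sec Y T) = ⟨g', x'⟩ := by
  subst h
  have : e = 𝟙 _ := (cart_pbMap Y g).hom_ext hb (he.trans (Category.id_comp _).symm)
  subst this
  rw [← hx, glob_id]

/-- The transition morphism between pullbacks. -/
def pbTrans (Y : ModScheme.{u}) {T T' : Scheme.{u}} (f : T' ⟶ T) (g : T ⟶ Y.scheme)
    (g' : T' ⟶ Y.scheme) (h : f ≫ g = g') : Y.pb g' ⟶ Y.pb g :=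
  (cart_pbMap Y g).lift (Y.pbMap g') f h

@[simp] theorem base_pbTrans {T T' : Scheme.{u}} (f : T' ⟶ T) (g : T ⟶ Y.scheme)
    (g' : T' ⟶ Y.scheme) (h : f ≫ g = g') : base (Y.pbTrans f g g' h) = f :=
  Cart.base_lift _ _ _ _

theorem pbTrans_comp {T T' : Scheme.{u}} (f : T' ⟶ T) (g : T ⟶ Y.scheme)
    (g' : T' ⟶ Y.scheme) (h : f ≫ g = g') : Y.pbTrans f g g' h ≫ Y.pbMap g = Y.pbMap g' :=
  Cart.lift_comp _ _ _ _

theorem cart_pbTrans {T T' : Scheme.{u}} (f : T' ⟶ T) (g : T ⟶ Y.scheme)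
    (g' : T' ⟶ Y.scheme) (h : f ≫ g = g') : Cart (Y.pbTrans f g g' h) := by
  refine Cart.of_comp (ψ := Y.pbMap g) ?_ (cart_pbMap Y g)
  rw [pbTrans_comp]
  exact cart_pbMap Y g'

theorem pbTrans_pbTrans {T T' T'' : Scheme.{u}} (f : T' ⟶ T) (f' : T'' ⟶ T') (g : T ⟶ Y.scheme)
    (g' : T' ⟶ Y.scheme) (g'' : T'' ⟶ Y.scheme) (h : f ≫ g = g') (h' : f' ≫ g' = g'')
    (h'' : (f' ≫ f) ≫ g = g'') :
    Y.pbTrans f' g' g'' h' ≫ Y.pbTrans f g g' h = Y.pbTrans (f' ≫ f) g g'' h'' := by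
  refine (cart_pbMap Y g).hom_ext (by simp; rfl) ?_
  rw [Category.assoc, pbTrans_comp, pbTrans_comp, pbTrans_comp]

/-- The pullback of sections. -/
def secMap {T T' : Scheme.{u}} (f : T' ⟶ T) (t : Sec Y T) : Sec Y T' :=
  ⟨f ≫ t.1, glob (Y.pbTrans f t.1 _ rfl) t.2⟩

theorem secMap_id {T : Scheme.{u}} (t : Sec Y T) : secMap (𝟙 T) t = t :=
  (sec_ext (Category.id_comp _).symm (Y.pbTrans (𝟙 _) t.1 _ rfl) (base_pbTrans _ _ _ _)
    (pbTrans_comp _ _ _ _) rfl).symm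

theorem secMap_comp {T T' T'' : Scheme.{u}} (f : T' ⟶ T) (f' : T'' ⟶ T') (t : Sec Y T) :
    secMap (f' ≫ f) t = secMap f' (secMap f t) := by
  have h : 𝟙 T'' ≫ (f' ≫ f) ≫ t.1 = f' ≫ f ≫ t.1 := by simp
  refine sec_ext (Category.assoc _ _ _) (Y.pbTrans (𝟙 _) _ _ h) (base_pbTrans _ _ _ _)
    (pbTrans_comp _ _ _ _) ?_
  refine (glob_comp _ _ _).symm.trans (Eq.trans (glob_congr ?_ _) (glob_comp _ _ _))
  exact (pbTrans_pbTrans _ _ _ _ _ _ _ (by simp)).trans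
    ((pbTrans_pbTrans _ _ _ _ _ _ _ (by simp)).trans (by congr 1)).symm

/-- The presheaf of sections of all pullbacks of a sheaf. -/
def secPresheaf (Y : ModScheme.{u}) : Scheme.{u}ᵒᵖ ⥤ Type u where
  obj T := Sec Y T.unop
  map f := ↾secMap f.unop
  map_id _ := ConcreteCategory.hom_ext _ _ fun t ↦ secMap_id t
  map_comp f g := ConcreteCategory.hom_ext _ _ fun t ↦ secMap_comp f.unop g.unop t

/-- The section over `X` of the pullback of a sheaf defined by a section of an isomorphic sheaf. -/
def secMk (κ : X ⟶ Y) (hκ : Cart κ) (x : Γ(X.sheaf, ⊤)) : Y.secPresheaf.obj (.op X.scheme) :=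
  ⟨base κ, glob (hκ.lift (Y.pbMap (base κ)) (𝟙 _) (Category.id_comp _)) x⟩

theorem secMk_congr {κ κ' : X ⟶ Y} (h : κ = κ') (hκ : Cart κ) (hκ' : Cart κ') (x : Γ(X.sheaf, ⊤)) :
    secMk κ hκ x = secMk κ' hκ' x := by
  subst h
  rfl

theorem secMk_injective (κ : X ⟶ Y) (hκ : Cart κ) : Function.Injective (secMk κ hκ) := by
  intro x y h
  have h1 := eq_of_heq (Sigma.mk.inj h).2
  let l := hκ.lift (Y.pbMap (base κ)) (𝟙 _) (Category.id_comp _)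
  have hb : base l = 𝟙 _ := Cart.base_lift _ _ _ _
  have hl : l ≫ κ = Y.pbMap (base κ) := Cart.lift_comp _ _ _ _
  let l' := (cart_pbMap Y (base κ)).lift κ (𝟙 _) (Category.id_comp _)
  have hb' : base l' = 𝟙 _ := Cart.base_lift _ _ _ _
  have hl' : l' ≫ Y.pbMap (base κ) = κ := Cart.lift_comp _ _ _ _
  have h2 : l' ≫ l = 𝟙 _ := by
    refine hκ.hom_ext ?_ ?_
    · rw [base_comp, hb, hb']
      exact Category.id_comp _
    · rw [Category.assoc, hl, hl', Category.id_comp]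
  have h3 (x : Γ(X.sheaf, ⊤)) : glob l' (glob l x) = x :=
    (glob_comp l' l x).symm.trans (glob_congr h2 x)
  rw [← h3 x, ← h3 y]
  exact congrArg (glob l') h1

theorem map_secMk (κ : X ⟶ Y) (hκ : Cart κ) (χ : Z ⟶ X) (hχ : Cart χ) (x : Γ(X.sheaf, ⊤)) :
    Y.secPresheaf.map (base χ).op (secMk κ hκ x) = secMk (χ ≫ κ) (hχ.comp hκ) (glob χ x) := by
  let b : Z.scheme ⟶ X.scheme := base χ
  let p : Y.pb (b ≫ base κ) ⟶ Y.pb (base κ) := Y.pbTrans b (base κ) _ rfl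
  let l := hκ.lift (Y.pbMap (base κ)) (𝟙 _) (Category.id_comp _)
  have hl : base l = 𝟙 X.scheme := Cart.base_lift _ _ _ _
  let l' : Y.pb (b ≫ base κ) ⟶ Z := (hχ.comp hκ).lift (Y.pbMap (base (χ ≫ κ))) (𝟙 _)
    (Category.id_comp _)
  have hl' : base l' = 𝟙 Z.scheme := Cart.base_lift _ _ _ _
  have hp : base p = b := base_pbTrans _ _ _ _
  have e : p ≫ l = l' ≫ χ := by
    refine hκ.hom_ext ?_ ?_
    · rw [base_comp, base_comp, hl, hl', hp]
      exact (Category.comp_id b).trans (Category.id_comp b).symm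
    · rw [Category.assoc, Category.assoc]
      refine (congrArg (p ≫ ·) (Cart.lift_comp hκ _ _ _)).trans ?_
      exact (pbTrans_comp (Y := Y) b (base κ) _ rfl).trans (Cart.lift_comp _ _ _ _).symm
  refine congrArg (Sigma.mk (b ≫ base κ)) ?_
  exact (glob_comp p l x).symm.trans ((glob_congr e x).trans (glob_comp l' χ x))

theorem exists_secMk {T : Scheme.{u}} (t : Y.secPresheaf.obj (.op T))
    {g : T ⟶ Y.scheme}
    (h : t.1 = g) : ∃ x : Γ((Y.pb g).sheaf, ⊤), secMk (Y.pbMap g) (cart_pbMap Y g) x = t := by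
  obtain ⟨g', x⟩ := t
  dsimp only at h
  subst h
  refine ⟨x, sec_ext rfl (𝟙 _) rfl (Category.id_comp _) ?_⟩
  refine (glob_id _).trans ((glob_congr ?_ x).trans (glob_id x))
  exact (cart_pbMap Y g').hom_ext (Cart.base_lift _ _ _ _)
    ((Cart.lift_comp _ _ _ _).trans (Category.id_comp _).symm)

/-- The scheme itself satisfies the sheaf condition, so a compatible family of pairs has a common
underlying morphism, and the condition reduces to descent for sections. -/
theorem isSheafFor_secPresheaf {T : Scheme.{u}} {I : Type*} {U : I → Scheme.{u}} (f : ∀ i, U i ⟶ T)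
    (hT : (Presieve.ofArrows U f).IsSheafFor (yoneda.obj Y.scheme))
    (h : ∀ g : T ⟶ Y.scheme, SecDescent fun i ↦ Y.pbTrans (f i) g _ rfl) :
    (Presieve.ofArrows U f).IsSheafFor Y.secPresheaf := by
  rw [Presieve.isSheafFor_arrows_iff] at hT ⊢
  intro t ht
  obtain ⟨g, hg, hg'⟩ := hT (fun i ↦ (t i).1) fun i j Z a b w ↦ congrArg Sigma.fst (ht i j Z a b w)
  choose x hx using fun i ↦ exists_secMk (t i) (g := f i ≫ g) (hg i).symm
  have hm (y : Γ((Y.pb g).sheaf, ⊤)) (i) :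
      Y.secPresheaf.map (f i).op (secMk (Y.pbMap g) (cart_pbMap Y g) y) =
        secMk (Y.pbMap (f i ≫ g)) (cart_pbMap _ _) (glob (Y.pbTrans (f i) g _ rfl) y) := by
    have h1 := map_secMk (Y.pbMap g) (cart_pbMap Y g) (Y.pbTrans (f i) g _ rfl)
      (cart_pbTrans _ _ _ _) y
    rw [base_pbTrans] at h1
    exact h1.trans (secMk_congr (pbTrans_comp _ _ _ _) _ _ _)
  obtain ⟨y, hy, hy'⟩ := h g x fun i j Z a b ha hb w ↦ by
    have h1 := ht i j Z.scheme (base a) (base b) (by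
      have := congrArg base w
      rw [base_comp, base_comp, base_pbTrans, base_pbTrans] at this
      exact this)
    rw [← hx, ← hx] at h1
    have h2 := (map_secMk _ (cart_pbMap _ _) a ha (x i)).symm.trans
      (h1.trans (map_secMk _ (cart_pbMap _ _) b hb (x j)))
    have h3 : a ≫ Y.pbMap (f i ≫ g) = b ≫ Y.pbMap (f j ≫ g) := by
      rw [← pbTrans_comp (f i) g _ rfl, ← pbTrans_comp (f j) g _ rfl, ← Category.assoc, w,
        Category.assoc]
    exact secMk_injective _ _ (h2.trans (secMk_congr h3.symm _ _ _))
  refine ⟨secMk (Y.pbMap g) (cart_pbMap _ _) y, fun i ↦ ?_, fun s hs ↦ ?_⟩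
  · rw [hm, hy, hx]
  · obtain ⟨z, rfl⟩ := exists_secMk s (hg' s.1 fun i ↦ congrArg Sigma.fst (hs i))
    refine congrArg _ (hy' z fun i ↦ secMk_injective _ (cart_pbMap _ _) ?_)
    rw [← hm, hs, hx]

/-- Conversely the sheaf condition for `secPresheaf` gives descent for sections. -/
theorem secDescent_of_isSheafFor {I : Type*} {X : I → ModScheme.{u}} (κ : ∀ i, X i ⟶ Y)
    (hκ : ∀ i, Cart (κ i))
    (hT : (Presieve.ofArrows (fun i ↦ (X i).scheme) fun i ↦ base (κ i)).IsSheafFor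
      (yoneda.obj Y.scheme))
    (h : (Presieve.ofArrows (fun i ↦ (X i).scheme) fun i ↦ base (κ i)).IsSheafFor Y.secPresheaf) :
    SecDescent κ := by
  rw [Presieve.isSheafFor_arrows_iff] at hT h
  intro x hx
  obtain ⟨t, ht, ht'⟩ := h (fun i ↦ secMk (κ i) (hκ i) (x i)) fun i j T a b w ↦ by
    let a' := (hκ i).lift (Y.pbMap (a ≫ base (κ i))) a rfl
    let b' := (hκ j).lift (Y.pbMap (a ≫ base (κ i))) b w.symm
    have ha : base a' = a := Cart.base_lift _ _ _ _
    have hb : base b' = b := Cart.base_lift _ _ _ _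
    have ha' : a' ≫ κ i = Y.pbMap _ := Cart.lift_comp _ _ _ _
    have hb' : b' ≫ κ j = Y.pbMap _ := Cart.lift_comp _ _ _ _
    have ca : Cart a' := Cart.of_comp (ha' ▸ cart_pbMap _ _) (hκ i)
    have cb : Cart b' := Cart.of_comp (hb' ▸ cart_pbMap _ _) (hκ j)
    have h1 := map_secMk (κ i) (hκ i) a' ca (x i)
    have h2 := map_secMk (κ j) (hκ j) b' cb (x j)
    rw [ha] at h1
    rw [hb] at h2
    refine h1.trans (Eq.trans ?_ h2.symm)
    rw [hx i j _ a' b' ca cb (ha'.trans hb'.symm)]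
    exact secMk_congr (ha'.trans hb'.symm) _ _ _
  obtain ⟨_, -, huniq⟩ := hT (fun i ↦ base (κ i)) fun i j Z a b w ↦ w
  have ht1 : t.1 = 𝟙 _ := (huniq t.1 fun i ↦ congrArg Sigma.fst (ht i)).trans
    (huniq (𝟙 Y.scheme) fun i ↦ Category.comp_id (base (κ i))).symm
  have hm (y : Γ(Y.sheaf, ⊤)) (i) :
      Y.secPresheaf.map (base (κ i)).op (secMk (𝟙 Y) (Cart.of_isIso _) y) =
        secMk (κ i) (hκ i) (glob (κ i) y) :=
    (map_secMk (𝟙 Y) (Cart.of_isIso _) (κ i) (hκ i) y).trans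
      (secMk_congr (Category.comp_id _) _ _ _)
  obtain ⟨z, hz⟩ := exists_secMk t ht1
  obtain ⟨z', hz'⟩ : ∃ z', secMk (𝟙 Y) (Cart.of_isIso _) z' = t := by
    let l := (cart_pbMap Y (𝟙 _)).lift (𝟙 Y) (𝟙 _) (Category.comp_id _)
    have hl : l ≫ Y.pbMap (𝟙 _) = 𝟙 Y := Cart.lift_comp _ _ _ _
    have hlb : base l = 𝟙 _ := Cart.base_lift _ _ _ _
    have cl : Cart l := Cart.of_comp (hl ▸ Cart.of_isIso _) (cart_pbMap _ _)
    have h1 := map_secMk (Y.pbMap (𝟙 _)) (cart_pbMap Y (𝟙 _)) l cl z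
    refine ⟨glob l z, ?_⟩
    rw [← hz]
    refine (secMk_congr hl.symm _ _ _).trans (h1.symm.trans ?_)
    rw [hlb]
    exact congrFun (congrArg (fun k : Y.secPresheaf.obj (.op Y.scheme) ⟶ _ ↦ (k : _ → _))
      (Y.secPresheaf.map_id (.op Y.scheme))) _
  refine ⟨z', fun i ↦ secMk_injective (κ i) (hκ i) ?_, fun y hy ↦
    secMk_injective (𝟙 Y) (Cart.of_isIso _) ?_⟩
  · rw [← hm, hz', ht]
  · exact ((ht' _ fun i ↦ (hm y i).trans (by rw [hy])).trans hz'.symm)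

/-- The presheaf of sections is even a sheaf for the fpqc topology. As that topology is generated by
Zariski coverings and faithfully flat morphisms of affine schemes, the two special cases of descent
suffice; the presheaf on all schemes serves to pass from these to general étale coverings. -/
theorem isSheaf_secPresheaf (hY : QC Y) :
    Presieve.IsSheaf Scheme.etaleTopology Y.secPresheaf := by
  have hle : Scheme.etaleTopology.{u} ≤ Scheme.fpqcTopology :=
    Scheme.etaleTopology_le_proetaleTopology.trans Scheme.proetaleTopology_le_fpqcTopology
  refine Presieve.isSheaf_of_le _ hle ?_
  have hsub (S : Scheme.{u}) : Presieve.IsSheaf Scheme.fpqcTopology (yoneda.obj S) :=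
    GrothendieckTopology.Subcanonical.isSheaf_of_isRepresentable _
  have : IsZariskiLocalAtSource (@Flat : MorphismProperty Scheme.{u}) :=
    HasRingHomProperty.instIsZariskiLocalAtSource (Q := RingHom.Flat)
  refine (isSheaf_type_propQCTopology_iff (P := @Flat.{u}) Y.secPresheaf).mpr
    ⟨?_, fun {R S} f hf hs ↦ ?_⟩
  · refine (Precoverage.isSheaf_toGrothendieck_iff_of_isStableUnderBaseChange_of_small.{u}
      (J := Scheme.precoverage @IsOpenImmersion) _).mpr fun T E ↦ ?_
    refine isSheafFor_secPresheaf (fun i ↦ E.f i) ?_ fun g ↦ ?_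
    · exact (Presieve.isSheafFor_iff_generate _).mpr
        (GrothendieckTopology.Subcanonical.isSheaf_of_isRepresentable
        (J := Scheme.zariskiTopology) (yoneda.obj Y.scheme) _
          (Precoverage.generate_mem_toGrothendieck E.mem₀))
    · have hE := Scheme.ofArrows_mem_precoverage_iff (P := @IsOpenImmersion) |>.mp E.mem₀
      refine secDescent_of_isOpenImmersion _ (fun i ↦ cart_pbTrans _ _ _ _) (fun i ↦ ?_) fun y ↦ ?_
      · rw [base_pbTrans]
        exact hE.2 i
      · obtain ⟨i, hi⟩ := hE.1 y
        refine ⟨i, ?_⟩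
        rw [base_pbTrans]
        exact hi
  · rw [← Presieve.ofArrows_pUnit.{0}]
    refine isSheafFor_secPresheaf (fun _ : PUnit ↦ Spec.map f) ?_ fun g ↦ ?_
    · rw [Presieve.ofArrows_pUnit.{0}]
      exact ((isSheaf_type_propQCTopology_iff (P := @Flat.{u}) _).mp (hsub Y.scheme)).2 f hf hs
    · have : IsAffine (Y.pb (Spec.map f ≫ g)).scheme := inferInstanceAs (IsAffine (Spec S))
      have : IsAffine (Y.pb g).scheme := inferInstanceAs (IsAffine (Spec R))
      refine secDescent_of_faithfullyFlat _ (cart_pbTrans _ _ _ _) (hY.pb _) (hY.pb _) ?_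
      rw [base_pbTrans]
      exact (Flat.flat_and_surjective_iff_faithfullyFlat_of_isAffine _).mp ⟨hf, hs⟩

/-- A family of morphisms whose underlying morphisms cover the target in the étale topology. -/
def EtaleCovering {I : Type*} {X : I → ModScheme.{u}} (κ : ∀ i, X i ⟶ Y) : Prop :=
  Sieve.ofArrows (fun i ↦ (X i).scheme) (fun i ↦ base (κ i)) ∈ Scheme.etaleTopology Y.scheme

/-- Étale descent for the sections of quasi-coherent sheaves. -/
theorem EtaleCovering.secDescent {I : Type*} {X : I → ModScheme.{u}} {κ : ∀ i, X i ⟶ Y}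
    (h : EtaleCovering κ) (hκ : ∀ i, Cart (κ i)) (hY : QC Y) : SecDescent κ := by
  have hsub : Presieve.IsSheaf Scheme.etaleTopology (yoneda.obj Y.scheme) :=
    Presieve.isSheaf_of_le _ (Scheme.etaleTopology_le_proetaleTopology.trans
      Scheme.proetaleTopology_le_fpqcTopology)
      (GrothendieckTopology.Subcanonical.isSheaf_of_isRepresentable (J := Scheme.fpqcTopology) _)
  exact secDescent_of_isSheafFor κ hκ
    ((Presieve.isSheafFor_iff_generate _).mpr (hsub _ h))
    ((Presieve.isSheafFor_iff_generate _).mpr (isSheaf_secPresheaf hY _ h))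

/-- The restriction of a morphism to an open subscheme of the target. -/
def restrHom (κ : X ⟶ Y) (V : Y.scheme.Opens) :
    X.restr (base κ ⁻¹ᵁ V).ι ⟶ Y.restr V.ι :=
  (cart_restrMap Y V.ι).lift (X.restrMap (base κ ⁻¹ᵁ V).ι ≫ κ) (base κ ∣_ V)
    (morphismRestrict_ι _ _)

theorem base_restrHom (κ : X ⟶ Y) (V : Y.scheme.Opens) : base (restrHom κ V) = base κ ∣_ V :=
  Cart.base_lift _ _ _ _

theorem restrHom_comp (κ : X ⟶ Y) (V : Y.scheme.Opens) :
    restrHom κ V ≫ Y.restrMap V.ι = X.restrMap (base κ ⁻¹ᵁ V).ι ≫ κ :=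
  Cart.lift_comp _ _ _ _

theorem Cart.restrHom {κ : X ⟶ Y} (h : Cart κ) (V : Y.scheme.Opens) : Cart (restrHom κ V) := by
  refine Cart.of_comp (ψ := Y.restrMap V.ι) ?_ (cart_restrMap _ _)
  rw [restrHom_comp]
  exact (cart_restrMap _ _).comp h

theorem EtaleCovering.restrHom {I : Type*} {X : I → ModScheme.{u}} {κ : ∀ i, X i ⟶ Y}
    (h : EtaleCovering κ) (V : Y.scheme.Opens) : EtaleCovering fun i ↦ restrHom (κ i) V := by
  refine Scheme.etaleTopology.superset_covering ?_ (Scheme.etaleTopology.pullback_stable V.ι h)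
  intro T f hf
  obtain ⟨_, a, _, ⟨i⟩, w⟩ := hf
  let b : T ⟶ (base (κ i) ⁻¹ᵁ V).toScheme := IsOpenImmersion.lift (base (κ i) ⁻¹ᵁ V).ι a (by
    rintro _ ⟨t, rfl⟩
    have h1 : base (κ i) (a t) = V.ι (f t) := congrArg (fun g : T ⟶ _ ↦ g t) w
    have h2 : a t ∈ base (κ i) ⁻¹ᵁ V := by
      change base (κ i) (a t) ∈ V
      rw [h1]
      exact (f t).2
    exact (Scheme.Opens.range_ι (base (κ i) ⁻¹ᵁ V)).ge h2)
  have hb : b ≫ (base (κ i) ⁻¹ᵁ V).ι = a := IsOpenImmersion.lift_fac _ _ _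
  refine ⟨_, b, _, ⟨i⟩, ?_⟩
  refine (congrArg (b ≫ ·) (base_restrHom (κ i) V)).trans ?_
  refine (cancel_mono V.ι).mp ((Category.assoc _ _ _).trans ?_)
  exact (congrArg (b ≫ ·) (morphismRestrict_ι _ _)).trans ((Category.assoc _ _ _).symm.trans
    ((congrArg (· ≫ base (κ i)) hb).trans w))

end ModScheme

end

noncomputable section

namespace ModScheme

variable {X Y Z W : ModScheme.{u}}

/-! ### Descent of morphisms -/

theorem glob_res (a : Z ⟶ X) (κ : X ⟶ Y) (V : Y.scheme.Opens) (h : ⊤ ≤ base κ ⁻¹ᵁ V)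
    (h' : ⊤ ≤ base (a ≫ κ) ⁻¹ᵁ V) (y : Γ(Y.sheaf, V)) :
    glob a (res κ V ⊤ h y) = res (a ≫ κ) V ⊤ h' y :=
  (Hom.res_eq_sec a ⊤ _).symm.trans (comp_res a κ h' le_rfl h y).symm

/-- Descent for the sections over an open subset, by restricting the covering to it. -/
theorem EtaleCovering.existsUnique_res {I : Type*} {X : I → ModScheme.{u}} {κ : ∀ i, X i ⟶ Y}
    (h : EtaleCovering κ) (hκ : ∀ i, Cart (κ i)) (hY : QC Y) (V : Y.scheme.Opens)
    (x : ∀ i, Γ((X i).sheaf, base (κ i) ⁻¹ᵁ V))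
    (hx : ∀ (i j : I) (Z : ModScheme.{u}) (a : Z ⟶ X i) (b : Z ⟶ X j), Cart a → Cart b →
      a ≫ κ i = b ≫ κ j → ∀ (U : Z.scheme.Opens) (ha : U ≤ base a ⁻¹ᵁ (base (κ i) ⁻¹ᵁ V))
        (hb : U ≤ base b ⁻¹ᵁ (base (κ j) ⁻¹ᵁ V)), res a _ U ha (x i) = res b _ U hb (x j)) :
    ∃! y : Γ(Y.sheaf, V), ∀ i, res (κ i) V _ le_rfl y = x i := by
  have ht {S : ModScheme.{u}} (U : S.scheme.Opens) : ⊤ ≤ base (S.restrMap U.ι) ⁻¹ᵁ U :=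
    fun y _ ↦ y.2
  have hbij {S : ModScheme.{u}} (U : S.scheme.Opens) :
      Function.Bijective (res (S.restrMap U.ι) U ⊤ (ht U)) := by
    have : IsOpenImmersion (base (S.restrMap U.ι)) := inferInstanceAs (IsOpenImmersion U.ι)
    exact bijective_res_opensRange (S.restrMap U.ι) (cart_restrMap S _) _
      (Scheme.Opens.opensRange_ι _).symm (ht U)
  have hglob (y : Γ(Y.sheaf, V)) (i : I) :
      glob (ModScheme.restrHom (κ i) V) (res (Y.restrMap V.ι) V ⊤ (ht V) y) =
        res ((X i).restrMap _) _ ⊤ (ht _) (res (κ i) V _ le_rfl y) := by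
    have h1 : ⊤ ≤ base (ModScheme.restrHom (κ i) V ≫ Y.restrMap V.ι) ⁻¹ᵁ V := by
      rw [restrHom_comp]
      exact ht (base (κ i) ⁻¹ᵁ V)
    refine (glob_res _ _ _ _ h1 y).trans ((res_congr (restrHom_comp _ _) V h1 y).trans ?_)
    exact comp_res _ _ _ _ _ _
  have key (y : Γ(Y.sheaf, V)) (i : I) : res (κ i) V _ le_rfl y = x i ↔
      glob (ModScheme.restrHom (κ i) V) (res (Y.restrMap V.ι) V ⊤ (ht V) y) =
        res ((X i).restrMap _) _ ⊤ (ht _) (x i) := by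
    rw [hglob, (hbij _).1.eq_iff]
  obtain ⟨y', hy, hy'⟩ := (h.restrHom V).secDescent (fun i ↦ (hκ i).restrHom V) (hY.restr V.ι)
    (fun i ↦ res ((X i).restrMap _) _ ⊤ (ht _) (x i)) fun i j Z a b ha hb w ↦ by
      have h1 {k : I} (c : Z ⟶ (X k).restr (base (κ k) ⁻¹ᵁ V).ι) :
          ⊤ ≤ base (c ≫ (X k).restrMap (base (κ k) ⁻¹ᵁ V).ι) ⁻¹ᵁ (base (κ k) ⁻¹ᵁ V) :=
        (base c).preimage_mono (ht _)
      refine (glob_res _ _ _ _ (h1 a) _).trans (Eq.trans ?_ (glob_res _ _ _ _ (h1 b) _).symm)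
      refine hx i j Z _ _ (ha.comp (cart_restrMap _ _)) (hb.comp (cart_restrMap _ _)) ?_ _ _ _
      rw [Category.assoc, Category.assoc, ← restrHom_comp, ← restrHom_comp, ← Category.assoc, w,
        Category.assoc]
  obtain ⟨y, rfl⟩ := (hbij V).2 y'
  exact ⟨y, fun i ↦ (key y i).mpr (hy i), fun z hz ↦ (hbij V).1 (hy' _ fun i ↦ (key z i).mp (hz i))⟩

/-- A morphism is given by its action on sections. -/
theorem exists_hom (f : X.scheme ⟶ Y.scheme)
    (l : ∀ V : Y.scheme.Opens, Γ(Y.sheaf, V) →+ Γ(X.sheaf, f ⁻¹ᵁ V))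
    (hl : ∀ (V W : Y.scheme.Opens) (h : V ≤ W) (m : Γ(Y.sheaf, W)),
      l V (secRes Y.sheaf h m) = secRes X.sheaf (f.preimage_mono h) (l W m))
    (hs : ∀ (V : Y.scheme.Opens) (r : Γ(Y.scheme, V)) (m : Γ(Y.sheaf, V)),
      l V (r • m) = f.app V r • l V m) :
    ∃ (φ : X ⟶ Y) (hb : base φ = f), ∀ V m, res φ V (f ⁻¹ᵁ V) (by rw [hb]) m = l V m := by
  let N : Y.scheme.Modules := (Scheme.Modules.pushforward f).obj X.sheaf
  let a : Y.sheaf.presheaf ⟶ N.presheaf :=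
    { app V := AddCommGrpCat.ofHom (l V.unop)
      naturality V W i := by
        refine ConcreteCategory.hom_ext _ _ fun m ↦ ?_
        exact hl W.unop V.unop i.unop.le m }
  let b : Y.sheaf ⟶ N := ⟨PresheafOfModules.homMk a fun V r m ↦ hs V.unop r m⟩
  exact ⟨⟨f, b⟩, rfl, fun V m ↦ Hom.res_eq_sec (⟨f, b⟩ : Hom X Y) V m⟩

/-- Morphisms on the members of a covering that agree wherever they can be compared. -/
def Compatible {I : Type*} {X : I → ModScheme.{u}} (κ : ∀ i, X i ⟶ Y) (σ : ∀ i, X i ⟶ W) : Prop :=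
  ∀ (i j : I) (Z : ModScheme.{u}) (a : Z ⟶ X i) (b : Z ⟶ X j), Cart a → Cart b →
    a ≫ κ i = b ≫ κ j → a ≫ σ i = b ≫ σ j

theorem res_smul (φ : X ⟶ Y) {V : Y.scheme.Opens} {U : X.scheme.Opens} (h : U ≤ base φ ⁻¹ᵁ V)
    (r : Γ(Y.scheme, V)) (m : Γ(Y.sheaf, V)) :
    res φ V U h (r • m) = (base φ).appLE V U h r • res φ V U h m := Hom.res_smul φ h r m

theorem appLE_of_eq_comp {S T T' : Scheme.{u}} {f : S ⟶ T} {k : S ⟶ T'} {g : T' ⟶ T}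
    (hf : f = k ≫ g) (V : T.Opens) (U : S.Opens) (h : U ≤ f ⁻¹ᵁ V) (h' : U ≤ k ⁻¹ᵁ (g ⁻¹ᵁ V))
    (r : Γ(T, V)) : f.appLE V U h r = k.appLE (g ⁻¹ᵁ V) U h' (g.app V r) := by
  subst hf
  rw [Scheme.Hom.comp_appLE]
  rfl

theorem EtaleCovering.hom_ext {I : Type*} {X : I → ModScheme.{u}} {κ : ∀ i, X i ⟶ Y}
    (h : EtaleCovering κ) (hκ : ∀ i, Cart (κ i)) (hY : QC Y) {s t : Y ⟶ W} (hb : base s = base t)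
    (hst : ∀ i, κ i ≫ s = κ i ≫ t) : s = t := by
  refine ModScheme.hom_ext hb fun V m ↦ ?_
  refine (h.existsUnique_res hκ hY (base s ⁻¹ᵁ V)
    (fun i ↦ res (κ i ≫ s) V (base (κ i) ⁻¹ᵁ (base s ⁻¹ᵁ V)) le_rfl m) ?_).unique
    (fun i ↦ (comp_res (κ i) s _ _ _ m).symm) (fun i ↦ ?_)
  · intro i j Z a b ha hb w U h1 h2
    have w' : a ≫ κ i ≫ s = b ≫ κ j ≫ s := by rw [← Category.assoc, w, Category.assoc]
    exact (comp_res a (κ i ≫ s) (W := V) h1 h1 le_rfl m).symm.trans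
      ((res_congr w' V _ m).trans (comp_res b (κ j ≫ s) h2 h2 le_rfl m))
  · refine (comp_res (κ i) t (W := V) (V := base s ⁻¹ᵁ V) ?_ le_rfl (by rw [hb]) m).symm.trans
      (res_congr (hst i).symm V _ m)
    rw [← hst]
    exact le_rfl

/-- Étale descent for morphisms out of a quasi-coherent sheaf. -/
theorem EtaleCovering.existsUnique_hom {I : Type*} {X : I → ModScheme.{u}} {κ : ∀ i, X i ⟶ Y}
    (h : EtaleCovering κ) (hκ : ∀ i, Cart (κ i)) (hY : QC Y) (σ : ∀ i, X i ⟶ W)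
    (g : Y.scheme ⟶ W.scheme) (hσ : ∀ i, base (σ i) = base (κ i) ≫ g) (hc : Compatible κ σ) :
    ∃! s : Y ⟶ W, base s = g ∧ ∀ i, κ i ≫ s = σ i := by
  have hle (i : I) (V : W.scheme.Opens) : base (κ i) ⁻¹ᵁ (g ⁻¹ᵁ V) ≤ base (σ i) ⁻¹ᵁ V := by
    rw [hσ]; rfl
  have H (V : W.scheme.Opens) (m : Γ(W.sheaf, V)) := h.existsUnique_res hκ hY (g ⁻¹ᵁ V)
    (fun i ↦ res (σ i) V (base (κ i) ⁻¹ᵁ (g ⁻¹ᵁ V)) (hle i V) m) (by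
      intro i j Z a b ha hb w U h1 h2
      have h3 : U ≤ base (a ≫ σ i) ⁻¹ᵁ V := h1.trans ((base a).preimage_mono (hle i V))
      have h4 : U ≤ base (b ≫ σ j) ⁻¹ᵁ V := h2.trans ((base b).preimage_mono (hle j V))
      exact (comp_res a (σ i) h3 h1 (hle i V) m).symm.trans
        ((res_congr (hc i j Z a b ha hb w) V _ m).trans (comp_res b (σ j) h4 h2 (hle j V) m)))
  -- The descended sections depend additively, semilinearly and functorially on `m` and `V` by
  -- uniqueness.
  choose l hl hl' using fun V m ↦ H V m
  dsimp only at hl hl'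
  obtain ⟨s, hb, hs⟩ := exists_hom (X := Y) (Y := W) g
    (fun V ↦ { toFun := l V
               map_zero' := (hl' V 0 0 fun i ↦ by rw [map_zero, map_zero]).symm
               map_add' := fun m n ↦ (hl' V (m + n) _ fun i ↦ by
                rw [map_add, map_add, hl, hl]).symm })
    (fun V V' hV m ↦ (hl' V _ _ fun i ↦ by
      refine (Hom.res_map (κ i) _ _ _).trans (Eq.trans ?_ (Hom.res_map (σ i) _ _ _).symm)
      refine Eq.trans ?_ (Hom.map_res (σ i) (U := base (κ i) ⁻¹ᵁ (g ⁻¹ᵁ V')) (hle i V')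
        ((base (κ i)).preimage_mono (g.preimage_mono hV)) m)
      refine Eq.trans ?_ (congrArg _ (hl V' m i))
      exact (Hom.map_res (κ i) _ _ _).symm).symm)
    (fun V r m ↦ (hl' V _ _ fun i ↦ by
      refine (res_smul (κ i) _ _ _).trans (Eq.trans ?_ (res_smul (σ i) _ _ _).symm)
      exact congrArg₂ (fun (t : Γ((X i).scheme, base (κ i) ⁻¹ᵁ (g ⁻¹ᵁ V))) n ↦ t • n)
        (appLE_of_eq_comp (hσ i) V _ _ _ r).symm (hl V m i)).symm)
  have hs' (i : I) : κ i ≫ s = σ i := by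
    refine ModScheme.hom_ext ?_ fun V m ↦ ?_
    · rw [hσ, base_comp, hb]
    · have h1 : base (κ i ≫ s) ⁻¹ᵁ V = base (κ i) ⁻¹ᵁ (g ⁻¹ᵁ V) := by rw [base_comp, hb]; rfl
      have h2 : g ⁻¹ᵁ V ≤ base s ⁻¹ᵁ V := by rw [hb]
      have h3 := (comp_res (κ i) s (W := V) h1.ge le_rfl h2 m).trans
        ((congrArg _ (hs V m)).trans (hl V m i))
      have h4 := congrArg (secRes (X i).sheaf h1.le) h3
      exact (Hom.map_res _ _ _ _).symm.trans (h4.trans (Hom.map_res _ _ _ _))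
  refine ⟨s, ⟨hb, hs'⟩, fun t ht ↦ ?_⟩
  exact h.hom_ext hκ hY (ht.1.trans hb.symm) fun i ↦ (ht.2 i).trans (hs' i).symm

/-- Being cartesian can be tested on an étale covering. -/
theorem EtaleCovering.cart {I : Type*} {X : I → ModScheme.{u}} {κ : ∀ i, X i ⟶ Y}
    (h : EtaleCovering κ) (hκ : ∀ i, Cart (κ i)) (hY : QC Y) (hW : QC W) (v : Y ⟶ W)
    (hv : ∀ i, Cart (κ i ≫ v)) : Cart v := by
  -- The morphism `w` to the pullback of `W` is over the identity; its inverse is obtained by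
  -- descending the `κ i` along the covering `κ i ≫ w`.
  let P := W.pb (base v)
  let w : Y ⟶ P := (cart_pbMap W (base v)).lift v (𝟙 _) (Category.id_comp _)
  have hwb : base w = 𝟙 Y.scheme := Cart.base_lift _ _ _ _
  have hw : w ≫ W.pbMap (base v) = v := Cart.lift_comp _ _ _ _
  have hκw (i) : Cart (κ i ≫ w) := by
    refine Cart.of_comp (ψ := W.pbMap (base v)) ?_ (cart_pbMap _ _)
    rw [Category.assoc, hw]
    exact hv i
  have hbase (i) : base (κ i ≫ w) = base (κ i) := by
    rw [base_comp, hwb]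
    exact Category.comp_id _
  have hcov : EtaleCovering fun i ↦ κ i ≫ w := by
    unfold EtaleCovering
    have : (fun i ↦ base (κ i ≫ w)) = fun i ↦ base (κ i) := funext hbase
    have h1 : Sieve.ofArrows (fun i ↦ (X i).scheme) (fun i ↦ base (κ i ≫ w)) =
      Sieve.ofArrows (fun i ↦ (X i).scheme) (fun i ↦ base (κ i)) := congrArg _ this
    exact h1 ▸ h
  obtain ⟨s, ⟨hs, hs'⟩, -⟩ := hcov.existsUnique_hom hκw (hW.pb _) κ (𝟙 Y.scheme)
    (fun i ↦ (hbase i).symm.trans (Category.comp_id _).symm) (by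
      intro i j Z a b ha hb e
      have e : a ≫ κ i ≫ w = b ≫ κ j ≫ w := e
      have h1 : base (a ≫ κ i) = base (b ≫ κ j) :=
        (congrArg (base a ≫ ·) (hbase i)).symm.trans
          ((congrArg base e).trans (congrArg (base b ≫ ·) (hbase j)))
      -- Compatibility of the `κ i` over `P`: the comparison `c` of `a ≫ κ i` with `b ≫ κ j` is the
      -- identity, since it is so after composition with `w`.
      let c := (hb.comp (hκ j)).lift (a ≫ κ i) (𝟙 _) ((Category.id_comp _).trans h1.symm)
      have hc : base c = 𝟙 _ := Cart.base_lift _ _ _ _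
      have hc' : c ≫ b ≫ κ j = a ≫ κ i := Cart.lift_comp _ _ _ _
      have h2 : c = 𝟙 Z := by
        refine (hb.comp (hκw j)).hom_ext hc ?_
        rw [Category.id_comp]
        have := congrArg (· ≫ w) hc'
        simp only [Category.assoc] at this
        exact this.trans e
      rw [← hc', h2, Category.id_comp])
  have h1 : w ≫ s = 𝟙 Y := by
    refine h.hom_ext hκ hY ?_ fun i ↦ ?_
    · rw [base_comp, hwb, hs]
      exact Category.comp_id _
    · rw [← Category.assoc, hs', Category.comp_id]
  have h2 : s ≫ w = 𝟙 P := by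
    refine hcov.hom_ext hκw (hW.pb _) ?_ fun i ↦ ?_
    · rw [base_comp, hwb, hs]
      exact Category.comp_id _
    · rw [← Category.assoc, hs', Category.comp_id]
  have : IsIso w := ⟨s, h1, h2⟩
  rw [← hw]
  exact (Cart.of_isIso w).comp (cart_pbMap _ _)

end ModScheme

end

noncomputable section

open ModScheme

/-! ### Descent data -/

/-- A descent datum for quasi-coherent sheaves on `S`: quasi-coherent sheaves on schemes over `S`
that cover `S`, and cartesian transition morphisms between them for all morphisms over `S`. Every
scheme over a member is required to be isomorphic to a member, so that fibre products of members and
open subschemes of members need no separate treatment; the index type may be large. -/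
structure DescentDatum (S : Scheme.{u}) (I : Type*) where
  obj : I → ModScheme.{u}
  qc : ∀ i, QC (obj i)
  map : ∀ i, (obj i).scheme ⟶ S
  trans : ∀ {i j : I} (h : (obj i).scheme ⟶ (obj j).scheme), h ≫ map j = map i → (obj i ⟶ obj j)
  base_trans : ∀ {i j : I} (h : (obj i).scheme ⟶ (obj j).scheme) (w : h ≫ map j = map i),
    base (trans h w) = h
  cart_trans : ∀ {i j : I} (h : (obj i).scheme ⟶ (obj j).scheme) (w : h ≫ map j = map i),
    Cart (trans h w)
  trans_comp : ∀ {i j k : I} (h : (obj i).scheme ⟶ (obj j).scheme)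
    (h' : (obj j).scheme ⟶ (obj k).scheme) (w : h ≫ map j = map i) (w' : h' ≫ map k = map j)
    (w'' : (h ≫ h') ≫ map k = map i), trans h w ≫ trans h' w' = trans (h ≫ h') w''
  exists_iso : ∀ (i : I) (T : Scheme.{u}) (f : T ⟶ (obj i).scheme),
    ∃ (j : I) (e : (obj j).scheme ⟶ T), IsIso e ∧ e ≫ f ≫ map i = map j
  covering : Sieve.ofArrows (fun i ↦ (obj i).scheme) map ∈ Scheme.etaleTopology S

namespace DescentDatum

variable {S : Scheme.{u}} {I : Type*} (D : DescentDatum S I)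

theorem trans_congr {i j : I} {h h' : (D.obj i).scheme ⟶ (D.obj j).scheme} (e : h = h')
    (w : h ≫ D.map j = D.map i) : D.trans h w = D.trans h' (e ▸ w) := by
  subst e
  rfl

/-- A cartesian morphism to two members of a descent datum, compatible with cartesian
morphisms to a common target that are compatible with the transition morphisms, is up
to isomorphism a pair of transition morphisms. -/
theorem exists_trans {J : Type*} (κ : J → I) {W : ModScheme.{u}} (ρ : ∀ j, D.obj (κ j) ⟶ W)
    (hρ : ∀ j, Cart (ρ j)) (f : W.scheme ⟶ S) (hf : ∀ j, base (ρ j) ≫ f = D.map (κ j))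
    (ht : ∀ (k : I) (i j : J) (h : (D.obj k).scheme ⟶ (D.obj (κ i)).scheme)
      (h' : (D.obj k).scheme ⟶ (D.obj (κ j)).scheme) (w) (w'),
      h ≫ base (ρ i) = h' ≫ base (ρ j) → D.trans h w ≫ ρ i = D.trans h' w' ≫ ρ j)
    {i j : J} {Z : ModScheme.{u}} (a : Z ⟶ D.obj (κ i)) (b : Z ⟶ D.obj (κ j)) (ha : Cart a)
    (e : a ≫ ρ i = b ≫ ρ j) :
    ∃ (k : I) (c : D.obj k ⟶ Z) (h : (D.obj k).scheme ⟶ (D.obj (κ i)).scheme)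
      (h' : (D.obj k).scheme ⟶ (D.obj (κ j)).scheme) (w : h ≫ D.map (κ i) = D.map k)
      (w' : h' ≫ D.map (κ j) = D.map k), IsIso c ∧ c ≫ a = D.trans h w ∧
      c ≫ b = D.trans h' w' := by
  obtain ⟨k, c₀, hc₀, hk⟩ := D.exists_iso (κ i) Z.scheme (base a)
  have w : (c₀ ≫ base a) ≫ D.map (κ i) = D.map k := (Category.assoc _ _ _).trans hk
  have eb : base a ≫ base (ρ i) = base b ≫ base (ρ j) := congrArg base e
  have w' : (c₀ ≫ base b) ≫ D.map (κ j) = D.map k := by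
    rw [← hk, ← hf, ← hf, Category.assoc, ← Category.assoc (base a), eb, Category.assoc]
  let c := ha.lift (D.trans (c₀ ≫ base a) w) c₀ (D.base_trans _ _).symm
  have hc : base c = c₀ := Cart.base_lift _ _ _ _
  have hca : c ≫ a = D.trans (c₀ ≫ base a) w := Cart.lift_comp _ _ _ _
  have : IsIso (base c) := by rw [hc]; exact hc₀
  refine ⟨k, c, _, _, w, w', (Cart.of_comp (hca ▸ D.cart_trans _ _) ha).isIso, hca, ?_⟩
  refine (hρ j).hom_ext ?_ ?_
  · rw [base_comp, hc, D.base_trans]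
  · rw [Category.assoc, ← e, ← Category.assoc, hca]
    refine ht _ _ _ _ _ _ _ ?_
    rw [Category.assoc, eb, Category.assoc]

/-- Compatibility of morphisms on members of a descent datum can be tested on transition
morphisms. -/
theorem compatible {J : Type*} (κ : J → I) {W W' : ModScheme.{u}} (ρ : ∀ j, D.obj (κ j) ⟶ W)
    (hρ : ∀ j, Cart (ρ j)) (f : W.scheme ⟶ S) (hf : ∀ j, base (ρ j) ≫ f = D.map (κ j))
    (ht : ∀ (k : I) (i j : J) (h : (D.obj k).scheme ⟶ (D.obj (κ i)).scheme)
      (h' : (D.obj k).scheme ⟶ (D.obj (κ j)).scheme) (w) (w'),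
      h ≫ base (ρ i) = h' ≫ base (ρ j) → D.trans h w ≫ ρ i = D.trans h' w' ≫ ρ j)
    (σ : ∀ j, D.obj (κ j) ⟶ W')
    (hσ : ∀ (k : I) (i j : J) (h : (D.obj k).scheme ⟶ (D.obj (κ i)).scheme)
      (h' : (D.obj k).scheme ⟶ (D.obj (κ j)).scheme) (w) (w'),
      h ≫ base (ρ i) = h' ≫ base (ρ j) → D.trans h w ≫ σ i = D.trans h' w' ≫ σ j) :
    Compatible ρ σ := by
  intro i j Z a b ha hb e
  obtain ⟨k, c, h, h', w, w', hc, h1, h2⟩ := D.exists_trans κ ρ hρ f hf ht a b ha e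
  rw [← cancel_epi c, ← Category.assoc, ← Category.assoc, h1, h2]
  refine hσ k i j h h' w w' ?_
  have h3 : base (c ≫ a ≫ ρ i) = base (c ≫ b ≫ ρ j) := by rw [e]
  rw [← Category.assoc, ← Category.assoc, h1, h2, base_comp, base_comp, D.base_trans,
    D.base_trans] at h3
  exact h3

/-- The members of a descent datum that map to a given member and to one of a covering family. -/
structure Refinement {A : Type*} (κ : A → I) (i : I) where
  idx : I
  elt : A
  left : (D.obj idx).scheme ⟶ (D.obj i).scheme
  right : (D.obj idx).scheme ⟶ (D.obj (κ elt)).scheme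
  left_map : left ≫ D.map i = D.map idx
  right_map : right ≫ D.map (κ elt) = D.map idx

variable {A : Type*} (κ : A → I)

/-- The transition morphism from a refinement. -/
def refine (i : I) (r : D.Refinement κ i) : D.obj r.idx ⟶ D.obj i := D.trans r.left r.left_map

/-- The members that map both to `i` and to the covering family form a covering of `i`. -/
theorem etaleCovering_refine
    (hκ : Sieve.ofArrows (fun a ↦ (D.obj (κ a)).scheme) (fun a ↦ D.map (κ a)) ∈
      Scheme.etaleTopology S) (i : I) : EtaleCovering (D.refine κ i) := by
  refine Scheme.etaleTopology.superset_covering ?_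
    (Scheme.etaleTopology.pullback_stable (D.map i) hκ)
  intro T f hf
  obtain ⟨_, g, _, ⟨a⟩, w⟩ := hf
  obtain ⟨j, e, he, hj⟩ := D.exists_iso i T f
  let r : D.Refinement κ i := ⟨j, a, e ≫ f, e ≫ g, (Category.assoc _ _ _).trans hj, by
    rw [Category.assoc, w, hj]⟩
  refine ⟨_, inv e, _, Presieve.ofArrows.mk r, ?_⟩
  · unfold DescentDatum.refine
    rw [D.base_trans]
    exact IsIso.inv_hom_id_assoc _ _

theorem cart_refine (i : I) (r : D.Refinement κ i) : Cart (D.refine κ i r) := D.cart_trans _ _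

theorem compatible_refine (i : I) {W : ModScheme.{u}}
    (σ : ∀ r : D.Refinement κ i, D.obj r.idx ⟶ W)
    (hσ : ∀ (k : I) (r s : D.Refinement κ i) (h : (D.obj k).scheme ⟶ (D.obj r.idx).scheme)
      (h' : (D.obj k).scheme ⟶ (D.obj s.idx).scheme) (w) (w'),
      D.trans h w ≫ σ r = D.trans h' w' ≫ σ s) :
    Compatible (D.refine κ i) σ := by
  refine D.compatible (fun r : D.Refinement κ i ↦ r.idx) (D.refine κ i) (D.cart_refine κ i)
    (D.map i) (fun r ↦ ?_) (fun k r s h h' w w' e ↦ ?_) σ fun k r s h h' w w' _ ↦ hσ k r s h h' w w'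
  · unfold DescentDatum.refine
    rw [D.base_trans, r.left_map]
  · unfold DescentDatum.refine at e ⊢
    rw [D.base_trans, D.base_trans] at e
    rw [D.trans_comp _ _ _ _ (by rw [Category.assoc, r.left_map, w]),
      D.trans_comp _ _ _ _ (by rw [Category.assoc, s.left_map, w'])]
    exact D.trans_congr e _

/-- Compatible morphisms from a covering family of a descent datum extend to all members. -/
theorem exists_extension
    (hκ : Sieve.ofArrows (fun a ↦ (D.obj (κ a)).scheme) (fun a ↦ D.map (κ a)) ∈
      Scheme.etaleTopology S) {N : S.Modules} (ρ : ∀ a, D.obj (κ a) ⟶ ⟨S, N⟩)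
    (hb : ∀ a, base (ρ a) = D.map (κ a))
    (hc : ∀ (k : I) (a b : A) (h : (D.obj k).scheme ⟶ (D.obj (κ a)).scheme)
      (h' : (D.obj k).scheme ⟶ (D.obj (κ b)).scheme) (w) (w'),
      D.trans h w ≫ ρ a = D.trans h' w' ≫ ρ b) :
    ∃ τ : ∀ i, D.obj i ⟶ (⟨S, N⟩ : ModScheme.{u}), (∀ i, base (τ i) = D.map i) ∧
      (∀ (i j : I) (h : (D.obj i).scheme ⟶ (D.obj j).scheme) (w), D.trans h w ≫ τ j = τ i) ∧
      (∀ (i : I) (a : A) (h : (D.obj i).scheme ⟶ (D.obj (κ a)).scheme) (w),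
        D.trans h w ≫ ρ a = τ i) := by
  -- The morphism `τ i` is descended from the covering of the member `i` by its refinements.
  let σ (i : I) (r : D.Refinement κ i) : D.obj r.idx ⟶ (⟨S, N⟩ : ModScheme.{u}) :=
    D.trans r.right r.right_map ≫ ρ r.elt
  have hσ (i : I) := (D.etaleCovering_refine κ hκ i).existsUnique_hom (D.cart_refine κ i) (D.qc i)
    (σ i) (D.map i) (fun r ↦ by
      refine (congrArg₂ (· ≫ ·) (D.base_trans r.right r.right_map) (hb r.elt)).trans ?_
      exact r.right_map.trans (r.left_map.symm.trans (congrArg (· ≫ D.map i)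
        (D.base_trans r.left r.left_map).symm)))
    (D.compatible_refine κ i (σ i) fun k r s h h' w w' ↦ by
      dsimp only [σ]
      rw [← Category.assoc, ← Category.assoc,
        D.trans_comp _ _ _ _ (by rw [Category.assoc, r.right_map, w]),
        D.trans_comp _ _ _ _ (by rw [Category.assoc, s.right_map, w'])]
      exact hc _ _ _ _ _ _ _)
  choose τ hτ _ using hσ
  have h1 (i : I) (a : A) (h : (D.obj i).scheme ⟶ (D.obj (κ a)).scheme) (w) :
      D.trans h w ≫ ρ a = τ i := by
    refine (D.etaleCovering_refine κ hκ i).hom_ext (D.cart_refine κ i) (D.qc i) ?_ fun r ↦ ?_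
    · exact (congrArg₂ (· ≫ ·) (D.base_trans h w) (hb a)).trans (w.trans (hτ i).1.symm)
    · rw [(hτ i).2 r, ← Category.assoc]
      unfold DescentDatum.refine
      rw [D.trans_comp _ _ _ _ (by rw [Category.assoc, w, r.left_map])]
      exact hc _ _ _ _ _ _ _
  refine ⟨τ, fun i ↦ (hτ i).1, fun i j h w ↦ ?_, h1⟩
  refine (D.etaleCovering_refine κ hκ i).hom_ext (D.cart_refine κ i) (D.qc i) ?_ fun r ↦ ?_
  · exact (congrArg₂ (· ≫ ·) (D.base_trans h w) (hτ j).1).trans (w.trans (hτ i).1.symm)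
  · rw [(hτ i).2 r, ← Category.assoc]
    unfold DescentDatum.refine
    rw [D.trans_comp _ _ _ _ (by rw [Category.assoc, w, r.left_map])]
    exact ((hτ j).2 ⟨r.idx, r.elt, r.left ≫ h, r.right,
      by rw [Category.assoc, w, r.left_map], r.right_map⟩)

/-- A solution of a descent datum: a quasi-coherent sheaf on `S` whose pullbacks to the members are
identified with the given sheaves, compatibly with the transition morphisms. -/
structure Gluing where
  sheaf : S.Modules
  qc : QC ⟨S, sheaf⟩
  hom : ∀ i, D.obj i ⟶ ⟨S, sheaf⟩
  base_hom : ∀ i, base (hom i) = D.map i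
  cart_hom : ∀ i, Cart (hom i)
  trans_hom : ∀ (i j : I) (h : (D.obj i).scheme ⟶ (D.obj j).scheme) (w),
    D.trans h w ≫ hom j = hom i

theorem Gluing.etaleCovering {D : DescentDatum S I} (G : D.Gluing) : EtaleCovering G.hom := by
  have h1 : Sieve.ofArrows (fun i ↦ (D.obj i).scheme) (fun i ↦ base (G.hom i)) =
    Sieve.ofArrows (fun i ↦ (D.obj i).scheme) D.map :=
      congrArg (Sieve.ofArrows (fun i ↦ (D.obj i).scheme)) (funext G.base_hom)
  unfold EtaleCovering
  exact h1 ▸ D.covering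

theorem Gluing.compatible {D : DescentDatum S I} (G : D.Gluing) {W : ModScheme.{u}}
    (σ : ∀ i, D.obj i ⟶ W)
    (hσ : ∀ (i j : I) (h : (D.obj i).scheme ⟶ (D.obj j).scheme) (w), D.trans h w ≫ σ j = σ i) :
    Compatible G.hom σ := by
  refine D.compatible (fun i ↦ i) G.hom G.cart_hom (𝟙 S) (fun i ↦ ?_) (fun k i j h h' w w' _ ↦ ?_)
    σ (fun k i j h h' w w' _ ↦ ?_)
  · rw [G.base_hom]; exact Category.comp_id _
  · rw [G.trans_hom, G.trans_hom]
  · rw [hσ, hσ]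

/-- A gluing along a covering family of members extends to a gluing. -/
theorem nonempty_gluing
    (hκ : Sieve.ofArrows (fun a ↦ (D.obj (κ a)).scheme) (fun a ↦ D.map (κ a)) ∈
      Scheme.etaleTopology S) {N : S.Modules} (hN : QC ⟨S, N⟩) (ρ : ∀ a, D.obj (κ a) ⟶ ⟨S, N⟩)
    (hb : ∀ a, base (ρ a) = D.map (κ a)) (hρ : ∀ a, Cart (ρ a))
    (hc : ∀ (k : I) (a b : A) (h : (D.obj k).scheme ⟶ (D.obj (κ a)).scheme)
      (h' : (D.obj k).scheme ⟶ (D.obj (κ b)).scheme) (w) (w'),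
      D.trans h w ≫ ρ a = D.trans h' w' ≫ ρ b) : Nonempty D.Gluing := by
  obtain ⟨τ, h1, h2, h3⟩ := D.exists_extension κ hκ ρ hb hc
  refine ⟨⟨N, hN, τ, h1, fun i ↦ ?_, h2⟩⟩
  refine (D.etaleCovering_refine κ hκ i).cart (D.cart_refine κ i) (D.qc i) hN _ fun r ↦ ?_
  have h4 : D.refine κ i r ≫ τ i = D.trans r.right r.right_map ≫ ρ r.elt :=
    (h2 _ _ _ _).trans (h3 _ _ _ _).symm
  rw [h4]
  exact (D.cart_trans _ _).comp (hρ _)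

/-- The pullback of a descent datum to `S'`: its members are those of `D` whose structure morphism
factors through `S'`. -/
def pullback {S' : Scheme.{u}} (f : S' ⟶ S) :
    DescentDatum S' (Σ i, {g : (D.obj i).scheme ⟶ S' // g ≫ f = D.map i}) where
  obj i := D.obj i.1
  qc i := D.qc i.1
  map i := i.2.1
  trans {i j} h w := D.trans h (by rw [← j.2.2, ← i.2.2, ← w, Category.assoc])
  base_trans _ _ := D.base_trans _ _
  cart_trans _ _ := D.cart_trans _ _
  trans_comp _ _ _ _ _ := D.trans_comp _ _ _ _ _
  exists_iso i T g := by
    obtain ⟨j, e, he, hj⟩ := D.exists_iso i.1 T g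
    refine ⟨⟨j, e ≫ g ≫ i.2.1, ?_⟩, e, he, rfl⟩
    rw [Category.assoc, Category.assoc, i.2.2, hj]
  covering := by
    refine Scheme.etaleTopology.superset_covering ?_
      (Scheme.etaleTopology.pullback_stable f D.covering)
    intro T g hg
    obtain ⟨_, a, _, ⟨i⟩, w⟩ := hg
    obtain ⟨j, e, he, hj⟩ := D.exists_iso i T a
    let r : Σ i, {g : (D.obj i).scheme ⟶ S' // g ≫ f = D.map i} := ⟨j, e ≫ g, by
      rw [Category.assoc, ← w, hj]⟩
    exact ⟨_, inv e, _, Presieve.ofArrows.mk r, IsIso.inv_hom_id_assoc _ _⟩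

end DescentDatum

end

noncomputable section

open ModScheme

/-! ### Flat base change -/

/-- Flat base change of a kernel: if `C` is flat over `R` and `G` embeds into the base changes of the
modules `P a` in such a way that the image is annihilated by the base change of `d`, then
`C ⊗ ker d` is `G`. -/
theorem bijective_of_flat {R C : Type u} [CommRing R] [CommRing C] [Algebra R C] [Module.Flat R C]
    {A B : Type*} [Finite A] [Finite B] (P : A → Type u) (Q : B → Type u)
    [∀ a, AddCommGroup (P a)] [∀ a, Module R (P a)] [∀ b, AddCommGroup (Q b)] [∀ b, Module R (Q b)]
    (d : (∀ a, P a) →ₗ[R] (∀ b, Q b)) {G : Type*} [AddCommGroup G] (Ga : A → Type*)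
    [∀ a, AddCommGroup (Ga a)] (e : ∀ a, C ⊗[R] P a ≃+ Ga a) (r : ∀ a, G →+ Ga a)
    (hr : ∀ y y', (∀ a, r a y = r a y') → y = y') (Φ : C ⊗[R] LinearMap.ker d →+ G)
    (hΦ : ∀ z a, r a (Φ z) =
      e a (LinearMap.lTensor C (LinearMap.proj a ∘ₗ (LinearMap.ker d).subtype) z))
    (H : ∀ (y : G) (w : C ⊗[R] (∀ a, P a)),
      (∀ a, e a (LinearMap.lTensor C (LinearMap.proj a) w) = r a y) →
      ∀ b, LinearMap.lTensor C (LinearMap.proj b ∘ₗ d) w = 0) : Function.Bijective Φ := by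
  classical
  have : Fintype A := Fintype.ofFinite A
  have : Fintype B := Fintype.ofFinite B
  have hA (w : C ⊗[R] (∀ a, P a)) (a : A) :
      TensorProduct.piRight R C C P w a = LinearMap.lTensor C (LinearMap.proj a) w := by
    induction w with
    | zero => simp
    | add x y hx hy => rw [map_add, map_add, ← hx, ← hy]; rfl
    | tmul c x => simp
  have hB (w : C ⊗[R] (∀ b, Q b)) (b : B) :
      TensorProduct.piRight R C C Q w b = LinearMap.lTensor C (LinearMap.proj b) w := by
    induction w with
    | zero => simp
    | add x y hx hy => rw [map_add, map_add, ← hx, ← hy]; rfl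
    | tmul c x => simp
  have hinj : Function.Injective (LinearMap.lTensor C (LinearMap.ker d).subtype) :=
    Module.Flat.lTensor_preserves_injective_linearMap _ (LinearMap.ker d).injective_subtype
  have hex : Function.Exact (LinearMap.lTensor C (LinearMap.ker d).subtype)
      (LinearMap.lTensor C d) :=
    Module.Flat.lTensor_exact C (LinearMap.exact_subtype_ker_map d)
  have hcomp (z) (a) : LinearMap.lTensor C (LinearMap.proj a ∘ₗ (LinearMap.ker d).subtype) z =
      LinearMap.lTensor C (LinearMap.proj a) (LinearMap.lTensor C (LinearMap.ker d).subtype z) := by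
    rw [LinearMap.lTensor_comp]; rfl
  constructor
  · rw [injective_iff_map_eq_zero]
    intro z hz
    apply hinj
    rw [map_zero]
    apply (TensorProduct.piRight R C C P).injective
    ext a
    rw [map_zero, hA, ← hcomp]
    apply (e a).injective
    rw [← hΦ, hz, map_zero]
    exact (map_zero (e a)).symm
  · intro y
    let w := (TensorProduct.piRight R C C P).symm fun a ↦ (e a).symm (r a y)
    have hw (a) : e a (LinearMap.lTensor C (LinearMap.proj a) w) = r a y := by
      rw [← hA, LinearEquiv.apply_symm_apply, AddEquiv.apply_symm_apply]
    have hdw : LinearMap.lTensor C d w = 0 := by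
      apply (TensorProduct.piRight R C C Q).injective
      ext b
      rw [hB, map_zero, ← LinearMap.comp_apply, ← LinearMap.lTensor_comp, H y w hw b]
      rfl
    obtain ⟨z, hz⟩ := (hex w).mp hdw
    refine ⟨z, hr _ _ fun a ↦ ?_⟩
    rw [hΦ, hcomp, hz, hw]

/-- Base change of modules along a pushout square of rings: `B ⊗[A] M = C ⊗[R] M`. -/
theorem exists_equiv_of_isPushout {R A C B : Type u} [CommRing R] [CommRing A] [CommRing C]
    [CommRing B] {f : R →+* A} {g : R →+* C} {f' : A →+* B} {g' : C →+* B}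
    (h : IsPushout (CommRingCat.ofHom g) (CommRingCat.ofHom f) (CommRingCat.ofHom g')
      (CommRingCat.ofHom f'))
    {M N : Type u} [AddCommGroup M] [AddCommGroup N] [Module A M] [Module B N] {l : M →ₛₗ[f'] N}
    (hl : IsBC l) :
    letI := g.toAlgebra
    letI : Module R M := Module.compHom M f
    ∃ e : C ⊗[R] M ≃+ N, ∀ c m, e (c ⊗ₜ m) = g' c • l m := by
  algebraize [f, g, f', g', f'.comp f]
  let : Module R M := Module.compHom M f
  have : IsScalarTower R A M := IsScalarTower.of_algebraMap_smul fun _ _ ↦ rfl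
  have : IsScalarTower R C B := IsScalarTower.of_algebraMap_eq fun r ↦
    (ConcreteCategory.congr_hom h.w r).symm
  have : Algebra.IsPushout R C A B := CommRingCat.isPushout_iff_isPushout.mp h
  obtain ⟨e, he⟩ := hl.exists_equiv
  refine ⟨(Algebra.IsPushout.cancelBaseChange R C A B M).symm.toAddEquiv.trans e, fun c m ↦ ?_⟩
  refine (congrArg e (Algebra.IsPushout.cancelBaseChange_symm_tmul R C A B M c m)).trans ?_
  exact he _ _

theorem IsBC.of_bijective {A B : Type u} [CommRing A] [CommRing B] {f : A →+* B} {M N : Type u}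
    [AddCommGroup M] [AddCommGroup N] [Module A M] [Module B N] {l : M →ₛₗ[f] N}
    (h : letI := f.toAlgebra
      ∃ e : B ⊗[A] M ≃+ N, ∀ b m, e (b ⊗ₜ m) = b • l m) : IsBC l := by
  let := f.toAlgebra
  obtain ⟨e, he⟩ := h
  intro Q _ _ g
  let : Module A Q := Module.compHom Q f
  have : IsScalarTower A B Q := IsScalarTower.of_algebraMap_smul fun _ _ ↦ rfl
  let g' : M →ₗ[A] Q := { g with map_smul' := g.map_smulₛₗ }
  have he' (b : B) (z : B ⊗[A] M) : e (b • z) = b • e z := by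
    induction z with
    | zero => rw [smul_zero, map_zero, smul_zero]
    | add x y hx hy => rw [smul_add, map_add, map_add, smul_add, hx, hy]
    | tmul c m => rw [TensorProduct.smul_tmul', he, he, smul_eq_mul, mul_smul]
  let E : B ⊗[A] M ≃ₗ[B] N := e.toLinearEquiv he'
  have hE (m : M) : E.symm (l m) = 1 ⊗ₜ m := by
    apply E.injective
    rw [LinearEquiv.apply_symm_apply]
    exact ((he 1 m).trans (one_smul _ _)).symm
  refine ⟨g'.liftBaseChange B ∘ₗ E.symm.toLinearMap, fun m ↦ ?_, fun k hk ↦ ?_⟩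
  · refine (congrArg (g'.liftBaseChange B) (hE m)).trans ?_
    exact (LinearMap.liftBaseChange_tmul ..).trans (one_smul _ _)
  · ext n
    obtain ⟨z, rfl⟩ := E.surjective n
    refine Eq.trans ?_ (congrArg (g'.liftBaseChange B) (E.symm_apply_apply z)).symm
    induction z with
    | zero => simp
    | add x y hx hy => rw [map_add, map_add, map_add, hx, hy]
    | tmul b m =>
      refine (congrArg k (he b m)).trans ?_
      rw [map_smul, hk, LinearMap.liftBaseChange_tmul]
      rfl

/-- For affine schemes the sections of the pullback of a quasi-coherent sheaf to a fibre product are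
a tensor product over the functions on the base. -/
theorem exists_equiv_of_isPullback {S T : Scheme.{u}} [IsAffine S] [IsAffine T]
    {X Z : ModScheme.{u}} [IsAffine X.scheme] (p : Z ⟶ X) (hp : Cart p) (hX : QC X)
    (g : X.scheme ⟶ S) (γ : T ⟶ S) (q : Z.scheme ⟶ T) (h : IsPullback q (base p) γ g) :
    letI := γ.appTop.hom.toAlgebra
    letI : Module Γ(S, ⊤) Γ(X.sheaf, ⊤) := Module.compHom _ g.appTop.hom
    ∃ e : Γ(T, ⊤) ⊗[Γ(S, ⊤)] Γ(X.sheaf, ⊤) ≃+ Γ(Z.sheaf, ⊤),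
      ∀ c x, e (c ⊗ₜ x) = q.appTop c • glob p x := by
  have : IsAffine Z.scheme := .of_isPullback h
  exact exists_equiv_of_isPushout (f := g.appTop.hom) (g := γ.appTop.hom)
    (f' := (base p).appTop.hom) (g' := q.appTop.hom) (isPushout_appTop_of_isPullback h)
    (l := globₗ p) (hp.isBC (hp.qc hX) hX)

namespace DescentDatum

variable {S : Scheme.{u}} {I : Type*} (D : DescentDatum S I)

/-- Over an affine scheme, finitely many affine members of a descent datum already cover. -/
theorem exists_finite_affine [IsAffine S] : ∃ (A : Type u) (_ : Finite A) (κ : A → I),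
    (∀ a, IsAffine (D.obj (κ a)).scheme) ∧ (∀ a, Flat (D.map (κ a))) ∧
    Sieve.ofArrows (fun a ↦ (D.obj (κ a)).scheme) (fun a ↦ D.map (κ a)) ∈
      Scheme.etaleTopology S := by
  obtain ⟨𝒰, hle⟩ := Scheme.mem_grothendieckTopology_iff.mp D.covering
  have H (s : S) : ∃ k : I, IsAffine (D.obj k).scheme ∧ Etale (D.map k) ∧
      s ∈ Set.range (D.map k) := by
    obtain ⟨i, y, rfl⟩ := ((Scheme.ofArrows_mem_precoverage_iff _).mp 𝒰.mem₀).1 s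
    obtain ⟨V, hV, hyV, -⟩ := TopologicalSpace.Opens.isBasis_iff_nbhd.mp
      (𝒰.X i).isBasis_affineOpens (TopologicalSpace.Opens.mem_top y)
    let V : (𝒰.X i).Opens := V
    obtain ⟨_, a, _, ⟨j⟩, w⟩ := hle _ _ ⟨i⟩
    obtain ⟨k, e, he, hk⟩ := D.exists_iso j V.toScheme (V.ι ≫ a)
    have : IsAffine V.toScheme := hV
    have hk' : e ≫ V.ι ≫ 𝒰.f i = D.map k := by rw [← hk, ← w]; simp
    refine ⟨k, .of_isIso e, ?_, ?_⟩
    · rw [← hk']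
      have : Etale (𝒰.f i) := 𝒰.map_prop i
      infer_instance
    · refine ⟨(inv e) ⟨y, hyV⟩, ?_⟩
      have h1 : inv e ≫ D.map k = V.ι ≫ 𝒰.f i := by rw [← hk', IsIso.inv_hom_id_assoc]
      exact congrArg (fun f : V.toScheme ⟶ S ↦ f ⟨y, hyV⟩) h1
  choose k hk1 hk2 hk3 using H
  obtain ⟨t, ht⟩ := isCompact_univ.elim_finite_subcover (fun s ↦ Set.range (D.map (k s)))
    (fun s ↦ (D.map (k s)).isOpenMap.isOpen_range) fun s _ ↦ Set.mem_iUnion.mpr ⟨s, hk3 s⟩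
  refine ⟨t, inferInstance, fun s ↦ k s, fun s ↦ hk1 _, fun s ↦ ?_, ?_⟩
  · have := hk2 s
    infer_instance
  · refine Precoverage.generate_mem_toGrothendieck
      ((Scheme.ofArrows_mem_precoverage_iff _).mpr ⟨fun s ↦ ?_, fun s ↦ hk2 s⟩)
    obtain ⟨s', hs'⟩ := Set.mem_iUnion.mp (ht (Set.mem_univ s))
    obtain ⟨h1, h2⟩ := Set.mem_iUnion.mp hs'
    exact ⟨⟨s', h1⟩, h2⟩

/-- The action of transition morphisms on global sections. -/
theorem glob_trans_comp {i j k : I} (h : (D.obj i).scheme ⟶ (D.obj j).scheme)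
    (h' : (D.obj j).scheme ⟶ (D.obj k).scheme) (w : h ≫ D.map j = D.map i)
    (w' : h' ≫ D.map k = D.map j) {g : (D.obj i).scheme ⟶ (D.obj k).scheme} (hg : h ≫ h' = g)
    (w'' : g ≫ D.map k = D.map i) (x : Γ((D.obj k).sheaf, ⊤)) :
    glob (D.trans h w) (glob (D.trans h' w') x) = glob (D.trans g w'') x := by
  subst hg
  exact (glob_comp _ _ _).symm.trans (glob_congr (D.trans_comp _ _ _ _ _) _)

/-- The global sections of a member as a module over the functions on the base. -/
abbrev module (i : I) : Module Γ(S, ⊤) Γ((D.obj i).sheaf, ⊤) :=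
  Module.compHom _ (D.map i).appTop.hom

/-- The action of a transition morphism on global sections, as a linear map. -/
def globTrans {i j : I} (h : (D.obj i).scheme ⟶ (D.obj j).scheme) (w : h ≫ D.map j = D.map i) :
    letI := D.module
    Γ((D.obj j).sheaf, ⊤) →ₗ[Γ(S, ⊤)] Γ((D.obj i).sheaf, ⊤) :=
  letI := D.module
  { glob (D.trans h w) with
    map_smul' r m := by
      have h1 : (base (D.trans h w)).appTop ((D.map j).appTop r) = (D.map i).appTop r := by
        rw [D.base_trans, ← w, Scheme.Hom.comp_appTop]
        rfl
      refine (glob_smul (D.trans h w) _ m).trans ?_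
      exact congrArg (fun t : Γ((D.obj i).scheme, ⊤) ↦ t • glob (D.trans h w) m) h1 }

/-- A member over the fibre product of two members. -/
theorem exists_prod (i j : I) : ∃ (k : I) (p : (D.obj k).scheme ⟶ (D.obj i).scheme)
    (q : (D.obj k).scheme ⟶ (D.obj j).scheme), IsPullback p q (D.map i) (D.map j) ∧
      p ≫ D.map i = D.map k := by
  obtain ⟨k, e, he, hk⟩ := D.exists_iso i (Limits.pullback (D.map i) (D.map j)) (pullback.fst _ _)
  refine ⟨k, e ≫ pullback.fst _ _, e ≫ pullback.snd _ _, ?_, by rw [Category.assoc, hk]⟩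
  exact (IsPullback.of_hasPullback _ _).of_iso' (asIso e) (Iso.refl _) (Iso.refl _) (Iso.refl _)
    (by simp) (by simp) (by simp) (by simp)

/-- Flat base change of the sections of a member. -/
theorem exists_equiv [IsAffine S] {i j k : I} [IsAffine (D.obj i).scheme] [IsAffine (D.obj j).scheme]
    (p : (D.obj k).scheme ⟶ (D.obj i).scheme) (q : (D.obj k).scheme ⟶ (D.obj j).scheme)
    (h : IsPullback p q (D.map i) (D.map j)) (w : q ≫ D.map j = D.map k) :
    letI := (D.map i).appTop.hom.toAlgebra
    letI := D.module
    ∃ e : Γ((D.obj i).scheme, ⊤) ⊗[Γ(S, ⊤)] Γ((D.obj j).sheaf, ⊤) ≃+ Γ((D.obj k).sheaf, ⊤),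
      ∀ c x, e (c ⊗ₜ x) = p.appTop c • glob (D.trans q w) x :=
  exists_equiv_of_isPullback (D.trans q w) (D.cart_trans _ _) (D.qc j) (D.map j) (D.map i) p
    (by rwa [D.base_trans])

/-- A descent datum on an affine scheme is effective. The glued sheaf is given by the module `ker d` of
families of sections over a finite affine subcovering that agree on the pairwise fibre products. By
flatness `ker d` commutes with base change to a member, where sections descend from the covering by
the fibre products with the chosen members. -/
theorem nonempty_gluing_of_isAffine [IsAffine S] : Nonempty D.Gluing := by
  obtain ⟨A, _, κ, hκA, hκF, hκ⟩ := D.exists_finite_affine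
  let R := Γ(S, ⊤)
  let _instM := D.module
  choose k p q hpb hk using fun b : A × A ↦ D.exists_prod (κ b.1) (κ b.2)
  have hk' (b : A × A) : q b ≫ D.map (κ b.2) = D.map (k b) := (hpb b).w.symm.trans (hk b)
  have hAk (b : A × A) : IsAffine (D.obj (k b)).scheme := .of_isPullback (hpb b)
  let P (a : A) : Type u := Γ((D.obj (κ a)).sheaf, ⊤)
  let Q (b : A × A) : Type u := Γ((D.obj (k b)).sheaf, ⊤)
  let ls (b : A × A) : P b.1 →ₗ[R] Q b := D.globTrans (p b) (hk b)
  let lt (b : A × A) : P b.2 →ₗ[R] Q b := D.globTrans (q b) (hk' b)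
  let d : (∀ a, P a) →ₗ[R] (∀ b, Q b) :=
    LinearMap.pi fun b ↦ ls b ∘ₗ LinearMap.proj b.1 - lt b ∘ₗ LinearMap.proj b.2
  have hd (x : LinearMap.ker d) (b : A × A) : ls b (x.1 b.1) = lt b (x.1 b.2) :=
    sub_eq_zero.mp (congrFun x.2 b)
  obtain ⟨N, hN, eN, heN⟩ := exists_qc_of_module S (LinearMap.ker d)
  let Y : ModScheme.{u} := ⟨S, N⟩
  have uY : GlobUniv Y := by
    have : IsAffine Y.scheme := inferInstanceAs (IsAffine S)
    exact GlobUniv.of_qc hN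
  let pr (a : A) : LinearMap.ker d →ₗ[R] P a := LinearMap.proj a ∘ₗ (LinearMap.ker d).subtype
  have heN' (r : R) (n : Γ(N, ⊤)) : eN.symm (r • n) = r • eN.symm n := by
    apply eN.injective
    rw [heN, AddEquiv.apply_symm_apply, AddEquiv.apply_symm_apply]
  have H (a : A) := uY (X := D.obj (κ a)) (D.map (κ a))
    ((pr a).toAddMonoidHom.comp eN.symm.toAddMonoidHom) (fun r n ↦
      (congrArg (pr a) (heN' r n)).trans ((pr a).map_smul r _))
  choose ρ hρ _ using H
  have hρb (a : A) : base (ρ a) = D.map (κ a) := (hρ a).1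
  have hρg (a : A) (n : Γ(N, ⊤)) : glob (ρ a) n = (eN.symm n).1 a := DFunLike.congr_fun (hρ a).2 n
  refine D.nonempty_gluing κ hκ hN ρ hρb (fun c ↦ ?_) (fun l a b h h' w w' ↦ ?_)
  · have : IsAffine Y.scheme := inferInstanceAs (IsAffine S)
    refine cart_of_isBC (D.qc _) hN (IsBC.of_bijective ?_)
    let C := Γ((D.obj (κ c)).scheme, ⊤)
    let _alg : Algebra R C := (D.map (κ c)).appTop.hom.toAlgebra
    have : Module.Flat R C := (D.map (κ c)).flat_appTop
    have : IsScalarTower R C (P c) := IsScalarTower.of_algebraMap_smul fun _ _ ↦ rfl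
    choose e he using fun a ↦ D.exists_equiv (p (c, a)) (q (c, a)) (hpb (c, a)) (hk' (c, a))
    -- It is to be shown that `C ⊗ ker d → P c` is bijective; `P c` embeds into the product of the
    -- `Q (c, a) = C ⊗ P a`.
    let Φ : C ⊗[R] LinearMap.ker d →ₗ[C] P c := (pr c).liftBaseChange C
    have hΦt (x : C) (m : LinearMap.ker d) : Φ (x ⊗ₜ m) = x • pr c m :=
      LinearMap.liftBaseChange_tmul ..
    have hΦ : Function.Bijective Φ.toAddMonoidHom := by
      refine bijective_of_flat P Q d (fun a ↦ Q (c, a)) e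
        (fun a ↦ glob (D.trans (p (c, a)) (hk (c, a)))) (fun y y' hy ↦ ?_) Φ.toAddMonoidHom
        (fun z a ↦ ?_) (fun y w hw b ↦ ?_)
      · refine ((D.etaleCovering_refine κ hκ (κ c)).secDescent (D.cart_refine κ _) (D.qc _)
          (fun r ↦ glob (D.refine κ (κ c) r) y) ?_).unique (fun r ↦ rfl) (fun r ↦ ?_)
        · intro r s Z a b _ _ e
          rw [← glob_comp, ← glob_comp, e]
        · let f := (hpb (c, r.elt)).lift r.left r.right (r.left_map.trans r.right_map.symm)
          have hf : f ≫ p (c, r.elt) = r.left := (hpb (c, r.elt)).lift_fst _ _ _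
          have hf' : f ≫ D.map (k (c, r.elt)) = D.map r.idx := by
            rw [← hk, ← Category.assoc, hf, r.left_map]
          have h1 (z) := D.glob_trans_comp f (p (c, r.elt)) hf' (hk _) hf r.left_map z
          exact (h1 y').symm.trans ((congrArg _ (hy r.elt)).symm.trans (h1 y))
      · induction z with
        | zero => simp only [map_zero]
        | add x y hx hy => rw [map_add, map_add, hx, hy, map_add, map_add]
        | tmul x m =>
          refine (congrArg _ (hΦt x m)).trans ?_
          refine (glob_smul (D.trans (p (c, a)) (hk (c, a))) x (m.1 c)).trans ?_
          refine Eq.trans ?_ (he a x (m.1 a)).symm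
          rw [D.base_trans]
          exact congrArg (fun t : Q (c, a) ↦ (p (c, a)).appTop x • t) (hd m (c, a))
      · obtain ⟨l, u, v, hl, hlu⟩ := D.exists_prod (κ c) (k b)
        have hlv : v ≫ D.map (k b) = D.map l := hl.w.symm.trans hlu
        obtain ⟨E, hE⟩ := D.exists_equiv u v hl hlv
        apply E.injective
        rw [map_zero]
        -- Both terms of the difference `d` take a section `y` of the member `κ c` to its restriction to
        -- the fibre product of `κ c` with `k b`, whichever projection `g` is used.
        have key (a : A) (g : (D.obj (k b)).scheme ⟶ (D.obj (κ a)).scheme)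
            (hg : g ≫ D.map (κ a) = D.map (k b)) :
            E (LinearMap.lTensor C (D.globTrans g hg) (LinearMap.lTensor C (LinearMap.proj a) w)) =
              glob (D.trans u hlu) y := by
          let f := (hpb (c, a)).lift u (v ≫ g) (by rw [Category.assoc, hg, hlu, hlv])
          have hf : f ≫ p (c, a) = u := (hpb (c, a)).lift_fst _ _ _
          have hf' : f ≫ q (c, a) = v ≫ g := (hpb (c, a)).lift_snd _ _ _
          have hfm : f ≫ D.map (k (c, a)) = D.map l := by
            rw [← hk, ← Category.assoc, hf, hlu]
          have hvg : (v ≫ g) ≫ D.map (κ a) = D.map l := by rw [Category.assoc, hg, hlv]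
          rw [← D.glob_trans_comp f (p (c, a)) hfm (hk _) hf hlu y]
          refine Eq.trans ?_ (congrArg (glob (D.trans f hfm)) (hw a))
          generalize LinearMap.lTensor C (LinearMap.proj a) w = z
          induction z with
          | zero => simp only [map_zero]
          | add x y hx hy => rw [map_add, map_add, map_add, hx, hy, map_add]
          | tmul x m =>
            refine (hE x _).trans ?_
            refine Eq.trans ?_ (congrArg (glob (D.trans f hfm)) (he a x m)).symm
            refine Eq.trans ?_ (glob_smul (D.trans f hfm) _ _).symm
            have h1 : (base (D.trans f hfm)).appTop ((p (c, a)).appTop x) = u.appTop x := by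
              rw [D.base_trans, ← hf, Scheme.Hom.comp_appTop]
              rfl
            refine congrArg₂ (fun (t : Γ((D.obj l).scheme, ⊤)) (m : Γ((D.obj l).sheaf, ⊤)) ↦ t • m)
              h1.symm ?_
            exact (D.glob_trans_comp v g hlv hg rfl hvg m).trans
              (D.glob_trans_comp f (q (c, a)) hfm (hk' _) hf' hvg m).symm
        have h1 : (LinearMap.proj b ∘ₗ d : (∀ a, P a) →ₗ[R] Q b) =
          ls b ∘ₗ LinearMap.proj b.1 - lt b ∘ₗ LinearMap.proj b.2 := rfl
        rw [h1, LinearMap.lTensor_sub, LinearMap.lTensor_comp, LinearMap.lTensor_comp,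
          LinearMap.sub_apply, map_sub, sub_eq_zero]
        exact (key b.1 _ _).trans (key b.2 _ _).symm
    have key : ∀ f : (D.obj (κ c)).scheme ⟶ S, f = D.map (κ c) →
        letI := f.appTop.hom.toAlgebra
        ∃ e : C ⊗[R] Γ(N, ⊤) ≃+ P c, ∀ x n, e (x ⊗ₜ n) = x • glob (ρ c) n := by
      rintro _ rfl
      let eL : Γ(N, ⊤) ≃ₗ[R] LinearMap.ker d := eN.symm.toLinearEquiv heN'
      refine ⟨(LinearEquiv.lTensor C eL).toAddEquiv.trans (AddEquiv.ofBijective _ hΦ),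
        fun x n ↦ ?_⟩
      refine (hΦt x (eL n)).trans ?_
      exact congrArg (fun t : P c ↦ x • t) (hρg c n).symm
    exact key _ (hρb c)
  · refine uY.hom_ext ?_ fun n ↦ ?_
    · refine (congrArg₂ (· ≫ ·) (D.base_trans h w) (hρb a)).trans (w.trans (w'.symm.trans
        (congrArg₂ (· ≫ ·) (D.base_trans h' w') (hρb b)).symm))
    · let f := (hpb (a, b)).lift h h' (w.trans w'.symm)
      have hf : f ≫ p (a, b) = h := (hpb (a, b)).lift_fst _ _ _
      have hf' : f ≫ q (a, b) = h' := (hpb (a, b)).lift_snd _ _ _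
      have hfm : f ≫ D.map (k (a, b)) = D.map l := by
        rw [← hk, ← Category.assoc, hf, w]
      refine (glob_comp _ _ _).trans (Eq.trans ?_ (glob_comp _ _ _).symm)
      rw [hρg, hρg, ← D.glob_trans_comp f (p (a, b)) hfm (hk _) hf w,
        ← D.glob_trans_comp f (q (a, b)) hfm (hk' _) hf' w']
      exact congrArg _ (hd (eN.symm n) (a, b))

end DescentDatum

end

noncomputable section

open ModScheme

/-! ### Gluing -/

/-- The functor of sections over an open subset, with values in types. -/
def sectionsFunctor {S : Scheme.{u}} (W : S.Opens) : S.Modules ⥤ Type u :=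
  Scheme.Modules.toPresheaf S ⋙ (evaluation _ _).obj (.op W) ⋙ forget Ab

instance {S : Scheme.{u}} (W : S.Opens) : PreservesLimits (sectionsFunctor W) := by
  have h1 : PreservesLimits ((evaluation S.Opensᵒᵖ AddCommGrpCat.{u}).obj (.op W)) := ⟨inferInstance⟩
  have h2 : PreservesLimits (forget AddCommGrpCat.{u}) := inferInstance
  have h3 : PreservesLimits (((evaluation S.Opensᵒᵖ AddCommGrpCat.{u}).obj (.op W)) ⋙
    forget AddCommGrpCat.{u}) := comp_preservesLimits _ _
  have h4 : PreservesLimits (Scheme.Modules.toPresheaf S) := inferInstance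
  exact comp_preservesLimits (Scheme.Modules.toPresheaf S)
    (((evaluation S.Opensᵒᵖ AddCommGrpCat.{u}).obj (.op W)) ⋙ forget AddCommGrpCat.{u})

theorem toPushforward_res (X : ModScheme.{u}) {T : Scheme.{u}} (g : X.scheme ⟶ T) (W : T.Opens)
    (h : g ⁻¹ᵁ W ≤ base (toPushforward X g) ⁻¹ᵁ W) (m : Γ(X.sheaf, g ⁻¹ᵁ W)) :
    res (toPushforward X g) W (g ⁻¹ᵁ W) h m = m :=
  Hom.res_eq_sec (toPushforward X g) W m

theorem pushforward_factor_res {S : Scheme.{u}} {X Z : ModScheme.{u}} (σ : Z ⟶ X)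
    (g : X.scheme ⟶ S) (f : Z.scheme ⟶ S) {α : (Scheme.Modules.pushforward g).obj X.sheaf ⟶
      (Scheme.Modules.pushforward f).obj Z.sheaf}
    (hα : toPushforward Z f ≫ vert α = σ ≫ toPushforward X g) (W : S.Opens)
    (h : f ⁻¹ᵁ W ≤ base σ ⁻¹ᵁ g ⁻¹ᵁ W) (m : Γ(X.sheaf, g ⁻¹ᵁ W)) :
    α.app W m = res σ (g ⁻¹ᵁ W) (f ⁻¹ᵁ W) h m := by
  have h1 := res_congr hα W (U := f ⁻¹ᵁ W) le_rfl m
  refine Eq.trans ?_ (h1.trans ?_)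
  · refine Eq.trans ?_ (comp_res (toPushforward Z f) (vert α) (V := W) _ le_rfl le_rfl m).symm
    exact (toPushforward_res _ _ _ _ _).symm.trans (congrArg _ (vert_res α W m).symm)
  · refine (comp_res σ (toPushforward X g) (V := g ⁻¹ᵁ W) _ h le_rfl m).trans ?_
    exact congrArg _ (toPushforward_res _ _ _ _ _)

/-- The sheaf of matching families of sections, constructed as a limit of direct images. -/
theorem exists_matching {S : Scheme.{u}} {A B : Type u} (X : A → ModScheme.{u})
    (g : ∀ a, (X a).scheme ⟶ S) (Z : B → ModScheme.{u}) (s t : B → A)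
    (σ : ∀ b, Z b ⟶ X (s b)) (τ : ∀ b, Z b ⟶ X (t b))
    (hb : ∀ b, base (σ b) ≫ g (s b) = base (τ b) ≫ g (t b)) :
    ∃ (N : S.Modules) (ρ : ∀ a, X a ⟶ (⟨S, N⟩ : ModScheme.{u})) (hρ : ∀ a, base (ρ a) = g a),
      (∀ b, σ b ≫ ρ (s b) = τ b ≫ ρ (t b)) ∧
      ∀ (W : S.Opens) (x : ∀ a, Γ((X a).sheaf, g a ⁻¹ᵁ W)),
        (∀ b (U : (Z b).scheme.Opens) (h1 : U ≤ base (σ b) ⁻¹ᵁ (g (s b) ⁻¹ᵁ W))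
          (h2 : U ≤ base (τ b) ⁻¹ᵁ (g (t b) ⁻¹ᵁ W)),
          res (σ b) _ U h1 (x (s b)) = res (τ b) _ U h2 (x (t b))) →
        ∃! n : Γ(N, W), ∀ a, res (ρ a) W (g a ⁻¹ᵁ W) (by rw [hρ]) n = x a := by
  let F (a : A) : S.Modules := (Scheme.Modules.pushforward (g a)).obj (X a).sheaf
  let f (b : B) : (Z b).scheme ⟶ S := base (σ b) ≫ g (s b)
  let K (b : B) : S.Modules := (Scheme.Modules.pushforward (f b)).obj (Z b).sheaf
  have hf' (b : B) : f b = base (τ b) ≫ g (t b) := hb b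
  choose α hα using fun b ↦ pushforward_factor (f b) (N := F (s b))
    (σ b ≫ toPushforward (X (s b)) (g (s b))) rfl
  choose β hβ using fun b ↦ pushforward_factor (f b) (N := F (t b))
    (τ b ≫ toPushforward (X (t b)) (g (t b))) (hb b).symm
  -- The sheaf is the equalizer of the products of direct images, in the form of a multiequalizer.
  let J : MulticospanShape.{u, u} := ⟨A, B, s, t⟩
  let M : MulticospanIndex J S.Modules := ⟨F, K, α, β⟩
  let N := limit M.multicospan
  let π (a : A) : N ⟶ F a := limit.π M.multicospan (WalkingMulticospan.left a)
  have hπ (b : B) : π (s b) ≫ α b = π (t b) ≫ β b := by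
    exact (limit.w M.multicospan (WalkingMulticospan.Hom.fst b)).trans
      (limit.w M.multicospan (WalkingMulticospan.Hom.snd b)).symm
  let ρ (a : A) : X a ⟶ (⟨S, N⟩ : ModScheme.{u}) := toPushforward (X a) (g a) ≫ vert (π a)
  have hρ (a : A) : base (ρ a) = g a := Category.comp_id _
  refine ⟨N, ρ, hρ, fun b ↦ ?_, fun W x hx ↦ ?_⟩
  · have h1 : σ b ≫ ρ (s b) = toPushforward (Z b) (f b) ≫ vert (α b) ≫ vert (π (s b)) := by
      rw [← Category.assoc (toPushforward _ _), hα, Category.assoc]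
    have h2 : τ b ≫ ρ (t b) = toPushforward (Z b) (f b) ≫ vert (β b) ≫ vert (π (t b)) := by
      rw [← Category.assoc (toPushforward _ _), hβ, Category.assoc]
    rw [h1, h2, ← vert_comp, ← vert_comp, hπ]
  · have hres (a : A) (n : Γ(N, W)) : res (ρ a) W (g a ⁻¹ᵁ W) (by rw [hρ]) n =
        (π a).app W n := by
      refine (comp_res (toPushforward (X a) (g a)) (vert (π a)) (V := W) _ le_rfl le_rfl n).trans ?_
      exact (congrArg _ (vert_res (π a) W n)).trans (toPushforward_res _ _ _ _ _)
    have hα' (b : B) (m : Γ((X (s b)).sheaf, g (s b) ⁻¹ᵁ W)) :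
        (α b).app W m = res (σ b) _ (f b ⁻¹ᵁ W) le_rfl m :=
      pushforward_factor_res (σ b) (g (s b)) (f b) (hα b) W _ m
    have hβ' (b : B) (m : Γ((X (t b)).sheaf, g (t b) ⁻¹ᵁ W)) :
        (β b).app W m = res (τ b) _ (f b ⁻¹ᵁ W) (by rw [hf']; rfl) m :=
      pushforward_factor_res (τ b) (g (t b)) (f b) (hβ b) W _ m
    -- Sections over `W` commute with limits.
    let e := Types.isLimitEquivSections
      (isLimitOfPreserves (sectionsFunctor W) (limit.isLimit M.multicospan))
    have he (n : Γ(N, W)) (a : A) :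
        (e n).1 (WalkingMulticospan.left a) = (π a).app W n := rfl
    let z : (M.multicospan ⋙ sectionsFunctor W).sections :=
      ⟨fun c ↦ match c with
        | .left a => x a
        | .right b => (α b).app W (x (s b)), by
      intro c d i
      change WalkingMulticospan.Hom c d at i
      cases i with
      | id => exact types_congr_hom (CategoryTheory.Functor.map_id _ _) _
      | fst b => rfl
      | snd b =>
        refine (hβ' b _).trans (Eq.trans ?_ (hα' b _).symm)
        exact (hx b _ _ _).symm⟩
    refine ⟨e.symm z, fun a ↦ ?_, fun n hn ↦ ?_⟩
    · refine (hres a _).trans ((he _ a).symm.trans ?_)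
      rw [Equiv.apply_symm_apply]
    · refine (e.eq_symm_apply (y := n)).mpr (Subtype.ext (funext fun c ↦ ?_))
      have h1 (a : A) : (e n).1 (WalkingMulticospan.left a) = x a := (he n a).trans
        ((hres a n).symm.trans (hn a))
      cases c with
      | left a => exact h1 a
      | right b =>
        refine ((e n).2 (WalkingMulticospan.Hom.fst b)).symm.trans ?_
        exact congrArg _ (h1 (s b))

end

noncomputable section

open ModScheme

/-! ### Effectivity of descent data -/

namespace DescentDatum

variable {S : Scheme.{u}} {I : Type*} (D : DescentDatum S I)

/-- Every open subscheme of a member is a member. -/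
theorem exists_open (i : I) (O : (D.obj i).scheme.Opens) :
    ∃ (j : I) (h : (D.obj j).scheme ⟶ (D.obj i).scheme) (_ : IsOpenImmersion h),
      h ≫ D.map i = D.map j ∧ h.opensRange = O := by
  obtain ⟨j, e, he, hj⟩ := D.exists_iso i O O.ι
  refine ⟨j, e ≫ O.ι, inferInstance, (Category.assoc _ _ _).trans hj, ?_⟩
  rw [Scheme.Hom.opensRange_comp_of_isIso, Scheme.Opens.opensRange_ι]

theorem bijective_res_trans {i j : I} (h : (D.obj j).scheme ⟶ (D.obj i).scheme)
    [hh : IsOpenImmersion h] (w : h ≫ D.map i = D.map j) (O : (D.obj i).scheme.Opens)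
    (hO : h.opensRange = O) (hle : ⊤ ≤ base (D.trans h w) ⁻¹ᵁ O) :
    Function.Bijective (res (D.trans h w) O ⊤ hle) := by
  have : IsOpenImmersion (base (D.trans h w)) := by rw [D.base_trans]; exact hh
  refine bijective_res_opensRange _ (D.cart_trans _ _) O ?_ hle
  subst hO
  ext1
  exact congrArg (fun f : (D.obj j).scheme ⟶ (D.obj i).scheme ↦ Set.range f)
    (D.base_trans h w).symm

theorem le_preimage {i j : I} {h : (D.obj j).scheme ⟶ (D.obj i).scheme}
    (w : h ≫ D.map i = D.map j) {W : S.Opens} (hj : D.map j ⁻¹ᵁ W = ⊤) :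
    ⊤ ≤ base (D.trans h w) ⁻¹ᵁ (D.map i ⁻¹ᵁ W) := by
  rw [D.base_trans, ← hj, ← w]
  rfl

/-- A compatible family of sections on the members that lie over an open subset `W` is induced
by a section over the preimage of `W` in any member. -/
theorem exists_section (W : S.Opens)
    (x : ∀ i, D.map i ⁻¹ᵁ W = ⊤ → Γ((D.obj i).sheaf, ⊤))
    (hx : ∀ (i j : I) (h : (D.obj i).scheme ⟶ (D.obj j).scheme) (w) (hi) (hj),
      glob (D.trans h w) (x j hj) = x i hi) (i : I) :
    ∃ y : Γ((D.obj i).sheaf, D.map i ⁻¹ᵁ W), ∀ (j : I) (h : (D.obj j).scheme ⟶ (D.obj i).scheme)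
      (w : h ≫ D.map i = D.map j) (hj : D.map j ⁻¹ᵁ W = ⊤),
        res (D.trans h w) (D.map i ⁻¹ᵁ W) ⊤ (D.le_preimage w hj) y = x j hj := by
  obtain ⟨t, e, he, wt, ht⟩ := D.exists_open i (D.map i ⁻¹ᵁ W)
  have hle : ⊤ ≤ e ⁻¹ᵁ (D.map i ⁻¹ᵁ W) := by
    intro y _
    exact ht.le ⟨y, rfl⟩
  have ht' : D.map t ⁻¹ᵁ W = ⊤ := by
    rw [← wt]
    exact top_le_iff.mp hle
  obtain ⟨y, hy⟩ := (D.bijective_res_trans e wt _ ht (D.le_preimage wt ht')).2 (x t ht')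
  refine ⟨y, fun j h w hj ↦ ?_⟩
  let h' : (D.obj j).scheme ⟶ (D.obj t).scheme := IsOpenImmersion.lift e h (by
    have h1 : Set.range h ⊆ (D.map i ⁻¹ᵁ W : (D.obj i).scheme.Opens) := by
      rintro _ ⟨z, rfl⟩
      have h2 : z ∈ D.map j ⁻¹ᵁ W := hj ▸ trivial
      rw [← w] at h2
      exact h2
    rw [← ht] at h1
    exact h1)
  have hh' : h' ≫ e = h := IsOpenImmersion.lift_fac _ _ _
  have w' : h' ≫ D.map t = D.map j := by rw [← wt, ← w, ← hh', Category.assoc]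
  have h3 : D.trans h' w' ≫ D.trans e wt = D.trans h w :=
    (D.trans_comp _ _ _ _ (by rw [hh', w])).trans (D.trans_congr hh' _)
  rw [← hx j t h' w' hj ht', ← hy]
  refine Eq.trans ?_ (glob_res _ _ _ _ ?_ y).symm
  exact res_congr h3.symm _ _ _

/-- Sections of a member are detected on its refinements by a covering family. -/
theorem glob_refine_injective {A : Type*} (κ : A → I)
    (hκ : Sieve.ofArrows (fun a ↦ (D.obj (κ a)).scheme) (fun a ↦ D.map (κ a)) ∈
      Scheme.etaleTopology S) (i : I) {y z : Γ((D.obj i).sheaf, ⊤)}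
    (h : ∀ r : D.Refinement κ i, glob (D.refine κ i r) y = glob (D.refine κ i r) z) : y = z := by
  refine ((D.etaleCovering_refine κ hκ i).secDescent (D.cart_refine κ i) (D.qc i)
    (fun r ↦ glob (D.refine κ i r) z) fun r s Z a b _ _ e ↦ ?_).unique h fun _ ↦ rfl
  rw [← glob_comp, ← glob_comp, e]

/-- The index type of a descent datum may be large, but a covering family indexed by a small type
exists. -/
theorem exists_small_covering : ∃ (A : Type u) (κ : A → I),
    Sieve.ofArrows (fun a ↦ (D.obj (κ a)).scheme) (fun a ↦ D.map (κ a)) ∈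
      Scheme.etaleTopology S := by
  obtain ⟨𝒰, hle⟩ := Scheme.mem_grothendieckTopology_iff.mp D.covering
  have H (a : 𝒰.I₀) : ∃ (j : I) (e : (D.obj j).scheme ⟶ 𝒰.X a), IsIso e ∧
      e ≫ 𝒰.f a = D.map j := by
    obtain ⟨_, g, _, ⟨j⟩, w⟩ := hle _ _ ⟨a⟩
    obtain ⟨k, e, he, hk⟩ := D.exists_iso j (𝒰.X a) g
    exact ⟨k, e, he, by rw [← hk, ← w]⟩
  choose κ e he hκe using H
  refine ⟨𝒰.I₀, κ, Precoverage.generate_mem_toGrothendieck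
    ((Scheme.ofArrows_mem_precoverage_iff _).mpr ⟨fun s ↦ ?_, fun a ↦ ?_⟩)⟩
  · obtain ⟨a, y, hy⟩ := ((Scheme.ofArrows_mem_precoverage_iff _).mp 𝒰.mem₀).1 s
    refine ⟨a, (inv (e a)) y, ?_⟩
    have h1 : inv (e a) ≫ D.map (κ a) = 𝒰.f a := by rw [← hκe, IsIso.inv_hom_id_assoc]
    rw [← hy, ← h1]
    rfl
  · rw [← hκe]
    have : Etale (𝒰.f a) := 𝒰.map_prop a
    infer_instance

theorem trans_comp_of_eq {i j k : I} {h : (D.obj i).scheme ⟶ (D.obj j).scheme}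
    {h' : (D.obj j).scheme ⟶ (D.obj k).scheme} {g : (D.obj i).scheme ⟶ (D.obj k).scheme}
    (e : h ≫ h' = g) (w : h ≫ D.map j = D.map i) (w' : h' ≫ D.map k = D.map j)
    (w'' : g ≫ D.map k = D.map i) : D.trans h w ≫ D.trans h' w' = D.trans g w'' := by
  subst e
  exact D.trans_comp _ _ _ _ _

/-- Sections of a member over an open subset of the preimage of `W` are detected on the members
that lie over `W`. -/
theorem section_ext {W : S.Opens} {i : I} {O : (D.obj i).scheme.Opens} (hO : O ≤ D.map i ⁻¹ᵁ W)
    {z z' : Γ((D.obj i).sheaf, O)} (hz : ∀ (j : I) (h : (D.obj j).scheme ⟶ (D.obj i).scheme)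
      (w : h ≫ D.map i = D.map j) (_ : D.map j ⁻¹ᵁ W = ⊤) (hle : ⊤ ≤ base (D.trans h w) ⁻¹ᵁ O),
        res (D.trans h w) O ⊤ hle z = res (D.trans h w) O ⊤ hle z') : z = z' := by
  obtain ⟨t, e, he, wt, ht⟩ := D.exists_open i O
  have hle : ⊤ ≤ e ⁻¹ᵁ O := fun y _ ↦ ht.le ⟨y, rfl⟩
  have hle' : ⊤ ≤ base (D.trans e wt) ⁻¹ᵁ O := by rw [D.base_trans]; exact hle
  refine (D.bijective_res_trans e wt O ht hle').1 (hz t e wt ?_ hle')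
  rw [← wt]
  exact top_le_iff.mp (hle.trans (e.preimage_mono hO))

/-- The sheaf of compatible families of sections on a small covering. -/
theorem exists_small_sheaf {A : Type u} (κ : A → I)
    (hκ : Sieve.ofArrows (fun a ↦ (D.obj (κ a)).scheme) (fun a ↦ D.map (κ a)) ∈
      Scheme.etaleTopology S) :
    ∃ (N : S.Modules) (ρ : ∀ a, D.obj (κ a) ⟶ (⟨S, N⟩ : ModScheme.{u}))
      (hρ : ∀ a, base (ρ a) = D.map (κ a)) (τ : ∀ i, D.obj i ⟶ (⟨S, N⟩ : ModScheme.{u})),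
      (∀ i, base (τ i) = D.map i) ∧
      (∀ (i j : I) (h : (D.obj i).scheme ⟶ (D.obj j).scheme) (w), D.trans h w ≫ τ j = τ i) ∧
      (∀ (i : I) (a : A) (h : (D.obj i).scheme ⟶ (D.obj (κ a)).scheme) (w),
        D.trans h w ≫ ρ a = τ i) ∧
      ∀ (W : S.Opens) (y : ∀ a, Γ((D.obj (κ a)).sheaf, D.map (κ a) ⁻¹ᵁ W)),
        (∀ (j : I) (a b : A) (h h') (w : h ≫ D.map (κ a) = D.map j)
          (w' : h' ≫ D.map (κ b) = D.map j) (hj : D.map j ⁻¹ᵁ W = ⊤),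
          res (D.trans h w) _ ⊤ (D.le_preimage w hj) (y a) =
            res (D.trans h' w') _ ⊤ (D.le_preimage w' hj) (y b)) →
        ∃! n : Γ(N, W), ∀ a, res (ρ a) W (D.map (κ a) ⁻¹ᵁ W) (by rw [hρ]) n = y a := by
  choose k p q hpb hk using fun b : A × A ↦ D.exists_prod (κ b.1) (κ b.2)
  have hk' (b : A × A) : q b ≫ D.map (κ b.2) = D.map (k b) := (hpb b).w.symm.trans (hk b)
  obtain ⟨N, ρ, hρ, hρc, hN⟩ := exists_matching (fun a ↦ D.obj (κ a)) (fun a ↦ D.map (κ a))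
    (fun b : A × A ↦ D.obj (k b)) Prod.fst Prod.snd (fun b ↦ D.trans (p b) (hk b))
    (fun b ↦ D.trans (q b) (hk' b)) (fun b ↦ by rw [D.base_trans, D.base_trans, hk, hk'])
  obtain ⟨τ, hτ, hτt, hτρ⟩ := D.exists_extension κ hκ ρ hρ fun l a b h h' w w' ↦ by
    let c := (hpb (a, b)).lift h h' (w.trans w'.symm)
    have h1 : c ≫ p (a, b) = h := (hpb (a, b)).lift_fst _ _ _
    have h2 : c ≫ q (a, b) = h' := (hpb (a, b)).lift_snd _ _ _
    have h3 : c ≫ D.map (k (a, b)) = D.map l := by rw [← hk, ← w, ← h1, Category.assoc]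
    rw [← D.trans_comp_of_eq h1 h3 (hk _) w, ← D.trans_comp_of_eq h2 h3 (hk' _) w',
      Category.assoc, Category.assoc]
    exact congrArg _ (hρc (a, b))
  refine ⟨N, ρ, hρ, τ, hτ, hτt, hτρ, fun W y hy ↦ hN W y fun b U h1 h2 ↦ ?_⟩
  refine D.section_ext (W := W) (i := k b) (O := U) ?_ fun j h w hj hle ↦ ?_
  · refine h1.trans ?_
    rw [D.base_trans, ← hk]
    rfl
  · have h3 : (h ≫ p b) ≫ D.map (κ b.1) = D.map j := by rw [Category.assoc, hk, w]
    have h4 : (h ≫ q b) ≫ D.map (κ b.2) = D.map j := by rw [Category.assoc, hk', w]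
    have h5 := comp_res (D.trans h w) (D.trans (p b) (hk b))
      (hle.trans (Scheme.Hom.preimage_mono _ h1)) hle h1 (y b.1)
    have h6 := comp_res (D.trans h w) (D.trans (q b) (hk' b))
      (hle.trans (Scheme.Hom.preimage_mono _ h2)) hle h2 (y b.2)
    refine h5.symm.trans (Eq.trans ?_ h6)
    refine (res_congr (D.trans_comp _ _ _ _ h3) _ _ _).trans (Eq.trans ?_
      (res_congr (D.trans_comp _ _ _ _ h4) _ _ _).symm)
    exact hy j _ _ _ _ h3 h4 hj

/-- The sheaf of compatible families of sections: its sections over `W` are the compatible families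
of sections of the members that lie over `W`. It is obtained from a small covering family. -/
theorem exists_sheaf : ∃ (N : S.Modules) (τ : ∀ i, D.obj i ⟶ (⟨S, N⟩ : ModScheme.{u}))
    (hτ : ∀ i, base (τ i) = D.map i),
    (∀ (i j : I) (h : (D.obj i).scheme ⟶ (D.obj j).scheme) (w), D.trans h w ≫ τ j = τ i) ∧
    ∀ (W : S.Opens) (x : ∀ i, D.map i ⁻¹ᵁ W = ⊤ → Γ((D.obj i).sheaf, ⊤)),
      (∀ (i j : I) (h : (D.obj i).scheme ⟶ (D.obj j).scheme) (w) (hi) (hj),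
        glob (D.trans h w) (x j hj) = x i hi) →
      ∃! n : Γ(N, W), ∀ i hi, res (τ i) W ⊤ (by rw [hτ, hi]) n = x i hi := by
  obtain ⟨A, κ, hκ⟩ := D.exists_small_covering
  obtain ⟨N, ρ, hρ, τ, hτ, hτt, hτρ, hN⟩ := D.exists_small_sheaf κ hκ
  refine ⟨N, τ, hτ, hτt, fun W x hx ↦ ?_⟩
  choose y hy using D.exists_section W x hx
  obtain ⟨n, hn, hn'⟩ := hN W (fun a ↦ y (κ a)) fun j a b h h' w w' hj ↦
    (hy (κ a) j h w hj).trans (hy (κ b) j h' w' hj).symm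
  have h2 (a : A) : D.map (κ a) ⁻¹ᵁ W ≤ base (ρ a) ⁻¹ᵁ W := by rw [hρ]
  refine ⟨n, fun i hi ↦ ?_, fun n' hn'' ↦ hn' n' fun a ↦ ?_⟩
  · refine D.glob_refine_injective κ hκ i fun r ↦ ?_
    have hr : D.map r.idx ⁻¹ᵁ W = ⊤ := by rw [← r.left_map, Scheme.Hom.comp_preimage, hi]; rfl
    have hr' : D.refine κ i r ≫ τ i = D.trans r.right r.right_map ≫ ρ r.elt :=
      (hτt _ _ _ _).trans (hτρ _ _ _ _).symm
    have h1 : ⊤ ≤ base (D.trans r.right r.right_map ≫ ρ r.elt) ⁻¹ᵁ W :=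
      (D.le_preimage r.right_map hr).trans (Scheme.Hom.preimage_mono _ (h2 _))
    have h3 : ⊤ ≤ base (D.refine κ i r ≫ τ i) ⁻¹ᵁ W := by rw [hr']; exact h1
    have h4 : ⊤ ≤ base (τ i) ⁻¹ᵁ W := by rw [hτ, hi]
    refine (glob_res (D.refine κ i r) (τ i) W h4 h3 n).trans ((res_congr hr' W h3 n).trans ?_)
    refine (comp_res _ _ h1 (D.le_preimage r.right_map hr) (h2 r.elt) n).trans ?_
    refine (congrArg _ (hn r.elt)).trans ?_
    exact (hy (κ r.elt) r.idx r.right r.right_map hr).trans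
      (hx r.idx i r.left r.left_map hr hi).symm
  · refine D.section_ext le_rfl fun j h w hj hle ↦ ?_
    have h1 : ⊤ ≤ base (D.trans h w ≫ ρ a) ⁻¹ᵁ W :=
      hle.trans (Scheme.Hom.preimage_mono _ (h2 _))
    refine (comp_res _ _ h1 hle (h2 a) n').symm.trans ((res_congr (hτρ j a h w) _ h1 n').trans ?_)
    exact (hn'' j hj).trans (hy (κ a) j h w hj).symm

/-- A gluing over an open subset is cartesian over the sheaf of compatible families of sections. -/
theorem cart_of_gluing {N : S.Modules} (τ : ∀ i, D.obj i ⟶ (⟨S, N⟩ : ModScheme.{u}))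
    (hτ : ∀ i, base (τ i) = D.map i)
    (hN : ∀ (W : S.Opens) (x : ∀ i, D.map i ⁻¹ᵁ W = ⊤ → Γ((D.obj i).sheaf, ⊤)),
      (∀ (i j : I) (h : (D.obj i).scheme ⟶ (D.obj j).scheme) (w) (hi) (hj),
        glob (D.trans h w) (x j hj) = x i hi) →
      ∃! n : Γ(N, W), ∀ i hi, res (τ i) W ⊤ (by rw [hτ, hi]) n = x i hi)
    {T : Scheme.{u}} (f : T ⟶ S) [IsOpenImmersion f] (G : (D.pullback f).Gluing)
    (ψ : (⟨T, G.sheaf⟩ : ModScheme.{u}) ⟶ ⟨S, N⟩) (hψ : base ψ = f)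
    (hc : ∀ i, G.hom i ≫ ψ = τ i.1) : Cart ψ := by
  have hψo : IsOpenImmersion (base ψ) := by rw [hψ]; infer_instance
  refine (cart_iff_of_isOpenImmersion ψ).mpr fun V ↦ ?_
  let W : S.Opens := base ψ ''ᵁ V
  have hWV : f ⁻¹ᵁ W = V := by
    rw [← hψ]
    exact (base ψ).preimage_image_eq V
  have hG (i) (hi : (D.pullback f).map i ⁻¹ᵁ V = ⊤) : ⊤ ≤ base (G.hom i) ⁻¹ᵁ V := by
    rw [G.base_hom, hi]
  have hi' (i) : (D.pullback f).map i ⁻¹ᵁ V = ⊤ ↔ D.map i.1 ⁻¹ᵁ W = ⊤ := by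
    rw [← i.2.2, Scheme.Hom.comp_preimage, hWV]
    rfl
  have hres (i) (hi : (D.pullback f).map i ⁻¹ᵁ V = ⊤) (n : Γ(N, W))
      (h : ⊤ ≤ base (τ i.1) ⁻¹ᵁ W) :
      res (G.hom i) V ⊤ (hG i hi) (res ψ W V ((base ψ).preimage_image_eq V).ge n) =
        res (τ i.1) W ⊤ h n := by
    have h1 : ⊤ ≤ base (G.hom i ≫ ψ) ⁻¹ᵁ W := by rw [hc]; exact h
    exact (comp_res (G.hom i) ψ h1 (hG i hi) _ n).symm.trans (res_congr (hc i) W h1 n)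
  -- sections of the gluing are detected on the members
  have hext (y z : Γ(G.sheaf, V)) (hyz : ∀ i hi, res (G.hom i) V ⊤ (hG i hi) y =
      res (G.hom i) V ⊤ (hG i hi) z) : y = z := by
    refine (G.etaleCovering.existsUnique_res G.cart_hom G.qc V
      (fun i ↦ res (G.hom i) V _ le_rfl z) fun i j Z a b _ _ e U ha hb ↦ ?_).unique
      (fun i ↦ ?_) fun _ ↦ rfl
    · have h1 : U ≤ base (a ≫ G.hom i) ⁻¹ᵁ V := ha
      have h2 : U ≤ base (b ≫ G.hom j) ⁻¹ᵁ V := hb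
      exact (comp_res a (G.hom i) h1 ha le_rfl z).symm.trans
        ((res_congr e V h1 z).trans (comp_res b (G.hom j) h2 hb le_rfl z))
    · refine (D.pullback f).section_ext (W := V) (i := i) (O := base (G.hom i) ⁻¹ᵁ V)
        (by rw [G.base_hom]) fun j h w hj hle ↦ ?_
      have h1 : ⊤ ≤ base ((D.pullback f).trans h w ≫ G.hom i) ⁻¹ᵁ V := hle
      have h2 (t : Γ(G.sheaf, V)) := (comp_res ((D.pullback f).trans h w) (G.hom i) h1 hle le_rfl
        t).symm.trans (res_congr (G.trans_hom j i h w) V h1 t)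
      exact (h2 y).trans ((hyz j hj).trans (h2 z).symm)
  refine Function.bijective_iff_existsUnique _ |>.mpr fun y ↦ ?_
  -- members over `W` factor through `f`
  have hfac (i) (hi : D.map i ⁻¹ᵁ W = ⊤) : ∃ g : (D.obj i).scheme ⟶ T, g ≫ f = D.map i := by
    refine ⟨IsOpenImmersion.lift f (D.map i) ?_, IsOpenImmersion.lift_fac _ _ _⟩
    rintro _ ⟨z, rfl⟩
    have h1 : z ∈ D.map i ⁻¹ᵁ W := hi ▸ trivial
    obtain ⟨t, -, ht⟩ := h1
    rw [hψ] at ht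
    exact ⟨t, ht⟩
  choose g hg using hfac
  obtain ⟨n, hn, hn'⟩ := hN W (fun i hi ↦ res (G.hom ⟨i, g i hi, hg i hi⟩) V ⊤
      (hG _ ((hi' ⟨i, g i hi, hg i hi⟩).mpr hi)) y) fun i j h w hi hj ↦ by
    have h1 : h ≫ g j hj = g i hi := by
      rw [← cancel_mono f, Category.assoc, hg, hg, w]
    have h2 := G.trans_hom ⟨i, g i hi, hg i hi⟩ ⟨j, g j hj, hg j hj⟩ h h1
    have h3 : ⊤ ≤ base ((D.pullback f).trans (i := ⟨i, g i hi, hg i hi⟩)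
        (j := ⟨j, g j hj, hg j hj⟩) h h1 ≫ G.hom ⟨j, g j hj, hg j hj⟩) ⁻¹ᵁ V := by
      rw [h2]
      exact hG _ ((hi' ⟨i, g i hi, hg i hi⟩).mpr hi)
    exact (glob_res _ _ _ _ h3 y).trans (res_congr h2 V h3 y)
  refine ⟨n, hext _ _ fun i hi ↦ ?_, fun m hm ↦ hn' m fun i hi ↦ ?_⟩
  · obtain ⟨i, g', hg'⟩ := i
    have h1 : D.map i ⁻¹ᵁ W = ⊤ := (hi' _).mp hi
    obtain rfl : g' = g i h1 := by rw [← cancel_mono f, hg', hg]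
    have h2 : ⊤ ≤ base (τ i) ⁻¹ᵁ W := by rw [hτ, h1]
    exact (hres _ hi n h2).trans (hn i h1)
  · have h2 : ⊤ ≤ base (τ i) ⁻¹ᵁ W := by rw [hτ, hi]
    exact (hres ⟨i, g i hi, hg i hi⟩ ((hi' ⟨i, g i hi, hg i hi⟩).mpr hi) m h2).symm.trans
      (congrArg _ hm)

/-- Étale descent for quasi-coherent sheaves: the sheaf of compatible families of sections is a
gluing, since over affine open subsets it agrees with the gluing that exists there. -/
theorem nonempty_gluing_of_scheme : Nonempty D.Gluing := by
  obtain ⟨N, τ, hτ, hτt, hN⟩ := D.exists_sheaf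
  -- over affine open subsets the descent datum is effective
  have H (U : S.Opens) (hU : IsAffineOpen U) : ∃ (G : (D.pullback U.ι).Gluing)
      (ψ : (⟨U, G.sheaf⟩ : ModScheme.{u}) ⟶ ⟨S, N⟩), base ψ = U.ι ∧
        (∀ i, G.hom i ≫ ψ = τ i.1) ∧ Cart ψ := by
    have : IsAffine U.toScheme := hU
    obtain ⟨G⟩ := (D.pullback U.ι).nonempty_gluing_of_isAffine
    obtain ⟨ψ, ⟨h1, h2⟩, -⟩ := G.etaleCovering.existsUnique_hom G.cart_hom G.qc
      (fun i ↦ τ i.1) U.ι (fun i ↦ by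
        rw [hτ, G.base_hom]
        exact i.2.2.symm) (G.compatible _ fun i j h w ↦ hτt _ _ _ _)
    exact ⟨G, ψ, h1, h2, D.cart_of_gluing τ hτ hN U.ι G ψ h1 h2⟩
  have hQC : QC ⟨S, N⟩ := by
    refine qc_of_forall_exists fun s ↦ ?_
    obtain ⟨U, hU, hs, -⟩ := TopologicalSpace.Opens.isBasis_iff_nbhd.mp S.isBasis_affineOpens
      (TopologicalSpace.Opens.mem_top s)
    let U : S.Opens := U
    refine ⟨U, hs, hU, ?_⟩
    obtain ⟨G, ψ, h1, -, h3⟩ := H U hU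
    let c := h3.lift (restrMap ⟨S, N⟩ U.ι) (𝟙 _) (by rw [h1]; exact Category.id_comp _)
    have hc : c ≫ ψ = restrMap ⟨S, N⟩ U.ι := Cart.lift_comp _ _ _ _
    refine Cart.qc (φ := c) (Cart.of_comp ?_ h3) G.qc
    rw [hc]
    exact cart_restrMap _ _
  refine ⟨⟨N, hQC, τ, hτ, fun i ↦ ?_, hτt⟩⟩
  -- the members over affine open subsets cover every member
  have hloc : Sieve.ofArrows
      (fun a : {j : I // ∃ U : S.Opens, IsAffineOpen U ∧ ∃ g, g ≫ U.ι = D.map j} ↦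
        (D.obj a.1).scheme) (fun a ↦ D.map a.1) ∈ Scheme.etaleTopology S := by
    let V (U : S.affineOpens) : Scheme.{u} := U.1
    have h1 : Sieve.ofArrows V (fun U : S.affineOpens ↦ U.1.ι) ∈ Scheme.etaleTopology S := by
      refine Precoverage.generate_mem_toGrothendieck
        ((Scheme.ofArrows_mem_precoverage_iff _).mpr ⟨fun s ↦ ?_, fun U ↦ ?_⟩)
      · obtain ⟨U, hU, hs, -⟩ := TopologicalSpace.Opens.isBasis_iff_nbhd.mp S.isBasis_affineOpens
          (TopologicalSpace.Opens.mem_top s)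
        exact ⟨⟨U, hU⟩, ⟨s, hs⟩, rfl⟩
      · exact inferInstanceAs (Etale U.1.ι)
    refine Scheme.etaleTopology.superset_covering ?_
      (Scheme.etaleTopology.intersection_covering D.covering h1)
    rintro T f ⟨⟨_, g, _, ⟨i⟩, w⟩, _, g', _, ⟨U⟩, w'⟩
    obtain ⟨j, e, he, hj⟩ := D.exists_iso i T g
    let a : {j : I // ∃ U : S.Opens, IsAffineOpen U ∧ ∃ g, g ≫ U.ι = D.map j} :=
      ⟨j, U.1, U.2, e ≫ g', by rw [← hj, Category.assoc, w', w]⟩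
    refine ⟨_, inv e, _, Presieve.ofArrows.mk a, ?_⟩
    rw [← hj, IsIso.inv_hom_id_assoc, w]
  refine (D.etaleCovering_refine _ hloc i).cart (D.cart_refine _ i) (D.qc i) hQC _ fun r ↦ ?_
  obtain ⟨U, hU, g, hg⟩ := r.elt.2
  obtain ⟨G, ψ, h1, h2, h3⟩ := H U hU
  have h4 : D.refine _ i r ≫ τ i = τ r.idx := hτt _ _ _ _
  have h5 : (r.right ≫ g) ≫ U.ι = D.map r.idx := by rw [Category.assoc, hg, r.right_map]
  rw [h4, ← h2 ⟨r.idx, r.right ≫ g, h5⟩]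
  exact (G.cart_hom _).comp h3

end DescentDatum

end

noncomputable section

open ModScheme

/-! ### Systems of sheaves as functors -/

/-- The transposition under adjunctions of a composition of morphisms over `f` and `g`, when the
comparison isomorphisms for left and right adjoints are conjugate. -/
theorem homEquiv_conjugateEquiv {A B C : Type*} [Category* A] [Category* B] [Category* C]
    {F : B ⥤ A} {F' : A ⥤ B} {G : C ⥤ B} {G' : B ⥤ C} {H : C ⥤ A} {H' : A ⥤ C} (f : F ⊣ F')
    (g : G ⊣ G') (h : H ⊣ H') (i : G ⋙ F ≅ H) (j : F' ⋙ G' ≅ H')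
    (e : conjugateEquiv (g.comp f) h i.inv = j.hom) {M : C} {K : B} {N : A} (a : G.obj M ⟶ K)
    (b : F.obj K ⟶ N) :
    h.homEquiv _ _ (i.inv.app M ≫ F.map a ≫ b) =
      g.homEquiv _ _ a ≫ G'.map (f.homEquiv _ _ b) ≫ j.hom.app N := by
  have h1 := unit_conjugateEquiv (g.comp f) h i.inv M
  rw [e] at h1
  rw [Adjunction.homEquiv_unit, Adjunction.homEquiv_unit, Adjunction.homEquiv_unit,
    Functor.map_comp, ← Category.assoc, ← h1]
  have h2 := j.hom.naturality (F.map a ≫ b)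
  rw [Category.assoc]
  refine (congrArg ((g.comp f).unit.app M ≫ ·) h2.symm).trans ?_
  have h3 := f.unit.naturality a
  dsimp at h3
  simp only [Adjunction.comp_unit_app, Functor.comp_map, Functor.map_comp, Category.assoc]
  rw [← Functor.map_comp_assoc, ← h3, Functor.map_comp_assoc]

namespace ModScheme

/-- Composition in `ModScheme` corresponds to the composition of morphisms of pullbacks that appears in
the compatibility condition for systems of sheaves. -/
theorem homOfPullback_comp {X Y Z : Scheme.{u}} (f : X ⟶ Y) (g : Y ⟶ Z) (h : X ⟶ Z)
    (w : f ≫ g = h) {M : Z.Modules} {K : Y.Modules} {N : X.Modules}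
    (a : (Scheme.Modules.pullback g).obj M ⟶ K) (b : (Scheme.Modules.pullback f).obj K ⟶ N) :
    homOfPullback h ((pullbackIso f g h w M).hom ≫ (Scheme.Modules.pullback f).map a ≫ b) =
      homOfPullback f b ≫ homOfPullback g a := by
  subst w
  have h1 : (pullbackIso f g (f ≫ g) rfl M).hom = (Scheme.Modules.pullbackComp f g).inv.app M := by
    unfold pullbackIso
    rw [appIso_hom, pullbackCongr_hom]
    exact Category.id_comp _
  have h2 := homEquiv_conjugateEquiv _ _ _ (Scheme.Modules.pullbackComp f g)
    (Scheme.Modules.pushforwardComp f g) (Scheme.Modules.conjugateEquiv_pullbackComp_inv f g) a b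
  unfold homOfPullback
  rw [h1, h2]
  rfl

end ModScheme

namespace ModuleSystem

variable {C : Type*} [Category* C] {p : C ⥤ Scheme.{u}}

/-- A value of a system of sheaves, as a scheme with a sheaf of modules. -/
def pair (M : ModuleSystem p) (c : C) : ModScheme.{u} := ⟨p.obj c, M.obj c⟩

/-- The morphism of schemes with sheaves of modules given by a system of sheaves. -/
def arrow (M : ModuleSystem p) {c d : C} (f : c ⟶ d) : M.pair c ⟶ M.pair d :=
  homOfPullback (p.map f) (M.iso f).hom

variable (M N : ModuleSystem p)

theorem cart_arrow {c d : C} (f : c ⟶ d) : Cart (M.arrow f) :=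
  (cart_homOfPullback_iff _ _).mpr inferInstance

theorem arrow_comp {c d e : C} (f : c ⟶ d) (g : d ⟶ e) :
    M.arrow (f ≫ g) = M.arrow f ≫ M.arrow g := by
  unfold arrow
  rw [M.iso_comp]
  exact homOfPullback_comp _ _ _ _ _ _

theorem arrow_id (c : C) : M.arrow (𝟙 c) = 𝟙 (M.pair c) := by
  -- The structure morphism of an identity is idempotent and invertible.
  have h1 : base (M.arrow (𝟙 c)) = 𝟙 (p.obj c) := p.map_id c
  have : IsIso (base (M.arrow (𝟙 c))) := by
    rw [h1]
    exact inferInstanceAs (IsIso (𝟙 (p.obj c)))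
  have := (M.cart_arrow (𝟙 c)).isIso
  rw [← cancel_epi (M.arrow (𝟙 c)), ← arrow_comp, Category.comp_id, Category.comp_id]

/-- A system of sheaves is determined by cartesian morphisms, compatible with composition. -/
theorem exists_of_arrow (obj : ∀ c, (p.obj c).Modules)
    (arrow : ∀ {c d : C}, (c ⟶ d) → ((⟨p.obj c, obj c⟩ : ModScheme.{u}) ⟶ ⟨p.obj d, obj d⟩))
    (hb : ∀ {c d : C} (f : c ⟶ d), base (arrow f) = p.map f)
    (hc : ∀ {c d : C} (f : c ⟶ d), Cart (arrow f))
    (comp : ∀ {c d e : C} (f : c ⟶ d) (g : d ⟶ e), arrow (f ≫ g) = arrow f ≫ arrow g) :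
    ∃ (iso : ∀ {c d : C} (f : c ⟶ d), (Scheme.Modules.pullback (p.map f)).obj (obj d) ≅ obj c)
      (iso_comp : _), ∀ {c d : C} (f : c ⟶ d),
      (ModuleSystem.mk obj iso iso_comp).arrow f = arrow f := by
  choose a ha using fun (c d : C) (f : c ⟶ d) ↦ eq_homOfPullback (arrow f) (hb f)
  have hi (c d : C) (f : c ⟶ d) : IsIso (a c d f) :=
    (cart_homOfPullback_iff _ _).mp (ha c d f ▸ hc f)
  refine ⟨fun {c d} f ↦ asIso (a c d f), fun {c d e} f g ↦ ?_, fun {c d} f ↦ ha c d f⟩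
  apply homOfPullback_injective
  refine (ha _ _ _).trans (Eq.trans ?_ (homOfPullback_comp _ _ _ _ _ _).symm)
  exact (comp f g).trans (congrArg₂ (· ≫ ·) (ha _ _ _).symm (ha _ _ _).symm)

variable {M N}

theorem arrow_comp_vert (φ : M ⟶ N) {c d : C} (f : c ⟶ d) :
    N.arrow f ≫ (vert (Hom.app φ d) : N.pair d ⟶ M.pair d) =
      (vert (Hom.app φ c) : N.pair c ⟶ M.pair c) ≫ M.arrow f :=
  (homOfPullback_comp_vert _ _ _).trans ((congrArg _ (Hom.comm φ f)).trans
    (vert_comp_homOfPullback _ _ _).symm)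

/-- A morphism `M ⟶ N` of systems of sheaves is a family of morphisms over the identities, in the
opposite direction, that commutes with the structure morphisms. -/
theorem exists_hom (v : ∀ c, N.pair c ⟶ M.pair c) (hv : ∀ c, base (v c) = 𝟙 (p.obj c))
    (h : ∀ {c d : C} (f : c ⟶ d), N.arrow f ≫ v d = v c ≫ M.arrow f) :
    ∃ φ : M ⟶ N, ∀ c, vert (Hom.app φ c) = v c := by
  choose a ha using fun c ↦ exists_vert (S := p.obj c) (M := M.obj c) (N := N.obj c) (v c) (hv c)
  refine ⟨⟨a, fun {c d} f ↦ homOfPullback_injective (p.map f) ?_⟩, ha⟩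
  refine (homOfPullback_comp_vert _ _ _).symm.trans (Eq.trans ?_ (vert_comp_homOfPullback _ _ _))
  exact (congrArg (N.arrow f ≫ ·) (ha d)).trans ((h f).trans
    (congrArg (· ≫ M.arrow f) (ha c).symm))

theorem hom_ext {φ ψ : M ⟶ N} (h : ∀ c, vert (Hom.app φ c) = vert (Hom.app ψ c)) : φ = ψ :=
  Hom.ext (funext fun c ↦ vert_injective (h c))

/-- A morphism of systems of sheaves whose components are isomorphisms is an isomorphism. -/
theorem isIso_of_isIso_app (φ : M ⟶ N) (h : ∀ c, IsIso (Hom.app φ c)) : IsIso φ := by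
  refine ⟨⟨fun c ↦ inv (Hom.app φ c), fun {c d} f ↦ ?_⟩, ?_, ?_⟩
  · rw [Functor.map_inv, IsIso.inv_comp_eq, ← Category.assoc, IsIso.eq_comp_inv]
    exact (Hom.comm φ f).symm
  · exact Hom.ext (funext fun c ↦ IsIso.hom_inv_id _)
  · exact Hom.ext (funext fun c ↦ IsIso.inv_hom_id _)

end ModuleSystem

end

noncomputable section

open ModScheme

/-! ### Comparison of categories fibred over schemes -/

section LocalEquivalence

variable {P Q : Type*} [Category* P] [Category* Q] {u : P ⥤ Q} {q : Q ⥤ Scheme.{u}}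

/-- The pairs of morphisms of `P` with common source through which a morphism `φ` of `Q` comes from
`P`: the composition of `left` with `φ` is `right`. -/
structure Roof (u : P ⥤ Q) {s t : P} (φ : u.obj s ⟶ u.obj t) where
  top : P
  left : top ⟶ s
  right : top ⟶ t
  fac : u.map left ≫ φ = u.map right

/-- The morphisms that equalize two given morphisms. -/
structure Equalizing {s t : P} (b b' : s ⟶ t) where
  top : P
  hom : top ⟶ s
  w : hom ≫ b = hom ≫ b'

/-- A functor `u` between categories over schemes, all of whose morphisms are cartesian, that
étale-locally on the base schemes is an equivalence: every object of `Q`, every morphism of `Q`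
between objects of `P`, and every equality in `Q` of morphisms of `P`, come from `P` after restriction
to an étale covering. -/
structure IsLocalEquivalence (u : P ⥤ Q) (q : Q ⥤ Scheme.{u}) : Prop where
  existsUnique_left : ∀ {r s t : P} (c : s ⟶ t) (d : r ⟶ t)
    (h : q.obj (u.obj r) ⟶ q.obj (u.obj s)), h ≫ q.map (u.map c) = q.map (u.map d) →
      ∃! e : r ⟶ s, q.map (u.map e) = h ∧ e ≫ c = d
  existsUnique_right : ∀ {x y z : Q} (c : y ⟶ z) (d : x ⟶ z) (h : q.obj x ⟶ q.obj y),
    h ≫ q.map c = q.map d → ∃! e : x ⟶ y, q.map e = h ∧ e ≫ c = d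
  exists_lift : ∀ (t : P) (T : Scheme.{u}) (f : T ⟶ q.obj (u.obj t)),
    ∃ (s : P) (c : s ⟶ t) (e : q.obj (u.obj s) ⟶ T), IsIso e ∧ e ≫ f = q.map (u.map c)
  covering : ∀ x : Q, Sieve.ofArrows (fun a : Σ t, u.obj t ⟶ x ↦ q.obj (u.obj a.1))
    (fun a ↦ q.map a.2) ∈ Scheme.etaleTopology (q.obj x)
  full : ∀ {s t : P} (φ : u.obj s ⟶ u.obj t),
    Sieve.ofArrows (fun a : Roof u φ ↦ q.obj (u.obj a.top)) (fun a ↦ q.map (u.map a.left)) ∈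
      Scheme.etaleTopology (q.obj (u.obj s))
  faithful : ∀ {s t : P} (b b' : s ⟶ t), u.map b = u.map b' →
    Sieve.ofArrows (fun a : Equalizing b b' ↦ q.obj (u.obj a.top))
      (fun a ↦ q.map (u.map a.hom)) ∈ Scheme.etaleTopology (q.obj (u.obj s))

namespace IsLocalEquivalence

variable (H : IsLocalEquivalence u q)

include H

/-- Compatibility of morphisms on the charts of an object can be tested on morphisms of `P`. -/
theorem compatible (N : ModuleSystem q) (hN : isQCoh q N) (x : Q) {W : ModScheme.{u}}
    (σ : ∀ a : Σ t, u.obj t ⟶ x, N.pair (u.obj a.1) ⟶ W)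
    (g : q.obj x ⟶ W.scheme) (hg : ∀ a, base (σ a) = q.map a.2 ≫ g)
    (hσ : ∀ (s : P) (a a' : Σ t, u.obj t ⟶ x) (b : s ⟶ a.1) (b' : s ⟶ a'.1),
      u.map b ≫ a.2 = u.map b' ≫ a'.2 → N.arrow (u.map b) ≫ σ a = N.arrow (u.map b') ≫ σ a') :
    Compatible (fun a : Σ t, u.obj t ⟶ x ↦ N.arrow a.2) σ := by
  intro a a' Z α β hα hβ w
  -- Up to isomorphism `α` is the structure morphism of some `c` in `P`, and `β` that of a morphism
  -- `φ` in `Q`; the latter comes from `P` on a covering.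
  obtain ⟨s, c, e, he, hc⟩ := H.exists_lift a.1 Z.scheme (base α)
  let γ : N.pair (u.obj s) ⟶ Z := hα.lift (N.arrow (u.map c)) e hc
  have hγ : base γ = e := Cart.base_lift _ _ _ _
  have hγα : γ ≫ α = N.arrow (u.map c) := Cart.lift_comp _ _ _ _
  have : IsIso γ := by
    have : IsIso (base γ) := hγ ▸ he
    exact (Cart.of_comp (hγα ▸ N.cart_arrow _) hα).isIso
  have hb : (e ≫ base β) ≫ q.map a'.2 = q.map (u.map c ≫ a.2) := by
    rw [q.map_comp, ← hc]
    exact (Category.assoc _ _ _).trans ((congrArg (e ≫ ·) (congrArg base w).symm).trans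
      (Category.assoc _ _ _).symm)
  obtain ⟨φ, ⟨h1, h2⟩, -⟩ := H.existsUnique_right a'.2 (u.map c ≫ a.2) (e ≫ base β) hb
  have hφ : γ ≫ β = N.arrow φ := by
    refine (N.cart_arrow a'.2).hom_ext ?_ ?_
    · rw [base_comp, hγ]
      exact h1.symm
    · rw [Category.assoc, ← w, ← Category.assoc, hγα, ← N.arrow_comp, ← N.arrow_comp, h2]
  rw [← cancel_epi γ, ← Category.assoc, ← Category.assoc, hγα, hφ]
  have hcov : EtaleCovering fun r : Roof u φ ↦ N.arrow (u.map r.left) := H.full φ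
  refine hcov.hom_ext (fun _ ↦ N.cart_arrow _) (hN _) ?_ fun r ↦ ?_
  · refine (congrArg (q.map (u.map c) ≫ ·) (hg a)).trans
      (Eq.trans ?_ (congrArg (q.map φ ≫ ·) (hg a')).symm)
    refine (Category.assoc _ _ _).symm.trans (Eq.trans ?_ (Category.assoc _ _ _))
    rw [← q.map_comp, ← q.map_comp, h2]
  · rw [← Category.assoc, ← Category.assoc, ← N.arrow_comp, ← N.arrow_comp, r.fac, ← u.map_comp]
    refine hσ _ _ _ _ _ ?_
    rw [u.map_comp, Category.assoc, ← h2, ← Category.assoc, r.fac]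

theorem etaleCovering (N : ModuleSystem q) (x : Q) :
    EtaleCovering fun a : Σ t, u.obj t ⟶ x ↦ N.arrow a.2 := H.covering x

/-- Morphisms are determined by their components at the objects of `P`, which cover all others. -/
theorem faithful_precomp : (QCoh.precomp u q).Faithful where
  map_injective {M N φ ψ} e := by
    refine ObjectProperty.hom_ext _ (ModuleSystem.hom_ext fun x ↦ ?_)
    refine (H.etaleCovering N.1 x).hom_ext (fun _ ↦ N.1.cart_arrow _) (N.2 x) rfl fun a ↦ ?_
    refine (ModuleSystem.arrow_comp_vert φ.hom a.2).trans (Eq.trans ?_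
      (ModuleSystem.arrow_comp_vert ψ.hom a.2).symm)
    have h1 : ModuleSystem.Hom.app φ.hom (u.obj a.1) = ModuleSystem.Hom.app ψ.hom (u.obj a.1) :=
      congrArg (fun χ : (QCoh.precomp u q).obj M ⟶ (QCoh.precomp u q).obj N ↦
        ModuleSystem.Hom.app χ.hom a.1) e
    rw [h1]

/-- A morphism of the restricted systems extends by descent of morphisms. -/
theorem full_precomp : (QCoh.precomp u q).Full where
  map_surjective {M N} ψ := by
    let v (t : P) : N.1.pair (u.obj t) ⟶ M.1.pair (u.obj t) := vert (ModuleSystem.Hom.app ψ.hom t)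
    have hv {s t : P} (b : s ⟶ t) : N.1.arrow (u.map b) ≫ v t = v s ≫ M.1.arrow (u.map b) :=
      ModuleSystem.arrow_comp_vert ψ.hom b
    have hbv (t : P) : base (v t) = 𝟙 (q.obj (u.obj t)) := rfl
    have hexists (x : Q) := (H.etaleCovering N.1 x).existsUnique_hom (W := M.1.pair x)
      (fun _ ↦ N.1.cart_arrow _) (N.2 x) (fun a ↦ v a.1 ≫ M.1.arrow a.2) (𝟙 (q.obj x))
      (fun a ↦ (Category.id_comp _).trans (Category.comp_id (q.map a.2)).symm)
      (H.compatible N.1 N.2 x _ (𝟙 (q.obj x))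
        (fun a ↦ (Category.id_comp _).trans (Category.comp_id (q.map a.2)).symm)
        fun s a a' b b' w ↦ by
          rw [← Category.assoc, ← Category.assoc, hv, hv, Category.assoc, Category.assoc,
            ← ModuleSystem.arrow_comp, ← ModuleSystem.arrow_comp, w])
    choose w hw _ using hexists
    obtain ⟨φ, hφ⟩ := ModuleSystem.exists_hom w (fun x ↦ (hw x).1) fun {x y} f ↦ by
      refine (H.etaleCovering N.1 x).hom_ext (fun _ ↦ N.1.cart_arrow _) (N.2 x) ?_ fun a ↦ ?_
      · refine (congrArg (q.map f ≫ ·) (hw y).1).trans ?_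
        refine Eq.trans ?_ (congrArg (· ≫ q.map f) (hw x).1.symm)
        exact (Category.comp_id _).trans (Category.id_comp _).symm
      · rw [← Category.assoc, ← Category.assoc, (hw x).2 a, ← ModuleSystem.arrow_comp,
          Category.assoc, ← ModuleSystem.arrow_comp]
        exact (hw y).2 ⟨a.1, a.2 ≫ f⟩
    refine ⟨⟨φ⟩, ObjectProperty.hom_ext _ (ModuleSystem.hom_ext fun t ↦ ?_)⟩
    refine (hφ (u.obj t)).trans ?_
    have h1 := (hw (u.obj t)).2 ⟨t, 𝟙 _⟩
    dsimp only at h1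
    rw [ModuleSystem.arrow_id, Category.id_comp, ModuleSystem.arrow_id, Category.comp_id] at h1
    exact h1

/-- The extension of a system of sheaves to the morphisms of `Q` between objects of `P`. -/
theorem exists_extend (M : ModuleSystem (u ⋙ q)) (hM : isQCoh (u ⋙ q) M) :
    ∃ m : ∀ {s t : P}, (u.obj s ⟶ u.obj t) → (M.pair s ⟶ M.pair t),
      (∀ {s t : P} (φ : u.obj s ⟶ u.obj t), base (m φ) = q.map φ) ∧
      (∀ {s t : P} (φ : u.obj s ⟶ u.obj t), Cart (m φ)) ∧
      (∀ {s t : P} (b : s ⟶ t), m (u.map b) = M.arrow b) ∧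
      (∀ {r s t : P} (φ : u.obj r ⟶ u.obj s) (ψ : u.obj s ⟶ u.obj t), m (φ ≫ ψ) = m φ ≫ m ψ) := by
  have hcov {s t : P} (φ : u.obj s ⟶ u.obj t) :
      EtaleCovering fun r : Roof u φ ↦ M.arrow r.left := H.full φ
  have hexists {s t : P} (φ : u.obj s ⟶ u.obj t) := (hcov φ).existsUnique_hom (W := M.pair t)
    (fun _ ↦ M.cart_arrow _) (hM s) (fun r ↦ M.arrow r.right) (q.map φ) (fun r ↦ by
      refine Eq.trans ?_ (q.map_comp (u.map r.left) φ)
      rw [r.fac]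
      rfl) (by
      intro r r' Z α β hα hβ w
      dsimp only at α β w
      -- Up to isomorphism `α` and `β` are structure morphisms of morphisms `c` and `d` of `P`. The two
      -- sides agree in `Q`, hence on a covering in `P`.
      obtain ⟨z, c, e, he, hc⟩ := H.exists_lift r.top Z.scheme (base α)
      let γ : M.pair z ⟶ Z := hα.lift (M.arrow c) e hc
      have hγ : base γ = e := Cart.base_lift _ _ _ _
      have hγα : γ ≫ α = M.arrow c := Cart.lift_comp _ _ _ _
      have : IsIso γ := by
        have : IsIso (base γ) := hγ ▸ he
        exact (Cart.of_comp (hγα ▸ M.cart_arrow _) hα).isIso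
      have hb : (e ≫ base β) ≫ q.map (u.map r'.left) = q.map (u.map (c ≫ r.left)) := by
        rw [u.map_comp, q.map_comp, ← hc]
        exact (Category.assoc _ _ _).trans ((congrArg (e ≫ ·) (congrArg base w).symm).trans
          (Category.assoc _ _ _).symm)
      obtain ⟨d, ⟨h1, h2⟩, -⟩ := H.existsUnique_left r'.left (c ≫ r.left) (e ≫ base β) hb
      have hd : γ ≫ β = M.arrow d := by
        refine (M.cart_arrow r'.left).hom_ext ?_ ?_
        · rw [base_comp, hγ]
          exact h1.symm
        · rw [Category.assoc, ← w, ← Category.assoc, hγα, ← M.arrow_comp, ← M.arrow_comp, h2]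
      have h3 : u.map (c ≫ r.right) = u.map (d ≫ r'.right) := by
        rw [u.map_comp, u.map_comp, ← r.fac, ← r'.fac, ← Category.assoc, ← Category.assoc,
          ← u.map_comp, ← u.map_comp, h2]
      rw [← cancel_epi γ, ← Category.assoc, ← Category.assoc, hγα, hd, ← M.arrow_comp,
        ← M.arrow_comp]
      have hcov' : EtaleCovering fun r : Equalizing (c ≫ r.right) (d ≫ r'.right) ↦
        M.arrow r.hom := H.faithful _ _ h3
      refine hcov'.hom_ext (fun _ ↦ M.cart_arrow _) (hM _) (congrArg q.map h3) fun i ↦ ?_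
      rw [← M.arrow_comp, ← M.arrow_comp, i.w])
  choose! m hm hm' using @hexists
  have huniq {s t : P} (φ : u.obj s ⟶ u.obj t) (v : M.pair s ⟶ M.pair t) (h1 : base v = q.map φ)
      (h2 : ∀ r : Roof u φ, M.arrow r.left ≫ v = M.arrow r.right) : m φ = v :=
    (hm' φ v ⟨h1, h2⟩).symm
  have harrow {s t : P} (b : s ⟶ t) : m (u.map b) = M.arrow b := by
    refine huniq _ _ rfl fun r ↦ ?_
    have h3 : u.map (r.left ≫ b) = u.map r.right := by rw [u.map_comp, r.fac]
    have hcov' : EtaleCovering fun i : Equalizing (r.left ≫ b) r.right ↦ M.arrow i.hom :=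
      H.faithful _ _ h3
    rw [← M.arrow_comp]
    refine hcov'.hom_ext (fun _ ↦ M.cart_arrow _) (hM _) (congrArg q.map h3) fun i ↦ ?_
    rw [← M.arrow_comp, ← M.arrow_comp, i.w]
  have hleft {r s t : P} (c : r ⟶ s) (φ : u.obj s ⟶ u.obj t) :
      m (u.map c ≫ φ) = M.arrow c ≫ m φ := by
    refine huniq _ _ ?_ fun i ↦ ?_
    · refine (congrArg (q.map (u.map c) ≫ ·) (hm φ).1).trans (q.map_comp _ _).symm
    · rw [← Category.assoc, ← M.arrow_comp]
      exact (hm φ).2 ⟨i.top, i.left ≫ c, i.right, by rw [u.map_comp, Category.assoc, i.fac]⟩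
  refine ⟨m, fun φ ↦ (hm φ).1, fun {s t} φ ↦ ?_, harrow, fun {r s t} φ ψ ↦ ?_⟩
  · refine (hcov φ).cart (W := M.pair t) (fun _ ↦ M.cart_arrow _) (hM s) (hM t) _ fun r ↦ ?_
    rw [(hm φ).2 r]
    exact M.cart_arrow _
  · refine (hcov φ).hom_ext (fun _ ↦ M.cart_arrow _) (hM r) ?_ fun i ↦ ?_
    · rw [base_comp, (hm _).1, (hm _).1, (hm _).1, q.map_comp]
      rfl
    · rw [← hleft, ← Category.assoc, ← Category.assoc, (hm φ).2 i, i.fac, hleft]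

/-- A system of sheaves on `P` is extended to an object `x` of `Q` by gluing its values at all objects
of `P` over `x`. -/
theorem essSurj_precomp : (QCoh.precomp u q).EssSurj where
  mem_essImage M := by
    obtain ⟨m, hmb, hmc, hma, hm⟩ := H.exists_extend M.1 M.2
    have hφ {x : Q} (a a' : Σ t, u.obj t ⟶ x) (h : q.obj (u.obj a.1) ⟶ q.obj (u.obj a'.1))
      (w : h ≫ q.map a'.2 = q.map a.2) := H.existsUnique_right a'.2 a.2 h w
    choose φ hφ hφ' using @hφ
    -- The descent datum given by the charts of `x`. A morphism of base schemes between charts comes from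
    -- a unique morphism `φ` of charts in `Q`, on which `m` is defined.
    let D (x : Q) : DescentDatum (q.obj x) (Σ t, u.obj t ⟶ x) :=
      { obj := fun a ↦ M.1.pair a.1
        qc := fun a ↦ M.2 a.1
        map := fun a ↦ q.map a.2
        trans := fun {a a'} h w ↦ m (φ a a' h w)
        base_trans := fun {a a'} h w ↦ (hmb _).trans (hφ a a' h w).1
        cart_trans := fun {a a'} h w ↦ hmc _
        trans_comp := fun {a b c} h h' w w' w'' ↦ by
          rw [← hm]
          refine congrArg m (hφ' a c (h ≫ h') w'' _ ⟨?_, ?_⟩)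
          · rw [q.map_comp, (hφ a b h w).1, (hφ b c h' w').1]
            rfl
          · rw [Category.assoc, (hφ b c h' w').2, (hφ a b h w).2]
        exists_iso := fun a T f ↦ by
          obtain ⟨s, c, e, he, hc⟩ := H.exists_lift a.1 T f
          refine ⟨⟨s, u.map c ≫ a.2⟩, e, he, ?_⟩
          rw [q.map_comp, ← hc]
          exact (Category.assoc _ _ _).symm
        covering := H.covering x }
    have hG (x : Q) := (D x).nonempty_gluing_of_scheme
    let G (x : Q) := Classical.choice (hG x)
    have hcongr {x : Q} (t : P) {b b' : u.obj t ⟶ x} (e : b = b') :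
        ((G x).hom ⟨t, b⟩ : M.1.pair t ⟶ ⟨q.obj x, (G x).sheaf⟩) = (G x).hom ⟨t, b'⟩ := by
      subst e
      rfl
    -- The charts of `x` are charts of `y` by composition with `f`, which gives the structure morphism.
    have hn {x y : Q} (f : x ⟶ y) := (G x).etaleCovering.existsUnique_hom
      (W := ⟨q.obj y, (G y).sheaf⟩) (G x).cart_hom (G x).qc
      (fun a ↦ (G y).hom ⟨a.1, a.2 ≫ f⟩) (q.map f) (fun a ↦ by
        refine ((G y).base_hom _).trans (Eq.trans ?_ (congrArg (· ≫ q.map f)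
          ((G x).base_hom a)).symm)
        exact q.map_comp _ _) ((G x).compatible _ fun a a' h w ↦ by
        have h1 : h ≫ q.map (a'.2 ≫ f) = q.map (a.2 ≫ f) := by
          exact (congrArg (h ≫ ·) (q.map_comp _ _)).trans ((Category.assoc _ _ _).symm.trans
            ((congrArg (· ≫ q.map f) w).trans (q.map_comp _ _).symm))
        have h2 := (G y).trans_hom ⟨a.1, a.2 ≫ f⟩ ⟨a'.1, a'.2 ≫ f⟩ h h1
        refine Eq.trans ?_ h2
        refine congrArg (fun v ↦ m v ≫ (G y).hom ⟨a'.1, a'.2 ≫ f⟩) ?_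
        refine hφ' ⟨a.1, a.2 ≫ f⟩ ⟨a'.1, a'.2 ≫ f⟩ h h1 _ ⟨(hφ a a' h w).1, ?_⟩
        rw [← Category.assoc, (hφ a a' h w).2])
    choose! n hn hn' using @hn
    have hnc {x y : Q} (f : x ⟶ y) : Cart (n f) :=
      (G x).etaleCovering.cart (W := ⟨q.obj y, (G y).sheaf⟩) (G x).cart_hom (G x).qc (G y).qc _
        fun a ↦ by
          rw [(hn f).2 a]
          exact (G y).cart_hom _
    obtain ⟨iso, iso_comp, hiso⟩ := ModuleSystem.exists_of_arrow (p := q) (fun x ↦ (G x).sheaf)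
      n (fun f ↦ (hn f).1) hnc fun {x y z} f g ↦ by
        refine (hn' (f ≫ g) _ ⟨?_, fun a ↦ ?_⟩).symm
        · rw [base_comp, (hn f).1, (hn g).1, q.map_comp]
        · rw [← Category.assoc, (hn f).2 a]
          exact ((hn g).2 ⟨a.1, a.2 ≫ f⟩).trans
            (hcongr a.1 (Category.assoc a.2 f g))
    let N : QCoh q := ⟨⟨fun x ↦ (G x).sheaf, iso, iso_comp⟩, fun x ↦ (G x).qc⟩
    -- At an object of `P` the identity is a chart, so the glued sheaf is the original one.
    let v (t : P) : M.1.pair t ⟶ N.1.pair (u.obj t) := (G (u.obj t)).hom ⟨t, 𝟙 _⟩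
    have hv (t : P) : base (v t) = 𝟙 (q.obj (u.obj t)) :=
      ((G (u.obj t)).base_hom _).trans (q.map_id _)
    obtain ⟨ψ, hψ⟩ := ModuleSystem.exists_hom (M := ((QCoh.precomp u q).obj N).1) (N := M.1) v hv
      fun {s t} b ↦ by
        have h1 : q.map (u.map b) ≫ q.map (𝟙 (u.obj t)) = q.map (u.map b) := by
          rw [q.map_id]
          exact Category.comp_id _
        have h2 := (G (u.obj t)).trans_hom ⟨s, u.map b⟩ ⟨t, 𝟙 _⟩ (q.map (u.map b)) h1
        have h3 : φ ⟨s, u.map b⟩ ⟨t, 𝟙 _⟩ (q.map (u.map b)) h1 = u.map b :=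
          (hφ' ⟨s, u.map b⟩ ⟨t, 𝟙 _⟩ (q.map (u.map b)) h1 _ ⟨rfl, Category.comp_id _⟩).symm
        have h4 : M.1.arrow b ≫ v t = (G (u.obj t)).hom ⟨s, u.map b⟩ := by
          rw [← h2]
          exact congrArg (· ≫ v t) ((hma b).symm.trans (congrArg m h3.symm))
        refine h4.trans (Eq.trans ?_ (congrArg (v s ≫ ·) (hiso (u.map b)).symm))
        refine Eq.trans ?_ ((hn (u.map b)).2 ⟨s, 𝟙 _⟩).symm
        exact hcongr s (Category.id_comp (u.map b)).symm
    have h1 : IsIso ψ := ModuleSystem.isIso_of_isIso_app _ fun t ↦ by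
      rw [← isIso_vert_iff, hψ]
      have : IsIso (base ((G (u.obj t)).hom ⟨t, 𝟙 _⟩)) := by
        change IsIso (base (v t))
        rw [hv]
        exact inferInstanceAs (IsIso (𝟙 (q.obj (u.obj t))))
      exact ((G (u.obj t)).cart_hom ⟨t, 𝟙 _⟩).isIso
    exact ⟨N, ⟨((isQCoh (u ⋙ q)).isoMk (asIso ψ))⟩⟩

/-- Restriction along a local equivalence is an equivalence on quasi-coherent sheaves. -/
theorem isEquivalence_precomp : (QCoh.precomp u q).IsEquivalence :=
  have := H.faithful_precomp
  have := H.full_precomp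
  have := H.essSurj_precomp
  { }

end IsLocalEquivalence

end LocalEquivalence

end

noncomputable section

open ModScheme

/-! ### The plus construction is a local equivalence -/

section Plus

universe v₁ u₁ v₂ u₂

variable {C : Type u₁} [Category.{v₁} C] {J : GrothendieckTopology C}
  {P : Type u₂} [Category.{v₂} P] {p : P ⥤ C}

/-- All morphisms are cartesian. -/
def CartesianArrows (p : P ⥤ C) : Prop :=
  ∀ ⦃x y z : P⦄ (c : y ⟶ z) (d : x ⟶ z) (h : p.obj x ⟶ p.obj y), h ≫ p.map c = p.map d →
    ∃! e : x ⟶ y, p.map e = h ∧ e ≫ c = d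

namespace CartesianArrows

theorem isStronglyCartesian (hp : CartesianArrows p) {x y : P} {S T : C} (f : S ⟶ T) (φ : x ⟶ y)
    [p.IsHomLift f φ] : p.IsStronglyCartesian f φ := by
  obtain ⟨⟩ := (inferInstance : p.IsHomLift f φ)
  constructor
  intro z g ψ hψ
  have h1 := IsHomLift.eq_of_isHomLift (p := p) (g ≫ p.map φ) ψ
  obtain ⟨e, ⟨h2, h3⟩, h4⟩ := hp φ ψ g h1
  refine ⟨e, ⟨h2 ▸ inferInstance, h3⟩, ?_⟩
  rintro e' ⟨h5, h6⟩
  exact h4 e' ⟨(IsHomLift.eq_of_isHomLift (p := p) _ e').symm, h6⟩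

/-- Morphisms factor uniquely through cartesian morphisms. -/
theorem existsUnique_lift (hp : CartesianArrows p) {x y z : P} {R S T : C} {f : S ⟶ T}
    {φ : y ⟶ z} (hφ : p.IsHomLift f φ) {f' : R ⟶ T} {ψ : x ⟶ z} (hψ : p.IsHomLift f' ψ)
    (g : R ⟶ S) (w : g ≫ f = f') : ∃! χ : x ⟶ y, p.IsHomLift g χ ∧ χ ≫ φ = ψ := by
  have := hp.isStronglyCartesian f φ
  exact Functor.IsStronglyCartesian.universal_property p f φ g f' w.symm ψ

theorem ext (hp : CartesianArrows p) {x y z : P} {R S T : C} {f : S ⟶ T}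
    {φ : y ⟶ z} (hφ : p.IsHomLift f φ) {g : R ⟶ S} {a b : x ⟶ y} (ha : p.IsHomLift g a)
    (hb : p.IsHomLift g b) (e : a ≫ φ = b ≫ φ) : a = b := by
  have := hp.isStronglyCartesian f φ
  exact Functor.IsStronglyCartesian.ext p f φ g e

/-- In the plus construction, the factorization of `d` through `c` is given locally by the
factorizations in `P`, which are compatible by uniqueness. -/
theorem plus (hp : CartesianArrows p) : CartesianArrows (Plus.proj J p) := by
  intro x y z c d h w
  obtain ⟨A, rfl⟩ := Quotient.exists_rep c
  obtain ⟨B, rfl⟩ := Quotient.exists_rep d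
  change x.base ⟶ y.base at h
  change h ≫ A.base = B.base at w
  have w' {T : C} {g : T ⟶ x.base} {g' : T ⟶ y.base} (e : g ≫ h = g') :
      g ≫ B.base = g' ≫ A.base := by rw [← w, ← e, Category.assoc]
  have hz {T : C} {g : T ⟶ x.base} {g' : T ⟶ y.base} (e : g ≫ h = g') (hg : B.Q g) :
      z.R (g' ≫ A.base) := w' e ▸ B.le_right g hg
  have hA {T : C} {g : T ⟶ x.base} {g' : T ⟶ y.base} (e : g ≫ h = g') (hg : A.Q (g ≫ h)) :
      A.Q g' := e ▸ hg
  -- The local factorizations, defined where both `d` and `c` are.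
  have H {T : C} (g : T ⟶ x.base) (g' : T ⟶ y.base) (e : g ≫ h = g')
      (hg : (B.Q ⊓ A.Q.pullback h) g) (hx : x.R g) (hy : y.R g') :=
    hp.existsUnique_lift (A.isHomLift_app g' _ rfl (hA e hg.2) hy (hz e hg.1))
      (B.isHomLift_app g _ (w' e) hg.1 hx (hz e hg.1)) (𝟙 T) (Category.comp_id _)
  choose a ha ha' using @H
  let E : Plus.PreHom x y :=
    { base := h
      Q := B.Q ⊓ A.Q.pullback h
      mem := J.intersection_covering B.mem (J.pullback_stable h A.mem)
      le_left := fun T g hg ↦ B.le_left g hg.1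
      le_right := fun T g hg ↦ A.le_left _ hg.2
      app := fun T g g' e hg hx hy ↦ a g g' e hg hx hy
      isHomLift_app := fun T g g' e hg hx hy ↦ (ha g g' e hg hx hy).1
      naturality := by
        intro T T' t g g₁ w₁ g' g₁' w₁' e e' hg hg₁ hx hy hx₁ hy₁
        have i1 := x.isHomLift_map t g g₁ w₁ hx hx₁
        have i2 := (ha g g' e hg hx hy).1
        have i3 := (ha g₁ g₁' e' hg₁ hx₁ hy₁).1
        have i4 := y.isHomLift_map t g' g₁' w₁' hy hy₁
        have i5 : p.IsHomLift t (x.map t g g₁ w₁ hx hx₁ ≫ a g g' e hg hx hy) := by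
          have : p.IsHomLift (t ≫ 𝟙 T) (x.map t g g₁ w₁ hx hx₁ ≫ a g g' e hg hx hy) :=
            inferInstance
          rwa [Category.comp_id] at this
        have i6 : p.IsHomLift t (a g₁ g₁' e' hg₁ hx₁ hy₁ ≫ y.map t g' g₁' w₁' hy hy₁) := by
          have : p.IsHomLift (𝟙 T' ≫ t) (a g₁ g₁' e' hg₁ hx₁ hy₁ ≫ y.map t g' g₁' w₁' hy hy₁) :=
            inferInstance
          rwa [Category.id_comp] at this
        refine hp.ext (A.isHomLift_app g' _ rfl (hA e hg.2) hy (hz e hg.1)) i5 i6 ?_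
        have h1 : t ≫ g' ≫ A.base = g₁' ≫ A.base := by rw [← w₁', Category.assoc]
        have n1 := B.naturality t g g₁ w₁ _ _ h1 (w' e) (w' e') hg.1 hg₁.1 hx (hz e hg.1)
          hx₁ (hz e' hg₁.1)
        have n2 := A.naturality t g' g₁' w₁' _ _ h1 rfl rfl (hA e hg.2) (hA e' hg₁.2) hy
          (hz e hg.1) hy₁ (hz e' hg₁.1)
        rw [Category.assoc, Category.assoc, (ha g g' e hg hx hy).2, n2, n1, ← Category.assoc,
          (ha g₁ g₁' e' hg₁ hx₁ hy₁).2] }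
  refine ⟨Quotient.mk _ E, ⟨rfl, ?_⟩, ?_⟩
  · refine Quotient.sound ⟨w, ⊤, J.top_mem _, fun T g g' e e' _ h1 h2 hx hz' ↦ ?_⟩
    have h3 : (g ≫ h) ≫ A.base = g' := (Category.assoc _ _ _).trans e
    subst h3
    have hy := A.le_left _ h1.2
    refine (Plus.PreHom.comp_app E A g (g ≫ h) _ _ h1 hx hz' rfl rfl h1.1 h1.1.2 hy).trans ?_
    exact (ha g (g ≫ h) rfl h1.1 hx hy).2
  · rintro χ ⟨h1, h2⟩
    obtain ⟨F, rfl⟩ := Quotient.exists_rep χ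
    obtain ⟨-, Q, hQ, hFA⟩ : (F.comp A).Rel B := Quotient.exact h2
    change F.base = h at h1
    refine Quotient.sound ⟨h1, Q, hQ, fun T g g' e e' hg hF hE hx hy ↦ ?_⟩
    change g ≫ h = g' at e'
    refine hp.ext (A.isHomLift_app g' _ rfl (hA e' hE.2) hy (hz e' hE.1))
      (F.isHomLift_app g g' e hF hx hy) (ha g g' e' hE hx hy).1 ?_
    refine Eq.trans ?_ (ha g g' e' hE hx hy).2.symm
    have h3 : (F.comp A).Q g := ⟨hF, by
      change A.Q (g ≫ F.base)
      rw [e]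
      exact hA e' hE.2⟩
    have h4 : g ≫ (F.comp A).base = g' ≫ A.base := by
      rw [← e]
      exact (Category.assoc _ _ _).symm
    refine (Plus.PreHom.comp_app F A g g' _ h4 h3 hx (hz e' hE.1) e rfl hF (hA e' hE.2)
      hy).symm.trans ?_
    exact hFA g _ h4 (w' e') hg h3 hE.1 hx (hz e' hE.1)

end CartesianArrows

namespace Plus

open CartesianArrows

theorem isHomLift_comp_id_right {x y z : P} {S T : C} {f : S ⟶ T} {φ : x ⟶ y} {ψ : y ⟶ z}
    (h : p.IsHomLift f φ) (h' : p.IsHomLift (𝟙 T) ψ) : p.IsHomLift f (φ ≫ ψ) := by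
  have : p.IsHomLift (f ≫ 𝟙 T) (φ ≫ ψ) := inferInstance
  rwa [Category.comp_id] at this

theorem isHomLift_id_comp {x y z : P} {S T : C} {f : S ⟶ T} {φ : x ⟶ y} {ψ : y ⟶ z}
    (h : p.IsHomLift (𝟙 S) φ) (h' : p.IsHomLift f ψ) : p.IsHomLift f (φ ≫ ψ) := by
  have : p.IsHomLift (𝟙 S ≫ f) (φ ≫ ψ) := inferInstance
  rwa [Category.id_comp] at this

/-- The chart of an object of the plus construction defined by one of its values. -/
theorem exists_chart [p.IsFibered] (hp : CartesianArrows p) (x : Plus J p) {T : C}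
    (g : T ⟶ x.base) (hg : x.R g) (t : P) (θ : t ⟶ x.obj g hg) (hθ : p.IsHomLift (𝟙 T) θ) :
    ∃ (a : (unit J p).obj t ⟶ x) (e : T ⟶ p.obj t), e ≫ (proj J p).map a = g := by
  obtain rfl := IsHomLift.domain_eq p (𝟙 T) θ
  have H {U : C} (s : U ⟶ p.obj t) (g' : U ⟶ x.base) (w : s ≫ g = g') (hy : x.R g') :=
    hp.existsUnique_lift (x.isHomLift_map s g g' w hg hy)
      (isHomLift_comp_id_right (f := s) (φ := pbMap t s) inferInstance hθ) (𝟙 U)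
      (Category.id_comp _)
  choose a ha _ using @H
  have nat {U U' : C} (h : U' ⟶ U) (s : U ⟶ p.obj t) (g' : U ⟶ x.base) (g₁' : U' ⟶ x.base)
      (w₁' : h ≫ g' = g₁') (w : s ≫ g = g') (w' : (h ≫ s) ≫ g = g₁') (hy : x.R g')
      (hy₁ : x.R g₁') : pbLift (𝟙 t) h (h ≫ s) s (pb_aux rfl) ≫ a s g' w hy =
        a (h ≫ s) g₁' w' hy₁ ≫ x.map h g' g₁' w₁' hy hy₁ := by
    refine hp.ext (x.isHomLift_map s g g' w hg hy) (g := h)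
      (isHomLift_comp_id_right (isHomLift_pbLift (𝟙 t) h (h ≫ s) s (pb_aux rfl)) (ha s g' w hy).1)
      (isHomLift_id_comp (ha _ g₁' w' hy₁).1 (x.isHomLift_map h g' g₁' w₁' hy hy₁)) ?_
    rw [Category.assoc, Category.assoc, (ha s g' w hy).2,
      ← x.map_comp s h g g' g₁' w w₁' w' hg hy hy₁, (ha _ g₁' w' hy₁).2, ← Category.assoc]
    exact congrArg (· ≫ θ) ((pbLift_fac _ _ _ _ _).trans (Category.comp_id _))
  exact ⟨Quotient.mk _
    { base := g
      Q := ⊤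
      mem := J.top_mem _
      le_left := fun _ _ _ ↦ trivial
      le_right := fun _ s _ ↦ x.R.downward_closed hg s
      app := fun _ s g' w _ _ hy ↦ a s g' w hy
      isHomLift_app := fun _ s g' w _ _ hy ↦ (ha s g' w hy).1
      naturality := by
        intro U U' h s s₁ w₁ g' g₁' w₁' w w' _ _ _ hy _ hy₁
        subst w₁
        exact nat h s g' g₁' w₁' w w' hy hy₁ }, 𝟙 _, Category.id_comp _⟩

variable [p.IsFibered]

/-- Objects of a fibred category can be pulled back along all morphisms. -/
theorem exists_lift (x : P) {T : C} (g : T ⟶ p.obj x) :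
    ∃ (t : P) (c : t ⟶ x) (e : p.obj t ≅ T), e.hom ≫ g = p.map c := by
  refine ⟨pb x g, pbMap x g, eqToIso (IsHomLift.domain_eq p g (pbMap x g)), ?_⟩
  rw [IsHomLift.fac' p g (pbMap x g)]
  simp

/-- A morphism in the plus construction between objects of `P` is given by a morphism of `P`
after restriction to a covering. -/
theorem exists_fac {s t : P} (A : PreHom (unitObj J p s) (unitObj J p t)) {r : P} (c : r ⟶ s)
    (h : A.Q (p.map c)) : ∃ b : r ⟶ t,
      (unit J p).map c ≫ (Quotient.mk _ A : (unit J p).obj s ⟶ (unit J p).obj t) =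
        (unit J p).map b := by
  let g : p.obj r ⟶ p.obj s := p.map c
  let β : p.obj s ⟶ p.obj t := A.base
  let B : pb s g ⟶ pb t (g ≫ β) := A.app g (g ≫ β) rfl h trivial trivial
  have hB : p.IsHomLift (𝟙 _) B := A.isHomLift_app _ _ _ _ _ _
  have hc : p.IsHomLift (𝟙 (p.obj r) ≫ g) c := by rw [Category.id_comp]; exact .map c
  let d : r ⟶ pb s g := Functor.IsStronglyCartesian.map p g (pbMap s g) (g := 𝟙 _) rfl c
  have hd : p.IsHomLift (𝟙 (p.obj r)) d :=
    inferInstanceAs (p.IsHomLift (𝟙 (p.obj r)) (Functor.IsStronglyCartesian.map p g (pbMap s g) _ c))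
  have hdc : d ≫ pbMap s g = c := Functor.IsStronglyCartesian.fac p g (pbMap s g) rfl c
  let b : r ⟶ t := d ≫ B ≫ pbMap t (g ≫ β)
  have hb : p.IsHomLift (g ≫ β) b :=
    isHomLift_id_comp hd (isHomLift_id_comp hB inferInstance)
  have hb' : g ≫ β = p.map b := IsHomLift.eq_of_isHomLift (p := p) _ b
  refine ⟨b, Quotient.sound ⟨hb', ⊤, J.top_mem _, fun T f g' w w' _ h1 h2 hx hy ↦ ?_⟩⟩
  change T ⟶ p.obj r at f
  change T ⟶ p.obj t at g'
  have h3 : (f ≫ g) ≫ β = g' := (Category.assoc _ _ _).trans w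
  refine (PreHom.comp_app (unitHom J p c) A f (f ≫ g) g' _ h1 hx hy rfl h3 trivial
    (A.Q.downward_closed h f) trivial).trans ?_
  have i1 : p.IsHomLift (𝟙 T) (A.app (f ≫ g) g' h3 (A.Q.downward_closed h f) trivial hy) :=
    A.isHomLift_app _ _ _ _ _ _
  have w1 : f ≫ p.map c = 𝟙 T ≫ f ≫ g := (Category.id_comp _).symm
  have w2 : f ≫ p.map b = 𝟙 T ≫ g' := w'.trans (Category.id_comp _).symm
  change pbLift c (𝟙 T) f (f ≫ g) w1 ≫ _ = pbLift b (𝟙 T) f g' w2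
  refine pb_ext (𝟙 T) g' (isHomLift_id_comp (isHomLift_pbLift _ _ _ _ _) i1)
    (isHomLift_pbLift _ _ _ _ _) ?_
  have n := A.naturality f g (f ≫ g) rfl (g ≫ β) g' ((Category.assoc _ _ _).symm.trans h3)
    rfl h3 h (A.Q.downward_closed h f) trivial trivial trivial hy
  have n' : A.app (f ≫ g) g' h3 (A.Q.downward_closed h f) trivial hy ≫ pbMap t g' =
      pbLift (𝟙 s) f (f ≫ g) g (pb_aux rfl) ≫ B ≫ pbMap t (g ≫ β) := by
    refine Eq.trans ?_ ((Category.assoc _ _ _).symm.trans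
      ((congrArg (· ≫ pbMap t (g ≫ β)) n).symm.trans (Category.assoc _ _ _)))
    refine congrArg (A.app (f ≫ g) g' h3 _ trivial hy ≫ ·) ?_
    exact ((pbLift_fac (𝟙 t) f g' (g ≫ β) (pb_aux ((Category.assoc _ _ _).symm.trans h3))).trans (Category.comp_id _)).symm
  let l : pb r f ⟶ pb s (f ≫ g) := pbLift c (𝟙 T) f (f ≫ g) w1
  let m : pb s (f ≫ g) ⟶ pb s g := pbLift (𝟙 s) f (f ≫ g) g (pb_aux rfl)
  have i2 : p.IsHomLift (𝟙 T) l := isHomLift_pbLift _ _ _ _ _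
  have i3 : p.IsHomLift f m := isHomLift_pbLift _ _ _ _ _
  have hm : m ≫ pbMap s g = pbMap s (f ≫ g) := (pbLift_fac _ _ _ _ _).trans (Category.comp_id _)
  have hl : l ≫ pbMap s (f ≫ g) = pbMap r f ≫ c := pbLift_fac _ _ _ _ _
  have hlm : l ≫ m = pbMap r f ≫ d := by
    refine pb_ext f g (isHomLift_id_comp i2 i3) (isHomLift_comp_id_right inferInstance hd) ?_
    rw [Category.assoc, Category.assoc, hdc, hm, hl]
  refine (Category.assoc _ _ _).trans ((congrArg (l ≫ ·) n').trans ?_)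
  refine (Category.assoc _ _ _).symm.trans ((congrArg (· ≫ B ≫ pbMap t (g ≫ β)) hlm).trans ?_)
  exact (Category.assoc _ _ _).trans (pbLift_fac b (𝟙 T) f g' w2).symm

/-- Morphisms of `P` that agree in the plus construction agree after restriction to a covering. -/
theorem exists_equalizing {s t : P} (b b' : s ⟶ t) (h : (unit J p).map b = (unit J p).map b') :
    ∃ Q ∈ J (p.obj s), ∀ (r : P) (c : r ⟶ s), Q (p.map c) → c ≫ b = c ≫ b' := by
  obtain ⟨h0, Q, hQ, e⟩ : (unitHom J p b).Rel (unitHom J p b') := Quotient.exact h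
  refine ⟨Q, hQ, fun r c hc ↦ ?_⟩
  let g : p.obj r ⟶ p.obj s := p.map c
  have hc' : p.IsHomLift (𝟙 (p.obj r) ≫ g) c := by rw [Category.id_comp]; exact .map c
  let d : r ⟶ pb s g := Functor.IsStronglyCartesian.map p g (pbMap s g) (g := 𝟙 _) rfl c
  have hdc : d ≫ pbMap s g = c := Functor.IsStronglyCartesian.fac p g (pbMap s g) rfl c
  change p.map b = p.map b' at h0
  have e1 := e g (g ≫ p.map b) rfl (by rw [h0]; rfl) hc trivial trivial trivial trivial
  have e2 := congrArg (· ≫ pbMap t (g ≫ p.map b)) e1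
  have e3 : pbMap s g ≫ b = pbMap s g ≫ b' :=
    (pbLift_fac b (𝟙 _) g (g ≫ p.map b) (Category.id_comp _).symm).symm.trans
      (e2.trans (pbLift_fac b' (𝟙 _) g (g ≫ p.map b) (by rw [Category.id_comp, h0])))
  rw [← hdc, Category.assoc, Category.assoc, e3]

end Plus

end Plus

section Over

universe v w

variable {B : Scheme.{u}} {P : Type w} [Category.{v} P] {p : P ⥤ Over B}

/-- A covering sieve in the étale site over `B` is generated by morphisms that form an étale
covering. -/
theorem ofArrows_mem_of_mem_over {X : Over B} {I : Type*} {Z : I → Over B} {f : ∀ i, Z i ⟶ X}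
    {Q : Sieve X} (hQ : Q ∈ Scheme.etaleTopology.over B X)
    (h : ∀ (T : Over B) (g : T ⟶ X), Q g → ∃ (i : I) (e : T ⟶ Z i), e ≫ f i = g) :
    Sieve.ofArrows (fun i ↦ (Z i).left) (fun i ↦ (f i).left) ∈ Scheme.etaleTopology X.left := by
  rw [← Sieve.overEquiv_ofArrows, ← GrothendieckTopology.mem_over_iff]
  refine GrothendieckTopology.superset_covering _ ?_ hQ
  intro T g hg
  obtain ⟨i, e, he⟩ := h T g hg
  exact ⟨_, e, _, Presieve.ofArrows.mk i, he⟩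

/-- The arrows are also cartesian over schemes, as a morphism of schemes between `B`-schemes that is
compatible with morphisms to a third one is a morphism of `B`-schemes. -/
theorem CartesianArrows.comp_forget (hp : CartesianArrows p) :
    CartesianArrows (p ⋙ Over.forget B) := by
  intro x y z c d h w
  change h ≫ (p.map c).left = (p.map d).left at w
  change (p.obj x).left ⟶ (p.obj y).left at h
  obtain ⟨e, ⟨h1, h2⟩, h3⟩ := hp c d (Over.homMk h
    ((congrArg (h ≫ ·) (Over.w (p.map c)).symm).trans ((Category.assoc _ _ _).symm.trans
      ((congrArg (· ≫ (p.obj z).hom) w).trans (Over.w (p.map d)))))) (Over.OverMorphism.ext w)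
  refine ⟨e, ⟨congrArg CommaMorphism.left h1, h2⟩, ?_⟩
  rintro e' ⟨h4, h5⟩
  exact h3 e' ⟨Over.OverMorphism.ext h4, h5⟩

/-- The plus construction for the étale topology does not change the quasi-coherent sheaves. -/
theorem Plus.isLocalEquivalence [p.IsFibered] (hp : CartesianArrows p) :
    IsLocalEquivalence (Plus.unit (Scheme.etaleTopology.over B) p)
      (Plus.proj (Scheme.etaleTopology.over B) p ⋙ Over.forget B) where
  existsUnique_left c d h w := hp.comp_forget c d h w
  existsUnique_right c d h w := hp.plus.comp_forget c d h w
  exists_lift t T f := by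
    obtain ⟨s, c, e, he⟩ := Plus.exists_lift (p := p) t
      (Over.homMk f : Over.mk (f ≫ (p.obj t).hom) ⟶ p.obj t)
    have h1 : IsIso e.hom.left := inferInstanceAs (IsIso ((Over.forget B).map e.hom))
    exact ⟨s, c, e.hom.left, h1, congrArg CommaMorphism.left he⟩
  covering x := by
    refine ofArrows_mem_of_mem_over
      (f := fun a : Σ t, (Plus.unit (Scheme.etaleTopology.over B) p).obj t ⟶ x ↦
        (Plus.proj (Scheme.etaleTopology.over B) p).map a.2) x.mem fun T g hg ↦ ?_
    have h1 := x.isHomLift_map (𝟙 T) g g (Category.id_comp _) hg hg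
    obtain ⟨a, e, he⟩ := Plus.exists_chart hp x g hg (x.obj g hg) (𝟙 _)
      (IsHomLift.id (IsHomLift.domain_eq p (𝟙 T) (x.map (𝟙 T) g g (Category.id_comp _) hg hg)))
    exact ⟨⟨_, a⟩, e, he⟩
  full {s t} φ := by
    obtain ⟨A, rfl⟩ := Quotient.exists_rep φ
    refine ofArrows_mem_of_mem_over (X := p.obj s) (f := fun a : Roof _ _ ↦ p.map a.left) A.mem
      fun T g hg ↦ ?_
    obtain ⟨r, c, e, he⟩ := Plus.exists_lift (p := p) s g
    obtain ⟨b, hb⟩ := Plus.exists_fac A c (he ▸ A.Q.downward_closed hg e.hom)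
    exact ⟨⟨r, c, b, hb⟩, e.inv, (Iso.inv_comp_eq e).mpr he.symm⟩
  faithful {s t} b b' h := by
    obtain ⟨Q, hQ, hQ'⟩ := Plus.exists_equalizing b b' h
    refine ofArrows_mem_of_mem_over (X := p.obj s) (f := fun a : Equalizing b b' ↦ p.map a.hom) hQ
      fun T g hg ↦ ?_
    obtain ⟨r, c, e, he⟩ := Plus.exists_lift (p := p) s g
    exact ⟨⟨r, c, hQ' r c (he ▸ Q.downward_closed hg e.hom)⟩, e.inv,
      (Iso.inv_comp_eq e).mpr he.symm⟩

/-- A category fibred in groupoids over `B`-schemes has the same quasi-coherent sheaves as its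
étale stackification. -/
theorem Stackification.isEquivalence_precomp [p.IsFibered] (hp : CartesianArrows p) :
    (QCoh.precomp (Stackification.unit (Scheme.etaleTopology.over B) p)
      (Stackification.proj (Scheme.etaleTopology.over B) p ⋙ Over.forget B)).IsEquivalence := by
  have h1 := (Plus.isLocalEquivalence hp).isEquivalence_precomp
  have h2 := (Plus.isLocalEquivalence (CartesianArrows.plus (J := Scheme.etaleTopology.over B) hp)).isEquivalence_precomp
  have h3 := (Plus.isLocalEquivalence (CartesianArrows.plus (J := Scheme.etaleTopology.over B) (CartesianArrows.plus (J := Scheme.etaleTopology.over B) hp))).isEquivalence_precomp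
  have h4 := @Functor.isEquivalence_trans _ _ _ _ _ _ _ _ h3 h2
  exact @Functor.isEquivalence_trans _ _ _ _ _ _ _ _ h4 h1

end Over

end

noncomputable section

open ModScheme EtaleNbhd

/-! ### Germs of étale neighbourhoods -/

section Germs

variable {k : Type u} [Field k] {n : ℕ}

/-- The compatibility with sections of the morphism to a base change. -/
theorem section_comp_lift {S T V Y : Scheme.{u}} {τ : S ⟶ V} {ψ : V ⟶ Y} {π : V ⟶ S}
    {π' : Y ⟶ T} {σ : T ⟶ Y} {f : S ⟶ T} (h : τ ≫ ψ = f ≫ σ) (h' : τ ≫ π = 𝟙 S)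
    (w : ψ ≫ π' = π ≫ f) (w' : (f ≫ σ) ≫ π' = 𝟙 S ≫ f) :
    τ ≫ pullback.lift ψ π w = 𝟙 S ≫ pullback.lift (f ≫ σ) (𝟙 S) w' := by
  rw [Category.id_comp]
  refine pullback.hom_ext ?_ ?_
  · rw [Category.assoc, pullback.lift_fst, pullback.lift_fst, h]
  · rw [Category.assoc, pullback.lift_snd, pullback.lift_snd, h']

/-- The base change of a pointed family. -/
def PtFam.baseChange (Z : PtFam k n) {S : SchOver k} (f : S ⟶ Z.base) : PtFam k n where
  base := S
  fam :=
    { total := pullback Z.fam.π f.left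
      π := pullback.snd _ _
      smooth := (smoothOfRelativeDimension_isStableUnderBaseChange n).of_isPullback
        (IsPullback.of_hasPullback Z.fam.π f.left) Z.fam.smooth
      σ := pullback.lift (f.left ≫ Z.fam.σ) (𝟙 _) (by
        rw [Category.assoc, Z.fam.σ_π, Category.comp_id, Category.id_comp])
      σ_π := pullback.lift_snd _ _ _ }

/-- The projection from the base change of a pointed family. -/
def PtFam.baseChangeMap (Z : PtFam k n) {S : SchOver k} (f : S ⟶ Z.base) : Z.baseChange f ⟶ Z :=
  PtFam.Hom.mk (X := Z.baseChange f) f (pullback.fst _ _)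
    ((fibrewiseEtale_iff n).mpr (EtSq.of_isPullback (IsPullback.of_hasPullback Z.fam.π f.left)))
    (pullback.lift_fst _ _ _)

namespace EtaleNbhd

variable {X Y : PtFam k n}

/-- The middle term of a common étale neighbourhood, as a pointed family. -/
def mid (A : EtaleNbhd X Y) : PtFam k n := ⟨X.base, A.V⟩

/-- The étale morphism to the source. -/
def left (A : EtaleNbhd X Y) : A.mid ⟶ X :=
  PtFam.Hom.mk (X := A.mid) (𝟙 X.base) A.φ
    ((fibrewiseEtale_iff n).mpr (EtSq.id_base _ _ _ A.φ_π A.etale_φ))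
    (A.σ_φ.trans (Category.id_comp _).symm)

/-- The morphism to the target. -/
def right (A : EtaleNbhd X Y) : A.mid ⟶ Y :=
  PtFam.Hom.mk (X := A.mid) A.base A.ψ ((fibrewiseEtale_iff n).mpr A.etSq_ψ) A.σ_ψ

/-- The étale morphism to the base change of the target. -/
def toBaseChange (A : EtaleNbhd X Y) : A.mid ⟶ Y.baseChange A.base :=
  PtFam.Hom.mk (X := A.mid) (Y := Y.baseChange A.base) (𝟙 X.base)
    (pullback.lift A.ψ A.V.π A.etSq_ψ.1)
    ((fibrewiseEtale_iff n).mpr (EtSq.id_base _ _ _ (pullback.lift_snd _ _ _) A.etSq_ψ.2))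
    (section_comp_lift A.σ_ψ A.V.σ_π _ _)

end EtaleNbhd

namespace FamilyGerm

variable {X Y : PtFam k n}

/-- A germ is the fraction of the two morphisms of a common étale neighbourhood that represents it. -/
theorem map_left_comp (A : EtaleNbhd X Y) :
    ofPtFam.map A.left ≫ (Quotient.mk _ A : ofPtFam.obj X ⟶ ofPtFam.obj Y) =
      ofPtFam.map A.right := by
  refine Quotient.sound (Equivalent.symm (equivalent_of_map (Category.id_comp A.base).symm
    (pullback.lift (𝟙 _) (𝟙 _) rfl) ?_ ?_ ?_ ?_))
  -- The composition is defined on the fibre product of `A.V` with itself over the source; it agrees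
  -- with `A.right` on the diagonal.
  · have h1 : Etale (pullback.diagonal A.φ) := inferInstance
    exact h1
  · refine pullback.hom_ext ?_ ?_
    · exact (Category.assoc _ _ _).trans ((congrArg (A.V.σ ≫ ·) (pullback.lift_fst _ _ _)).trans
        ((Category.comp_id _).trans (pullback.lift_fst _ _ _).symm))
    · refine (Category.assoc _ _ _).trans ((congrArg (A.V.σ ≫ ·) (pullback.lift_snd _ _ _)).trans
        ((Category.comp_id _).trans (Eq.trans ?_ (pullback.lift_snd _ _ _).symm)))
      exact (Category.id_comp _).symm
  · exact (Category.assoc _ _ _).symm.trans ((congrArg (· ≫ 𝟙 _) (pullback.lift_fst _ _ _)).trans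
      (Category.comp_id _))
  · exact (Category.assoc _ _ _).symm.trans ((congrArg (· ≫ A.ψ) (pullback.lift_snd _ _ _)).trans
      (Category.id_comp _))

/-- An étale morphism of pointed families over the same base becomes invertible on germs. -/
theorem isIso_map (f : X ⟶ Y) (e : X.base = Y.base) (h : PtFam.Hom.base f = eqToHom e) :
    IsIso (ofPtFam.map f) := by
  obtain ⟨S, X⟩ := X
  obtain ⟨S', Y⟩ := Y
  dsimp only at e
  subst e
  obtain ⟨b, t, hf, hσ⟩ := f
  change b = 𝟙 S at h
  subst h
  have ht : EtSq X.π Y.π t (𝟙 S.left) := (fibrewiseEtale_iff n).mp hf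
  have het : Etale t := ht.etale
  let A : EtaleNbhd (⟨S, Y⟩ : PtFam k n) ⟨S, X⟩ :=
    { base := 𝟙 S
      V := X
      φ := t
      etale_φ := het
      φ_π := ht.1.trans (Category.comp_id _)
      σ_φ := hσ.trans (Category.id_comp _)
      ψ := 𝟙 _
      etSq_ψ := EtSq.id_base _ _ _ (Category.id_comp _) inferInstance
      σ_ψ := (Category.comp_id _).trans (Category.id_comp _).symm }
  refine ⟨Quotient.mk _ A, map_left_comp A, Quotient.sound (equivalent_of_map
    (Category.id_comp _) (pullback.fst _ _ ≫ t) ?_ ?_ ?_ ?_)⟩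
  · exact etale_comp_mem (etale_fst (etale_of_isIso (𝟙 X.total))) het
  · exact (Category.assoc _ _ _).symm.trans ((congrArg (· ≫ t) (pullback.lift_fst _ _ _)).trans
      (hσ.trans (Category.id_comp _)))
  · exact Category.comp_id _
  · refine (Category.comp_id _).trans ?_
    exact congrArg (· ≫ t) ((Category.comp_id _).symm.trans
      (pullback.condition.trans (Category.comp_id _)))

/-- A morphism of pointed families that is a base change is cartesian on germs. -/
theorem existsUnique_map (m : X ⟶ Y) (P : IsPullback (PtFam.Hom.total m) X.fam.π Y.fam.π
    (PtFam.Hom.base m).left) {Z : FamilyGerm k n} (d : Z ⟶ ofPtFam.obj Y)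
    (h : proj.obj Z ⟶ proj.obj (ofPtFam.obj X)) (w : h ≫ proj.map (ofPtFam.map m) = proj.map d) :
    ∃! e : Z ⟶ ofPtFam.obj X, proj.map e = h ∧ e ≫ ofPtFam.map m = d := by
  obtain ⟨D, rfl⟩ := Quotient.exists_rep d
  obtain ⟨B, rfl, e⟩ := comp_ofHom D m P h w.symm
  refine ⟨Quotient.mk _ B, ⟨rfl, Quotient.sound e⟩, ?_⟩
  rintro χ ⟨h1, h2⟩
  obtain ⟨B', rfl⟩ := Quotient.exists_rep χ
  have h3 : (B'.comp (ofHom m)).Equivalent D := Quotient.exact h2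
  exact Quotient.sound (comp_ofHom_cancel m P h1 (h3.trans e.symm))

/-- All morphisms of germs are cartesian. -/
theorem cartesianArrows : CartesianArrows (proj : FamilyGerm k n ⥤ SchOver k) := by
  rintro X ⟨Y⟩ ⟨Z⟩ c d h w
  change ofPtFam.obj Y ⟶ ofPtFam.obj Z at c
  change X ⟶ ofPtFam.obj Z at d
  change proj.obj X ⟶ proj.obj (ofPtFam.obj Y) at h
  change h ≫ proj.map c = proj.map d at w
  change ∃! e : X ⟶ ofPtFam.obj Y, proj.map e = h ∧ e ≫ c = d
  obtain ⟨C, hC⟩ := Quotient.exists_rep c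
  change EtaleNbhd Y Z at C
  have hlm : C.toBaseChange ≫ Z.baseChangeMap C.base = C.right :=
    PtFam.Hom.ext (Category.id_comp _) (pullback.lift_fst _ _ _)
  have i1 : IsIso (ofPtFam.map C.left) := isIso_map C.left rfl rfl
  have i2 : IsIso (ofPtFam.map C.toBaseChange) := isIso_map C.toBaseChange rfl rfl
  -- The morphism `c` is an isomorphism followed by the projection from a base change.
  let i : ofPtFam.obj Y ⟶ ofPtFam.obj (Z.baseChange C.base) :=
    inv (ofPtFam.map C.left) ≫ ofPtFam.map C.toBaseChange
  have hi : IsIso i := inferInstance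
  have hc : c = i ≫ ofPtFam.map (Z.baseChangeMap C.base) := by
    rw [← hC, Category.assoc, ← ofPtFam.map_comp, hlm]
    exact (IsIso.eq_inv_comp _).mpr (map_left_comp C)
  have hw : (h ≫ proj.map i) ≫ proj.map (ofPtFam.map (Z.baseChangeMap C.base)) = proj.map d := by
    rw [Category.assoc, ← proj.map_comp, ← hc, w]
  obtain ⟨e, ⟨h1, h2⟩, h3⟩ := existsUnique_map (Z.baseChangeMap C.base)
    (IsPullback.of_hasPullback Z.fam.π C.base.left) d _ hw
  refine ⟨e ≫ inv i, ⟨?_, ?_⟩, ?_⟩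
  · rw [proj.map_comp, Functor.map_inv, IsIso.comp_inv_eq]
    exact h1
  · rw [hc, Category.assoc, IsIso.inv_hom_id_assoc]
    exact h2
  · rintro e' ⟨h4, h5⟩
    rw [IsIso.eq_comp_inv]
    refine h3 _ ⟨?_, ?_⟩
    · rw [proj.map_comp, h4]
    · rw [Category.assoc, ← hc, h5]

end FamilyGerm

/-- The trivial germs form a full subcategory of the germs. -/
theorem TrivialGerm.cartesianArrows :
    CartesianArrows (proj : TrivialGerm k n ⥤ SchOver k) := fun X Y Z c d h w ↦
  FamilyGerm.cartesianArrows (x := ⟨X.pt⟩) (y := ⟨Y.pt⟩) (z := ⟨Z.pt⟩) c d h w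

end Germs

/-! ### Étale coordinates -/

section Coordinates

/-- Étale coordinates: Zariski-locally on the source, a smooth morphism of relative dimension `n`
factors through an étale morphism to the affine space. -/
theorem exists_etale_affineSpace (n : ℕ) {X S : Scheme.{u}} (π : X ⟶ S)
    [SmoothOfRelativeDimension n π] (x : X) :
    ∃ (V : Scheme.{u}) (j : V ⟶ X) (f : V ⟶ 𝔸(ULift.{u} (Fin n); S)), IsOpenImmersion j ∧
      x ∈ Set.range j ∧ Etale f ∧ f ≫ 𝔸(ULift.{u} (Fin n); S) ↘ S = j ≫ π := by
  obtain ⟨W, hW, hxW, -⟩ := TopologicalSpace.Opens.isBasis_iff_nbhd.mp S.isBasis_affineOpens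
    (TopologicalSpace.Opens.mem_top (π x))
  obtain ⟨V, hV, eV, hst⟩ := exists_std n π x ⟨W, hW⟩ (π ⁻¹ᵁ W) hxW le_rfl
  obtain ⟨g, hg, hge⟩ := hst.exists_etale_mvPolynomial
  let r : MvPolynomial (ULift.{u} (Fin n)) Γ(S, W) ≃+* MvPolynomial (Fin n) Γ(S, W) :=
    (MvPolynomial.renameEquiv Γ(S, W) Equiv.ulift).toRingEquiv
  have hr : (g.comp r.toRingHom).comp MvPolynomial.C = (π.appLE W V.1 eV).hom := by
    rw [← hg]
    ext a
    simp [r]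
  let f₀ : Spec Γ(X, V.1) ⟶ Spec (.of (MvPolynomial (ULift.{u} (Fin n)) Γ(S, W))) :=
    Spec.map (CommRingCat.ofHom (g.comp r.toRingHom))
  have h₀ : Etale f₀ := by
    have h1 : f₀ = Spec.map (CommRingCat.ofHom g) ≫ Spec.map (CommRingCat.ofHom r.toRingHom) := by
      rw [← Spec.map_comp]
      rfl
    have h2 : Etale (Spec.map (CommRingCat.ofHom g)) :=
      (HasRingHomProperty.Spec_iff (P := @Etale.{u})).mpr hge
    have h3 : Etale (Spec.map (CommRingCat.ofHom r.toRingHom)) :=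
      etale_of_iso (Scheme.Spec.mapIso r.toCommRingCatIso.op)
    rw [h1]
    exact etale_comp_mem h2 h3
  have hW' : Etale hW.fromSpec := by
    have := hW.isOpenImmersion_fromSpec
    exact inferInstance
  have hm : Etale (AffineSpace.map (ULift.{u} (Fin n)) hW.fromSpec) :=
    MorphismProperty.of_isPullback (P := @Etale.{u})
      (AffineSpace.isPullback_map hW.fromSpec).flip hW'
  have hf : Etale (f₀ ≫ (AffineSpace.SpecIso (ULift.{u} (Fin n)) Γ(S, W)).inv ≫
      AffineSpace.map _ hW.fromSpec) :=
    etale_comp_mem h₀ (etale_comp_mem (etale_of_iso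
      (AffineSpace.SpecIso (ULift.{u} (Fin n)) Γ(S, W)).symm) hm)
  refine ⟨Spec Γ(X, V.1), V.2.fromSpec, _, V.2.isOpenImmersion_fromSpec, ?_, hf, ?_⟩
  · rw [V.2.range_fromSpec]
    exact hV
  · rw [Category.assoc, Category.assoc, AffineSpace.map_over, AffineSpace.SpecIso_inv_over_assoc,
      ← hW.SpecMap_appLE_fromSpec π V.2 eV, ← Spec.map_comp_assoc, ← CommRingCat.ofHom_comp, hr]
    rfl

/-- The translation of the affine space by a vector. -/
def translation (n : Type u) (S : Scheme.{u}) (v : n → Γ(S, ⊤)) : 𝔸(n; S) ⟶ 𝔸(n; S) :=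
  AffineSpace.homOfVector (𝔸(n; S) ↘ S)
    fun i ↦ AffineSpace.coord S i + (𝔸(n; S) ↘ S).appTop (v i)

theorem translation_over (n : Type u) (S : Scheme.{u}) (v : n → Γ(S, ⊤)) :
    translation n S v ≫ 𝔸(n; S) ↘ S = 𝔸(n; S) ↘ S := AffineSpace.homOfVector_over _ _

theorem comp_translation_appTop {n : Type u} {S T : Scheme.{u}} (v : n → Γ(S, ⊤))
    (f : T ⟶ 𝔸(n; S)) (g : T ⟶ S) (w : f ≫ 𝔸(n; S) ↘ S = g) (i : n) :
    (f ≫ translation n S v).appTop (AffineSpace.coord S i) =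
      f.appTop (AffineSpace.coord S i) + g.appTop (v i) := by
  subst w
  rw [Scheme.Hom.comp_appTop, Scheme.Hom.comp_appTop, CommRingCat.comp_apply, translation,
    AffineSpace.homOfVector_appTop_coord, map_add, CommRingCat.comp_apply]

theorem translation_comp (n : Type u) (S : Scheme.{u}) (v w : n → Γ(S, ⊤)) (h : v + w = 0) :
    translation n S v ≫ translation n S w = 𝟙 _ := by
  refine AffineSpace.hom_ext ?_ fun i ↦ ?_
  · rw [Category.assoc, translation_over, translation_over, Category.id_comp]
  · rw [comp_translation_appTop w (translation n S v) _ (translation_over n S v), translation,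
      AffineSpace.homOfVector_appTop_coord, add_assoc, ← map_add]
    have h1 : v i + w i = 0 := congrFun h i
    rw [h1, map_zero, add_zero]
    simp

instance (n : Type u) (S : Scheme.{u}) (v : n → Γ(S, ⊤)) : IsIso (translation n S v) :=
  ⟨translation n S (-v), translation_comp n S v (-v) (add_neg_cancel v),
    translation_comp n S (-v) v (neg_add_cancel v)⟩

/-- A section of the affine space can be moved to the zero section. -/
theorem exists_translation {n : Type u} {S : Scheme.{u}} (τ : S ⟶ 𝔸(n; S))
    (h : τ ≫ 𝔸(n; S) ↘ S = 𝟙 S) : ∃ t : 𝔸(n; S) ⟶ 𝔸(n; S), IsIso t ∧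
      t ≫ 𝔸(n; S) ↘ S = 𝔸(n; S) ↘ S ∧ τ ≫ t = AffineSpace.homOfVector (𝟙 S) 0 := by
  refine ⟨translation n S fun i ↦ -τ.appTop (AffineSpace.coord S i), inferInstance,
    translation_over _ _ _, AffineSpace.hom_ext ?_ fun i ↦ ?_⟩
  · rw [Category.assoc, translation_over, h, AffineSpace.homOfVector_over]
  · rw [comp_translation_appTop _ τ _ h, AffineSpace.homOfVector_appTop_coord]
    simp

end Coordinates

section TrivialGerms

variable {k : Type u} [Field k] {n : ℕ}

/-- Zariski-locally on the base, the germ of a pointed family is trivial. -/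
theorem exists_trivial (X : PtFam k n) (s : X.base.left) :
    ∃ (U : X.base.left.Opens) (t : TrivialGerm k n) (b : TrivialGerm.incl.obj t ⟶ ⟨X⟩)
      (e : U.toScheme ⟶ t.base.left), s ∈ U ∧ e ≫ (FamilyGerm.proj.map b).left = U.ι := by
  obtain ⟨V, j, f, hj, hs, hf, w⟩ := exists_etale_affineSpace n X.fam.π (X.fam.σ s)
  -- Étale coordinates are chosen near the point `σ s` and restricted to the open subset `U` of the
  -- base over which the section stays in their domain. A translation takes the section to zero.
  let U : X.base.left.Opens := X.fam.σ ⁻¹ᵁ j.opensRange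
  have hr : Set.range (U.ι ≫ X.fam.σ) ⊆ Set.range j := by
    rintro _ ⟨y, rfl⟩
    exact y.2
  let τ : U.toScheme ⟶ V := IsOpenImmersion.lift j (U.ι ≫ X.fam.σ) hr
  have hτ : τ ≫ j = U.ι ≫ X.fam.σ := IsOpenImmersion.lift_fac _ _ _
  have P := IsPullback.of_hasPullback (j ≫ X.fam.π) U.ι
  let W := pullback (j ≫ X.fam.π) U.ι
  let σW : U.toScheme ⟶ W := pullback.lift τ (𝟙 _) (by
    rw [reassoc_of% hτ, X.fam.σ_π, Category.comp_id, Category.id_comp])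
  have Q := AffineSpace.isPullback_map (n := ULift.{u} (Fin n)) U.ι
  let f₀ : W ⟶ 𝔸(ULift.{u} (Fin n); U.toScheme) := Q.lift (pullback.fst _ _ ≫ f) (pullback.snd _ _)
    (by rw [Category.assoc, w, pullback.condition])
  have hf₀ : f₀ ≫ 𝔸(ULift.{u} (Fin n); U.toScheme) ↘ U.toScheme = pullback.snd _ _ :=
    Q.lift_snd _ _ _
  have hle : EtSq (pullback.snd (j ≫ X.fam.π) U.ι) (j ≫ X.fam.π) (pullback.fst _ _) U.ι :=
    EtSq.of_isPullback P
  have hf₁ : Etale f₀ := by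
    have h1 := hle.comp (EtSq.id_base f _ _ w hf)
    refine EtSq.etale (π := pullback.snd _ _) (EtSq.cancel (fS := 𝟙 _) ?_ ?_ Q)
    · rw [Q.lift_fst, Category.id_comp]
      rwa [Category.comp_id] at h1
    · rw [hf₀, Category.comp_id]
  obtain ⟨t, ht, ht', hσt⟩ := exists_translation (σW ≫ f₀) (by
    rw [Category.assoc, hf₀]
    exact pullback.lift_snd _ _ _)
  let T : TrivialGerm k n := ⟨Over.mk (U.ι ≫ X.base.hom)⟩
  have h2 : EtSq (pullback.snd (j ≫ X.fam.π) U.ι) X.fam.π (pullback.fst _ _ ≫ j) U.ι := by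
    have h1 := hle.comp (EtSq.id_base j X.fam.π _ rfl (inferInstanceAs (Etale j)))
    rwa [Category.comp_id] at h1
  let A : EtaleNbhd T.pt X :=
    { base := Over.homMk U.ι
      V :=
        { total := W
          π := pullback.snd _ _
          smooth := by
            rw [← hf₀]
            exact smooth_etale_comp hf₁ (smooth_affineSpace n _)
          σ := σW
          σ_π := pullback.lift_snd _ _ _ }
      φ := f₀ ≫ t
      etale_φ := etale_comp_mem hf₁ (etale_of_isIso t)
      φ_π := (Category.assoc _ _ _).trans ((congrArg (f₀ ≫ ·) ht').trans hf₀)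
      σ_φ := (Category.assoc _ _ _).symm.trans hσt
      ψ := pullback.fst _ _ ≫ j
      etSq_ψ := h2
      σ_ψ := (Category.assoc _ _ _).symm.trans
        ((congrArg (· ≫ j) (pullback.lift_fst _ _ _)).trans hτ) }
  exact ⟨U, T, Quotient.mk _ A, 𝟙 _, hs, Category.id_comp _⟩

/-- The inclusion of the trivial germs is a local equivalence. -/
theorem TrivialGerm.isLocalEquivalence :
    IsLocalEquivalence (TrivialGerm.incl (k := k) (n := n)) FamilyGerm.toScheme where
  existsUnique_left c d h w := TrivialGerm.cartesianArrows.comp_forget c d h w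
  existsUnique_right c d h w := FamilyGerm.cartesianArrows.comp_forget c d h w
  exists_lift t T f := by
    obtain ⟨s, c, e, he⟩ := Plus.exists_lift (p := TrivialGerm.proj) t
      (Over.homMk f : Over.mk (f ≫ t.base.hom) ⟶ t.base)
    have h1 : IsIso e.hom.left := inferInstanceAs (IsIso ((Over.forget _).map e.hom))
    exact ⟨s, c, e.hom.left, h1, congrArg CommaMorphism.left he⟩
  covering x := by
    choose U t b e hs he using exists_trivial x.pt
    have h1 : Sieve.ofArrows (fun s ↦ (U s).toScheme) (fun s ↦ (U s).ι) ∈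
        Scheme.etaleTopology x.pt.base.left :=
      Precoverage.generate_mem_toGrothendieck ((Scheme.ofArrows_mem_precoverage_iff _).mpr
        ⟨fun s ↦ ⟨s, ⟨s, hs s⟩, rfl⟩, fun s ↦ inferInstanceAs (Etale (U s).ι)⟩)
    refine Scheme.etaleTopology.superset_covering ?_ h1
    rintro _ _ ⟨_, g, _, ⟨s⟩, rfl⟩
    exact ⟨_, g ≫ e s, _, Presieve.ofArrows.mk
      (⟨t s, b s⟩ : Σ t, TrivialGerm.incl.obj t ⟶ x),
      (Category.assoc _ _ _).trans (congrArg (g ≫ ·) (he s))⟩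
  full {s t} φ := by
    refine Scheme.etaleTopology.superset_covering (fun T g _ ↦ ?_) (Scheme.etaleTopology.top_mem _)
    exact ⟨_, g, _, Presieve.ofArrows.mk
      (⟨s, 𝟙 s, φ, Category.id_comp φ⟩ : Roof TrivialGerm.incl φ), Category.comp_id _⟩
  faithful {s t} b b' h := by
    refine Scheme.etaleTopology.superset_covering (fun T g _ ↦ ?_) (Scheme.etaleTopology.top_mem _)
    exact ⟨_, g, _, Presieve.ofArrows.mk
      (⟨s, 𝟙 s, congrArg (𝟙 s ≫ ·) h⟩ : Equalizing b b'), Category.comp_id _⟩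

/-- Quasi-coherent sheaves on germs of families and on trivial germs agree. -/
theorem FamilyGerm.isEquivalence_restrictTrivial :
    (FamilyGerm.restrictTrivial (k := k) (n := n)).IsEquivalence :=
  TrivialGerm.isLocalEquivalence.isEquivalence_precomp

/-- Quasi-coherent sheaves on the stack of pointed étale germs and on trivial germs agree. -/
theorem PointedEtaleGerm.isEquivalence_restrictTrivial :
    (PointedEtaleGerm.restrictTrivial (k := k) (n := n)).IsEquivalence :=
  Stackification.isEquivalence_precomp TrivialGerm.cartesianArrows

end TrivialGerms

end

noncomputable section

open ModScheme EtaleNbhd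

/-! ### Germs and pointed families -/

section GermExtension

variable {k : Type u} [Field k] {n : ℕ}

namespace EtaleNbhd

variable {X Y Z : PtFam k n}

/-- The morphisms of pointed families from the composition of two common étale neighbourhoods to its
factors. -/
theorem exists_comp (A : EtaleNbhd X Y) (B : EtaleNbhd Y Z) :
    ∃ (a : (A.comp B).mid ⟶ A.mid) (b : (A.comp B).mid ⟶ B.mid),
      (A.comp B).left = a ≫ A.left ∧ a ≫ A.right = b ≫ B.left ∧ (A.comp B).right = b ≫ B.right := by
  have h : EtSq (A.comp B).V.π B.V.π (pullback.snd A.ψ B.φ) A.base.left := by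
    have h1 := A.etSq_ψ.pullback_snd B.φ
    rwa [B.φ_π] at h1
  refine ⟨PtFam.Hom.mk (X := (A.comp B).mid) (Y := A.mid) (𝟙 X.base) (pullback.fst A.ψ B.φ)
      ((fibrewiseEtale_iff n).mpr (EtSq.id_base _ _ _ rfl (etale_fst B.etale_φ)))
      ((pullback.lift_fst _ _ _).trans (Category.id_comp _).symm),
    PtFam.Hom.mk (X := (A.comp B).mid) (Y := B.mid) A.base (pullback.snd A.ψ B.φ)
      ((fibrewiseEtale_iff n).mpr h) (pullback.lift_snd _ _ _), ?_, ?_, ?_⟩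
  · exact PtFam.Hom.ext (Category.id_comp _).symm rfl
  · exact PtFam.Hom.ext ((Category.id_comp _).trans (Category.comp_id _).symm) pullback.condition
  · exact PtFam.Hom.ext rfl rfl

/-- Equivalent common étale neighbourhoods are equalized, near every point of the base, by a pointed
family over an open subset of the base. -/
theorem Equivalent.exists_hom {A B : EtaleNbhd X Y} (h : A.Equivalent B) (s : X.base.left) :
    ∃ (W : PtFam k n) (a : W ⟶ A.mid) (b : W ⟶ B.mid), a ≫ A.left = b ≫ B.left ∧
      a ≫ A.right = b ≫ B.right ∧ s ∈ Set.range (PtFam.Hom.base (a ≫ A.left)).left ∧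
        Etale (PtFam.Hom.base (a ≫ A.left)).left := by
  obtain ⟨U, hU, W, a, b, ha, hb, h1, h2, h3, h4, h5, h6⟩ := h.2 s
  have key {V : Scheme.{u}} {π : V ⟶ X.base.left} {c : W.total ⟶ V} (hc : Etale c)
      (w : c ≫ π = W.π ≫ U.ι) : EtSq W.π π c U.ι := by
    refine ⟨w, ?_⟩
    have h7 : Etale (pullback.fst π U.ι) := inferInstance
    have h8 : Etale (pullback.lift c W.π w ≫ pullback.fst π U.ι) := by
      rwa [pullback.lift_fst]
    exact Etale.of_comp _ (pullback.fst π U.ι)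
  let W' : PtFam k n := ⟨Over.mk (U.ι ≫ X.base.hom), W⟩
  let i : W'.base ⟶ X.base := Over.homMk U.ι
  let a' : W' ⟶ A.mid := PtFam.Hom.mk (X := W') (Y := A.mid) i a
    ((fibrewiseEtale_iff n).mpr (key ha h1)) h3
  let b' : W' ⟶ B.mid := PtFam.Hom.mk (X := W') (Y := B.mid) i b
    ((fibrewiseEtale_iff n).mpr (key hb h2)) h4
  have h7 : (PtFam.Hom.base (a' ≫ A.left)).left = U.ι := Category.comp_id U.ι
  refine ⟨W', a', b', PtFam.Hom.ext rfl h5, PtFam.Hom.ext (congrArg (i ≫ ·) h.1) h6, ?_, ?_⟩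
  · rw [h7]
    exact ⟨⟨s, hU⟩, rfl⟩
  · rw [h7]
    exact inferInstanceAs (Etale U.ι)

end EtaleNbhd

namespace FamilyGerm

/-- The functor `(X ⇄ S) ↦ S` on pointed families. -/
abbrev ptScheme (k : Type u) [Field k] (n : ℕ) : PtFam k n ⥤ Scheme.{u} :=
  ofPtFam ⋙ toScheme

variable {X Y Z : PtFam k n} (G : ModuleSystem (ptScheme k n))

theorem isIso_arrow_left (A : EtaleNbhd X Y) : IsIso (G.arrow A.left) := by
  have : IsIso (base (G.arrow A.left)) := inferInstanceAs (IsIso (𝟙 X.base.left))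
  exact (G.cart_arrow A.left).isIso

/-- The action of a common étale neighbourhood on a system of sheaves on pointed families. -/
def nbhdArrow (A : EtaleNbhd X Y) : G.pair X ⟶ G.pair Y :=
  have := isIso_arrow_left G A
  inv (G.arrow A.left) ≫ G.arrow A.right

theorem arrow_left_comp (A : EtaleNbhd X Y) :
    G.arrow A.left ≫ nbhdArrow G A = G.arrow A.right := by
  have := isIso_arrow_left G A
  exact IsIso.hom_inv_id_assoc _ _

theorem eq_nbhdArrow (A : EtaleNbhd X Y) {v : G.pair X ⟶ G.pair Y}
    (h : G.arrow A.left ≫ v = G.arrow A.right) : v = nbhdArrow G A := by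
  have := isIso_arrow_left G A
  exact (IsIso.eq_inv_comp _).mpr h

theorem base_nbhdArrow (A : EtaleNbhd X Y) : base (nbhdArrow G A) = A.base.left := by
  refine (Category.id_comp _).symm.trans ?_
  exact congrArg base (arrow_left_comp G A)

theorem cart_nbhdArrow (A : EtaleNbhd X Y) : Cart (nbhdArrow G A) := by
  have := isIso_arrow_left G A
  exact (Cart.of_isIso _).comp (G.cart_arrow _)

theorem nbhdArrow_ofHom (f : X ⟶ Y) : nbhdArrow G (ofHom f) = G.arrow f := by
  refine (eq_nbhdArrow G (ofHom f) ?_).symm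
  have h1 : G.arrow (ofHom f).left = 𝟙 _ := G.arrow_id X
  rw [h1]
  exact Category.id_comp _

theorem nbhdArrow_comp (A : EtaleNbhd X Y) (B : EtaleNbhd Y Z) :
    nbhdArrow G (A.comp B) = nbhdArrow G A ≫ nbhdArrow G B := by
  obtain ⟨a, b, h1, h2, h3⟩ := A.exists_comp B
  refine (eq_nbhdArrow G _ ?_).symm
  rw [h1, h3, G.arrow_comp, G.arrow_comp, Category.assoc, ← Category.assoc (G.arrow A.left),
    arrow_left_comp, ← Category.assoc, ← G.arrow_comp, h2, G.arrow_comp, Category.assoc,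
    arrow_left_comp]

/-- Equivalent étale neighbourhoods act in the same way, because they do so Zariski-locally on the
base. -/
theorem nbhdArrow_congr (hG : isQCoh _ G) {A B : EtaleNbhd X Y} (h : A.Equivalent B) :
    nbhdArrow G A = nbhdArrow G B := by
  choose W a b h1 h2 hs he using h.exists_hom
  have hcov : EtaleCovering fun s ↦ G.arrow (a s ≫ A.left) :=
    Precoverage.generate_mem_toGrothendieck ((Scheme.ofArrows_mem_precoverage_iff _).mpr
      ⟨fun s ↦ ⟨s, hs s⟩, fun s ↦ he s⟩)
  refine hcov.hom_ext (fun s ↦ G.cart_arrow _) (hG X) ?_ fun s ↦ ?_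
  · rw [base_nbhdArrow, base_nbhdArrow, h.1]
  · refine Eq.trans ?_ (congrArg (· ≫ nbhdArrow G B) (congrArg G.arrow (h1 s)).symm)
    rw [G.arrow_comp, G.arrow_comp, Category.assoc, Category.assoc, arrow_left_comp,
      arrow_left_comp, ← G.arrow_comp, ← G.arrow_comp, h2]

theorem faithful_precomp : (QCoh.precomp (ofPtFam (k := k) (n := n)) toScheme).Faithful where
  map_injective {M N φ ψ} e := by
    refine ObjectProperty.hom_ext _ (ModuleSystem.Hom.ext (funext fun x ↦ ?_))
    exact congrArg (fun χ : (QCoh.precomp ofPtFam toScheme).obj M ⟶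
      (QCoh.precomp ofPtFam toScheme).obj N ↦ ModuleSystem.Hom.app χ.hom x.pt) e

/-- By `map_left_comp`, naturality with respect to the germs follows from naturality with respect to
the morphisms of pointed families. -/
theorem full_precomp : (QCoh.precomp (ofPtFam (k := k) (n := n)) toScheme).Full where
  map_surjective {M N} ψ := by
    let v (x : FamilyGerm k n) : N.1.pair x ⟶ M.1.pair x := vert (ModuleSystem.Hom.app ψ.hom x.pt)
    have hv {X Y : PtFam k n} (f : X ⟶ Y) : N.1.arrow (ofPtFam.map f) ≫ v (ofPtFam.obj Y) =
        v (ofPtFam.obj X) ≫ M.1.arrow (ofPtFam.map f) := ModuleSystem.arrow_comp_vert ψ.hom f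
    obtain ⟨φ, hφ⟩ := ModuleSystem.exists_hom v (fun _ ↦ rfl) fun {x y} c ↦ by
      obtain ⟨X⟩ := x
      obtain ⟨Y⟩ := y
      change ofPtFam.obj X ⟶ ofPtFam.obj Y at c
      obtain ⟨C, hC⟩ := Quotient.exists_rep c
      change EtaleNbhd X Y at C
      have i1 : IsIso (ofPtFam.map C.left) := isIso_map C.left rfl rfl
      have hc : ofPtFam.map C.left ≫ c = ofPtFam.map C.right := hC ▸ map_left_comp C
      have i2 : IsIso (N.1.arrow (ofPtFam.map C.left)) := by
        have : IsIso (base (N.1.arrow (ofPtFam.map C.left))) :=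
          inferInstanceAs (IsIso (toScheme.map (ofPtFam.map C.left)))
        exact (N.1.cart_arrow _).isIso
      change N.1.arrow c ≫ v (ofPtFam.obj Y) = v (ofPtFam.obj X) ≫ M.1.arrow c
      rw [← cancel_epi (N.1.arrow (ofPtFam.map C.left)), ← Category.assoc, ← Category.assoc,
        ← N.1.arrow_comp, hc, hv, hv, Category.assoc, ← M.1.arrow_comp, hc]
    exact ⟨⟨φ⟩, ObjectProperty.hom_ext _ (ModuleSystem.hom_ext fun X ↦ hφ ⟨X⟩)⟩

/-- A system of sheaves on pointed families extends to germs by `nbhdArrow`. -/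
theorem essSurj_precomp : (QCoh.precomp (ofPtFam (k := k) (n := n)) toScheme).EssSurj where
  mem_essImage G := by
    obtain ⟨iso, iso_comp, h⟩ := ModuleSystem.exists_of_arrow (p := toScheme (k := k) (n := n))
      (fun x ↦ G.1.obj x.pt)
      (fun {x y} c ↦ Quotient.lift (nbhdArrow (X := x.pt) (Y := y.pt) G.1)
        (fun _ _ h ↦ nbhdArrow_congr G.1 G.2 h) c)
      (fun {x y} c ↦ by
        obtain ⟨C, rfl⟩ := Quotient.exists_rep c
        exact base_nbhdArrow (X := x.pt) (Y := y.pt) G.1 C)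
      (fun {x y} c ↦ by
        obtain ⟨C, rfl⟩ := Quotient.exists_rep c
        exact cart_nbhdArrow (X := x.pt) (Y := y.pt) G.1 C)
      (fun {x y z} c d ↦ by
        obtain ⟨C, rfl⟩ := Quotient.exists_rep c
        obtain ⟨D, rfl⟩ := Quotient.exists_rep d
        exact nbhdArrow_comp (X := x.pt) (Y := y.pt) (Z := z.pt) G.1 C D)
    let M : QCoh (toScheme (k := k) (n := n)) := ⟨⟨fun x ↦ G.1.obj x.pt, iso, iso_comp⟩,
      fun x ↦ G.2 x.pt⟩
    obtain ⟨φ, hφ⟩ := ModuleSystem.exists_hom (M := G.1)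
      (N := ((QCoh.precomp ofPtFam toScheme).obj M).1) (fun X ↦ 𝟙 (G.1.pair X)) (fun _ ↦ rfl)
      fun {X Y} f ↦ by
        refine (Category.comp_id (M.1.arrow (ofPtFam.map f))).trans ?_
        exact (h (ofPtFam.map f)).trans ((nbhdArrow_ofHom G.1 f).trans (Category.id_comp _).symm)
    have h1 : IsIso φ := ModuleSystem.isIso_of_isIso_app _ fun t ↦ by
      rw [← isIso_vert_iff, hφ]
      exact inferInstanceAs (IsIso (𝟙 (G.1.pair t)))
    exact ⟨M, ⟨((isQCoh _).isoMk (asIso φ)).symm⟩⟩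

/-- A quasi-coherent sheaf on germs is the same thing as a compatible system of quasi-coherent
sheaves for pointed families and their fibrewise étale morphisms. -/
theorem isEquivalence_precomp_ofPtFam :
    (QCoh.precomp (ofPtFam (k := k) (n := n)) toScheme).IsEquivalence :=
  have := faithful_precomp (k := k) (n := n)
  have := full_precomp (k := k) (n := n)
  have := essSurj_precomp (k := k) (n := n)
  { }

end FamilyGerm

end GermExtension

end

noncomputable section

open ModScheme

/-! ### Universal modules and pointed families -/

section Along

variable {C : Type*} [Category* C] {p q : C ⥤ Scheme.{u}}

/-- The projections from the pullback along a natural transformation commute with the structure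
morphisms. -/
theorem ModuleSystem.arrow_pullbackAlong (α : p ⟶ q) (M : ModuleSystem q) {c d : C} (f : c ⟶ d) :
    ((pullbackAlong α).obj M).arrow f ≫ (M.pair d).pbMap (α.app d) =
      (M.pair c).pbMap (α.app c) ≫ M.arrow f := by
  refine (homOfPullback_comp (p.map f) (α.app d) _ rfl (𝟙 _) (alongIso α M f).hom).symm.trans
    (Eq.trans ?_ (homOfPullback_comp (α.app c) (q.map f) _ (naturality_symm α f)
      (M.iso f).hom (𝟙 _)))
  rw [alongIso_hom]
  simp

theorem ModuleSystem.vert_pullbackAlong (α : p ⟶ q) {M N : ModuleSystem q} (φ : M ⟶ N) (c : C) :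
    vert (Hom.app ((pullbackAlong α).map φ) c) ≫ (M.pair c).pbMap (α.app c) =
      (N.pair c).pbMap (α.app c) ≫ vert (Hom.app φ c) := by
  refine (vert_comp_homOfPullback _ _ _).trans (Eq.trans ?_ (homOfPullback_comp_vert _ _ _).symm)
  exact congrArg _ ((Category.id_comp _).trans (Category.comp_id _).symm)

end Along

section Diagonal

variable (k : Type u) [Field k] (n : ℕ)

/-- The second projections `(X ×_S X)/X ⟶ X/S`. -/
def sndDiagonal : Fam.diagonal ⋙ PtFam.forget ⟶ 𝟭 (Fam k n) where
  app X := Fam.Hom.mk (X := PtFam.forget.obj (Fam.diagonal.obj X)) (Y := X)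
    (Over.homMk X.fam.π) (pullback.snd _ _) ((fibrewiseEtale_iff n).mpr
      (EtSq.of_isPullback (IsPullback.of_hasPullback X.fam.π X.fam.π).flip))
  naturality X Y f := Fam.Hom.ext (Over.OverMorphism.ext (Fam.Hom.w f)) (diagMap_snd (Fam.Hom.w f))

section SectionDiagonal

variable {X S X' S' : Scheme.{u}} {π : X ⟶ S} {σ : S ⟶ X} {π' : X' ⟶ S'} {σ' : S' ⟶ X'}

/-- The morphism `x ↦ (σ (π x), x)`. -/
def sectionDiagonal (h : σ ≫ π = 𝟙 S) : X ⟶ pullback π π :=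
  pullback.lift (π ≫ σ) (𝟙 X) (by rw [Category.assoc, h, Category.comp_id, Category.id_comp])

/-- The pointed family `X ⇄ S` is the pullback of `X ×_S X ⇄ X` along `σ`. -/
theorem isPullback_sectionDiagonal (h : σ ≫ π = 𝟙 S) :
    IsPullback (sectionDiagonal h) π (pullback.fst π π) σ := by
  refine IsPullback.of_right (h₁₂ := pullback.snd π π) (h₂₂ := π) (v₁₃ := π) ?_
    (pullback.lift_fst _ _ _) (IsPullback.of_hasPullback π π).flip
  rw [sectionDiagonal, pullback.lift_snd, h]
  exact IsPullback.id_horiz π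

theorem section_comp_sectionDiagonal (h : σ ≫ π = 𝟙 S) :
    σ ≫ sectionDiagonal h = σ ≫ pullback.diagonal π := by
  refine pullback.hom_ext ?_ ?_
  · rw [Category.assoc, Category.assoc, pullback.diagonal_fst, sectionDiagonal, pullback.lift_fst,
      reassoc_of% h, Category.comp_id]
  · rw [Category.assoc, Category.assoc, pullback.diagonal_snd, sectionDiagonal, pullback.lift_snd]

theorem sectionDiagonal_naturality (h : σ ≫ π = 𝟙 S) (h' : σ' ≫ π' = 𝟙 S') {f : X ⟶ X'}
    {g : S ⟶ S'} (w : f ≫ π' = π ≫ g) (w' : σ ≫ f = g ≫ σ') :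
    f ≫ sectionDiagonal h' = sectionDiagonal h ≫ diagMap w := by
  refine pullback.hom_ext ?_ ?_
  · rw [Category.assoc, Category.assoc, diagMap_fst, sectionDiagonal, sectionDiagonal,
      pullback.lift_fst, pullback.lift_fst_assoc, reassoc_of% w, Category.assoc, w']
  · rw [Category.assoc, Category.assoc, diagMap_snd, sectionDiagonal, sectionDiagonal,
      pullback.lift_snd, pullback.lift_snd_assoc, Category.comp_id, Category.id_comp]

end SectionDiagonal

/-- The morphisms from a pointed family `X ⇄ S` to `X ×_S X ⇄ X`, over the section `σ`. -/
def toDiagonal : 𝟭 (PtFam k n) ⟶ PtFam.forget ⋙ Fam.diagonal where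
  app X := PtFam.Hom.mk (X := X) (Y := Fam.diagonal.obj (PtFam.forget.obj X))
    (Over.homMk X.fam.σ (by
      change X.fam.σ ≫ X.fam.π ≫ X.base.hom = X.base.hom
      rw [← Category.assoc, X.fam.σ_π, Category.id_comp]))
    (sectionDiagonal X.fam.σ_π)
    ((fibrewiseEtale_iff n).mpr (EtSq.of_isPullback (isPullback_sectionDiagonal X.fam.σ_π)))
    (section_comp_sectionDiagonal X.fam.σ_π)
  naturality X Y f := PtFam.Hom.ext
    (Over.OverMorphism.ext (PtFam.Hom.σ_total f).symm)
    (sectionDiagonal_naturality X.fam.σ_π Y.fam.σ_π (PtFam.Hom.etSq f).1 (PtFam.Hom.σ_total f))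

/-- Restriction of systems of quasi-coherent sheaves on pointed families to the families
`X ×_S X ⇄ X`. -/
def PtFam.restrictDiagonal : QCoh (FamilyGerm.ptScheme k n) ⥤ UniversalOModule k n :=
  QCoh.precomp Fam.diagonal (FamilyGerm.ptScheme k n)

/-- The functor `F ↦ σ^* F`, with values in quasi-coherent systems. -/
def UniversalOModule.toPtFam : UniversalOModule k n ⥤ QCoh (FamilyGerm.ptScheme k n) :=
  (isQCoh _).lift UniversalOModule.pullbackSection fun F X ↦
    QC.pb (Y := F.1.pair (PtFam.forget.obj X)) (F.2 _) X.fam.σ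

/-- The canonical morphism `σ^* F ⟶ F` over the section `σ`. -/
def UniversalOModule.proj (F : UniversalOModule k n) (X : PtFam k n) :
    ((toPtFam k n).obj F).1.pair X ⟶ F.1.pair (PtFam.forget.obj X) :=
  (F.1.pair (PtFam.forget.obj X)).pbMap X.fam.σ

variable {k n}

theorem UniversalOModule.cart_proj (F : UniversalOModule k n) (X : PtFam k n) :
    Cart (proj k n F X) := cart_pbMap _ _

theorem UniversalOModule.arrow_comp_proj (F : UniversalOModule k n) {X Y : PtFam k n}
    (f : X ⟶ Y) : ((toPtFam k n).obj F).1.arrow f ≫ proj k n F Y =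
      proj k n F X ≫ F.1.arrow (PtFam.forget.map f) :=
  ModuleSystem.arrow_pullbackAlong PtFam.σ ((ModuleSystem.precomp PtFam.forget _).obj F.1) f

theorem UniversalOModule.vert_comp_proj {F F' : UniversalOModule k n} (ψ : F ⟶ F')
    (X : PtFam k n) :
    (vert (ModuleSystem.Hom.app ((toPtFam k n).map ψ).hom X) : ((toPtFam k n).obj F').1.pair X ⟶
      ((toPtFam k n).obj F).1.pair X) ≫ proj k n F X =
      proj k n F' X ≫ (vert (ModuleSystem.Hom.app ψ.hom (PtFam.forget.obj X)) :
        F'.1.pair (PtFam.forget.obj X) ⟶ F.1.pair (PtFam.forget.obj X)) :=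
  ModuleSystem.vert_pullbackAlong PtFam.σ ((ModuleSystem.precomp PtFam.forget _).map ψ.hom) X

/-- `Δ^* F_{X ×_S X/X} ≅ F_{X/S}` by means of the second projection. -/
theorem UniversalOModule.exists_unit (F : UniversalOModule k n) :
    ∃ φ : F ≅ (toPtFam k n ⋙ PtFam.restrictDiagonal k n).obj F, ∀ X,
      vert (ModuleSystem.Hom.app φ.hom.hom X) =
        proj k n F (Fam.diagonal.obj X) ≫ F.1.arrow ((sndDiagonal k n).app X) := by
  have hb (X : Fam k n) : base (proj k n F (Fam.diagonal.obj X) ≫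
      F.1.arrow ((sndDiagonal k n).app X)) = 𝟙 X.fam.total := pullback.diagonal_snd X.fam.π
  obtain ⟨φ, hφ⟩ := ModuleSystem.exists_hom (M := F.1)
    (N := ((toPtFam k n ⋙ PtFam.restrictDiagonal k n).obj F).1)
    (fun X ↦ proj k n F (Fam.diagonal.obj X) ≫ F.1.arrow ((sndDiagonal k n).app X)) hb
    fun {X Y} f ↦ by
      have h1 := arrow_comp_proj F (Fam.diagonal.map f)
      refine (Category.assoc _ _ _).symm.trans ((congrArg (· ≫ F.1.arrow ((sndDiagonal k n).app Y))
        h1).trans ((Category.assoc _ _ _).trans (Eq.trans ?_ (Category.assoc _ _ _).symm)))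
      refine congrArg (proj k n F (Fam.diagonal.obj X) ≫ ·) ?_
      rw [← F.1.arrow_comp]
      exact (congrArg F.1.arrow ((sndDiagonal k n).naturality f)).trans (F.1.arrow_comp _ _)
  have h1 : IsIso φ := ModuleSystem.isIso_of_isIso_app _ fun X ↦ by
    rw [← isIso_vert_iff, hφ]
    have : IsIso (base (proj k n F (Fam.diagonal.obj X) ≫ F.1.arrow ((sndDiagonal k n).app X))) := by
      rw [hb]
      exact inferInstanceAs (IsIso (𝟙 X.fam.total))
    exact ((cart_proj F _).comp (F.1.cart_arrow _)).isIso
  exact ⟨(isQCoh _).isoMk (asIso φ), hφ⟩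

/-- `σ^* M_{X ×_S X ⇄ X} ≅ M_{X ⇄ S}`, because `X ⇄ S` is the pullback of `X ×_S X ⇄ X` along `σ`. -/
theorem UniversalOModule.exists_counit (M : QCoh (FamilyGerm.ptScheme k n)) :
    ∃ φ : (PtFam.restrictDiagonal k n ⋙ toPtFam k n).obj M ≅ M, ∀ X,
      (vert (ModuleSystem.Hom.app φ.hom.hom X) : M.1.pair X ⟶
        ((PtFam.restrictDiagonal k n ⋙ toPtFam k n).obj M).1.pair X) ≫
        proj k n ((PtFam.restrictDiagonal k n).obj M) X = M.1.arrow ((toDiagonal k n).app X) := by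
  let F := (PtFam.restrictDiagonal k n).obj M
  let v (X : PtFam k n) : M.1.pair X ⟶ ((toPtFam k n).obj F).1.pair X :=
    (cart_proj F X).lift (M.1.arrow ((toDiagonal k n).app X)) (𝟙 X.base.left) (Category.id_comp _)
  have hb (X : PtFam k n) : base (v X) = 𝟙 X.base.left := Cart.base_lift _ _ _ _
  have hv (X : PtFam k n) : v X ≫ proj k n F X = M.1.arrow ((toDiagonal k n).app X) :=
    Cart.lift_comp _ _ _ _
  obtain ⟨φ, hφ⟩ := ModuleSystem.exists_hom (M := ((toPtFam k n).obj F).1) (N := M.1) v hb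
    fun {X Y} f ↦ by
      refine (cart_proj F Y).hom_ext ?_ ?_
      · refine (congrArg ((FamilyGerm.ptScheme k n).map f ≫ ·) (hb Y)).trans (Eq.trans ?_
          (congrArg (· ≫ (FamilyGerm.ptScheme k n).map f) (hb X)).symm)
        exact (Category.comp_id _).trans (Category.id_comp _).symm
      · rw [Category.assoc, Category.assoc, hv, arrow_comp_proj, ← Category.assoc, hv]
        refine (M.1.arrow_comp _ _).symm.trans ?_
        exact (congrArg M.1.arrow ((toDiagonal k n).naturality f)).trans (M.1.arrow_comp _ _)
  have h1 : IsIso φ := ModuleSystem.isIso_of_isIso_app _ fun X ↦ by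
    rw [← isIso_vert_iff, hφ]
    have h2 : IsIso (base (v X)) := by
      rw [hb]
      exact inferInstanceAs (IsIso (𝟙 X.base.left))
    have h3 : Cart (v X) := Cart.of_comp ((hv X).symm ▸ M.1.cart_arrow _) (cart_proj F X)
    exact @Cart.isIso _ _ _ h3 h2
  exact ⟨(isQCoh _).isoMk (asIso φ), fun X ↦ (congrArg (· ≫ proj k n F X) (hφ X)).trans (hv X)⟩

/-- Universal modules are the same as systems of quasi-coherent sheaves on pointed families. -/
theorem UniversalOModule.exists_equivalence : ∃ e : UniversalOModule k n ≌
    QCoh (FamilyGerm.ptScheme k n), e.functor = toPtFam k n ∧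
      e.inverse = PtFam.restrictDiagonal k n := by
  choose η hη using exists_unit (k := k) (n := n)
  choose ε hε using exists_counit (k := k) (n := n)
  refine ⟨.mk (toPtFam k n) (PtFam.restrictDiagonal k n)
    (NatIso.ofComponents η fun {F F'} ψ ↦ ?_) (NatIso.ofComponents ε fun {M M'} ψ ↦ ?_), rfl, rfl⟩
  · refine ObjectProperty.hom_ext _ (ModuleSystem.hom_ext fun X ↦ ?_)
    refine (vert_comp _ _).trans (Eq.trans ?_ (vert_comp _ _).symm)
    let a : F'.1.pair X ⟶ F.1.pair X := vert (ModuleSystem.Hom.app ψ.hom X)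
    let a' : F'.1.pair (PtFam.forget.obj (Fam.diagonal.obj X)) ⟶
      F.1.pair (PtFam.forget.obj (Fam.diagonal.obj X)) := vert (ModuleSystem.Hom.app ψ.hom _)
    let b : ((toPtFam k n).obj F').1.pair (Fam.diagonal.obj X) ⟶
        ((toPtFam k n).obj F).1.pair (Fam.diagonal.obj X) :=
      vert (ModuleSystem.Hom.app ((toPtFam k n).map ψ).hom (Fam.diagonal.obj X))
    have h1 : b ≫ proj k n F (Fam.diagonal.obj X) = proj k n F' (Fam.diagonal.obj X) ≫ a' :=
      vert_comp_proj ψ (Fam.diagonal.obj X)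
    have h2 : F'.1.arrow ((sndDiagonal k n).app X) ≫ a = a' ≫ F.1.arrow ((sndDiagonal k n).app X) :=
      ModuleSystem.arrow_comp_vert ψ.hom ((sndDiagonal k n).app X)
    refine (congrArg (· ≫ a) (hη F' X)).trans (Eq.trans ?_ (congrArg (b ≫ ·) (hη F X)).symm)
    refine (Category.assoc _ _ _).trans ?_
    exact (congrArg (proj k n F' (Fam.diagonal.obj X) ≫ ·) h2).trans
      ((Category.assoc _ _ _).symm.trans ((congrArg (· ≫ F.1.arrow ((sndDiagonal k n).app X))
        h1.symm).trans (Category.assoc _ _ _)))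
  · refine ObjectProperty.hom_ext _ (ModuleSystem.hom_ext fun X ↦ ?_)
    refine (vert_comp _ _).trans (Eq.trans ?_ (vert_comp _ _).symm)
    let F := (PtFam.restrictDiagonal k n).obj M
    let F' := (PtFam.restrictDiagonal k n).obj M'
    let e : M.1.pair X ⟶ ((toPtFam k n).obj F).1.pair X :=
      vert (ModuleSystem.Hom.app (ε M).hom.hom X)
    let e' : M'.1.pair X ⟶ ((toPtFam k n).obj F').1.pair X :=
      vert (ModuleSystem.Hom.app (ε M').hom.hom X)
    let χ : F ⟶ F' := (PtFam.restrictDiagonal k n).map ψ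
    let a : ((toPtFam k n).obj F').1.pair X ⟶ ((toPtFam k n).obj F).1.pair X :=
      vert (ModuleSystem.Hom.app ((toPtFam k n).map χ).hom X)
    let b : M'.1.pair X ⟶ M.1.pair X := vert (ModuleSystem.Hom.app ψ.hom X)
    let b' : F'.1.pair (PtFam.forget.obj X) ⟶ F.1.pair (PtFam.forget.obj X) :=
      vert (ModuleSystem.Hom.app χ.hom (PtFam.forget.obj X))
    have h1 : a ≫ proj k n F X = proj k n F' X ≫ b' := vert_comp_proj χ X
    have h2 : M'.1.arrow ((toDiagonal k n).app X) ≫ b' = b ≫ M.1.arrow ((toDiagonal k n).app X) :=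
      ModuleSystem.arrow_comp_vert ψ.hom ((toDiagonal k n).app X)
    have he : e ≫ proj k n F X = M.1.arrow ((toDiagonal k n).app X) := hε M X
    have he' : e' ≫ proj k n F' X = M'.1.arrow ((toDiagonal k n).app X) := hε M' X
    change e' ≫ a = b ≫ e
    refine (cart_proj F X).hom_ext rfl ?_
    rw [Category.assoc, Category.assoc, h1, he, ← Category.assoc, he']
    exact h2

end Diagonal

end

end UniversalModule

theorem mainTheorem9 (k : Type u) [Field k] [IsAlgClosed k] [CharZero k] (n : ℕ) :
    (FamilyGerm.restrictTrivial (k := k) (n := n)).IsEquivalence ∧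
    (PointedEtaleGerm.restrictTrivial (k := k) (n := n)).IsEquivalence ∧
    ∃ θ : UniversalOModule k n ≌ QCoh (FamilyGerm.toScheme : FamilyGerm k n ⥤ Scheme.{u}),
      Nonempty (θ.functor ⋙ FamilyGerm.restrictPtFam ≅ UniversalOModule.pullbackSection) ∧
      Nonempty (θ.inverse ≅ FamilyGerm.restrictDiagonal) ∧
      ∃ Θ : UniversalOModule k n ≌
          QCoh (PointedEtaleGerm.toScheme : PointedEtaleGerm k n ⥤ Scheme.{u}),
        Nonempty (Θ.functor ⋙ PointedEtaleGerm.restrictTrivial ≅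
          θ.functor ⋙ FamilyGerm.restrictTrivial) := by
  have h1 := FamilyGerm.isEquivalence_restrictTrivial (k := k) (n := n)
  have h2 := PointedEtaleGerm.isEquivalence_restrictTrivial (k := k) (n := n)
  have h3 := FamilyGerm.isEquivalence_precomp_ofPtFam (k := k) (n := n)
  obtain ⟨e, he, he'⟩ := UniversalOModule.exists_equivalence (k := k) (n := n)
  let E := (QCoh.precomp (FamilyGerm.ofPtFam (k := k) (n := n)) FamilyGerm.toScheme).asEquivalence
  let θ : UniversalOModule k n ≌ QCoh (FamilyGerm.toScheme : FamilyGerm k n ⥤ Scheme.{u}) :=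
    e.trans E.symm
  refine ⟨h1, h2, θ, ⟨?_⟩, ⟨?_⟩, θ.trans (FamilyGerm.restrictTrivial.asEquivalence.trans
    PointedEtaleGerm.restrictTrivial.asEquivalence.symm), ⟨?_⟩⟩
  · exact Functor.isoWhiskerLeft e.functor (Functor.isoWhiskerRight E.counitIso (isQCoh _).ι) ≪≫
      Functor.isoWhiskerRight (eqToIso he) (isQCoh _).ι
  · exact Functor.isoWhiskerLeft E.functor (eqToIso he')
  · exact Functor.isoWhiskerLeft (θ.functor ⋙ FamilyGerm.restrictTrivial)
      PointedEtaleGerm.restrictTrivial.asEquivalence.counitIso
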